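/- Let $(X,\omega,J)$ be a compact Kähler manifold of complex dimension $n$ with Riemannian metric $g=\omega(\cdot,J\cdot)$, Riemannian volume $dv_X$ and Levi-Civita connection $\nabla^{TX}$. Let $(L,h^L)$ be a Hermitian holomorphic line bundle on $X$ with Chern connection $\nabla^L$ and curvature $R^L=(\nabla^L)^2$ such that $\omega=\frac{\sqrt{-1}}{2\pi}R^L$. Let $(E,h^E)$ be a Hermitian complex vector bundle (not necessarily holomorphic) with a Hermitian connection $\nabla^E$ of curvature $R^E=(\nabla^E)^2$, and let $R^{\det}$ be the curvature of the Chern connection of $\det(T^{(1,0)}X)$ with the metric induced by $g$. Let $p\in\mathbb N$. On $\Omega^{0,\bullet}(X,L^p\otimes E)=\mathscr C^\infty(X,\Lambda^\bullet(T^{*(0,1)}X)\otimes L^p\otimes E)$ let $\bar\partial$ be the operator extending the $(0,1)$-part of $\nabla^{L^p\otimes E}=\nabla^{L^p}\otimes 1+1\otimes\nabla^E$ by the Leibniz formula $\bar\partial(\alpha\otimes s)=(\bar\partial\alpha)\otimes s+(-1)^{\deg\alpha}\alpha\wedge\bar\partial s$. Let $\bar\partial^{*}$ be its formal adjoint for the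 $L^2$-product defined by $dv_X$, $h^L$, $h^E$ and the metric on $\Lambda^\bullet(T^{*(0,1)}X)$ induced by $g$, and set $D_p=\sqrt2\,(\bar\partial+\bar\partial^{*})$. Let $\langle\cdot,\cdot\rangle$ be the $\mathbb C$-bilinear extension of $g$ to $TX\otimes\mathbb C$. Let $(w_1,\dots,w_n)$ be a local orthonormal frame of $T^{(1,0)}X$, i.e. $\langle w_j,\overline w_k\rangle=\delta_{jk}$. Let $(\overline w^1,\dots,\overline w^n)$ be the frame of $T^{*(0,1)}X$ dual to $(\overline w_1,\dots,\overline w_n)$; the metric on $\Lambda^\bullet(T^{*(0,1)}X)$ is the one for which the $\overline w^{j_1}\wedge\dots\wedge\overline w^{j_k}$, $j_1<\dots<j_k$, are orthonormal. Let $\mathcal N$ be the number operator, equal to $j$ on $(0,j)$-forms, and let $$\Delta=-\sum_{j=1}^{2n}\Big((\nabla_{e_j})^2-\nabla_{\nabla^{TX}_{e_j}e_j}\Big)$$ for any local orthonormal frame $(e_j)$ of $TX$, where $\nabla$ is the connection on $\Lambda^\bullet(T^{*(0,1)}X)\otimes L^p\otimes E$ induced by $\nabla^{TX}$, $\nabla^L$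 and $\nabla^E$. Then $\bar\partial$ and $\bar\partial^*$ are well defined on $\Omega^{0,\bullet}(X,L^p\otimes E)$ with values in it, and, with summation over repeated indices, $$D_p^2=\Delta-R^E(w_j,\overline w_j)-2\pi pn+4\pi p\,\mathcal N+2\Big(R^E+\tfrac12R^{\det}\Big)(w_\ell,\overline w_m)\,\overline w^m\wedge i_{\overline w_\ell}+R^E(w_\ell,w_m)\,i_{\overline w_\ell}i_{\overline w_m}+R^E(\overline w_\ell,\overline w_m)\,\overline w^\ell\wedge\overline w^m\wedge .$$ -/

import Mathlib

open Bundle Manifold MeasureTheory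
open scoped ContDiff Topology TensorProduct ComplexConjugate Bundle

noncomputable section

namespace SpinDirac

/-! ### The underlying real structures of complex manifolds and complex vector bundles

A complex manifold `X` is a space charted on a complex normed space `E` with holomorphic transition
maps.  Its underlying real manifold uses the same charts, with `E` regarded as a real space; the
real tangent space is `TangentSpace 𝓘(ℝ, E) x`. -/

section Real

/-- The real smooth manifold underlying a complex manifold. -/
instance realManifold {E : Type*} [NormedAddCommGroup E] [NormedSpace ℂ E]
    {X : Type*} [TopologicalSpace X] [ChartedSpace E X] [IsManifold 𝓘(ℂ, E) ω X] :
    IsManifold 𝓘(ℝ, E) ∞ X := by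
  apply isManifold_of_contDiffOn
  intro e e' he he'
  have h := (contDiffGroupoid ω 𝓘(ℂ, E)).compatible he he'
  rw [contDiffGroupoid, mem_groupoid_of_pregroupoid] at h
  have h2 : ContDiffOn ℂ ω _ _ := h.1
  exact (h2.restrict_scalars ℝ).of_le le_top

variable {B : Type*} [TopologicalSpace B]
  {F : Type*} [NormedAddCommGroup F] [NormedSpace ℂ F]
  {V : B → Type*} [TopologicalSpace (TotalSpace F V)]
  [∀ x, AddCommGroup (V x)] [∀ x, Module ℂ (V x)] [∀ x, Module ℝ (V x)]
  [∀ x, IsScalarTower ℝ ℂ (V x)]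

theorem isLinear_real (e : Trivialization F (π F V)) [e.IsLinear ℂ] : e.IsLinear ℝ where
  linear b hb :=
    { map_add := (Trivialization.linear ℂ e hb).map_add
      map_smul := fun c v => by
        have h := (Trivialization.linear ℂ e hb).map_smul (c : ℂ) v
        have h1 : (c : ℂ) • v = c • v := by
          rw [← algebraMap_smul ℂ c v]; rfl
        rw [h1] at h
        rw [h]
        exact algebraMap_smul ℂ c _ }

variable [∀ x, TopologicalSpace (V x)] [FiberBundle F V]

/-- The real vector bundle underlying a complex vector bundle. -/
instance realVectorBundle [VectorBundle ℂ F V] : VectorBundle ℝ F V where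
  trivialization_linear' e _ := isLinear_real e
  continuousOn_coordChange' e e' _ _ := by
    have := isLinear_real (F := F) (V := V) e
    have := isLinear_real (F := F) (V := V) e'
    have h := continuousOn_coordChange ℂ e e'
    have h2 := (ContinuousLinearMap.restrictScalarsL ℂ F F ℝ ℝ).continuous.comp_continuousOn h
    refine h2.congr fun b hb => ?_
    ext v
    simp [Trivialization.coordChangeL_apply _ _ hb]

/-- The real smooth vector bundle underlying a holomorphic vector bundle. -/
instance realContMDiffVectorBundle {E : Type*} [NormedAddCommGroup E] [NormedSpace ℂ E]
    [ChartedSpace E B] [VectorBundle ℂ F V] [ContMDiffVectorBundle ω F V 𝓘(ℂ, E)] :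
    ContMDiffVectorBundle ∞ F V 𝓘(ℝ, E) where
  contMDiffOn_coordChangeL e e' _ _ := by
    have := isLinear_real (F := F) (V := V) e
    have := isLinear_real (F := F) (V := V) e'
    have h := ContMDiffVectorBundle.contMDiffOn_coordChangeL (n := ω) (IB := 𝓘(ℂ, E))
      (F := F) (E := V) e e'
    have h2 : ContMDiffOn 𝓘(ℝ, E) 𝓘(ℝ, F →L[ℝ] F) ∞
        (fun b : B => (e.coordChangeL ℂ e' b : F →L[ℂ] F).restrictScalars ℝ)
        (e.baseSet ∩ e'.baseSet) := by
      intro b hb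
      have h3 := contMDiffWithinAt_iff.1 (h b hb)
      refine contMDiffWithinAt_iff.2
        ⟨(ContinuousLinearMap.restrictScalarsL ℂ F F ℝ ℝ).continuous.continuousAt.comp_continuousWithinAt
          h3.1, ?_⟩
      exact (ContinuousLinearMap.restrictScalarsL ℂ F F ℝ ℝ).contDiff.comp_contDiffWithinAt
        ((h3.2.restrict_scalars ℝ).of_le le_top)
    refine h2.congr fun b hb => ?_
    ext v
    simp [Trivialization.coordChangeL_apply _ _ hb]

end Real

variable {E : Type*} [NormedAddCommGroup E] [NormedSpace ℂ E]
  {X : Type*} [TopologicalSpace X] [ChartedSpace E X]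

/-! ### Complex structure and complexified tangent spaces -/

section Tangent

variable (E) in
/-- The complex structure `J` of `T_x X`.  In each holomorphic chart it is multiplication by `i`. -/
def J (x : X) : TangentSpace 𝓘(ℝ, E) x →L[ℝ] TangentSpace 𝓘(ℝ, E) x :=
  (Complex.I • ContinuousLinearMap.id ℝ E : E →L[ℝ] E)

theorem J_J (x : X) (v : TangentSpace 𝓘(ℝ, E) x) : J E x (J E x v) = -v := by
  change Complex.I • (Complex.I • (show E from v)) = -(show E from v)
  rw [smul_smul, Complex.I_mul_I, neg_one_smul]

variable (E) in
/-- The vector `re + i im` of the complexified tangent space `T_x X ⊗ ℂ`. -/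
structure ComplexTangent (x : X) where
  re : TangentSpace 𝓘(ℝ, E) x
  im : TangentSpace 𝓘(ℝ, E) x

namespace ComplexTangent

/-- Complex conjugation of `T_x X ⊗ ℂ`. -/
def conjugate {x : X} (u : ComplexTangent E x) : ComplexTangent E x := ⟨u.re, -u.im⟩

/-- `u ∈ T^{(1,0)}_x X`, i.e. `J u = i u` for the `ℂ`-linear extension of `J`. -/
def IsType10 {x : X} (u : ComplexTangent E x) : Prop := J E x u.re = -u.im ∧ J E x u.im = u.re

end ComplexTangent

/-- The value at `(u, v)` of the `ℂ`-bilinear extension to `T_x X ⊗ ℂ` of an `ℝ`-bilinear map. -/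
def complexify₂ {M : Type*} [AddCommGroup M] [Module ℂ M] {x : X}
    (b : TangentSpace 𝓘(ℝ, E) x → TangentSpace 𝓘(ℝ, E) x → M) (u v : ComplexTangent E x) : M :=
  (b u.re v.re - b u.im v.im) + Complex.I • (b u.re v.im + b u.im v.re)

variable (E) in
/-- The space `T^{*(0,1)}_x X` of `ℂ`-valued `ℝ`-linear forms `α` on `T_x X` with
`α ∘ J = -i α`, as a complex subspace of `T^*_x X ⊗ ℂ`. -/
def T01Dual (x : X) : Submodule ℂ (TangentSpace 𝓘(ℝ, E) x →L[ℝ] ℂ) where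
  carrier := {α | ∀ v, α (J E x v) = -Complex.I * α v}
  add_mem' {α β} hα hβ v := by
    simp only [add_apply, hα v, hβ v]; ring
  zero_mem' v := by simp
  smul_mem' c α hα v := by
    simp only [smul_apply, smul_eq_mul, hα v]; ring

/-- The pairing of a `(0,1)`-form, extended `ℂ`-linearly, with a complexified tangent vector, as a
linear form on `T^{*(0,1)}_x X`. -/
def evalDual {x : X} (u : ComplexTangent E x) : Module.Dual ℂ (T01Dual E x) where
  toFun α := (α : TangentSpace 𝓘(ℝ, E) x →L[ℝ] ℂ) u.re
    + Complex.I * (α : TangentSpace 𝓘(ℝ, E) x →L[ℝ] ℂ) u.im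
  map_add' α β := by
    simp only [Submodule.coe_add, add_apply]; ring
  map_smul' c α := by
    simp only [Submodule.coe_smul, smul_apply, smul_eq_mul, RingHom.id_apply]
    ring

/-- The `(0,1)`-part `v ↦ (β v + i β (J v)) / 2` of a `ℂ`-valued form `β`. -/
def part01 {x : X} (β : TangentSpace 𝓘(ℝ, E) x →L[ℝ] ℂ) : T01Dual E x :=
  ⟨(1 / 2 : ℂ) • (β + Complex.I • β.comp (J E x)), fun v => by
    simp only [smul_apply, add_apply,
      ContinuousLinearMap.comp_apply, J_J, map_neg, smul_eq_mul]
    linear_combination (1 / 2 : ℂ) * β (J E x v) * Complex.I_sq⟩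

/-- `∂̄f`, the `(0,1)`-part of `df`, for a complex function `f`. -/
def dbarFun (f : X → ℂ) (x : X) : T01Dual E x := part01 (mvfderiv 𝓘(ℝ, E) f x)

variable [FiniteDimensional ℂ E]

variable (E) in
/-- A complex basis of `T_x X`, depending only on the model space. -/
def tangentBasis (x : X) (j : Fin (Module.finrank ℂ E)) : TangentSpace 𝓘(ℝ, E) x :=
  Module.finBasis ℂ E j

variable (E) in
/-- The `(0,1)`-forms `v ↦ conj (b^j v)`, where `b^j` is the basis dual to `tangentBasis`. -/
def conjDualBasis (x : X) (j : Fin (Module.finrank ℂ E)) : T01Dual E x :=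
  ⟨(Complex.conjCLE : ℂ →L[ℝ] ℂ).comp
      ((LinearMap.toContinuousLinearMap ((Module.finBasis ℂ E).coord j)).restrictScalars ℝ :
        E →L[ℝ] ℂ), fun v => by
    change conj ((Module.finBasis ℂ E).coord j (Complex.I • (show E from v)))
      = -Complex.I * conj ((Module.finBasis ℂ E).coord j (show E from v))
    rw [map_smul, smul_eq_mul, map_mul, Complex.conj_I]⟩

end Tangent

/-! ### Smooth sections, connections, curvature -/

section Connections

variable [IsManifold 𝓘(ℂ, E) ω X]

variable (E) (F : Type*) [NormedAddCommGroup F] [NormedSpace ℂ F]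
  {V : X → Type*} [TopologicalSpace (TotalSpace F V)]
  [∀ x, AddCommGroup (V x)] [∀ x, Module ℂ (V x)] [∀ x, Module ℝ (V x)]
  [∀ x, TopologicalSpace (V x)] [∀ x, IsTopologicalAddGroup (V x)]
  [∀ x, ContinuousSMul ℝ (V x)] [FiberBundle F V]

/-- The section `s` is (real) smooth on the set `U`. -/
def SmoothSectionOn (s : Π x : X, V x) (U : Set X) : Prop :=
  ContMDiffOn 𝓘(ℝ, E) (𝓘(ℝ, E).prod 𝓘(ℝ, F)) ∞ (fun x => TotalSpace.mk' F x (s x)) U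

/-- The section `s` is holomorphic on the set `U`. -/
def HolomorphicSectionOn (s : Π x : X, V x) (U : Set X) : Prop :=
  MDifferentiableOn 𝓘(ℂ, E) (𝓘(ℂ, E).prod 𝓘(ℂ, F)) (fun x => TotalSpace.mk' F x (s x)) U

variable {E}

/-- The vector field `v` is (real) smooth on the set `U`. -/
def SmoothFieldOn (v : Π x : X, TangentSpace 𝓘(ℝ, E) x) (U : Set X) : Prop :=
  ContMDiffOn 𝓘(ℝ, E) (𝓘(ℝ, E).prod 𝓘(ℝ, E)) ∞
    (fun x => (TotalSpace.mk' E x (v x) : TotalSpace E (fun y : X => TangentSpace 𝓘(ℝ, E) y))) U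

variable {F}

variable (E F) in
/-- The Hermitian metric `h` is smooth: it takes smooth values on smooth local sections. -/
def IsSmoothHermitianMetric (h : ∀ x : X, V x → V x → ℂ) : Prop :=
  ∀ (U : Set X) (s t : Π x : X, V x), IsOpen U → SmoothSectionOn E F s U →
    SmoothSectionOn E F t U → ContMDiffOn 𝓘(ℝ, E) 𝓘(ℝ, ℂ) ∞ (fun x => h x (s x) (t x)) U

/-- A smooth `ℂ`-linear connection on a complex vector bundle. -/
structure IsComplexConnection (nabla : CovariantDerivative 𝓘(ℝ, E) F V) : Prop where
  complex_linear : ∀ (s : Π x : X, V x) (x : X),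
    MDifferentiableAt 𝓘(ℝ, E) (𝓘(ℝ, E).prod 𝓘(ℝ, F)) (fun y => TotalSpace.mk' F y (s y)) x →
    ∀ v : TangentSpace 𝓘(ℝ, E) x,
      nabla (fun y => Complex.I • s y) x v = Complex.I • nabla s x v
  smooth : ∀ (s : Π x : X, V x) (v : Π x : X, TangentSpace 𝓘(ℝ, E) x),
    SmoothSectionOn E F s Set.univ → SmoothFieldOn v Set.univ →
    SmoothSectionOn E F (fun x => nabla s x (v x)) Set.univ

/-- A Hermitian connection: a smooth `ℂ`-linear connection preserving the Hermitian metric `h`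
(conjugate-linear in the first variable). -/
structure IsHermitianConnection (h : ∀ x : X, V x → V x → ℂ)
    (nabla : CovariantDerivative 𝓘(ℝ, E) F V) : Prop extends IsComplexConnection nabla where
  metric : ∀ (s t : Π x : X, V x), SmoothSectionOn E F s Set.univ → SmoothSectionOn E F t Set.univ →
    ∀ (x : X) (v : TangentSpace 𝓘(ℝ, E) x),
      mvfderiv 𝓘(ℝ, E) (fun y => h y (s y) (t y)) x v
        = h x (nabla s x v) (t x) + h x (s x) (nabla t x v)

/-- The Chern connection of a Hermitian holomorphic vector bundle: the Hermitian connection whose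
`(0,1)`-part is the Dolbeault operator, i.e. kills local holomorphic sections. -/
structure IsChernConnection (h : ∀ x : X, V x → V x → ℂ)
    (nabla : CovariantDerivative 𝓘(ℝ, E) F V) : Prop extends IsHermitianConnection h nabla where
  holomorphic : ∀ (U : Set X) (s : Π x : X, V x), IsOpen U → HolomorphicSectionOn E F s U →
    ∀ x ∈ U, ∀ v : TangentSpace 𝓘(ℝ, E) x,
      nabla s x v + Complex.I • nabla s x (J E x v) = 0

/-- `R` is the curvature of `nabla`:
`R(u, v) s = ∇_u ∇_v s - ∇_v ∇_u s - ∇_{[u, v]} s` for local smooth fields `u, v` and sections `s`. -/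
def IsCurvature (nabla : CovariantDerivative 𝓘(ℝ, E) F V)
    (R : ∀ x : X, TangentSpace 𝓘(ℝ, E) x → TangentSpace 𝓘(ℝ, E) x → (V x →ₗ[ℂ] V x)) : Prop :=
  ∀ (U : Set X) (u v : Π x : X, TangentSpace 𝓘(ℝ, E) x) (s : Π x : X, V x), IsOpen U →
    SmoothFieldOn u U → SmoothFieldOn v U → SmoothSectionOn E F s U → ∀ x ∈ U,
      R x (u x) (v x) (s x) =
        nabla (fun y => nabla s y (v y)) x (u x) - nabla (fun y => nabla s y (u y)) x (v x)
          - nabla s x (VectorField.mlieBracket 𝓘(ℝ, E) u v x)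

/-- The curvature of a smooth complex connection, uniquely determined by `IsCurvature`. -/
def curvature (nabla : CovariantDerivative 𝓘(ℝ, E) F V) :
    ∀ x : X, TangentSpace 𝓘(ℝ, E) x → TangentSpace 𝓘(ℝ, E) x → (V x →ₗ[ℂ] V x) :=
  Classical.epsilon (IsCurvature nabla)

end Connections

/-! ### The holomorphic line bundle `det T^{(1,0)} X` -/

section Det

variable (E X) in
/-- The line bundle `det T^{(1,0)} X`, with the holomorphic cocycle given by the determinants of the
complex Jacobian matrices of the changes of charts.  In the chart `φ`, the number `1` represents
`b_1 ∧ ⋯ ∧ b_n` for the coordinate fields of a fixed basis `b` of the model space. -/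
def detCore [FiniteDimensional ℂ E] [IsManifold 𝓘(ℂ, E) ω X] :
    VectorBundleCore ℂ X ℂ (atlas E X) where
  baseSet := (tangentBundleCore 𝓘(ℂ, E) X).baseSet
  isOpen_baseSet := (tangentBundleCore 𝓘(ℂ, E) X).isOpen_baseSet
  indexAt := (tangentBundleCore 𝓘(ℂ, E) X).indexAt
  mem_baseSet_at := (tangentBundleCore 𝓘(ℂ, E) X).mem_baseSet_at
  coordChange i j x :=
    ((tangentBundleCore 𝓘(ℂ, E) X).coordChange i j x).det • ContinuousLinearMap.id ℂ ℂ
  coordChange_self i x hx v := by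
    have h : (tangentBundleCore 𝓘(ℂ, E) X).coordChange i i x = ContinuousLinearMap.id ℂ E := by
      ext w; exact (tangentBundleCore 𝓘(ℂ, E) X).coordChange_self i x hx w
    rw [h]; simp [ContinuousLinearMap.det]
  continuousOn_coordChange i j := by
    have h := (tangentBundleCore 𝓘(ℂ, E) X).continuousOn_coordChange i j
    have h2 := (ContinuousLinearMap.continuous_det (𝕜 := ℂ) (E := E)).comp_continuousOn h
    exact h2.smul continuousOn_const
  coordChange_comp i j k x hx v := by
    have h : (tangentBundleCore 𝓘(ℂ, E) X).coordChange i k x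
        = ((tangentBundleCore 𝓘(ℂ, E) X).coordChange j k x).comp
          ((tangentBundleCore 𝓘(ℂ, E) X).coordChange i j x) := by
      ext w; exact ((tangentBundleCore 𝓘(ℂ, E) X).coordChange_comp i j k x hx w).symm
    rw [h]
    simp [ContinuousLinearMap.det, LinearMap.det_comp, mul_assoc]

instance detFiberModuleReal [FiniteDimensional ℂ E] [IsManifold 𝓘(ℂ, E) ω X] (x : X) :
    Module ℝ ((detCore E X).Fiber x) := inferInstanceAs (Module ℝ ℂ)

instance detFiberIsTopologicalAddGroup [FiniteDimensional ℂ E] [IsManifold 𝓘(ℂ, E) ω X] (x : X) :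
    IsTopologicalAddGroup ((detCore E X).Fiber x) := inferInstanceAs (IsTopologicalAddGroup ℂ)

instance detFiberContinuousSMul [FiniteDimensional ℂ E] [IsManifold 𝓘(ℂ, E) ω X] (x : X) :
    ContinuousSMul ℝ ((detCore E X).Fiber x) := inferInstanceAs (ContinuousSMul ℝ ℂ)

end Det

instance tangentFiniteDimensional [FiniteDimensional ℂ E] (x : X) :
    FiniteDimensional ℝ (TangentSpace 𝓘(ℝ, E) x) := inferInstanceAs (FiniteDimensional ℝ E)

/-! ### Kähler metrics -/

section Metric

variable [RiemannianBundle (fun x : X => TangentSpace 𝓘(ℝ, E) x)]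

/-- The `ℂ`-bilinear extension of the Riemannian metric to `T_x X ⊗ ℂ`. -/
def metricC {x : X} (u v : ComplexTangent E x) : ℂ :=
  complexify₂ (fun a b => ((inner ℝ a b : ℝ) : ℂ)) u v

/-- The form `ω(u, v) = g(J u, v)`, so that `g(u, v) = ω(u, J v)` when `g` is `J`-invariant. -/
def kahlerForm (x : X) (u v : TangentSpace 𝓘(ℝ, E) x) : ℝ := inner ℝ (J E x u) v

variable (E X) in
/-- The Riemannian metric is Kähler: it is `J`-invariant and its form `ω` is closed. -/
structure IsKahlerMetric [IsManifold 𝓘(ℂ, E) ω X] : Prop where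
  invariant : ∀ (x : X) (u v : TangentSpace 𝓘(ℝ, E) x),
    (inner ℝ (J E x u) (J E x v) : ℝ) = inner ℝ u v
  closed : ∀ u v w : Π x : X, TangentSpace 𝓘(ℝ, E) x,
    SmoothFieldOn u Set.univ → SmoothFieldOn v Set.univ → SmoothFieldOn w Set.univ → ∀ x : X,
      mvfderiv 𝓘(ℝ, E) (fun y => kahlerForm y (v y) (w y)) x (u x)
        - mvfderiv 𝓘(ℝ, E) (fun y => kahlerForm y (u y) (w y)) x (v x)
        + mvfderiv 𝓘(ℝ, E) (fun y => kahlerForm y (u y) (v y)) x (w x)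
        - kahlerForm x (VectorField.mlieBracket 𝓘(ℝ, E) u v x) (w x)
        + kahlerForm x (VectorField.mlieBracket 𝓘(ℝ, E) u w x) (v x)
        - kahlerForm x (VectorField.mlieBracket 𝓘(ℝ, E) v w x) (u x) = 0

/-- The smooth Levi-Civita connection: metric and torsion-free. -/
structure IsLeviCivita [IsManifold 𝓘(ℂ, E) ω X]
    (nablaT : CovariantDerivative 𝓘(ℝ, E) E (fun x : X => TangentSpace 𝓘(ℝ, E) x)) : Prop where
  smooth : ∀ u v : Π x : X, TangentSpace 𝓘(ℝ, E) x,
    SmoothFieldOn u Set.univ → SmoothFieldOn v Set.univ →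
    SmoothFieldOn (fun x => nablaT u x (v x)) Set.univ
  metric : ∀ u v : Π x : X, TangentSpace 𝓘(ℝ, E) x,
    SmoothFieldOn u Set.univ → SmoothFieldOn v Set.univ →
    ∀ (x : X) (a : TangentSpace 𝓘(ℝ, E) x),
      mvfderiv 𝓘(ℝ, E) (fun y => (inner ℝ (u y) (v y) : ℝ)) x a
        = inner ℝ (nablaT u x a) (v x) + inner ℝ (u x) (nablaT v x a)
  torsion_free : ∀ u v : Π x : X, TangentSpace 𝓘(ℝ, E) x,
    SmoothFieldOn u Set.univ → SmoothFieldOn v Set.univ →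
    ∀ x : X, nablaT v x (u x) - nablaT u x (v x) = VectorField.mlieBracket 𝓘(ℝ, E) u v x

/-- The Riemannian density `√det (g(∂_i, ∂_j))` of the chart at `x₀`, for the coordinate fields of
the basis `Module.finBasis ℝ E` of the model space, at the point with coordinate `z`. -/
def volumeDensity [FiniteDimensional ℂ E] (x₀ : X) (z : E) : ℝ :=
  let d : Fin (Module.finrank ℝ E) → TangentSpace 𝓘(ℝ, E) ((extChartAt 𝓘(ℝ, E) x₀).symm z) :=
    fun i => mfderiv 𝓘(ℝ, E) 𝓘(ℝ, E) (extChartAt 𝓘(ℝ, E) x₀).symm z (Module.finBasis ℝ E i)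
  Real.sqrt (Matrix.of fun i j => (inner ℝ (d i) (d j) : ℝ)).det

variable (E) in
/-- `vol` is the Riemannian volume measure. -/
def IsRiemannianVolume [FiniteDimensional ℂ E] [MeasurableSpace E] [BorelSpace E]
    [MeasurableSpace X] (vol : Measure X) : Prop :=
  ∀ (x₀ : X) (A : Set X), MeasurableSet A → A ⊆ (chartAt E x₀).source →
    vol A = ∫⁻ z in extChartAt 𝓘(ℝ, E) x₀ '' A, ENNReal.ofReal (volumeDensity x₀ z)
      ∂(Module.finBasis ℝ E).addHaar

variable [FiniteDimensional ℂ E]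

/-- The Hermitian metric of `det T^{(1,0)} X` induced by the metric of `X`: the square norm of
`∂_1 ∧ ⋯ ∧ ∂_n` is the determinant of `⟨∂_i, ∂̄_j⟩`, with `∂_i = (b_i - i J b_i) / 2`. -/
def detMetric [IsManifold 𝓘(ℂ, E) ω X] (x : X) (a b : (detCore E X).Fiber x) : ℂ :=
  let d : Fin (Module.finrank ℂ E) → ComplexTangent E x := fun i =>
    ⟨(1 / 2 : ℝ) • tangentBasis E x i, -((1 / 2 : ℝ) • J E x (tangentBasis E x i))⟩
  conj (show ℂ from a) * (show ℂ from b)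
    * (Matrix.of fun i j => metricC (d i) (d j).conjugate).det

/-- The Hermitian metric on `T^{*(0,1)}_x X` (conjugate-linear in the first variable), extending the
dual Riemannian metric.  If `w_j` is an orthonormal basis of `T^{(1,0)}_x X`, then the dual basis of
`w̄_j` is orthonormal. -/
def formMetric {x : X} (α β : T01Dual E x) : ℂ :=
  ∑ i, conj ((α : TangentSpace 𝓘(ℝ, E) x →L[ℝ] ℂ)
        (stdOrthonormalBasis ℝ (TangentSpace 𝓘(ℝ, E) x) i))
    * (β : TangentSpace 𝓘(ℝ, E) x →L[ℝ] ℂ)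
        (stdOrthonormalBasis ℝ (TangentSpace 𝓘(ℝ, E) x) i)

end Metric

/-! ### The bundle `Λ^{0,•}(T^*X) ⊗ L^p ⊗ V` -/

section Fibers

variable (E) (p : ℕ) (L V : X → Type*)
  [∀ x, AddCommGroup (L x)] [∀ x, Module ℂ (L x)] [∀ x, AddCommGroup (V x)] [∀ x, Module ℂ (V x)]

/-- The fiber of `L^p ⊗ V`. -/
abbrev TwistFiber (x : X) := (⨂[ℂ] _ : Fin p, L x) ⊗[ℂ] V x

/-- The fiber of `Λ^{0,•}(T^*X) ⊗ L^p ⊗ V`. -/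
abbrev FormFiber (x : X) := ExteriorAlgebra ℂ (T01Dual E x) ⊗[ℂ] TwistFiber p L V x

/-- The data of `(0,1)`-forms `α_1, …, α_q`, sections `l_1, …, l_p` of `L` and a section `e`
of `V`, defining a decomposable section `α_1 ∧ ⋯ ∧ α_q ⊗ l_1 ⊗ ⋯ ⊗ l_p ⊗ e`. -/
structure Decomposable where
  deg : ℕ
  form : Fin deg → Π x : X, T01Dual E x
  line : Fin p → Π x : X, L x
  vec : Π x : X, V x

variable {E p L V}

/-- The section `α_1 ∧ ⋯ ∧ α_q ⊗ l_1 ⊗ ⋯ ⊗ l_p ⊗ e`. -/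
def Decomposable.val (c : Decomposable E p L V) (x : X) : FormFiber E p L V x :=
  ExteriorAlgebra.ιMulti ℂ c.deg (fun i => c.form i x) ⊗ₜ[ℂ]
    (PiTensorProduct.tprod ℂ (fun i => c.line i x) ⊗ₜ[ℂ] c.vec x)

/-- Exterior multiplication `α ∧`. -/
def wedge {x : X} (α : T01Dual E x) : FormFiber E p L V x →ₗ[ℂ] FormFiber E p L V x :=
  LinearMap.rTensor _ (LinearMap.mulLeft ℂ (ExteriorAlgebra.ι ℂ α))

/-- Interior multiplication `i_u`, the antiderivation with `i_u α = α(u)`. -/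
def interiorMul {x : X} (u : ComplexTangent E x) : FormFiber E p L V x →ₗ[ℂ] FormFiber E p L V x :=
  LinearMap.rTensor _ (CliffordAlgebra.contractLeft (Q := 0) (evalDual u))

/-- The number operator of an exterior algebra, multiplication by `q` in degree `q`. -/
def extNumber (M : Type*) [AddCommGroup M] [Module ℂ M] :
    ExteriorAlgebra ℂ M →ₗ[ℂ] ExteriorAlgebra ℂ M :=
  (DirectSum.toModule ℂ ℕ (ExteriorAlgebra ℂ M)
      (fun q => (q : ℂ) • (⋀[ℂ]^q M).subtype)).comp
    (DirectSum.decomposeLinearEquiv (fun q : ℕ => ⋀[ℂ]^q M)).toLinearMap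

/-- The number operator `𝒩` on `Λ^{0,•}(T^*X) ⊗ L^p ⊗ V`. -/
def number {x : X} : FormFiber E p L V x →ₗ[ℂ] FormFiber E p L V x :=
  LinearMap.rTensor _ (extNumber (T01Dual E x))

/-- The action of an endomorphism of `V_x` on `Λ^{0,•}(T^*X) ⊗ L^p ⊗ V`. -/
def actEnd {x : X} (A : V x →ₗ[ℂ] V x) : FormFiber E p L V x →ₗ[ℂ] FormFiber E p L V x :=
  LinearMap.lTensor _ (LinearMap.lTensor _ A)

end Fibers

/-! ### Smooth sections and operators -/

section Operators

variable [IsManifold 𝓘(ℂ, E) ω X] {p : ℕ}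
  {L : X → Type*} [∀ x, NormedAddCommGroup (L x)] [∀ x, InnerProductSpace ℂ (L x)]
  [TopologicalSpace (TotalSpace ℂ L)] [FiberBundle ℂ L]
  {F : Type*} [NormedAddCommGroup F] [NormedSpace ℂ F]
  {V : X → Type*} [∀ x, NormedAddCommGroup (V x)] [∀ x, InnerProductSpace ℂ (V x)]
  [TopologicalSpace (TotalSpace F V)] [FiberBundle F V]

/-- A `(0,1)`-form is smooth on `U` if it takes smooth values on smooth vector fields. -/
def SmoothFormOn (α : Π x : X, T01Dual E x) (U : Set X) : Prop :=
  ∀ (W : Set X) (v : Π x : X, TangentSpace 𝓘(ℝ, E) x), IsOpen W → SmoothFieldOn v W →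
    ContMDiffOn 𝓘(ℝ, E) 𝓘(ℝ, ℂ) ∞
      (fun x => (α x : TangentSpace 𝓘(ℝ, E) x →L[ℝ] ℂ) (v x)) (U ∩ W)

variable (F) in
/-- All the factors of a decomposable section are smooth on `U`. -/
def Decomposable.SmoothOn (c : Decomposable E p L V) (U : Set X) : Prop :=
  (∀ i, SmoothFormOn (c.form i) U) ∧ (∀ i, SmoothSectionOn E ℂ (c.line i) U) ∧
    SmoothSectionOn E F c.vec U

variable (F) in
/-- `s ∈ Ω^{0,•}(X, L^p ⊗ V)`: near each point, `s` is a finite sum of decomposable sections with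
smooth factors. -/
def IsSmoothForm (s : Π x : X, FormFiber E p L V x) : Prop :=
  ∀ x : X, ∃ U : Set X, IsOpen U ∧ x ∈ U ∧ ∃ (m : ℕ) (c : Fin m → Decomposable E p L V),
    (∀ k, (c k).SmoothOn F U) ∧ ∀ y ∈ U, s y = ∑ k, (c k).val y

section Derivatives

variable (nablaT : CovariantDerivative 𝓘(ℝ, E) E (fun x : X => TangentSpace 𝓘(ℝ, E) x))
  (nablaL : CovariantDerivative 𝓘(ℝ, E) ℂ L) (nablaV : CovariantDerivative 𝓘(ℝ, E) F V)

/-- `β = ∇_v α` at `x` for the dual of the connection `nablaT`: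
`β(u) = v(α(u)) - α(∇_v u)` for all vector fields `u`. -/
def IsFormDerivative (α : Π x : X, T01Dual E x) (x : X) (v : TangentSpace 𝓘(ℝ, E) x)
    (β : T01Dual E x) : Prop :=
  ∀ u : Π x : X, TangentSpace 𝓘(ℝ, E) x, SmoothFieldOn u Set.univ →
    (β : TangentSpace 𝓘(ℝ, E) x →L[ℝ] ℂ) (u x) =
      mvfderiv 𝓘(ℝ, E) (fun y => (α y : TangentSpace 𝓘(ℝ, E) y →L[ℝ] ℂ) (u y)) x v
        - (α x : TangentSpace 𝓘(ℝ, E) x →L[ℝ] ℂ) (nablaT u x v)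

/-- The covariant derivative
`∑_i l_1 ⊗ ⋯ ⊗ ∇_v l_i ⊗ ⋯ ⊗ l_p ⊗ e + l_1 ⊗ ⋯ ⊗ l_p ⊗ ∇_v e` in `L^p ⊗ V`. -/
def twistDerivative (c : Decomposable E p L V) (x : X) (v : TangentSpace 𝓘(ℝ, E) x) :
    TwistFiber p L V x :=
  (∑ i, PiTensorProduct.tprod ℂ
      (Function.update (fun j => c.line j x) i (nablaL (c.line i) x v))) ⊗ₜ[ℂ] c.vec x
    + PiTensorProduct.tprod ℂ (fun j => c.line j x) ⊗ₜ[ℂ] nablaV c.vec x v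

/-- `ξ` is the derivative at `x` along `v` of `s` for the tensor product connection on
`Λ^{0,•}(T^*X) ⊗ L^p ⊗ V`: near `x`, `s` is a finite sum of smooth decomposable sections, and `ξ`
is given by the Leibniz rule. -/
def HasCovariantDerivative (s : Π x : X, FormFiber E p L V x) (x : X)
    (v : TangentSpace 𝓘(ℝ, E) x) (ξ : FormFiber E p L V x) : Prop :=
  ∃ U : Set X, IsOpen U ∧ x ∈ U ∧ ∃ (m : ℕ) (c : Fin m → Decomposable E p L V)
    (β : ∀ k, Fin (c k).deg → T01Dual E x),
    (∀ k, (c k).SmoothOn F U) ∧ (∀ y ∈ U, s y = ∑ k, (c k).val y) ∧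
    (∀ k i, IsFormDerivative nablaT ((c k).form i) x v (β k i)) ∧
    ξ = ∑ k,
      ((∑ i, ExteriorAlgebra.ιMulti ℂ (c k).deg
            (Function.update (fun j => (c k).form j x) i (β k i))) ⊗ₜ[ℂ]
          (PiTensorProduct.tprod ℂ (fun j => (c k).line j x) ⊗ₜ[ℂ] (c k).vec x)
        + ExteriorAlgebra.ιMulti ℂ (c k).deg (fun j => (c k).form j x) ⊗ₜ[ℂ]
            twistDerivative nablaL nablaV (c k) x v)

/-- The connection `∇^{Λ^{0,•} ⊗ L^p ⊗ V}`; like `deriv`, it is meaningful on smooth sections. -/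
def covariantDerivative (s : Π x : X, FormFiber E p L V x) (x : X)
    (v : TangentSpace 𝓘(ℝ, E) x) : FormFiber E p L V x :=
  Classical.epsilon (HasCovariantDerivative nablaT nablaL nablaV s x v)

/-- The Bochner Laplacian `-∑_j (∇_{e_j} ∇_{e_j} - ∇_{∇_{e_j} e_j})` computed with a frame `e`. -/
def bochnerLaplacian {N : ℕ} (e : Fin N → Π x : X, TangentSpace 𝓘(ℝ, E) x)
    (s : Π x : X, FormFiber E p L V x) (x : X) : FormFiber E p L V x :=
  -∑ j, (covariantDerivative nablaT nablaL nablaV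
        (fun y => covariantDerivative nablaT nablaL nablaV s y (e j y)) x (e j x)
      - covariantDerivative nablaT nablaL nablaV s x (nablaT (e j) x (e j x)))

variable [FiniteDimensional ℂ E]

/-- `ξ = ∂̄s` at `x` for the Dolbeault operator of `L^p ⊗ V`.  Near `x`, the form `s` is a finite sum
of terms `α ⊗ t` where `α = ∂̄f_1 ∧ ⋯ ∧ ∂̄f_q` (so `∂̄α = 0`) and `t` is a section of `L^p ⊗ V`; then,
by the Leibniz formula, `∂̄(α ⊗ t) = (-1)^q α ∧ ∂̄t`.  Here `∂̄t` is the `(0,1)`-part of `∇t`, i.e.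
`∂̄t = ∑_j b̄^j ⊗ (∇_{b_j} t + i ∇_{J b_j} t) / 2` for any complex basis `b_j` of `T_x X`, with
`b̄^j` the conjugate of the dual basis. -/
def HasDolbeault (s : Π x : X, FormFiber E p L V x) (x : X) (ξ : FormFiber E p L V x) : Prop :=
  ∃ U : Set X, IsOpen U ∧ x ∈ U ∧ ∃ (m : ℕ) (c : Fin m → Decomposable E p L V)
    (f : ∀ k, Fin (c k).deg → X → ℂ),
    (∀ k, (c k).SmoothOn F U) ∧ (∀ y ∈ U, s y = ∑ k, (c k).val y) ∧
    (∀ k i, ContMDiffOn 𝓘(ℝ, E) 𝓘(ℝ, ℂ) ∞ (f k i) U) ∧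
    (∀ k i, ∀ y ∈ U, (c k).form i y = dbarFun (f k i) y) ∧
    ξ = ∑ k, (-1 : ℂ) ^ (c k).deg • ∑ j,
      (ExteriorAlgebra.ιMulti ℂ (c k).deg (fun i => (c k).form i x)
          * ExteriorAlgebra.ι ℂ (conjDualBasis E x j)) ⊗ₜ[ℂ]
        ((1 / 2 : ℂ) • (twistDerivative nablaL nablaV (c k) x (tangentBasis E x j)
          + Complex.I • twistDerivative nablaL nablaV (c k) x (J E x (tangentBasis E x j))))

/-- The Dolbeault operator `∂̄` of `L^p ⊗ V` on `Ω^{0,•}(X, L^p ⊗ V)`; like `deriv`, it is meaningful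
on smooth sections. -/
def dolbeault (s : Π x : X, FormFiber E p L V x) (x : X) : FormFiber E p L V x :=
  Classical.epsilon (HasDolbeault nablaL nablaV s x)

end Derivatives

section Adjoint

variable [FiniteDimensional ℂ E] [RiemannianBundle (fun x : X => TangentSpace 𝓘(ℝ, E) x)]

/-- `h` is the Hermitian form on `Λ^{0,•}(T^*_x X) ⊗ L_x^p ⊗ V_x` induced by the metrics. -/
def IsInducedHermitian {x : X} (h : FormFiber E p L V x →ₗ⋆[ℂ] FormFiber E p L V x →ₗ[ℂ] ℂ) :
    Prop :=
  (∀ (q : ℕ) (α β : Fin q → T01Dual E x) (l l' : Fin p → L x) (e e' : V x),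
    h (ExteriorAlgebra.ιMulti ℂ q α ⊗ₜ[ℂ] (PiTensorProduct.tprod ℂ l ⊗ₜ[ℂ] e))
        (ExteriorAlgebra.ιMulti ℂ q β ⊗ₜ[ℂ] (PiTensorProduct.tprod ℂ l' ⊗ₜ[ℂ] e'))
      = (Matrix.of fun i j => formMetric (α i) (β j)).det * (∏ i, inner ℂ (l i) (l' i))
        * inner ℂ e e') ∧
  (∀ (q q' : ℕ) (α : Fin q → T01Dual E x) (β : Fin q' → T01Dual E x) (t t' : TwistFiber p L V x),
    q ≠ q' → h (ExteriorAlgebra.ιMulti ℂ q α ⊗ₜ[ℂ] t) (ExteriorAlgebra.ιMulti ℂ q' β ⊗ₜ[ℂ] t') = 0)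

/-- The Hermitian metric of `Λ^{0,•}(T^*X) ⊗ L^p ⊗ V`, uniquely determined by
`IsInducedHermitian`. -/
def inducedHermitian (x : X) : FormFiber E p L V x →ₗ⋆[ℂ] FormFiber E p L V x →ₗ[ℂ] ℂ :=
  Classical.epsilon IsInducedHermitian

variable [MeasurableSpace X] (vol : Measure X)

/-- The `L²` product on `Ω^{0,•}(X, L^p ⊗ V)`. -/
def l2Product (s t : Π x : X, FormFiber E p L V x) : ℂ :=
  ∫ x, inducedHermitian x (s x) (t x) ∂vol

variable (nablaL : CovariantDerivative 𝓘(ℝ, E) ℂ L) (nablaV : CovariantDerivative 𝓘(ℝ, E) F V)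

/-- `t = ∂̄^* s`, for the formal adjoint `∂̄^*` of `∂̄` with respect to the `L²` product. -/
def IsDolbeaultAdjoint (s t : Π x : X, FormFiber E p L V x) : Prop :=
  IsSmoothForm F t ∧ ∀ r : Π x : X, FormFiber E p L V x, IsSmoothForm F r →
    l2Product vol (dolbeault nablaL nablaV r) s = l2Product vol r t

/-- The formal adjoint `∂̄^*` of `∂̄` on `Ω^{0,•}(X, L^p ⊗ V)`. -/
def dolbeaultAdjoint (s : Π x : X, FormFiber E p L V x) : Π x : X, FormFiber E p L V x :=
  Classical.epsilon (IsDolbeaultAdjoint vol nablaL nablaV s)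

/-- The operator `D_p = √2 (∂̄ + ∂̄^*)` on `Ω^{0,•}(X, L^p ⊗ V)`. -/
def dirac (s : Π x : X, FormFiber E p L V x) (x : X) : FormFiber E p L V x :=
  ((Real.sqrt 2 : ℝ) : ℂ) •
    (dolbeault nablaL nablaV s x + dolbeaultAdjoint vol nablaL nablaV s x)

end Adjoint

end Operators

end SpinDirac

end

open SpinDirac

noncomputable section

namespace SpinDirac

open Finset (sum_congr sum_add_distrib smul_sum sum_comm sum_insert mul_sum sum_sub_distrib
  sum_neg_distrib sum_eq_zero sum_mul sum_eq_single sum_smul)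
open Complex (I I_sq reCLM imCLM)
open Module (finrank finBasis)
open VectorField (mlieBracket)
open ExteriorAlgebra (ιMulti)
open PiTensorProduct (tprod)
open LinearMap (trace)

set_option linter.unusedSectionVars false

set_option hygiene false in
/-- The real tangent bundle. -/
local notation:max "𝕋" => TangentSpace 𝓘(ℝ, E)
set_option hygiene false in
/-- Vector fields. -/
local notation:max "𝔛" => (y : X) → 𝕋 y
set_option hygiene false in
/-- The model with corners of the underlying real manifold. -/
local notation:max "𝕀" => 𝓘(ℝ, E)
set_option hygiene false in
/-- The differential of a function. -/
local notation:max "𝕕" => _root_.mvfderiv 𝓘(ℝ, E)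
set_option hygiene false in
/-- The chart at `x₀`. -/
local notation:max "φ₀" => extChartAt 𝓘(ℝ, E) x₀
set_option hygiene false in
/-- The fibers of `Λ^{0,•}(T^*X) ⊗ L^p ⊗ V`. -/
local notation:max "𝔽" => FormFiber E p L V
set_option hygiene false in
/-- Decomposable sections. -/
local notation:max "𝔻" => Decomposable E p L V
set_option hygiene false in
/-- The standing assumptions on the metrics and connections. -/
local notation:max "ℍ" => HermitianData nablaT nablaL nablaV
set_option hygiene false in
/-- The domain of the chart at a point. -/
local notation:max "𝕌" x:max => (chartAt E x).source

section Germs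

variable (E : Type*) [NormedAddCommGroup E] [NormedSpace ℝ E]
  {X : Type*} [TopologicalSpace X] [ChartedSpace E X]

/-- The function `f` is smooth near `x`. -/
def FnNear {G : Type*} [NormedAddCommGroup G] [NormedSpace ℝ G] (f : X → G) (x : X) : Prop :=
  ∀ᶠ y in 𝓝 x, ContMDiffAt 𝕀 𝓘(ℝ, G) ∞ f y

variable (F : Type*) [NormedAddCommGroup F] [NormedSpace ℝ F]
  {V : X → Type*} [TopologicalSpace (TotalSpace F V)]
  [∀ x, TopologicalSpace (V x)] [FiberBundle F V]

/-- The section `s` is smooth near `x`. -/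
def SmoothNear (s : Π x : X, V x) (x : X) : Prop :=
  ∀ᶠ y in 𝓝 x, ContMDiffAt 𝕀 ((𝕀).prod 𝓘(ℝ, F)) ∞ (fun z => TotalSpace.mk' F z (s z)) y

variable {E F} {s t : Π x : X, V x} {x : X}
  {G : Type*} [NormedAddCommGroup G] [NormedSpace ℝ G] {f f' : X → G}

lemma FnNear.eventually (h : FnNear E f x) : ∀ᶠ y in 𝓝 x, FnNear E f y :=
  h.eventually_nhds

lemma FnNear.contMDiffAt (h : FnNear E f x) : ContMDiffAt 𝕀 𝓘(ℝ, G) ∞ f x :=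
  h.self_of_nhds

lemma FnNear.mdiff (h : FnNear E f x) : MDifferentiableAt 𝕀 𝓘(ℝ, G) f x :=
  h.contMDiffAt.mdifferentiableAt (by simp)

lemma FnNear.congr (h : FnNear E f x) (hf : f' =ᶠ[𝓝 x] f) : FnNear E f' x := by
  filter_upwards [h, hf.eventuallyEq_nhds] with y hy hy' using hy.congr_of_eventuallyEq hy'

lemma FnNear.add (h : FnNear E f x) (h' : FnNear E f' x) : FnNear E (fun y => f y + f' y) x := by
  filter_upwards [h, h'] with y hy hy' using hy.add hy'

lemma FnNear.const (c : G) : FnNear E (fun _ : X => c) x :=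
  .of_forall fun _ => contMDiffAt_const

lemma FnNear.sum {ι : Type*} {S : Finset ι} {g : ι → X → G} (h : ∀ i ∈ S, FnNear E (g i) x) :
    FnNear E (fun y => ∑ i ∈ S, g i y) x := by
  have h2 := (Filter.eventually_all_finset S).2 h
  filter_upwards [h2] with y hy using contMDiffAt_finsetSum hy

lemma FnNear.clm {G' : Type*} [NormedAddCommGroup G'] [NormedSpace ℝ G'] (A : G →L[ℝ] G')
    (h : FnNear E f x) : FnNear E (fun y => A (f y)) x := by
  filter_upwards [h] with y hy
  exact (A.contMDiff.contMDiffAt).comp y hy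

lemma FnNear.mul {𝔸 : Type*} [NormedRing 𝔸] [NormedAlgebra ℝ 𝔸] {f f' : X → 𝔸}
    (h : FnNear E f x) (h' : FnNear E f' x) : FnNear E (fun y => f y * f' y) x := by
  have := ((ContinuousLinearMap.mul ℝ 𝔸).isBoundedBilinearMap.contDiff (n := ∞)).contMDiff
  filter_upwards [h, h'] with y hy hy'
  exact this.contMDiffAt.comp y (hy.prodMk_space hy')

lemma FnNear.smul {r : X → ℝ} (h : FnNear E r x) (h' : FnNear E f x) :
    FnNear E (fun y => r y • f y) x := by
  filter_upwards [h, h'] with y hy hy' using hy.smul hy'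

lemma SmoothNear.eventually (h : SmoothNear E F s x) : ∀ᶠ y in 𝓝 x, SmoothNear E F s y :=
  h.eventually_nhds

lemma SmoothNear.contMDiffAt (h : SmoothNear E F s x) :
    ContMDiffAt 𝕀 ((𝕀).prod 𝓘(ℝ, F)) ∞ (fun z => TotalSpace.mk' F z (s z)) x :=
  h.self_of_nhds

lemma SmoothNear.mdiff (h : SmoothNear E F s x) :
    MDifferentiableAt 𝕀 ((𝕀).prod 𝓘(ℝ, F)) (fun z => TotalSpace.mk' F z (s z)) x :=
  h.contMDiffAt.mdifferentiableAt (by simp)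

lemma SmoothNear.congr (h : SmoothNear E F s x) (hs : ∀ᶠ y in 𝓝 x, t y = s y) :
    SmoothNear E F t x := by
  filter_upwards [h, hs.eventually_nhds] with y hy hy'
  exact hy.congr_of_eventuallyEq (hy'.mono fun z hz => by simp [hz])

lemma smoothNear_of_contMDiffOn {U : Set X} (hU : IsOpen U) (hx : x ∈ U)
    (h : ContMDiffOn 𝕀 ((𝕀).prod 𝓘(ℝ, F)) ∞ (fun z => TotalSpace.mk' F z (s z)) U) :
    SmoothNear E F s x := by
  filter_upwards [hU.mem_nhds hx] with y hy using h.contMDiffAt (hU.mem_nhds hy)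

lemma contMDiffOn_of_smoothNear {U : Set X} (h : ∀ x ∈ U, SmoothNear E F s x) :
    ContMDiffOn 𝕀 ((𝕀).prod 𝓘(ℝ, F)) ∞ (fun z => TotalSpace.mk' F z (s z)) U :=
  fun x hx => (h x hx).contMDiffAt.contMDiffWithinAt

lemma SmoothNear.exists_open (h : SmoothNear E F s x) : ∃ U : Set X, IsOpen U ∧ x ∈ U ∧
    ∀ y ∈ U, SmoothNear E F s y := by
  obtain ⟨U, h1, h2, h3⟩ := eventually_nhds_iff.1 h
  exact ⟨U, h2, h3, fun y hy => by filter_upwards [h2.mem_nhds hy] with z hz using h1 z hz⟩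

section Module

variable [∀ x, AddCommGroup (V x)] [∀ x, Module ℝ (V x)] [VectorBundle ℝ F V]

lemma SmoothNear.add (h : SmoothNear E F s x) (h' : SmoothNear E F t x) :
    SmoothNear E F (fun y => s y + t y) x := by
  filter_upwards [h, h'] with y hy hy' using hy.add_section hy'

lemma SmoothNear.smul {r : X → ℝ} (hr : FnNear E r x) (h : SmoothNear E F s x) :
    SmoothNear E F (fun y => r y • s y) x := by
  filter_upwards [hr, h] with y hy hy' using hy.smul_section hy'

lemma SmoothNear.neg (h : SmoothNear E F s x) : SmoothNear E F (fun y => - s y) x := by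
  refine (SmoothNear.smul (FnNear.const (-1 : ℝ)) h).congr ?_
  filter_upwards with y using by simp

lemma SmoothNear.sub (h : SmoothNear E F s x) (h' : SmoothNear E F t x) :
    SmoothNear E F (fun y => s y - t y) x := by
  simpa only [sub_eq_add_neg] using h.add h'.neg

lemma SmoothNear.const_smul (r : ℝ) (h : SmoothNear E F s x) :
    SmoothNear E F (fun y => r • s y) x := SmoothNear.smul (FnNear.const r) h

lemma SmoothNear.sum {ι : Type*} {S : Finset ι} {g : ι → Π x : X, V x}
    (h : ∀ i ∈ S, SmoothNear E F (g i) x) : SmoothNear E F (fun y => ∑ i ∈ S, g i y) x := by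
  have h2 := (Filter.eventually_all_finset S).2 h
  filter_upwards [h2] with y hy using ContMDiffAt.sum_section hy

lemma SmoothNear.zero : SmoothNear E F (fun y => (0 : V y)) x := by
  filter_upwards with y using (contMDiff_zeroSection ℝ V).contMDiffAt

/-- A section that is smooth near `x` has the germ of a smooth global section. -/
lemma SmoothNear.exists_global [FiniteDimensional ℝ E] [T2Space X] [IsManifold 𝕀 ∞ X]
    (h : SmoothNear E F s x) :
    ∃ s' : Π x : X, V x, (∀ y, SmoothNear E F s' y) ∧ ∀ᶠ y in 𝓝 x, s' y = s y := by
  obtain ⟨U, hU, hxU, hs⟩ := h.exists_open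
  obtain ⟨χ, -, hχ⟩ := (SmoothBumpFunction.nhds_basis_tsupport (I := 𝕀) x).mem_iff.1
    (hU.mem_nhds hxU)
  refine ⟨fun y => χ y • s y, fun y => ?_, ?_⟩
  · by_cases hy : y ∈ U
    · exact SmoothNear.smul (.of_forall fun z => χ.contMDiffAt) (hs y hy)
    · have hy' : y ∉ tsupport χ := fun hc => hy (hχ hc)
      refine SmoothNear.zero.congr ?_
      filter_upwards [(isClosed_tsupport χ).isOpen_compl.mem_nhds hy'] with z hz
      rw [image_eq_zero_of_notMem_tsupport hz, zero_smul]
  · filter_upwards [χ.eventuallyEq_one] with y hy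
    simp [hy]

/-- Every vector is the value of a section that is smooth near the point. -/
lemma exists_smoothNear [FiniteDimensional ℝ F] [ContMDiffVectorBundle ∞ F V 𝕀] (v : V x) :
    ∃ s : Π x : X, V x, SmoothNear E F s x ∧ s x = v := by
  refine ⟨FiberBundle.extend F v, ?_, by simp⟩
  obtain ⟨u, hu, h⟩ := FiberBundle.exists_contMDiffOn_extend (k := ∞) 𝕀 F v
  obtain ⟨w, hwu, hw, hxw⟩ := mem_nhds_iff.1 hu
  exact smoothNear_of_contMDiffOn hw hxw (h.mono hwu)

/-- Every tangent vector is the value of a vector field that is smooth near the point. -/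
lemma exists_field [FiniteDimensional ℝ E] [IsManifold 𝕀 1 X]
    [ContMDiffVectorBundle ∞ E (𝕋 : X → Type _) 𝕀] (v : 𝕋 x) :
    ∃ s : 𝔛, SmoothNear E E s x ∧ s x = v :=
  exists_smoothNear v

end Module

end Germs

section DirectionalDerivative

variable {E : Type*} [NormedAddCommGroup E] [NormedSpace ℝ E]
  {X : Type*} [TopologicalSpace X] [ChartedSpace E X] {x : X}
  {G : Type*} [NormedAddCommGroup G] [NormedSpace ℝ G] {f f' : X → G}

lemma mvfderiv_congr (h : f' =ᶠ[𝓝 x] f) : 𝕕 f' x = 𝕕 f x := by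
  ext v
  have h1 : mfderiv 𝕀 𝓘(ℝ, G) f' x v = mfderiv 𝕀 𝓘(ℝ, G) f x v := by
    rw [h.mfderiv_eq]
    rfl
  exact h1

lemma mvfderiv_eq_of_hasMFDerivAt {A : 𝕋 x →L[ℝ] G}
    (h : HasMFDerivAt 𝕀 𝓘(ℝ, G) f x A) : 𝕕 f x = A := by
  ext v
  have := h.mfderiv
  exact congrArg (fun B : 𝕋 x →L[ℝ] G => B v) this

lemma hasMFDerivAt_mvfderiv (h : MDifferentiableAt 𝕀 𝓘(ℝ, G) f x) :
    HasMFDerivAt 𝕀 𝓘(ℝ, G) f x (𝕕 f x) := h.hasMFDerivAt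

lemma mvfderiv_clm {G' : Type*} [NormedAddCommGroup G'] [NormedSpace ℝ G'] (A : G →L[ℝ] G')
    (h : MDifferentiableAt 𝕀 𝓘(ℝ, G) f x) (v : 𝕋 x) : 𝕕 (fun y => A (f y)) x v = A (𝕕 f x v) := by
  have h2 := (A.hasMFDerivAt (x := f x)).comp x (hasMFDerivAt_mvfderiv h)
  exact congrArg (fun B : 𝕋 x →L[ℝ] G' => B v) (mvfderiv_eq_of_hasMFDerivAt h2)

lemma mvfderiv_sum_apply {ι : Type*} (S : Finset ι) {g : ι → X → G}
    (h : ∀ i ∈ S, MDifferentiableAt 𝕀 𝓘(ℝ, G) (g i) x) (v : 𝕋 x) :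
    𝕕 (fun y => ∑ i ∈ S, g i y) x v = ∑ i ∈ S, 𝕕 (g i) x v := by
  classical
  suffices h2 : ∀ T ⊆ S, MDifferentiableAt 𝕀 𝓘(ℝ, G) (fun y => ∑ i ∈ T, g i y) x ∧
      𝕕 (fun y => ∑ i ∈ T, g i y) x v = ∑ i ∈ T, 𝕕 (g i) x v from
    (h2 S subset_rfl).2
  intro T
  induction T using Finset.induction_on with
  | empty =>
    intro _
    simp only [Finset.sum_empty]
    exact ⟨mdifferentiableAt_const, by rw [mvfderiv_const]; rfl⟩
  | insert a T ha ih =>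
    intro hT
    simp only [sum_insert ha]
    have h1 := h a (hT (Finset.mem_insert_self a T))
    obtain ⟨h2, h3⟩ := ih ((Finset.subset_insert a T).trans hT)
    refine ⟨h1.add h2, ?_⟩
    rw [mvfderiv_fun_add h1 h2, ← h3]
    rfl

lemma mvfderiv_mul_apply {R : Type*} [NormedCommRing R] [NormedAlgebra ℝ R] {f g : X → R}
    (hf : MDifferentiableAt 𝕀 𝓘(ℝ, R) f x) (hg : MDifferentiableAt 𝕀 𝓘(ℝ, R) g x) (v : 𝕋 x) :
    𝕕 (fun y => f y * g y) x v = f x * 𝕕 g x v + 𝕕 f x v * g x := by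
  have h2 := mvfderiv_eq_of_hasMFDerivAt ((hasMFDerivAt_mvfderiv hf).mul (hasMFDerivAt_mvfderiv hg))
  have h3 : 𝕕 (fun y => f y * g y) x = _ := h2
  rw [h3]
  simp [mul_comm]

lemma mvfderiv_prod_apply {ι : Type*} [DecidableEq ι] (S : Finset ι)
    {R : Type*} [NormedCommRing R] [NormedAlgebra ℝ R] {g : ι → X → R}
    (h : ∀ i ∈ S, FnNear E (g i) x) (v : 𝕋 x) : FnNear E (fun y => ∏ i ∈ S, g i y) x ∧
    𝕕 (fun y => ∏ i ∈ S, g i y) x v = ∑ i ∈ S, 𝕕 (g i) x v * ∏ j ∈ S.erase i, g j x := by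
  induction S using Finset.induction_on with
  | empty => simpa using ⟨FnNear.const (1 : R), by rw [mvfderiv_const]; rfl⟩
  | insert a S ha ih =>
    obtain ⟨h1, h2⟩ := ih fun i hi => h i (Finset.mem_insert_of_mem hi)
    have h3 := h a (Finset.mem_insert_self a S)
    simp only [Finset.prod_insert ha]
    refine ⟨h3.mul h1, ?_⟩
    rw [mvfderiv_mul_apply h3.mdiff h1.mdiff, h2, sum_insert ha, Finset.erase_insert ha,
      add_comm, mul_sum]
    congr 1
    refine sum_congr rfl fun i hi => ?_
    have hia : i ≠ a := fun hc => ha (hc ▸ hi)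
    rw [Finset.erase_insert_of_ne hia.symm, Finset.prod_insert (fun hc => ha (Finset.mem_of_mem_erase hc))]
    ring

lemma mvfderiv_det_apply {m : Type*} [Fintype m] [DecidableEq m]
    {R : Type*} [NormedCommRing R] [NormedAlgebra ℝ R] {g : X → Matrix m m R}
    (h : ∀ i j, FnNear E (fun y => g y i j) x) (v : 𝕋 x) : FnNear E (fun y => (g y).det) x ∧
    𝕕 (fun y => (g y).det) x v = ((g x).adjugate *
      Matrix.of fun i j => 𝕕 (fun y => g y i j) x v).trace := by
  have hp : ∀ σ : Equiv.Perm m, FnNear E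
      (fun y => ((Equiv.Perm.sign σ : ℤ) : R) * ∏ i, g y (σ i) i) x :=
    fun σ => (FnNear.const _).mul (mvfderiv_prod_apply _ (fun i _ => h (σ i) i) v).1
  have h1 : (fun y => (g y).det)
      = fun y => ∑ σ : Equiv.Perm m, ((Equiv.Perm.sign σ : ℤ) : R) * ∏ i, g y (σ i) i := by
    funext y; exact Matrix.det_apply' (g y)
  rw [h1]
  refine ⟨FnNear.sum fun σ _ => hp σ, ?_⟩
  rw [mvfderiv_sum_apply _ fun σ _ => (hp σ).mdiff]
  have h2 : ∀ σ : Equiv.Perm m, 𝕕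
      (fun y => ((Equiv.Perm.sign σ : ℤ) : R) * ∏ i, g y (σ i) i) x v
      = ∑ i, ((Equiv.Perm.sign σ : ℤ) : R) * (𝕕 (fun y => g y (σ i) i) x v *
        ∏ j ∈ Finset.univ.erase i, g x (σ j) j) := by
    intro σ
    obtain ⟨h3, h4⟩ := mvfderiv_prod_apply Finset.univ (fun i _ => h (σ i) i) v
    rw [mvfderiv_mul_apply (FnNear.const _).mdiff h3.mdiff, h4, mvfderiv_const, mul_sum]
    simp
  simp only [h2]
  rw [sum_comm]
  simp only [Matrix.trace, Matrix.diag_apply]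
  refine sum_congr rfl fun i _ => ?_
  set N : Matrix m m R := Matrix.of fun i j => 𝕕 (fun y => g y i j) x v
  have h5 : ((g x).adjugate * N) i i = ((g x).updateCol i (fun k => N k i)).det := by
    rw [Matrix.mul_apply]
    have : ((g x).updateCol i (fun k => N k i)).det = Matrix.cramer (g x) (fun k => N k i) i :=
      (Matrix.cramer_apply _ _ _).symm
    rw [this, Matrix.cramer_eq_adjugate_mulVec]
    rfl
  rw [h5, Matrix.det_apply']
  refine sum_congr rfl fun σ _ => ?_
  rw [← Finset.mul_prod_erase Finset.univ _ (Finset.mem_univ i)]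
  congr 2
  · simp [N]
  · refine Finset.prod_congr rfl fun j hj => ?_
    rw [Matrix.updateCol_ne (Finset.ne_of_mem_erase hj)]

end DirectionalDerivative

section Tensorial

variable {E : Type*} [NormedAddCommGroup E] [NormedSpace ℝ E]
  {X : Type*} [TopologicalSpace X] [ChartedSpace E X] {x : X}
  {F : Type*} [NormedAddCommGroup F] [NormedSpace ℝ F] [FiniteDimensional ℝ F]
  {V : X → Type*} [TopologicalSpace (TotalSpace F V)]
  [∀ x, AddCommGroup (V x)] [∀ x, Module ℝ (V x)]
  [∀ x, TopologicalSpace (V x)] [FiberBundle F V] [VectorBundle ℝ F V]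
  [ContMDiffVectorBundle ∞ F V 𝕀]

variable (E F V x) in
/-- Every point has a smooth local frame with smooth coefficients. -/
lemma exists_frame : ∃ (e : Fin (finrank ℝ F) → Π y : X, V y)
    (c : Fin (finrank ℝ F) → Π y : X, V y →ₗ[ℝ] ℝ), (∀ i, SmoothNear E F (e i) x) ∧
    (∀ s : Π y : X, V y, SmoothNear E F s x → ∀ i, FnNear E (fun y => c i y (s y)) x) ∧
    ∀ s : Π y : X, V y, ∀ᶠ y in 𝓝 x, s y = ∑ i, c i y (s y) • e i y := by
  have : ContMDiffVectorBundle 1 F V 𝕀 := ContMDiffVectorBundle.of_le (n := ∞) (by simp)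
  let t := trivializationAt F V x
  let b := finBasis ℝ F
  have hx : x ∈ t.baseSet := FiberBundle.mem_baseSet_trivializationAt F V x
  refine ⟨t.localFrame b, t.localFrameCoeff 𝕀 b, fun i => ?_, fun s hs i => ?_, fun s => ?_⟩
  · exact smoothNear_of_contMDiffOn t.open_baseSet hx (t.contMDiffOn_localFrame_baseSet ∞ b i)
  · filter_upwards [hs, t.open_baseSet.mem_nhds hx] with y hy hyt
    exact contMDiffAt_localFrameCoeff b hyt hy i
  · exact t.eventually_eq_localFrame_sum_coeff_smul b hx

/-- An operation on germs at `x` of smooth sections which is linear over smooth functions. -/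
structure GermTensorial {A : Type*} [AddCommGroup A] [Module ℝ A] (Φ : (Π y : X, V y) → A)
    (x : X) : Prop where
  congr : ∀ s t : Π y : X, V y, SmoothNear E F s x → (∀ᶠ y in 𝓝 x, t y = s y) → Φ t = Φ s
  add : ∀ s t : Π y : X, V y, SmoothNear E F s x → SmoothNear E F t x →
    Φ (fun y => s y + t y) = Φ s + Φ t
  smul : ∀ (f : X → ℝ) (s : Π y : X, V y), FnNear E f x → SmoothNear E F s x →
    Φ (fun y => f y • s y) = f x • Φ s

lemma GermTensorial.sum {A : Type*} [AddCommGroup A] [Module ℝ A] {Φ : (Π y : X, V y) → A}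
    (h : GermTensorial (E := E) (F := F) Φ x) {ι : Type*} (S : Finset ι) {g : ι → Π y : X, V y}
    (hg : ∀ i ∈ S, SmoothNear E F (g i) x) : Φ (fun y => ∑ i ∈ S, g i y) = ∑ i ∈ S, Φ (g i) := by
  classical
  induction S using Finset.induction_on with
  | empty =>
    have h1 := h.smul (fun _ => 0) (fun y => 0) (FnNear.const 0) SmoothNear.zero
    simpa using h1
  | insert a S ha ih =>
    simp only [sum_insert ha]
    rw [h.add _ _ (hg a (Finset.mem_insert_self a S))
      (SmoothNear.sum fun i hi => hg i (Finset.mem_insert_of_mem hi)),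
      ih fun i hi => hg i (Finset.mem_insert_of_mem hi)]

lemma GermTensorial.pointwise {A : Type*} [AddCommGroup A] [Module ℝ A] {Φ : (Π y : X, V y) → A}
    (h : GermTensorial (E := E) (F := F) Φ x) {s t : Π y : X, V y} (hs : SmoothNear E F s x)
    (ht : SmoothNear E F t x) (hst : s x = t x) : Φ s = Φ t := by
  obtain ⟨e, c, he, hc, hsum⟩ := exists_frame (E := E) (F := F) (V := V) (x := x)
  have key : ∀ s : Π y : X, V y, SmoothNear E F s x → Φ s = ∑ i, c i x (s x) • Φ (e i) := by
    intro s hs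
    have h1 : SmoothNear E F (fun y => ∑ i, c i y (s y) • e i y) x :=
      SmoothNear.sum fun i _ => (he i).smul (hc s hs i)
    rw [h.congr _ _ h1 (hsum s), h.sum _ fun i _ => (he i).smul (hc s hs i)]
    exact sum_congr rfl fun i _ => h.smul _ _ (hc s hs i) (he i)
  rw [key s hs, key t ht, hst]

end Tensorial

section Coordinates

variable {E : Type*} [NormedAddCommGroup E] [NormedSpace ℝ E]
  {X : Type*} [TopologicalSpace X] [ChartedSpace E X] [IsManifold 𝕀 ∞ X] {x₀ y : X}

lemma isManifold_one : IsManifold 𝕀 1 X := IsManifold.of_le (n := ∞) (by simp)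

lemma isManifold_two : IsManifold 𝕀 2 X := IsManifold.of_le (n := ∞) (by decide)

attribute [local instance] isManifold_one isManifold_two

/-- The vector field near `x₀` which is constant, equal to `w`, in the chart at `x₀`. -/
def coordField (x₀ : X) (w : E) (y : X) : 𝕋 y :=
  (trivializationAt E (𝕋) x₀).symmL ℝ y w

lemma mem_tangent_baseSet (hy : y ∈ 𝕌 x₀) :
    y ∈ (trivializationAt E (𝕋 : X → Type _) x₀).baseSet := hy

/-- The coordinate fields at `y` as a linear equivalence. -/
def coordEquiv (hy : y ∈ 𝕌 x₀) : E ≃L[ℝ] 𝕋 y :=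
  ((trivializationAt E (𝕋) x₀).continuousLinearEquivAt ℝ y
    (mem_tangent_baseSet hy)).symm

lemma coordEquiv_apply (hy : y ∈ 𝕌 x₀) (w : E) : coordEquiv hy w = coordField x₀ w y :=
  congrFun (Trivialization.symm_continuousLinearEquivAt_eq _ (mem_tangent_baseSet hy)) w

lemma coordField_add (w w' : E) : coordField x₀ (w + w') y = coordField x₀ w y + coordField x₀ w' y :=
  map_add _ _ _

lemma coordField_smul (c : ℝ) (w : E) : coordField x₀ (c • w) y = c • coordField x₀ w y :=
  map_smul _ _ _

lemma coordField_self (w : E) : coordField x₀ w x₀ = w := by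
  unfold coordField
  rw [TangentBundle.symmL_trivializationAt_eq_core (mem_chart_source E x₀)]
  exact (tangentBundleCore 𝕀 X).coordChange_self _ _ (mem_achart_source E x₀) _

lemma coordField_eq_inverse (hy : y ∈ 𝕌 x₀) (w : E) :
    coordField x₀ w y = (mfderiv 𝕀 𝕀 φ₀ y).inverse w := by
  set t := trivializationAt E (𝕋 : X → Type _) x₀
  have h : t.continuousLinearMapAt ℝ y = mfderiv 𝕀 𝕀 φ₀ y :=
    TangentBundle.continuousLinearMapAt_trivializationAt (I := 𝕀) hy
  have h3 : (t.continuousLinearMapAt ℝ y).inverse = t.symmL ℝ y :=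
    ContinuousLinearMap.inverse_eq
      (ContinuousLinearMap.ext fun v => t.continuousLinearMapAt_symmL (mem_tangent_baseSet hy) v)
      (ContinuousLinearMap.ext fun v => t.symmL_continuousLinearMapAt (mem_tangent_baseSet hy) v)
  have h4 : (mfderiv 𝕀 𝕀 φ₀ y).inverse
    = (t.continuousLinearMapAt ℝ y).inverse := congrArg _ h.symm
  exact (congrArg (fun B : E →L[ℝ] 𝕋 y => B w) (h4.trans h3)).symm

lemma coordField_smoothNear (hy : y ∈ 𝕌 x₀) (w : E) : SmoothNear E E (coordField x₀ w) y := by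
  set t := trivializationAt E (𝕋 : X → Type _) x₀
  refine smoothNear_of_contMDiffOn t.open_baseSet (mem_tangent_baseSet hy) ?_
  intro z hz
  rw [t.contMDiffWithinAt_section _ hz]
  have : ContMDiffOn 𝕀 𝕀 ∞ (fun _ : X => w) t.baseSet := contMDiffOn_const
  refine (this.congr fun y hy => ?_) z hz
  have h1 : coordField x₀ w y = t.symm y w := t.symmL_apply hy w
  rw [h1]
  exact congrArg Prod.snd (t.apply_mk_symm hy w)

/-- A constant vector field on a vector space. -/
def constField (w : E) (z : E) : 𝕋 z := w

lemma constField_mdifferentiableAt (w z : E) : MDifferentiableAt 𝕀 ((𝕀).prod 𝕀)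
      (fun z => (TotalSpace.mk' E z (constField w z) : TotalSpace E (𝕋 : E → Type _))) z := by
  have h : ContDiffAt ℝ 1 (constField w) z := contDiffAt_const (c := w)
  exact (contMDiffAt_vectorSpace_iff_contDiffAt.2 h).mdifferentiableAt one_ne_zero

lemma mlieBracket_constField (w w' z : E) : mlieBracket 𝕀 (constField w) (constField w') z = 0 := by
  rw [← VectorField.mlieBracketWithin_univ, VectorField.mlieBracketWithin_eq_lieBracketWithin]
  change VectorField.lieBracketWithin ℝ (fun _ : E => w) (fun _ : E => w') Set.univ z = (0 : E)
  simp [VectorField.lieBracketWithin]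

lemma mlieBracket_coordField (hy : y ∈ 𝕌 x₀) [CompleteSpace E] (w w' : E) :
    mlieBracket 𝕀 (coordField x₀ w) (coordField x₀ w') y = 0 := by
  have h1 : ∀ w : E, coordField x₀ w =ᶠ[𝓝 y] VectorField.mpullback 𝕀 𝕀
      φ₀ (constField w) := by
    intro w
    filter_upwards [(chartAt E x₀).open_source.mem_nhds hy] with z hz
    exact coordField_eq_inverse hz w
  rw [Filter.EventuallyEq.mlieBracket_vectorField_eq (h1 w) (h1 w')]
  have h3 : minSmoothness ℝ 2 = 2 := minSmoothness_of_isRCLikeNormedField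
  have : IsManifold 𝕀 (minSmoothness ℝ 2) X := by rw [h3]; infer_instance
  rw [← VectorField.mpullback_mlieBracket (n := ∞) (constField_mdifferentiableAt w _)
    (constField_mdifferentiableAt w' _) (contMDiffAt_extChartAt' hy) (by rw [h3]; decide),
    VectorField.mpullback_apply, mlieBracket_constField]
  exact map_zero _

variable {G : Type*} [NormedAddCommGroup G] [NormedSpace ℝ G] {f : X → G}

lemma mfderiv_extChartAt_coordField (hy : y ∈ 𝕌 x₀) (w : E) :
    mfderiv 𝕀 𝕀 φ₀ y (coordField x₀ w y) = w := by
  set t := trivializationAt E (𝕋 : X → Type _) x₀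
  have h : t.continuousLinearMapAt ℝ y = mfderiv 𝕀 𝕀 φ₀ y :=
    TangentBundle.continuousLinearMapAt_trivializationAt (I := 𝕀) hy
  exact (congrArg (fun B : 𝕋 y →L[ℝ] E => B (coordField x₀ w y)) h).symm.trans
    (t.continuousLinearMapAt_symmL (mem_tangent_baseSet hy) w)

lemma contDiffAt_comp_symm {n : WithTop ℕ∞} [IsManifold 𝕀 n X] (hy : y ∈ 𝕌 x₀)
    (hf : ContMDiffAt 𝕀 𝓘(ℝ, G) n f y) : ContDiffAt ℝ n (f ∘ (φ₀).symm) (φ₀ y) := by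
  have hy' : y ∈ (φ₀).source := by simpa using hy
  have h1 : ContMDiffAt 𝕀 𝕀 n (φ₀).symm
      (φ₀ y) :=
    (contMDiffOn_extChartAt_symm x₀).contMDiffAt
      ((isOpen_extChartAt_target x₀).mem_nhds ((φ₀).map_source hy'))
  exact (hf.comp_of_eq h1 ((φ₀).left_inv hy')).contDiffAt

lemma mvfderiv_coordField (hy : y ∈ 𝕌 x₀) (hf : ContMDiffAt 𝕀 𝓘(ℝ, G) 1 f y) (w : E) :
    𝕕 f y (coordField x₀ w y) = fderiv ℝ (f ∘ (φ₀).symm) (φ₀ y) w := by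
  have hy' : y ∈ (φ₀).source := by simpa using hy
  have h1 := (contDiffAt_comp_symm hy hf).differentiableAt one_ne_zero
  have h2 : f =ᶠ[𝓝 y] (f ∘ (φ₀).symm) ∘ φ₀ := by
    filter_upwards [extChartAt_source_mem_nhds' hy'] with z hz
    simp only [Function.comp_apply, (φ₀).left_inv hz]
  rw [mvfderiv_congr h2]
  have h3 := h1.hasFDerivAt.hasMFDerivAt.comp y (mdifferentiableAt_extChartAt hy).hasMFDerivAt
  rw [mvfderiv_eq_of_hasMFDerivAt h3]
  exact congrArg _ (mfderiv_extChartAt_coordField hy w)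

lemma FnNear.mvfderiv_coordField (hy : y ∈ 𝕌 x₀) (hf : FnNear E f y) (w : E) :
    FnNear E (fun z => 𝕕 f z (coordField x₀ w z)) y := by
  have h1 : FnNear E (fun z => fderiv ℝ (f ∘ (φ₀).symm)
      (φ₀ z) w) y := by
    filter_upwards [hf, (chartAt E x₀).open_source.mem_nhds hy] with z hz hzs
    have h2 := (contDiffAt_comp_symm hzs hz).fderiv_right (m := ∞) (by simp)
    have h3 := (h2.clm_apply (contDiffAt_const (c := w))).contMDiffAt
    exact ContMDiffAt.comp (I' := 𝕀) z h3 (contMDiffAt_extChartAt' hzs)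
  refine h1.congr ?_
  filter_upwards [hf, (chartAt E x₀).open_source.mem_nhds hy] with z hz hzs
  exact SpinDirac.mvfderiv_coordField hzs (hz.of_le (by simp)) w

lemma mvfderiv_coordField_comm (hy : y ∈ 𝕌 x₀) (hf : FnNear E f y) (w w' : E) :
    𝕕 (fun z => 𝕕 f z (coordField x₀ w z)) y (coordField x₀ w' y)
      = 𝕕 (fun z => 𝕕 f z (coordField x₀ w' z)) y (coordField x₀ w y) := by
  have hy' : y ∈ (φ₀).source := by simpa using hy
  set g := f ∘ (φ₀).symm with hg
  set z₀ := φ₀ y with hz₀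
  have h1 : ∀ w w' : E, 𝕕
      (fun z => 𝕕 f z (coordField x₀ w z)) y (coordField x₀ w' y)
      = fderiv ℝ (fun u => fderiv ℝ g u w) z₀ w' := by
    intro w w'
    rw [SpinDirac.mvfderiv_coordField hy
      ((FnNear.mvfderiv_coordField hy hf w).contMDiffAt.of_le (by simp))]
    congr 1
    apply Filter.EventuallyEq.fderiv_eq
    have h2 : ∀ᶠ u in 𝓝 z₀, (φ₀).symm u ∈ 𝕌 x₀ ∧
        ContMDiffAt 𝕀 𝓘(ℝ, G) ∞ f ((φ₀).symm u) := by
      have h3 : Filter.Tendsto (φ₀).symm (𝓝 z₀) (𝓝 y) := by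
        have := (continuousAt_extChartAt_symm' hy').tendsto
        rwa [(φ₀).left_inv hy'] at this
      exact h3.eventually (Filter.Eventually.and ((chartAt E x₀).open_source.mem_nhds hy) hf)
    filter_upwards [h2, extChartAt_target_mem_nhds' (I := 𝕀)
      ((φ₀).map_source hy')] with u hu hut
    change 𝕕 f _ (coordField x₀ w _) = _
    rw [SpinDirac.mvfderiv_coordField hu.1 (hu.2.of_le (by simp)), (φ₀).right_inv hut]
  rw [h1, h1]
  have hgd : ContDiffAt ℝ ∞ g z₀ := contDiffAt_comp_symm hy hf.contMDiffAt
  have h4 := VectorField.fderiv_apply_lieBracket (V := fun _ : E => w) (W := fun _ : E => w')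
    (hgd.of_le (m := 2) (by decide)) (minSmoothness_of_isRCLikeNormedField).le
    (differentiableAt_const _) (differentiableAt_const _)
  have h5 : VectorField.lieBracket ℝ (fun _ : E => w) (fun _ : E => w') z₀ = 0 := by
    simp [VectorField.lieBracket]
  rw [h5, map_zero] at h4
  exact (sub_eq_zero.1 h4.symm).symm

variable [FiniteDimensional ℝ E]

lemma exists_coordField_expansion (hy : y ∈ 𝕌 x₀) {ι : Type*} [Fintype ι]
    (b : Module.Basis ι ℝ E) {v : 𝔛} (hv : SmoothNear E E v y) :
    ∃ c : ι → X → ℝ, (∀ i, FnNear E (c i) y) ∧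
      ∀ᶠ z in 𝓝 y, v z = ∑ i, c i z • coordField x₀ (b i) z := by
  set t := trivializationAt E (𝕋 : X → Type _) x₀
  have ht : ∀ᶠ z in 𝓝 y, z ∈ t.baseSet := t.open_baseSet.mem_nhds (mem_tangent_baseSet hy)
  refine ⟨fun i z => t.localFrameCoeff 𝕀 b i z (v z), fun i => ?_, ?_⟩
  · filter_upwards [hv, ht] with z hz hzt
    exact contMDiffAt_localFrameCoeff b hzt hz i
  · filter_upwards [ht, t.eventually_eq_localFrame_sum_coeff_smul (I := 𝕀) b
      (mem_tangent_baseSet hy) (s := v)] with z hz hv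
    refine hv.trans (sum_congr rfl fun i _ => ?_)
    congr 1
    rw [t.localFrame_apply_of_mem_baseSet b hz]
    have h2 : (t.basisAt b hz) i = t.symm z (b i) := by simp [Trivialization.basisAt]
    exact h2.trans (t.symmL_apply (R := ℝ) hz (b i)).symm

lemma FnNear.mvfderiv {v : 𝔛} (hf : FnNear E f y)
    (hv : SmoothNear E E v y) : FnNear E (fun z => 𝕕 f z (v z)) y := by
  obtain ⟨c, hc, hsum⟩ := exists_coordField_expansion (mem_chart_source E y)
    (finBasis ℝ E) hv
  have h1 : FnNear E (fun z => ∑ i, c i z • 𝕕 f z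
      (coordField y (finBasis ℝ E i) z)) y :=
    FnNear.sum fun i _ => (hc i).smul (hf.mvfderiv_coordField (mem_chart_source E y) _)
  refine h1.congr ?_
  filter_upwards [hsum] with z hz
  rw [hz, map_sum]
  exact sum_congr rfl fun i _ => map_smul _ _ _

/-- The Lie bracket is the commutator of derivations. -/
lemma mvfderiv_mlieBracket {u v : 𝔛} (hf : FnNear E f y)
    (hu : SmoothNear E E u y) (hv : SmoothNear E E v y) : 𝕕 f y (mlieBracket 𝕀 u v y)
      = 𝕕 (fun z => 𝕕 f z (v z)) y (u y) - 𝕕 (fun z => 𝕕 f z (u z)) y (v y) := by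
  let Φ : (𝔛) → (𝔛) → G :=
    fun u v => 𝕕 (fun z => 𝕕 f z (v z)) y (u y)
      - 𝕕 (fun z => 𝕕 f z (u z)) y (v y)
      - 𝕕 f y (mlieBracket 𝕀 u v y)
  have hanti : ∀ u v, Φ u v = - Φ v u := by
    intro u v
    simp only [Φ]
    rw [VectorField.mlieBracket_swap_apply, map_neg]
    abel
  have hten : ∀ u, SmoothNear E E u y → GermTensorial (E := E) (F := E) (fun v => Φ u v) y := by
    intro u hu
    constructor
    · intro s t hs hst
      have h1 : (fun z => 𝕕 f z (t z)) =ᶠ[𝓝 y]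
          fun z => 𝕕 f z (s z) := by
        filter_upwards [hst] with z hz; rw [hz]
      simp only [Φ]
      rw [mvfderiv_congr h1, hst.self_of_nhds,
        Filter.EventuallyEq.mlieBracket_vectorField_eq (Filter.EventuallyEq.refl _ u) hst]
    · intro s t hs ht
      have h1 : 𝕕 (fun z => 𝕕 f z (s z + t z)) y
          = 𝕕 (fun z => 𝕕 f z (s z)) y
            + 𝕕 (fun z => 𝕕 f z (t z)) y := by
        simp only [map_add]
        exact mvfderiv_fun_add (hf.mvfderiv hs).mdiff (hf.mvfderiv ht).mdiff
      have h2 : mlieBracket 𝕀 u (fun z => s z + t z) y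
          = mlieBracket 𝕀 u s y + mlieBracket 𝕀 u t y :=
        VectorField.mlieBracket_add_right hs.mdiff ht.mdiff
      simp only [Φ]
      rw [h1, h2, map_add, map_add, add_apply]
      abel
    · intro r s hr hs
      have h1 : 𝕕 (fun z => 𝕕 f z (r z • s z)) y
          = r y • 𝕕 (fun z => 𝕕 f z (s z)) y
            + (𝕕 r y).smulRight (𝕕 f y (s y)) := by
        simp only [map_smul]
        exact mvfderiv_fun_smul hr.mdiff (hf.mvfderiv hs).mdiff
      have h2 : mlieBracket 𝕀 u (fun z => r z • s z) y
          = 𝕕 r y (u y) • s y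
            + r y • mlieBracket 𝕀 u s y :=
        VectorField.mlieBracket_smul_right hr.mdiff hs.mdiff
      simp only [Φ]
      rw [h1, h2]
      simp only [map_add, map_smul, add_apply, smul_apply, ContinuousLinearMap.smulRight_apply]
      module
  have hc := fun w => coordField_smoothNear (E := E) (mem_chart_source E y) w
  obtain ⟨a, ha⟩ : ∃ a : E, a = u y := ⟨u y, rfl⟩
  obtain ⟨b, hb⟩ : ∃ b : E, b = v y := ⟨v y, rfl⟩
  have h0 : Φ (coordField y a) (coordField y b) = 0 := by
    simp only [Φ]
    rw [mlieBracket_coordField (mem_chart_source E y), map_zero, sub_zero, sub_eq_zero]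
    exact mvfderiv_coordField_comm (mem_chart_source E y) hf _ _
  have h1 : Φ u v = Φ u (coordField y b) :=
    (hten u hu).pointwise hv (hc _) (((coordField_self b).trans hb).symm)
  have h2 : Φ (coordField y b) u = Φ (coordField y b) (coordField y a) :=
    (hten _ (hc _)).pointwise hu (hc _) (((coordField_self a).trans ha).symm)
  have h3 : Φ u v = 0 := by rw [h1, hanti, h2, ← hanti, h0]
  exact (sub_eq_zero.1 h3).symm

end Coordinates

section Connection

attribute [local instance] isManifold_one isManifold_two

variable {E : Type*} [NormedAddCommGroup E] [NormedSpace ℝ E] [FiniteDimensional ℝ E]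
  {X : Type*} [TopologicalSpace X] [T2Space X] [ChartedSpace E X] [IsManifold 𝕀 ∞ X] {x : X}
  {F : Type*} [NormedAddCommGroup F] [NormedSpace ℝ F] [FiniteDimensional ℝ F]
  {V : X → Type*} [TopologicalSpace (TotalSpace F V)]
  [∀ x, AddCommGroup (V x)] [∀ x, Module ℝ (V x)]
  [∀ x, TopologicalSpace (V x)] [∀ x, IsTopologicalAddGroup (V x)]
  [∀ x, ContinuousSMul ℝ (V x)] [FiberBundle F V] [VectorBundle ℝ F V]
  [ContMDiffVectorBundle ∞ F V 𝕀]
  {nabla : CovariantDerivative 𝕀 F V} {s t : Π y : X, V y}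
  {u v : 𝔛}

lemma conn_congr (nabla : CovariantDerivative 𝕀 F V) (hs : SmoothNear E F s x)
    (h : ∀ᶠ y in 𝓝 x, t y = s y) : nabla t x = nabla s x :=
  nabla.isCovariantDerivativeOn.congr_of_eventuallyEq (hs.congr h).mdiff hs.mdiff
    Filter.univ_mem h

lemma conn_add (nabla : CovariantDerivative 𝕀 F V) (hs : SmoothNear E F s x)
    (ht : SmoothNear E F t x) (a : 𝕋 x) :
    nabla (fun y => s y + t y) x a = nabla s x a + nabla t x a :=
  congrArg (fun B : 𝕋 x →L[ℝ] V x => B a)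
    (nabla.isCovariantDerivativeOn.add hs.mdiff ht.mdiff)

lemma conn_smul (nabla : CovariantDerivative 𝕀 F V) {f : X → ℝ} (hf : FnNear E f x)
    (hs : SmoothNear E F s x) (a : 𝕋 x) :
    nabla (fun y => f y • s y) x a = f x • nabla s x a + 𝕕 f x a • s x :=
  congrArg (fun B : 𝕋 x →L[ℝ] V x => B a)
    (nabla.isCovariantDerivativeOn.leibniz hs.mdiff hf.mdiff)

lemma conn_const_smul (nabla : CovariantDerivative 𝕀 F V) (r : ℝ)
    (hs : SmoothNear E F s x) (a : 𝕋 x) : nabla (fun y => r • s y) x a = r • nabla s x a := by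
  rw [conn_smul nabla (FnNear.const r) hs, mvfderiv_const]
  simp

lemma conn_sum (nabla : CovariantDerivative 𝕀 F V) {ι : Type*} (S : Finset ι)
    {g : ι → Π y : X, V y} (h : ∀ i ∈ S, SmoothNear E F (g i) x) (a : 𝕋 x) :
    nabla (fun y => ∑ i ∈ S, g i y) x a = ∑ i ∈ S, nabla (g i) x a := by
  classical
  induction S using Finset.induction_on with
  | empty =>
    have := conn_const_smul nabla (0 : ℝ) (SmoothNear.zero (E := E) (F := F) (V := V) (x := x)) a
    simpa using this
  | insert b S hb ih =>
    simp only [sum_insert hb]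
    rw [conn_add nabla (h b (Finset.mem_insert_self b S))
      (SmoothNear.sum fun i hi => h i (Finset.mem_insert_of_mem hi)),
      ih fun i hi => h i (Finset.mem_insert_of_mem hi)]

variable (nabla) in
/-- The connection maps smooth sections and fields to smooth sections. -/
def SmoothConn : Prop :=
  ∀ (s : Π y : X, V y) (v : 𝔛), (∀ y, SmoothNear E F s y) →
    (∀ y, SmoothNear E E v y) → ∀ y, SmoothNear E F (fun z => nabla s z (v z)) y

lemma SmoothConn.near (h : SmoothConn nabla) (hs : SmoothNear E F s x)
    (hv : SmoothNear E E v x) : SmoothNear E F (fun y => nabla s y (v y)) x := by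
  obtain ⟨s', hs', hss⟩ := hs.exists_global
  obtain ⟨v', hv', hvv⟩ := hv.exists_global
  refine (h s' v' hs' hv' x).congr ?_
  filter_upwards [hss.eventually_nhds, hvv, hs.eventually] with y h1 h2 h3
  rw [← conn_congr nabla h3 h1, h2]

variable (nabla) in
/-- The expression `∇_u ∇_v s - ∇_v ∇_u s - ∇_{[u, v]} s`. -/
def curvExpr (u v : 𝔛) (s : Π y : X, V y) (x : X) : V x :=
  nabla (fun y => nabla s y (v y)) x (u x) - nabla (fun y => nabla s y (u y)) x (v x)
    - nabla s x (mlieBracket 𝕀 u v x)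

lemma curvExpr_swap : curvExpr nabla u v s x = - curvExpr nabla v u s x := by
  unfold curvExpr
  rw [VectorField.mlieBracket_swap_apply, map_neg]
  abel

lemma curvExpr_tensorial_right (hn : SmoothConn nabla) (hu : SmoothNear E E u x)
    (hs : SmoothNear E F s x) :
    GermTensorial (E := E) (F := E) (fun v => curvExpr nabla u v s x) x := by
  constructor
  · intro v v' hv hvv
    have h1 : nabla (fun y => nabla s y (v' y)) x = nabla (fun y => nabla s y (v y)) x :=
      conn_congr nabla (hn.near hs hv) (by filter_upwards [hvv] with y hy; rw [hy])
    simp only [curvExpr]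
    rw [h1, hvv.self_of_nhds,
      Filter.EventuallyEq.mlieBracket_vectorField_eq (Filter.EventuallyEq.refl _ u) hvv]
  · intro v v' hv hv'
    have h1 := conn_add nabla (hn.near hs hv) (hn.near hs hv') (u x)
    have h2 : mlieBracket 𝕀 u (fun z => v z + v' z) x
        = mlieBracket 𝕀 u v x + mlieBracket 𝕀 u v' x :=
      VectorField.mlieBracket_add_right hv.mdiff hv'.mdiff
    simp only [curvExpr, map_add]
    rw [h1, h2, map_add]
    abel
  · intro f v hf hv
    have h1 := conn_smul nabla hf (hn.near hs hv) (u x)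
    have h2 : mlieBracket 𝕀 u (fun z => f z • v z) x
        = 𝕕 f x (u x) • v x + f x • mlieBracket 𝕀 u v x :=
      VectorField.mlieBracket_smul_right hf.mdiff hv.mdiff
    simp only [curvExpr, map_smul]
    rw [h1, h2, map_add, map_smul, map_smul]
    module

lemma curvExpr_tensorial_section (hn : SmoothConn nabla) (hu : SmoothNear E E u x)
    (hv : SmoothNear E E v x) :
    GermTensorial (E := E) (F := F) (fun s => curvExpr nabla u v s x) x := by
  constructor
  · intro s s' hs hss
    have h1 : ∀ v, SmoothNear E E v x →
        nabla (fun y => nabla s' y (v y)) x = nabla (fun y => nabla s y (v y)) x := fun v hv =>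
      conn_congr nabla (hn.near hs hv) (by
        filter_upwards [hss.eventually_nhds, hs.eventually] with y hy hys
        rw [conn_congr nabla hys hy])
    simp only [curvExpr]
    rw [h1 v hv, h1 u hu, conn_congr nabla hs hss]
  · intro s s' hs hs'
    have h1 : ∀ v, SmoothNear E E v x → ∀ a, nabla (fun y => nabla (fun z => s z + s' z) y (v y)) x a
        = nabla (fun y => nabla s y (v y)) x a + nabla (fun y => nabla s' y (v y)) x a := by
      intro v hv a
      rw [← conn_add nabla (hn.near hs hv) (hn.near hs' hv)]
      refine congrArg (fun B : 𝕋 x →L[ℝ] V x => B a)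
        (conn_congr nabla ((hn.near hs hv).add (hn.near hs' hv)) ?_)
      filter_upwards [hs.eventually, hs'.eventually] with y h1 h2 using conn_add nabla h1 h2 _
    simp only [curvExpr]
    rw [h1 v hv, h1 u hu, conn_add nabla hs hs']
    abel
  · intro f s hf hs
    have h1 : ∀ v, SmoothNear E E v x → ∀ a, nabla (fun y => nabla (fun z => f z • s z) y (v y)) x a
        = f x • nabla (fun y => nabla s y (v y)) x a + 𝕕 f x a • nabla s x (v x)
          + (𝕕 f x (v x) • nabla s x a
            + 𝕕 (fun y => 𝕕 f y (v y)) x a • s x) := by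
      intro v hv a
      rw [← conn_smul nabla hf (hn.near hs hv), ← conn_smul nabla (hf.mvfderiv hv) hs,
        ← conn_add nabla (SmoothNear.smul hf (hn.near hs hv)) (SmoothNear.smul (hf.mvfderiv hv) hs)]
      refine congrArg (fun B : 𝕋 x →L[ℝ] V x => B a)
        (conn_congr nabla ((SmoothNear.smul hf (hn.near hs hv)).add
          (SmoothNear.smul (hf.mvfderiv hv) hs)) ?_)
      filter_upwards [hs.eventually, hf.eventually] with y h1 h2 using conn_smul nabla h2 h1 _
    simp only [curvExpr]
    rw [h1 v hv, h1 u hu, conn_smul nabla hf hs, mvfderiv_mlieBracket hf hu hv]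
    module

lemma curvExpr_pointwise (hn : SmoothConn nabla) {u' v' : 𝔛}
    {s' : Π y : X, V y} (hu : SmoothNear E E u x) (hv : SmoothNear E E v x)
    (hs : SmoothNear E F s x) (hu' : SmoothNear E E u' x) (hv' : SmoothNear E E v' x)
    (hs' : SmoothNear E F s' x) (huu : u x = u' x) (hvv : v x = v' x) (hss : s x = s' x) :
    curvExpr nabla u v s x = curvExpr nabla u' v' s' x := by
  have h1 := (curvExpr_tensorial_right hn hu hs).pointwise hv hv' hvv
  have h2 := (curvExpr_tensorial_section hn hu hv').pointwise hs hs' hss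
  have h3 := (curvExpr_tensorial_right hn hv' hs').pointwise hu hu' huu
  rw [h1, h2, curvExpr_swap, h3, ← curvExpr_swap]

variable (nabla) in
/-- The curvature of a smooth connection, evaluated on arbitrary smooth extensions. -/
def curvTensor (x : X) (a b : 𝕋 x) (c : V x) : V x :=
  curvExpr nabla (exists_field a).choose
    (exists_field b).choose
    (exists_smoothNear (E := E) (F := F) c).choose x

lemma curvTensor_eq (hn : SmoothConn nabla) (hu : SmoothNear E E u x) (hv : SmoothNear E E v x)
    (hs : SmoothNear E F s x) : curvTensor nabla x (u x) (v x) (s x) = curvExpr nabla u v s x :=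
  curvExpr_pointwise hn (exists_smoothNear _).choose_spec.1 (exists_smoothNear _).choose_spec.1
    (exists_smoothNear _).choose_spec.1 hu hv hs (exists_smoothNear _).choose_spec.2
    (exists_smoothNear _).choose_spec.2 (exists_smoothNear _).choose_spec.2

variable (a b a' b' : 𝕋 x) (c c' : V x)

lemma curvTensor_swap (hn : SmoothConn nabla) :
    curvTensor nabla x a b c = - curvTensor nabla x b a c := by
  obtain ⟨u, hu, rfl⟩ := exists_field a
  obtain ⟨v, hv, rfl⟩ := exists_field b
  obtain ⟨s, hs, rfl⟩ := exists_smoothNear (E := E) (F := F) c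
  rw [curvTensor_eq hn hu hv hs, curvTensor_eq hn hv hu hs, curvExpr_swap]

lemma curvTensor_add_right (hn : SmoothConn nabla) :
    curvTensor nabla x a (b + b') c = curvTensor nabla x a b c + curvTensor nabla x a b' c := by
  obtain ⟨u, hu, rfl⟩ := exists_field a
  obtain ⟨v, hv, rfl⟩ := exists_field b
  obtain ⟨v', hv', rfl⟩ := exists_field b'
  obtain ⟨s, hs, rfl⟩ := exists_smoothNear (E := E) (F := F) c
  rw [curvTensor_eq hn hu hv hs, curvTensor_eq hn hu hv' hs,
    ← (curvExpr_tensorial_right hn hu hs).add v v' hv hv', ← curvTensor_eq hn hu (hv.add hv') hs]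

lemma curvTensor_smul_right (hn : SmoothConn nabla) (r : ℝ) :
    curvTensor nabla x a (r • b) c = r • curvTensor nabla x a b c := by
  obtain ⟨u, hu, rfl⟩ := exists_field a
  obtain ⟨v, hv, rfl⟩ := exists_field b
  obtain ⟨s, hs, rfl⟩ := exists_smoothNear (E := E) (F := F) c
  rw [curvTensor_eq hn hu hv hs,
    ← (curvExpr_tensorial_right hn hu hs).smul (fun _ => r) v (FnNear.const r) hv,
    ← curvTensor_eq hn hu (hv.const_smul r) hs]

lemma curvTensor_add_left (hn : SmoothConn nabla) :
    curvTensor nabla x (a + a') b c = curvTensor nabla x a b c + curvTensor nabla x a' b c := by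
  rw [curvTensor_swap _ _ _ hn, curvTensor_add_right _ _ _ _ hn, curvTensor_swap a b c hn,
    curvTensor_swap a' b c hn]
  abel

lemma curvTensor_smul_left (hn : SmoothConn nabla) (r : ℝ) :
    curvTensor nabla x (r • a) b c = r • curvTensor nabla x a b c := by
  rw [curvTensor_swap _ _ _ hn, curvTensor_smul_right _ _ _ hn, curvTensor_swap a b c hn, smul_neg]

lemma curvTensor_add_section (hn : SmoothConn nabla) :
    curvTensor nabla x a b (c + c') = curvTensor nabla x a b c + curvTensor nabla x a b c' := by
  obtain ⟨u, hu, rfl⟩ := exists_field a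
  obtain ⟨v, hv, rfl⟩ := exists_field b
  obtain ⟨s, hs, rfl⟩ := exists_smoothNear (E := E) (F := F) c
  obtain ⟨s', hs', rfl⟩ := exists_smoothNear (E := E) (F := F) c'
  rw [curvTensor_eq hn hu hv hs, curvTensor_eq hn hu hv hs',
    ← (curvExpr_tensorial_section hn hu hv).add s s' hs hs', ← curvTensor_eq hn hu hv (hs.add hs')]

lemma curvTensor_smul_section (hn : SmoothConn nabla) (r : ℝ) :
    curvTensor nabla x a b (r • c) = r • curvTensor nabla x a b c := by
  obtain ⟨u, hu, rfl⟩ := exists_field a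
  obtain ⟨v, hv, rfl⟩ := exists_field b
  obtain ⟨s, hs, rfl⟩ := exists_smoothNear (E := E) (F := F) c
  rw [curvTensor_eq hn hu hv hs,
    ← (curvExpr_tensorial_section hn hu hv).smul (fun _ => r) s (FnNear.const r) hs,
    ← curvTensor_eq hn hu hv (hs.const_smul r)]

end Connection

section Kahler

attribute [local instance] isManifold_one isManifold_two

/-- A shortcut for instance search. -/
lemma tangent_vectorBundle {E : Type*} [NormedAddCommGroup E] [NormedSpace ℂ E] {X : Type*}
    [TopologicalSpace X] [ChartedSpace E X] [IsManifold 𝓘(ℂ, E) ω X] :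
    VectorBundle ℝ E (fun x : X => 𝕋 x) := inferInstance

attribute [local instance] tangent_vectorBundle

variable {E : Type*} [NormedAddCommGroup E] [NormedSpace ℂ E] [FiniteDimensional ℂ E]
  {X : Type*} [TopologicalSpace X] [T2Space X] [ChartedSpace E X] [IsManifold 𝓘(ℂ, E) ω X]
  [RiemannianBundle (fun x : X => 𝕋 x)]
  [IsContMDiffRiemannianBundle 𝕀 ∞ E (fun x : X => 𝕋 x)]
  {nablaT : CovariantDerivative 𝕀 E (fun x : X => 𝕋 x)}

section ComplexStructure

variable {x x₀ y : X}

lemma smoothNear_of_smoothFieldOn {v : 𝔛} {U : Set X}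
    (h : SmoothFieldOn v U) (hU : IsOpen U) (hx : x ∈ U) : SmoothNear E E v x :=
  smoothNear_of_contMDiffOn hU hx h

lemma smoothFieldOn_of_smoothNear {v : 𝔛} {U : Set X}
    (h : ∀ y ∈ U, SmoothNear E E v y) : SmoothFieldOn v U :=
  contMDiffOn_of_smoothNear h

lemma differentiableAt_chart_change (hy : y ∈ 𝕌 x₀) :
    DifferentiableAt ℂ ((extChartAt 𝓘(ℂ, E) y) ∘ (extChartAt 𝓘(ℂ, E) x₀).symm)
      (extChartAt 𝓘(ℂ, E) x₀ y) := by
  have hy' : y ∈ (extChartAt 𝓘(ℂ, E) x₀).source := by simpa using hy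
  have h1 : MDifferentiableAt 𝓘(ℂ, E) 𝓘(ℂ, E) (extChartAt 𝓘(ℂ, E) x₀).symm
      (extChartAt 𝓘(ℂ, E) x₀ y) :=
    ((contMDiffOn_extChartAt_symm (n := ω) x₀).contMDiffAt
      ((isOpen_extChartAt_target x₀).mem_nhds
        ((extChartAt 𝓘(ℂ, E) x₀).map_source hy'))).mdifferentiableAt (by simp)
  have h2 : MDifferentiableAt 𝓘(ℂ, E) 𝓘(ℂ, E) (extChartAt 𝓘(ℂ, E) y)
      ((extChartAt 𝓘(ℂ, E) x₀).symm (extChartAt 𝓘(ℂ, E) x₀ y)) := by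
    rw [(extChartAt 𝓘(ℂ, E) x₀).left_inv hy']
    exact (contMDiffAt_extChartAt (n := ω)).mdifferentiableAt (by simp)
  exact mdifferentiableAt_iff_differentiableAt.1 (h2.comp _ h1)

lemma coordField_eq_coordChange (hy : y ∈ 𝕌 x₀) (w : E) : coordField x₀ w y
      = (tangentBundleCore 𝓘(ℂ, E) X).coordChange (achart E x₀) (achart E y) y w := by
  have h1 := congrArg (fun B : E →L[ℝ] E => B w)
    (TangentBundle.symmL_trivializationAt_eq_core (𝕜 := ℝ) (I := 𝕀) hy)
  refine h1.trans ?_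
  rw [tangentBundleCore_coordChange_achart, tangentBundleCore_coordChange_achart]
  simp only [modelWithCornersSelf_coe, Set.range_id, fderivWithin_univ]
  have h2 := (differentiableAt_chart_change hy).fderiv_restrictScalars ℝ
  exact congrArg (fun B : E →L[ℝ] E => B w) h2

lemma J_coordField (hy : y ∈ 𝕌 x₀) (w : E) :
    J E y (coordField x₀ w y) = coordField x₀ (I • w) y := by
  have h1 := coordField_eq_coordChange hy w
  have h2 := coordField_eq_coordChange hy (I • w)
  rw [map_smul] at h2
  rw [h2, h1]
  rfl

lemma SmoothNear.J {v : 𝔛} (hv : SmoothNear E E v x) : SmoothNear E E (fun y => J E y (v y)) x := by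
  obtain ⟨c, hc, h⟩ := exists_coordField_expansion (mem_chart_source E x)
    (finBasis ℝ E) hv
  refine SmoothNear.congr (SmoothNear.sum (S := Finset.univ) fun i _ =>
    SmoothNear.smul (hc i) (coordField_smoothNear (mem_chart_source E x)
      (I • finBasis ℝ E i))) ?_
  filter_upwards [h, (chartAt E x).open_source.mem_nhds (mem_chart_source E x)] with y hy hys
  rw [hy, map_sum]
  refine sum_congr rfl fun i _ => ?_
  rw [map_smul, J_coordField hys]

end ComplexStructure

section LeviCivita

variable {x : X} {u v w : 𝔛}

lemma FnNear.inner (hu : SmoothNear E E u x) (hv : SmoothNear E E v x) :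
    FnNear E (fun y => (Inner.inner ℝ (u y) (v y) : ℝ)) x := by
  filter_upwards [hu.eventually, hv.eventually] with y h1 h2
  exact ContMDiffAt.inner_bundle (E := fun x : X => 𝕋 x)
    h1.contMDiffAt h2.contMDiffAt

lemma IsLeviCivita.smoothConn (h : IsLeviCivita nablaT) : SmoothConn nablaT := by
  intro s v hs hv y
  exact smoothNear_of_smoothFieldOn (U := Set.univ)
    (h.smooth s v (smoothFieldOn_of_smoothNear fun y _ => hs y)
      (smoothFieldOn_of_smoothNear fun y _ => hv y)) isOpen_univ trivial

lemma IsLeviCivita.metric_near (h : IsLeviCivita nablaT) (hu : SmoothNear E E u x)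
    (hv : SmoothNear E E v x) (a : 𝕋 x) : 𝕕 (fun y => (inner ℝ (u y) (v y) : ℝ)) x a
      = inner ℝ (nablaT u x a) (v x) + inner ℝ (u x) (nablaT v x a) := by
  obtain ⟨u', hu', huu⟩ := hu.exists_global
  obtain ⟨v', hv', hvv⟩ := hv.exists_global
  have h1 := h.metric u' v' (smoothFieldOn_of_smoothNear fun y _ => hu' y)
      (smoothFieldOn_of_smoothNear fun y _ => hv' y) x a
  rw [conn_congr nablaT hu huu, conn_congr nablaT hv hvv, huu.self_of_nhds, hvv.self_of_nhds] at h1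
  rw [← h1]
  congr 1
  refine mvfderiv_congr ?_
  filter_upwards [huu, hvv] with y h1 h2
  rw [h1, h2]

lemma IsLeviCivita.torsion_near (h : IsLeviCivita nablaT) (hu : SmoothNear E E u x)
    (hv : SmoothNear E E v x) : nablaT v x (u x) - nablaT u x (v x) = mlieBracket 𝕀 u v x := by
  obtain ⟨u', hu', huu⟩ := hu.exists_global
  obtain ⟨v', hv', hvv⟩ := hv.exists_global
  have h1 := h.torsion_free u' v' (smoothFieldOn_of_smoothNear fun y _ => hu' y)
      (smoothFieldOn_of_smoothNear fun y _ => hv' y) x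
  rw [conn_congr nablaT hu huu, conn_congr nablaT hv hvv, huu.self_of_nhds,
    hvv.self_of_nhds, Filter.EventuallyEq.mlieBracket_vectorField_eq huu hvv] at h1
  exact h1

lemma IsLeviCivita.coordField_symm (h : IsLeviCivita nablaT) {x₀ : X} (hx : x ∈ 𝕌 x₀) (a b : E) :
    nablaT (coordField x₀ a) x (coordField x₀ b x)
      = nablaT (coordField x₀ b) x (coordField x₀ a x) := by
  have h1 := h.torsion_near (coordField_smoothNear hx b) (coordField_smoothNear hx a)
  rw [mlieBracket_coordField hx] at h1
  exact sub_eq_zero.1 h1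

/-- The algebraic core of `∇J = 0` on a Kähler manifold. -/
lemma parallel_of_closed {H : Type*} [NormedAddCommGroup H] [InnerProductSpace ℝ H]
    (I : H →ₗ[ℝ] H) (hI : ∀ v, I (I v) = -v)
    (hinv : ∀ u v, (inner ℝ (I u) v : ℝ) = -inner ℝ u (I v))
    (N : H → H → H) (hneg : ∀ a b, N a (-b) = -N a b) (hsymm : ∀ a b, N a b = N b a)
    (hskew : ∀ a b c, (inner ℝ (N a (I b)) c + inner ℝ (I b) (N a c))
      + (inner ℝ (N a b) (I c) + inner ℝ b (N a (I c)) : ℝ) = 0)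
    (hclosed : ∀ a b c, (inner ℝ (N a (I b)) c + inner ℝ (I b) (N a c) : ℝ)
      - (inner ℝ (N b (I a)) c + inner ℝ (I a) (N b c))
      + (inner ℝ (N c (I a)) b + inner ℝ (I a) (N c b)) = 0) (a b : H) : N a (I b) = I (N a b) := by
  set T : H → H → H → ℝ := fun a b c => inner ℝ (N a (I b) - I (N a b)) c with hT
  have hTe : ∀ a b c, T a b c = inner ℝ (N a (I b)) c + inner ℝ (N a b) (I c) := fun a b c => by
    simp only [hT, inner_sub_left, hinv]; ring
  have hinv' : ∀ u v, (inner ℝ u (I v) : ℝ) = -inner ℝ v (I u) := fun u v => by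
    rw [real_inner_comm, hinv]
  have hanti : ∀ a b c, T a b c = -T a c b := fun a b c => by
    have h1 := hskew a b c
    rw [hTe, hTe]
    have e1 := real_inner_comm (I b) (N a c)
    have e2 := real_inner_comm b (N a (I c))
    linarith
  have hmove : ∀ a b c, T a (I b) c = T a b (I c) := fun a b c => by
    simp only [hTe, hI, hneg, inner_neg_left, inner_neg_right]; ring
  set S : H → H → H → ℝ := fun a b c => T (I a) b c + T a b (I c) with hS
  have hS1 : ∀ a b c, S a b c = S b a c := fun a b c => by
    simp only [hS, hTe, hI, inner_neg_right]
    rw [hsymm (I a) (I b), hsymm (I a) b, hsymm a (I b), hsymm a b]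
    ring
  have hS2 : ∀ a b c, S a b c = -S a c b := fun a b c => by
    simp only [hS]
    rw [hanti (I a) b c, ← hmove a b c, hanti a (I b) c]
    ring
  have hS0 : ∀ a b c, S a b c = 0 := fun a b c => by
    have h1 : S a b c = -S a b c := by
      calc S a b c = -S a c b := hS2 _ _ _
        _ = -S c a b := by rw [hS1]
        _ = S c b a := by rw [hS2 c a b, neg_neg]
        _ = S b c a := by rw [hS1]
        _ = -S b a c := by rw [hS2]
        _ = -S a b c := by rw [hS1]
    linarith
  have hcyc : ∀ a b c, T a b c + T b c a + T c a b = 0 := fun a b c => by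
    have h1 := hclosed a b c
    rw [hanti b c a, hTe, hTe, hTe]
    have e1 := real_inner_comm (I b) (N a c)
    rw [hsymm b a, hsymm c a]
    rw [hsymm c b] at h1
    linarith
  have hT0 : ∀ a b c, T b c (I a) = 0 := fun a b c => by
    have h1 := hcyc (I a) b c
    have h2 := hcyc a b (I c)
    have h3 := hS0 a b c
    have h4 := hS0 c a b
    simp only [hS] at h3 h4
    rw [hmove b c a] at h2
    rw [hmove c a b] at h1
    linarith
  have h0 : N a (I b) - I (N a b) = 0 := by
    refine ext_inner_right ℝ fun c => ?_
    have h1 := hT0 (-(I c)) a b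
    rw [map_neg, hI, neg_neg] at h1
    rw [inner_zero_left]
    exact h1
  exact sub_eq_zero.1 h0

end LeviCivita

section KahlerCurvature

variable {x : X} {u v w : 𝔛}

lemma IsKahlerMetric.inner_J (hX : IsKahlerMetric E X) (a b : 𝕋 x) :
    (inner ℝ (J E x a) b : ℝ) = -inner ℝ a (J E x b) := by
  rw [← hX.invariant x (J E x a) b, J_J, inner_neg_left]

lemma IsKahlerMetric.closed_near (hX : IsKahlerMetric E X) (hu : SmoothNear E E u x)
    (hv : SmoothNear E E v x) (hw : SmoothNear E E w x) :
    𝕕 (fun y => kahlerForm y (v y) (w y)) x (u x) - 𝕕 (fun y => kahlerForm y (u y) (w y)) x (v x)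
        + 𝕕 (fun y => kahlerForm y (u y) (v y)) x (w x) - kahlerForm x (mlieBracket 𝕀 u v x) (w x)
        + kahlerForm x (mlieBracket 𝕀 u w x) (v x)
        - kahlerForm x (mlieBracket 𝕀 v w x) (u x) = 0 := by
  obtain ⟨u', hu', huu⟩ := hu.exists_global
  obtain ⟨v', hv', hvv⟩ := hv.exists_global
  obtain ⟨w', hw', hww⟩ := hw.exists_global
  have h1 := hX.closed u' v' w' (smoothFieldOn_of_smoothNear fun y _ => hu' y)
      (smoothFieldOn_of_smoothNear fun y _ => hv' y)
      (smoothFieldOn_of_smoothNear fun y _ => hw' y) x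
  have key : ∀ {a b a' b' : 𝔛}, (∀ᶠ y in 𝓝 x, a' y = a y) →
      (∀ᶠ y in 𝓝 x, b' y = b y) → 𝕕 (fun y => kahlerForm y (a' y) (b' y)) x
        = 𝕕 (fun y => kahlerForm y (a y) (b y)) x := by
    intro a b a' b' ha hb
    refine mvfderiv_congr ?_
    filter_upwards [ha, hb] with y h1 h2
    rw [h1, h2]
  rw [key hvv hww, key huu hww, key huu hvv, Filter.EventuallyEq.mlieBracket_vectorField_eq huu hvv,
    Filter.EventuallyEq.mlieBracket_vectorField_eq huu hww,
    Filter.EventuallyEq.mlieBracket_vectorField_eq hvv hww,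
    huu.self_of_nhds, hvv.self_of_nhds, hww.self_of_nhds] at h1
  exact h1

lemma coordField_J_eventually (w : E) :
    ∀ᶠ y in 𝓝 x, J E y (coordField x w y) = coordField x (I • w) y := by
  filter_upwards [(chartAt E x).open_source.mem_nhds (mem_chart_source E x)] with y hy
  exact J_coordField hy w

lemma coordField_smoothNear_self (w : E) : SmoothNear E E (coordField x w) x :=
  coordField_smoothNear (mem_chart_source E x) w

lemma kahlerForm_zero_left (b : 𝕋 x) : kahlerForm x 0 b = 0 := by
  simp [kahlerForm]

lemma IsKahlerMetric.closed_of_commute (hX : IsKahlerMetric E X) (hu : SmoothNear E E u x)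
    (hv : SmoothNear E E v x) (hw : SmoothNear E E w x) (huv : mlieBracket 𝕀 u v x = 0)
    (huw : mlieBracket 𝕀 u w x = 0) (hvw : mlieBracket 𝕀 v w x = 0) :
    𝕕 (fun y => kahlerForm y (v y) (w y)) x (u x) - 𝕕 (fun y => kahlerForm y (u y) (w y)) x (v x)
        + 𝕕 (fun y => kahlerForm y (u y) (v y)) x (w x) = 0 := by
  have h1 := hX.closed_near hu hv hw
  rw [huv, huw, hvw, kahlerForm_zero_left, kahlerForm_zero_left, kahlerForm_zero_left, sub_zero,
    add_zero, sub_zero] at h1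
  exact h1

/-- Coordinate fields of the chart at `x` are mapped to coordinate fields by `∇J = 0`. -/
lemma IsKahlerMetric.nabla_J_coordField (hX : IsKahlerMetric E X) (h : IsLeviCivita nablaT)
    (a : 𝕋 x) (b : E) :
    nablaT (coordField x (I • b)) x a = J E x (nablaT (coordField x b) x a) := by
  have hinner : ∀ (a : 𝕋 x) (b c : E),
      𝕕 (fun y => (inner ℝ (coordField x b y) (coordField x c y) : ℝ)) x a
        = inner ℝ (nablaT (coordField x b) x a) (show 𝕋 x from c)
          + inner ℝ (show 𝕋 x from b) (nablaT (coordField x c) x a) := by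
    intro a b c
    have h1 := h.metric_near (coordField_smoothNear_self b) (coordField_smoothNear_self c) a
    rw [coordField_self, coordField_self] at h1
    exact h1
  have hk : ∀ b c : E, 𝕕 (fun y => kahlerForm y (coordField x b y)
      (coordField x c y)) x = 𝕕 (fun y =>
        (inner ℝ (coordField x (I • b) y) (coordField x c y) : ℝ)) x := by
    intro b c
    refine mvfderiv_congr ?_
    filter_upwards [coordField_J_eventually (x := x) b] with y hy
    simp only [kahlerForm, hy]
  refine parallel_of_closed (H := 𝕋 x) (J E x).toLinearMap (J_J x)
    hX.inner_J (fun a b => nablaT (coordField x (show E from b)) x a) ?_ ?_ ?_ ?_ a b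
  · intro a b
    have h1 := conn_const_smul nablaT (-1) (coordField_smoothNear_self (x := x) (show E from b)) a
    have h2 : (fun y => (-1 : ℝ) • coordField x (show E from b) y)
        = coordField x (-(show E from b)) := by
      funext y
      rw [← coordField_smul, neg_one_smul]
    rw [h2, neg_one_smul] at h1
    exact h1
  · intro a b
    have h1 := h.coordField_symm (mem_chart_source E x) (show E from b) (show E from a)
    rw [coordField_self, coordField_self] at h1
    exact h1
  · intro a (b : E) (c : E)
    have h1 := hinner a (I • b) c
    have h2 := hinner a b (I • c)
    have h3 : (fun y => (inner ℝ (coordField x (I • b) y) (coordField x c y) : ℝ))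
        =ᶠ[𝓝 x] fun y => -1 *
          (inner ℝ (coordField x b y) (coordField x (I • c) y) : ℝ) := by
      filter_upwards [coordField_J_eventually (x := x) b,
        coordField_J_eventually (x := x) c] with y h1 h2
      rw [← h1, ← h2, hX.inner_J, neg_one_mul]
    have h4 := mvfderiv_mul_apply (FnNear.const (E := E) (x := x) (-1 : ℝ)).mdiff
      (FnNear.inner (coordField_smoothNear_self (x := x) b)
        (coordField_smoothNear_self (I • c))).mdiff a
    rw [← mvfderiv_congr h3, mvfderiv_const] at h4
    simp only [zero_apply, zero_mul, add_zero] at h4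
    rw [h1, h2, neg_one_mul] at h4
    exact add_eq_zero_iff_eq_neg.2 h4
  · intro (a : E) (b : E) (c : E)
    have h0 := fun a b : E => mlieBracket_coordField (mem_chart_source E x) a b
    have h1 := hX.closed_of_commute (coordField_smoothNear_self (x := x) a)
      (coordField_smoothNear_self b) (coordField_smoothNear_self c) (h0 a b) (h0 a c) (h0 b c)
    rw [hk, hk, hk, hinner, hinner, hinner, coordField_self, coordField_self, coordField_self] at h1
    exact h1

lemma IsKahlerMetric.nabla_J (hX : IsKahlerMetric E X) (h : IsLeviCivita nablaT)
    (hv : SmoothNear E E v x) (a : 𝕋 x) :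
    nablaT (fun y => J E y (v y)) x a = J E x (nablaT v x a) := by
  have ht : GermTensorial (E := E) (F := E) (fun v : 𝔛 =>
      nablaT (fun y => J E y (v y)) x a - J E x (nablaT v x a)) x := by
    constructor
    · intro s t hs hst
      have h1 : nablaT (fun y => J E y (t y)) x = nablaT (fun y => J E y (s y)) x :=
        conn_congr nablaT hs.J (by filter_upwards [hst] with y hy; rw [hy])
      rw [h1, conn_congr nablaT hs hst]
    · intro s t hs ht
      have h1 := conn_add nablaT hs.J ht.J a
      rw [conn_add nablaT hs ht, map_add]
      simp only [map_add]
      rw [h1]; abel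
    · intro f s hf hs
      have h1 := conn_smul nablaT hf hs.J a
      rw [conn_smul nablaT hf hs]
      simp only [map_add, map_smul]
      rw [h1]
      module
  obtain ⟨b, hb⟩ : ∃ b : E, b = v x := ⟨v x, rfl⟩
  have h1 := ht.pointwise hv (coordField_smoothNear_self (x := x) b)
    (hb.symm.trans (coordField_self b).symm)
  have h2 := conn_congr nablaT (coordField_smoothNear_self (x := x) (I • b))
    (coordField_J_eventually (x := x) b)
  rw [h2, hX.nabla_J_coordField h, sub_self] at h1
  exact sub_eq_zero.1 h1

variable (a b c d : 𝕋 x)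

lemma curvTensor_coordField (hn : SmoothConn nablaT) (a b c : E) :
    curvTensor nablaT x (show 𝕋 x from a) (show 𝕋 x from b) (show 𝕋 x from c)
      = nablaT (fun y => nablaT (coordField x c) y (coordField x b y)) x (show 𝕋 x from a)
        - nablaT (fun y => nablaT (coordField x c) y (coordField x a y)) x (show 𝕋 x from b) := by
  have h1 := curvTensor_eq hn (coordField_smoothNear_self (x := x) a)
    (coordField_smoothNear_self b) (coordField_smoothNear_self c)
  unfold curvExpr at h1
  rw [coordField_self, coordField_self, coordField_self,
    mlieBracket_coordField (mem_chart_source E x), map_zero, sub_zero] at h1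
  exact h1

lemma IsLeviCivita.bianchi (h : IsLeviCivita nablaT) :
    curvTensor nablaT x a b c + curvTensor nablaT x b c a + curvTensor nablaT x c a b = 0 := by
  have key : ∀ a b c : E, nablaT (fun y => nablaT (coordField x c) y (coordField x b y)) x
      (show 𝕋 x from a)
      = nablaT (fun y => nablaT (coordField x b) y (coordField x c y)) x
      (show 𝕋 x from a) := by
    intro a b c
    refine congrArg (fun B : 𝕋 x →L[ℝ] 𝕋 x => B a)
      (conn_congr nablaT (h.smoothConn.near (coordField_smoothNear_self b)
        (coordField_smoothNear_self c)) ?_)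
    filter_upwards [(chartAt E x).open_source.mem_nhds (mem_chart_source E x)] with y hy
    exact h.coordField_symm hy c b
  have h1 := curvTensor_coordField (x := x) h.smoothConn a b c
  have h2 := curvTensor_coordField (x := x) h.smoothConn b c a
  have h3 := curvTensor_coordField (x := x) h.smoothConn c a b
  have k1 := key a b c
  have k2 := key b c a
  have k3 := key c a b
  calc _ = _ := congrArg₂ (· + ·) (congrArg₂ (· + ·) h1 h2) h3
    _ = 0 := by
      simp only
      rw [k1, k2, k3]
      abel

lemma IsLeviCivita.curvTensor_skew (h : IsLeviCivita nablaT) :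
    (inner ℝ (curvTensor nablaT x a b c) d : ℝ) = -inner ℝ c (curvTensor nablaT x a b d) := by
  obtain ⟨u, hu, rfl⟩ := exists_field a
  obtain ⟨v, hv, rfl⟩ := exists_field b
  obtain ⟨s, hs, rfl⟩ := exists_field c
  obtain ⟨t, ht, rfl⟩ := exists_field d
  have hn := h.smoothConn
  rw [curvTensor_eq hn hu hv hs, curvTensor_eq hn hu hv ht]
  have hf := FnNear.inner hs ht
  have key : ∀ {v : 𝔛}, SmoothNear E E v x → ∀ a : 𝕋 x,
      𝕕 (fun y => 𝕕 (fun z => (inner ℝ (s z) (t z) : ℝ)) y (v y)) x a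
      = (inner ℝ (nablaT (fun y => nablaT s y (v y)) x a) (t x)
          + inner ℝ (nablaT s x (v x)) (nablaT t x a))
        + (inner ℝ (nablaT s x a) (nablaT t x (v x))
          + inner ℝ (s x) (nablaT (fun y => nablaT t y (v y)) x a) : ℝ) := by
    intro v hv a
    have h1 : (fun y => 𝕕 (fun z => (inner ℝ (s z) (t z) : ℝ)) y (v y))
        =ᶠ[𝓝 x] fun y => (inner ℝ (nablaT s y (v y)) (t y) : ℝ)
          + inner ℝ (s y) (nablaT t y (v y)) := by
      filter_upwards [hs.eventually, ht.eventually] with y h1 h2 using h.metric_near h1 h2 _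
    rw [mvfderiv_congr h1, mvfderiv_fun_add (FnNear.inner (hn.near hs hv) ht).mdiff
      (FnNear.inner hs (hn.near ht hv)).mdiff]
    have e1 := h.metric_near (hn.near hs hv) ht a
    have e2 := h.metric_near hs (hn.near ht hv) a
    rw [add_apply, e1, e2]
  have h1 := mvfderiv_mlieBracket hf hu hv
  rw [key hu, key hv, h.metric_near hs ht] at h1
  simp only [curvExpr, inner_sub_left, inner_sub_right]
  linarith

lemma IsLeviCivita.curvTensor_pair (h : IsLeviCivita nablaT) :
    (inner ℝ (curvTensor nablaT x a b c) d : ℝ) = inner ℝ (curvTensor nablaT x c d a) b := by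
  set r : 𝕋 x → 𝕋 x → 𝕋 x → 𝕋 x → ℝ := fun a b c d => inner ℝ (curvTensor nablaT x a b c) d with hr
  have h1 : ∀ a b c d, r a b c d = -r b a c d := fun a b c d => by
    simp only [hr]
    rw [curvTensor_swap a b c h.smoothConn, inner_neg_left]
  have h2 : ∀ a b c d, r a b c d = -r a b d c := fun a b c d => by
    simp only [hr]
    rw [h.curvTensor_skew, real_inner_comm]
  have h3 : ∀ a b c d, r a b c d + r b c a d + r c a b d = 0 := fun a b c d => by
    simp only [hr]
    rw [← inner_add_left, ← inner_add_left, h.bianchi, inner_zero_left]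
  change r a b c d = r c d a b
  have e1 := h3 a b c d
  have e2 := h3 b c d a
  have e3 := h3 c d a b
  have e4 := h3 d a b c
  have f1 := h2 b c a d
  have f2 := h2 c a b d
  have f3 := h2 d b c a
  have f4 := h2 c d b a
  have f5 := h2 a c d b
  have f6 := h2 d a c b
  have f7 := h2 a b d c
  have f8 := h1 b d a c
  have f9 := h1 c a b d
  have f10 := h1 c a d b
  have f11 := h1 b d c a
  linarith

lemma IsKahlerMetric.curvTensor_J (hX : IsKahlerMetric E X) (h : IsLeviCivita nablaT) :
    curvTensor nablaT x a b (J E x c) = J E x (curvTensor nablaT x a b c) := by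
  obtain ⟨u, hu, rfl⟩ := exists_field a
  obtain ⟨v, hv, rfl⟩ := exists_field b
  obtain ⟨s, hs, rfl⟩ := exists_field c
  have hn := h.smoothConn
  rw [curvTensor_eq hn hu hv hs]
  refine (curvTensor_eq hn hu hv hs.J).trans ?_
  have key : ∀ {v : 𝔛}, SmoothNear E E v x →
      ∀ a : 𝕋 x, nablaT (fun y => nablaT (fun z => J E z (s z)) y (v y)) x a
        = J E x (nablaT (fun y => nablaT s y (v y)) x a) := by
    intro v hv a
    rw [← hX.nabla_J h (hn.near hs hv)]
    refine congrArg (fun B : 𝕋 x →L[ℝ] 𝕋 x => B a)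
      (conn_congr nablaT (hn.near hs hv).J ?_)
    filter_upwards [hs.eventually] with y hy using hX.nabla_J h hy _
  simp only [curvExpr]
  rw [key hu, key hv, hX.nabla_J h hs, map_sub, map_sub]

lemma IsKahlerMetric.curvTensor_J_J (hX : IsKahlerMetric E X) (h : IsLeviCivita nablaT) :
    curvTensor nablaT x (J E x a) (J E x b) c = curvTensor nablaT x a b c := by
  refine ext_inner_right ℝ fun d => ?_
  rw [h.curvTensor_pair, hX.curvTensor_J c d a h, hX.invariant, ← h.curvTensor_pair]

end KahlerCurvature

section FnNearComp

variable {E : Type*} [NormedAddCommGroup E] [NormedSpace ℝ E]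
  {X : Type*} [TopologicalSpace X] [ChartedSpace E X] {x : X}

lemma FnNear.comp_contDiffAt {G G' : Type*} [NormedAddCommGroup G] [NormedSpace ℝ G]
    [NormedAddCommGroup G'] [NormedSpace ℝ G'] {f : X → G} {φ : G → G'} (hf : FnNear E f x)
    (hφ : ∀ᶠ z in 𝓝 (f x), ContDiffAt ℝ ∞ φ z) : FnNear E (fun y => φ (f y)) x := by
  filter_upwards [hf.eventually, hf.contMDiffAt.continuousAt.eventually hφ] with y h1 h2
  exact h2.contMDiffAt.comp y h1.contMDiffAt

lemma FnNear.inv {f : X → ℝ} (hf : FnNear E f x) (h0 : f x ≠ 0) : FnNear E (fun y => (f y)⁻¹) x :=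
  hf.comp_contDiffAt (φ := fun z => z⁻¹) (by
    filter_upwards [isOpen_ne.mem_nhds h0] with z hz
    exact contDiffAt_inv ℝ hz)

lemma FnNear.sqrt {f : X → ℝ} (hf : FnNear E f x) (h0 : f x ≠ 0) :
    FnNear E (fun y => Real.sqrt (f y)) x :=
  hf.comp_contDiffAt (φ := Real.sqrt) (by
    filter_upwards [isOpen_ne.mem_nhds h0] with z hz
    exact Real.contDiffAt_sqrt hz)

end FnNearComp

/-- The trace of a bilinear map does not depend on the orthonormal basis. -/
lemma sum_orthonormalBasis_eq {H M ι κ : Type*} [NormedAddCommGroup H] [InnerProductSpace ℝ H]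
    [AddCommGroup M] [Module ℝ M] [Fintype ι] [Fintype κ] (e : OrthonormalBasis ι ℝ H)
    (f : OrthonormalBasis κ ℝ H) (B : H →ₗ[ℝ] H →ₗ[ℝ] M) :
    ∑ i, B (e i) (e i) = ∑ k, B (f k) (f k) := by
  have h1 : ∀ i, B (e i) (e i) = ∑ k, ∑ l, (inner ℝ (f k) (e i) * inner ℝ (f l) (e i) : ℝ) •
      B (f k) (f l) := by
    intro i
    conv_lhs => rw [← f.sum_repr (e i)]
    simp only [map_sum, LinearMap.sum_apply, map_smul, LinearMap.smul_apply, smul_sum, smul_smul,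
      f.repr_apply_apply]
    rw [sum_comm]
    simp only [mul_comm]
  simp only [h1]
  rw [sum_comm]
  refine sum_congr rfl fun k _ => ?_
  rw [sum_comm]
  have h2 : ∀ l, ∑ i, (inner ℝ (f k) (e i) * inner ℝ (f l) (e i) : ℝ) • B (f k) (f l)
      = (inner ℝ (f k) (f l) : ℝ) • B (f k) (f l) := by
    intro l
    rw [← sum_smul, ← e.sum_inner_mul_inner (f k) (f l)]
    simp only [real_inner_comm]
  simp only [h2]
  rw [sum_eq_single k]
  · simp
  · intro l _ hl
    rw [f.inner_eq_zero (Ne.symm hl), zero_smul]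
  · simp

section Frames

variable {x : X} {u v w : 𝔛}

lemma finrank_tangent : finrank ℝ (𝕋 x) = finrank ℝ E := rfl

/-- The orthonormal basis given by an orthonormal family of the right cardinality. -/
def orthonormalBasisOf {ι : Type*} [Fintype ι] {e : ι → 𝕋 x}
    (he : Orthonormal ℝ e) (hc : Fintype.card ι = finrank ℝ E) :
    OrthonormalBasis ι ℝ (𝕋 x) :=
  OrthonormalBasis.mk he (by
    rw [he.linearIndependent.span_eq_top_of_card_eq_finrank' (hc.trans finrank_tangent.symm)])

lemma coe_orthonormalBasisOf {ι : Type*} [Fintype ι] {e : ι → 𝕋 x}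
    (he : Orthonormal ℝ e) (hc : Fintype.card ι = finrank ℝ E) :
    ⇑(orthonormalBasisOf he hc) = e := OrthonormalBasis.coe_mk _ _

lemma linearIndependent_coordField {x₀ y : X} (hy : y ∈ 𝕌 x₀) {ι : Type*}
    {b : ι → E} (hb : LinearIndependent ℝ b) :
    LinearIndependent ℝ (fun i => coordField x₀ (b i) y) := by
  have h := hb.map' (coordEquiv hy).toLinearEquiv.toLinearMap (coordEquiv hy).toLinearEquiv.ker
  have e : (fun i => coordField x₀ (b i) y)
      = ⇑(coordEquiv hy).toLinearEquiv.toLinearMap ∘ b :=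
    funext fun i => (coordEquiv_apply hy (b i)).symm
  rw [e]
  exact h

variable (E) in
lemma exists_orthonormal_frame (x : X) : ∃ e : Fin (finrank ℝ E) → 𝔛,
      (∀ i, SmoothNear E E (e i) x) ∧ ∀ᶠ y in 𝓝 x, Orthonormal ℝ (fun i => e i y) := by
  set b := finBasis ℝ E
  set f : Π y : X, Fin (finrank ℝ E) → 𝕋 y :=
    fun y i => coordField x (b i) y with hf
  have hli : ∀ᶠ y in 𝓝 x, LinearIndependent ℝ (f y) := by
    filter_upwards [(chartAt E x).open_source.mem_nhds (mem_chart_source E x)] with y hy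
    exact linearIndependent_coordField hy b.linearIndependent
  have hli0 := hli.self_of_nhds
  have hgs : ∀ n, SmoothNear E E (fun y => InnerProductSpace.gramSchmidt ℝ (f y) n) x := by
    intro n
    induction n using WellFoundedLT.induction with
    | _ n ih =>
      have h1 : (fun y => InnerProductSpace.gramSchmidt ℝ (f y) n) = fun y => f y n - ∑ i ∈ Finset.Iio n,
          ((inner ℝ (InnerProductSpace.gramSchmidt ℝ (f y) i) (f y n) : ℝ) *
            (inner ℝ (InnerProductSpace.gramSchmidt ℝ (f y) i)
              (InnerProductSpace.gramSchmidt ℝ (f y) i) : ℝ)⁻¹) •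
            InnerProductSpace.gramSchmidt ℝ (f y) i := by
        funext y
        rw [InnerProductSpace.gramSchmidt_def]
        congr 1
        refine sum_congr rfl fun i _ => ?_
        rw [Submodule.starProjection_singleton, real_inner_self_eq_norm_sq, div_eq_mul_inv]
        rfl
      rw [h1]
      refine SmoothNear.sub (coordField_smoothNear_self (b n)) (SmoothNear.sum fun i hi => ?_)
      have hi' := ih i (Finset.mem_Iio.1 hi)
      refine SmoothNear.smul (FnNear.mul (FnNear.inner hi' (coordField_smoothNear_self (b n)))
        (FnNear.inv (FnNear.inner hi' hi') ?_)) hi'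
      exact inner_self_ne_zero.2 (InnerProductSpace.gramSchmidt_ne_zero i hli0)
  refine ⟨fun n y => InnerProductSpace.gramSchmidtNormed ℝ (f y) n, fun n => ?_, ?_⟩
  · have h1 : (fun y => InnerProductSpace.gramSchmidtNormed ℝ (f y) n) = fun y =>
        (Real.sqrt (inner ℝ (InnerProductSpace.gramSchmidt ℝ (f y) n)
          (InnerProductSpace.gramSchmidt ℝ (f y) n) : ℝ))⁻¹ •
          InnerProductSpace.gramSchmidt ℝ (f y) n := by
      funext y
      rw [real_inner_self_eq_norm_sq, Real.sqrt_sq (norm_nonneg _)]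
      rfl
    change SmoothNear E E (fun y => InnerProductSpace.gramSchmidtNormed ℝ (f y) n) x
    rw [h1]
    have h0 : (inner ℝ (InnerProductSpace.gramSchmidt ℝ (f x) n)
        (InnerProductSpace.gramSchmidt ℝ (f x) n) : ℝ) ≠ 0 :=
      inner_self_ne_zero.2 (InnerProductSpace.gramSchmidt_ne_zero n hli0)
    have h2 := FnNear.inner (hgs n) (hgs n)
    refine SmoothNear.smul ((h2.sqrt h0).inv ?_) (hgs n)
    rw [real_inner_self_eq_norm_sq, Real.sqrt_sq (norm_nonneg _)]
    exact norm_ne_zero_iff.2 (InnerProductSpace.gramSchmidt_ne_zero n hli0)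
  · filter_upwards [hli] with y hy
    exact InnerProductSpace.gramSchmidtNormed_orthonormal hy

end Frames

section Flat

variable {x : X}

lemma T01Dual.map_J (α : T01Dual E x) (v : 𝕋 x) : (α : 𝕋 x →L[ℝ] ℂ) (J E x v)
      = -I * (α : 𝕋 x →L[ℝ] ℂ) v := α.2 v

lemma T01Dual.real_smul (r : ℝ) (α : T01Dual E x) : r • α = (r : ℂ) • α := by
  ext u
  simp

/-- The `(0,1)`-part of the real form `g(v, ·)`. -/
def flat01 : 𝕋 x →ₗ[ℝ] T01Dual E x where
  toFun v := part01 (Complex.ofRealCLM.comp (innerSL ℝ v))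
  map_add' v w := by
    ext u
    simp only [part01, map_add, Submodule.coe_add, smul_apply, add_apply,
      ContinuousLinearMap.comp_apply, innerSL_apply_apply, Complex.ofRealCLM_apply, smul_eq_mul]
    ring
  map_smul' r v := by
    ext u
    simp only [part01, map_smul, Submodule.coe_smul_of_tower, smul_apply, add_apply,
      ContinuousLinearMap.comp_apply, innerSL_apply_apply, Complex.ofRealCLM_apply, smul_eq_mul,
      Complex.ofReal_mul, Complex.real_smul, RingHom.id_apply]
    ring

lemma flat01_apply (v u : 𝕋 x) : (flat01 v : 𝕋 x →L[ℝ] ℂ) u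
      = (1 / 2 : ℂ) * (((inner ℝ v u : ℝ) : ℂ) + I * ((inner ℝ v (J E x u) : ℝ) : ℂ)) := by
  simp only [flat01, part01, LinearMap.coe_mk, AddHom.coe_mk, smul_apply, add_apply,
      ContinuousLinearMap.comp_apply, innerSL_apply_apply, Complex.ofRealCLM_apply, smul_eq_mul]

lemma flat01_J (hJ : ∀ a b : 𝕋 x, (inner ℝ (J E x a) b : ℝ) = -inner ℝ a (J E x b)) (v : 𝕋 x) :
    flat01 (J E x v) = I • flat01 v := by
  ext u
  rw [Submodule.coe_smul, smul_apply, flat01_apply, flat01_apply, hJ, hJ, J_J, inner_neg_right,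
    smul_eq_mul]
  push_cast
  linear_combination (-1/2 : ℂ) * ((inner ℝ v (J E x u) : ℝ) : ℂ) * I_sq

lemma flat01_smul (r : ℝ) (v : 𝕋 x) : flat01 (r • v) = (r : ℂ) • flat01 v := by
  rw [map_smul, T01Dual.real_smul]

/-- The vector `a` with `flat01 a = α`. -/
def sharp01 (α : T01Dual E x) : 𝕋 x :=
  ∑ i, (2 * ((α : 𝕋 x →L[ℝ] ℂ)
    (stdOrthonormalBasis ℝ (𝕋 x) i)).re) • stdOrthonormalBasis ℝ (𝕋 x) i

lemma inner_sharp01 (α : T01Dual E x) (u : 𝕋 x) :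
    (inner ℝ (sharp01 α) u : ℝ) = 2 * ((α : 𝕋 x →L[ℝ] ℂ) u).re := by
  conv_rhs => rw [← (stdOrthonormalBasis ℝ (𝕋 x)).sum_repr u]
  rw [sharp01, sum_inner, map_sum, Complex.re_sum, mul_sum]
  refine sum_congr rfl fun i _ => ?_
  rw [inner_smul_left, map_smul, Complex.real_smul, Complex.re_ofReal_mul,
    OrthonormalBasis.repr_apply_apply]
  simp only [conj_trivial]
  ring

lemma flat01_sharp01 (α : T01Dual E x) : flat01 (sharp01 α) = α := by
  ext u
  rw [flat01_apply, inner_sharp01, inner_sharp01, T01Dual.map_J α]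
  generalize (α : 𝕋 x →L[ℝ] ℂ) u = z
  apply Complex.ext <;> simp

lemma sharp01_eq_sum {ι : Type*} [Fintype ι] (e : OrthonormalBasis ι ℝ (𝕋 x)) (α : T01Dual E x) :
    sharp01 α = ∑ i, (2 * ((α : 𝕋 x →L[ℝ] ℂ) (e i)).re) • e i := by
  conv_lhs => rw [← e.sum_repr (sharp01 α)]
  refine sum_congr rfl fun i _ => ?_
  rw [e.repr_apply_apply, real_inner_comm, inner_sharp01]

lemma formMetric_flat01 (hJ : ∀ a b : 𝕋 x, (inner ℝ (J E x a) b : ℝ)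
    = -inner ℝ a (J E x b)) (v : 𝕋 x) (β : T01Dual E x) :
    formMetric (flat01 v) β = (β : 𝕋 x →L[ℝ] ℂ) v := by
  set b := stdOrthonormalBasis ℝ (𝕋 x) with hb
  have hexp : ∀ w, (β : 𝕋 x →L[ℝ] ℂ) w
      = ∑ i, ((inner ℝ w (b i) : ℝ) : ℂ) * (β : 𝕋 x →L[ℝ] ℂ) (b i) := by
    intro w
    conv_lhs => rw [← b.sum_repr w]
    rw [map_sum]
    refine sum_congr rfl fun i _ => ?_
    rw [map_smul, Complex.real_smul, b.repr_apply_apply, real_inner_comm]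
  have h1 : (β : 𝕋 x →L[ℝ] ℂ) v = (1 / 2 : ℂ) * ((β : 𝕋 x →L[ℝ] ℂ) v
        + I * (β : 𝕋 x →L[ℝ] ℂ) (J E x v)) := by
    rw [T01Dual.map_J β]
    linear_combination (1/2 : ℂ) * (β : 𝕋 x →L[ℝ] ℂ) v * I_sq
  rw [h1, hexp v, hexp (J E x v), mul_sum, ← sum_add_distrib, mul_sum]
  unfold formMetric
  refine sum_congr rfl fun i _ => ?_
  rw [flat01_apply, hJ]
  simp only [map_mul, map_add, Complex.conj_ofReal, Complex.conj_I, map_div₀, map_one, map_ofNat]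
  push_cast
  ring

end Flat

section Exterior

variable {M : Type*} [AddCommGroup M] [Module ℂ M]

/-- Contraction of the exterior algebra with a linear form. -/
def extContract (d : Module.Dual ℂ M) : ExteriorAlgebra ℂ M →ₗ[ℂ] ExteriorAlgebra ℂ M :=
  CliffordAlgebra.contractLeft (Q := 0) d

lemma extContract_ι_mul (d : Module.Dual ℂ M) (a : M) (z : ExteriorAlgebra ℂ M) :
    extContract d (ExteriorAlgebra.ι ℂ a * z) = d a • z - ExteriorAlgebra.ι ℂ a * extContract d z :=
  CliffordAlgebra.contractLeft_ι_mul _ _ _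

lemma extContract_one (d : Module.Dual ℂ M) : extContract d 1 = 0 :=
  CliffordAlgebra.contractLeft_one _ _

lemma extContract_extContract (d : Module.Dual ℂ M) (z : ExteriorAlgebra ℂ M) :
    extContract d (extContract d z) = 0 :=
  CliffordAlgebra.contractLeft_contractLeft _ _

lemma extContract_comm (d d' : Module.Dual ℂ M) (z : ExteriorAlgebra ℂ M) :
    extContract d (extContract d' z) = - extContract d' (extContract d z) :=
  CliffordAlgebra.contractLeft_comm _ _ _

lemma extContract_add (d d' : Module.Dual ℂ M) (z : ExteriorAlgebra ℂ M) :
    extContract (d + d') z = extContract d z + extContract d' z := by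
  simp [extContract]

lemma extContract_smul (c : ℂ) (d : Module.Dual ℂ M) (z : ExteriorAlgebra ℂ M) :
    extContract (c • d) z = c • extContract d z := by
  simp [extContract]

lemma ι_mul_ι_comm (a b : M) (z : ExteriorAlgebra ℂ M) :
    ExteriorAlgebra.ι ℂ a * (ExteriorAlgebra.ι ℂ b * z)
      = -(ExteriorAlgebra.ι ℂ b * (ExteriorAlgebra.ι ℂ a * z)) := by
  rw [← mul_assoc, ← mul_assoc, eq_neg_iff_add_eq_zero, ← add_mul,
    ExteriorAlgebra.ι_add_mul_swap, zero_mul]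

lemma extContract_ιMulti (d : Module.Dual ℂ M) {q : ℕ} (α : Fin (q + 1) → M) :
    extContract d (ιMulti ℂ (q + 1) α) = ∑ j : Fin (q + 1), ((-1 : ℂ) ^ (j : ℕ) * d (α j)) •
        ιMulti ℂ q (fun i => α (j.succAbove i)) := by
  induction q with
  | zero =>
    rw [ExteriorAlgebra.ιMulti_succ_apply, extContract_ι_mul]
    simp [extContract_one]
  | succ q ih =>
    rw [ExteriorAlgebra.ιMulti_succ_apply, extContract_ι_mul, ih, sub_eq_add_neg,
      mul_sum, ← sum_neg_distrib, Fin.sum_univ_succ (n := q + 1)]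
    congr 1
    · simp [Matrix.vecTail, Function.comp_def]
    · refine sum_congr rfl fun j _ => ?_
      rw [ExteriorAlgebra.ιMulti_succ_apply (fun i => α (j.succ.succAbove i)), mul_smul_comm,
        ← neg_smul]
      congr 1
      · simp [Matrix.vecTail, pow_succ]
      · simp [Matrix.vecTail, Function.comp_def]

lemma algebraMapInv_ιMulti_succ {q : ℕ} (α : Fin (q + 1) → M) :
    ExteriorAlgebra.algebraMapInv (ιMulti ℂ (q + 1) α) = 0 := by
  rw [ExteriorAlgebra.ιMulti_succ_apply, map_mul]
  simp [ExteriorAlgebra.algebraMapInv]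

lemma extNumber_ιMulti {q : ℕ} (α : Fin q → M) :
    extNumber M (ιMulti ℂ q α) = (q : ℂ) • ιMulti ℂ q α := by
  have hm : ιMulti ℂ q α ∈ ⋀[ℂ]^q M :=
    ExteriorAlgebra.ιMulti_range ℂ q ⟨α, rfl⟩
  simp only [extNumber, LinearMap.comp_apply]
  have h1 : (DirectSum.decomposeLinearEquiv (fun q : ℕ => ⋀[ℂ]^q M)).toLinearMap
      (ιMulti ℂ q α)
      = DirectSum.lof ℂ ℕ (fun q : ℕ => ⋀[ℂ]^q M) q ⟨ιMulti ℂ q α, hm⟩ :=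
    DirectSum.decompose_of_mem (fun q : ℕ => ⋀[ℂ]^q M) hm
  rw [h1, DirectSum.toModule_lof]
  rfl

lemma exterior_span_induction {P : ExteriorAlgebra ℂ M → Prop}
    (h : ∀ q (α : Fin q → M), P (ιMulti ℂ q α)) (hadd : ∀ z w, P z → P w → P (z + w))
    (hsmul : ∀ (c : ℂ) z, P z → P (c • z)) (z : ExteriorAlgebra ℂ M) : P z := by
  have hz : z ∈ Submodule.span ℂ
      (Set.range fun x : Σ n, (Fin n → M) => ιMulti ℂ x.1 x.2) := by
    rw [ExteriorAlgebra.ιMulti_span]; trivial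
  induction hz using Submodule.span_induction with
  | mem z hz => obtain ⟨⟨q, α⟩, rfl⟩ := hz; exact h q α
  | zero => simpa using hsmul 0 _ (h 0 Fin.elim0)
  | add z w _ _ hz hw => exact hadd z w hz hw
  | smul c z _ hz => exact hsmul c z hz

lemma extNumber_eq_sum {ι : Type*} [Fintype ι] (b : Module.Basis ι ℂ M) (z : ExteriorAlgebra ℂ M) :
    extNumber M z = ∑ i, ExteriorAlgebra.ι ℂ (b i) * extContract (b.coord i) z := by
  refine exterior_span_induction (P := fun z => extNumber M z
    = ∑ i, ExteriorAlgebra.ι ℂ (b i) * extContract (b.coord i) z) (fun q α => ?_) ?_ ?_ z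
  · rw [extNumber_ιMulti]
    induction q with
    | zero => simp [extContract_one]
    | succ q ih =>
      rw [ExteriorAlgebra.ιMulti_succ_apply]
      simp only [extContract_ι_mul, mul_sub, mul_smul_comm]
      have h1 : ∀ i, ExteriorAlgebra.ι ℂ (b i) * (ExteriorAlgebra.ι ℂ (α 0) *
          extContract (b.coord i) (ιMulti ℂ q (Matrix.vecTail α)))
          = -(ExteriorAlgebra.ι ℂ (α 0) * (ExteriorAlgebra.ι ℂ (b i) *
          extContract (b.coord i) (ιMulti ℂ q (Matrix.vecTail α)))) :=
        fun i => ι_mul_ι_comm _ _ _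
      simp only [h1, sub_neg_eq_add, sum_add_distrib, ← mul_sum, ← ih]
      have h2 : ∑ i, (b.coord i) (α 0) • (ExteriorAlgebra.ι ℂ (b i) * ιMulti ℂ q (Matrix.vecTail α))
          = ExteriorAlgebra.ι ℂ (α 0) * ιMulti ℂ q (Matrix.vecTail α) := by
        conv_rhs => rw [← b.sum_repr (α 0)]
        rw [map_sum, sum_mul]
        simp only [map_smul, smul_mul_assoc, Module.Basis.coord_apply]
      rw [h2, mul_smul_comm]
      push_cast
      module
  · intro z w hz hw
    simp only [map_add, mul_add, sum_add_distrib, hz, hw]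
  · intro c z hz
    simp only [map_smul, hz, mul_smul_comm, smul_sum]

/-- The opposite of a complex algebra with the conjugate action of `ℂ`. -/
def ConjOp (A : Type*) := Aᵐᵒᵖ

instance (A : Type*) [Ring A] : Ring (ConjOp A) := inferInstanceAs (Ring Aᵐᵒᵖ)

instance (A : Type*) [Ring A] [Algebra ℂ A] : Algebra ℂ (ConjOp A) :=
  ((algebraMap ℂ Aᵐᵒᵖ).comp (starRingEnd ℂ)).toAlgebra' fun c a =>
    Algebra.commutes (A := Aᵐᵒᵖ) (conj c) a

/-- The element of `ConjOp A` given by an element of `A`. -/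
def ConjOp.of {A : Type*} (a : A) : ConjOp A := MulOpposite.op a

/-- The element of `A` given by an element of `ConjOp A`. -/
def ConjOp.un {A : Type*} (a : ConjOp A) : A := MulOpposite.unop (α := A) a

section ConjOp

variable {A : Type*} [Ring A]

lemma ConjOp.un_injective : Function.Injective (ConjOp.un (A := A)) := MulOpposite.unop_injective

lemma ConjOp.un_of (a : A) : ConjOp.un (ConjOp.of a) = a := rfl

lemma ConjOp.un_add (a b : ConjOp A) : (a + b).un = a.un + b.un := rfl

lemma ConjOp.un_smul [Algebra ℂ A] (c : ℂ) (a : ConjOp A) : (c • a).un = conj c • a.un := by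
  have h : (c • a).un = a.un * algebraMap ℂ A (conj c) := rfl
  rw [h, ← Algebra.commutes, ← Algebra.smul_def]

end ConjOp

variable (f : M →ₗ⋆[ℂ] Module.Dual ℂ M)

/-- The algebra map sending `α_1 ∧ ⋯ ∧ α_q` to the product in reverse order of the contractions with
`f α_i`. -/
def conjContract : ExteriorAlgebra ℂ M →ₐ[ℂ] ConjOp (Module.End ℂ (ExteriorAlgebra ℂ M)) :=
  ExteriorAlgebra.lift ℂ ⟨
    { toFun := fun m => ConjOp.of (extContract (f m))
      map_add' := fun m m' => by
        refine ConjOp.un_injective (LinearMap.ext fun z => ?_)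
        rw [ConjOp.un_add, ConjOp.un_of, ConjOp.un_of, ConjOp.un_of, LinearMap.add_apply, map_add,
          extContract_add]
      map_smul' := fun c m => by
        refine ConjOp.un_injective (LinearMap.ext fun z => ?_)
        rw [RingHom.id_apply, ConjOp.un_smul, ConjOp.un_of, ConjOp.un_of, LinearMap.map_smulₛₗ,
          extContract_smul, LinearMap.smul_apply] },
    fun m => by
      refine ConjOp.un_injective (LinearMap.ext fun z => ?_)
      exact extContract_extContract (f m) z⟩

/-- The sesquilinear form on an exterior algebra induced by a sesquilinear form. -/
def extHerm : ExteriorAlgebra ℂ M →ₗ⋆[ℂ] ExteriorAlgebra ℂ M →ₗ[ℂ] ℂ :=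
  LinearMap.mk₂'ₛₗ (starRingEnd ℂ) (RingHom.id ℂ)
    (fun z w => ExteriorAlgebra.algebraMapInv
      ((conjContract f z).un w))
    (fun z z' w => by
      rw [map_add]
      exact map_add ExteriorAlgebra.algebraMapInv _ _)
    (fun c z w => by
      rw [map_smul, ConjOp.un_smul, LinearMap.smul_apply, map_smul])
    (fun z w w' => by rw [map_add, map_add])
    (fun c z w => by rw [map_smul, map_smul, RingHom.id_apply])

lemma extHerm_one (w : ExteriorAlgebra ℂ M) : extHerm f 1 w = ExteriorAlgebra.algebraMapInv w := by
  simp only [extHerm, LinearMap.mk₂'ₛₗ_apply, map_one]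
  rfl

lemma extHerm_ι_mul (m : M) (z w : ExteriorAlgebra ℂ M) :
    extHerm f (ExteriorAlgebra.ι ℂ m * z) w = extHerm f z (extContract (f m) w) := by
  simp only [extHerm, LinearMap.mk₂'ₛₗ_apply, map_mul]
  congr 1
  have h : conjContract f (ExteriorAlgebra.ι ℂ m) = ConjOp.of (extContract (f m)) :=
    ExteriorAlgebra.lift_ι_apply ℂ _ _ m
  rw [h]
  rfl

lemma extHerm_ιMulti {q : ℕ} (α β : Fin q → M) : extHerm f (ιMulti ℂ q α) (ιMulti ℂ q β)
      = (Matrix.of fun i j => f (α i) (β j)).det := by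
  induction q with
  | zero => simp [extHerm_one]
  | succ q ih =>
    rw [ExteriorAlgebra.ιMulti_succ_apply, extHerm_ι_mul, extContract_ιMulti, map_sum,
      Matrix.det_succ_row_zero]
    refine sum_congr rfl fun j _ => ?_
    rw [map_smul, ih, smul_eq_mul]
    rfl

lemma extHerm_ιMulti_of_ne {q q' : ℕ} (h : q ≠ q') (α : Fin q → M) (β : Fin q' → M) :
    extHerm f (ιMulti ℂ q α) (ιMulti ℂ q' β) = 0 := by
  induction q generalizing q' with
  | zero =>
    obtain ⟨k, rfl⟩ := Nat.exists_eq_succ_of_ne_zero h.symm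
    rw [ExteriorAlgebra.ιMulti_zero_apply, extHerm_one]
    exact algebraMapInv_ιMulti_succ β
  | succ q ih =>
    rw [ExteriorAlgebra.ιMulti_succ_apply, extHerm_ι_mul]
    cases q' with
    | zero => rw [ExteriorAlgebra.ιMulti_zero_apply, extContract_one, map_zero]
    | succ k =>
      rw [extContract_ιMulti, map_sum]
      refine sum_eq_zero fun j _ => ?_
      rw [map_smul, ih (fun h' => h (by rw [h'])), smul_zero]

lemma extHerm_nondegenerate [FiniteDimensional ℂ M] (hf : Function.Surjective f)
    {w : ExteriorAlgebra ℂ M} (hw : ∀ z, extHerm f z w = 0) : w = 0 := by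
  set b := finBasis ℂ M
  choose m hm using fun i => hf (b.coord i)
  have key : ∀ s : Finset (Fin (finrank ℂ M)), b.ExteriorAlgebra.coord s
      = extHerm f (ExteriorAlgebra.ιMulti_family ℂ s.card m (Set.powersetCard.ofCard rfl)) := by
    intro s
    refine b.ExteriorAlgebra.ext fun t => ?_
    rw [Module.Basis.coord_apply, Module.Basis.repr_self, Finsupp.single_apply]
    by_cases hc : t.card = s.card
    · have hdet : extHerm f (ExteriorAlgebra.ιMulti_family ℂ s.card m (Set.powersetCard.ofCard rfl))
          (ExteriorAlgebra.ιMulti_family ℂ s.card b (Set.powersetCard.ofCard hc))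
          = exteriorPower.ιMultiDual ℂ s.card b (Set.powersetCard.ofCard rfl)
            (exteriorPower.ιMulti_family ℂ s.card b (Set.powersetCard.ofCard hc)) := by
        rw [extHerm_ιMulti, exteriorPower.ιMulti_family, exteriorPower.ιMultiDual_apply_ιMulti,
          ← Matrix.det_transpose]
        congr 1
        ext i j
        simp [hm]
      rw [ExteriorAlgebra.basis_apply_ofCard b hc, hdet]
      by_cases hst : t = s
      · subst hst
        rw [exteriorPower.ιMultiDual_apply_diag]
        simp
      · rw [exteriorPower.ιMultiDual_apply_nondiag]
        · simp [hst]
        · intro h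
          exact hst (congrArg Subtype.val h).symm
    · rw [ExteriorAlgebra.basis_apply, extHerm_ιMulti_of_ne f (Ne.symm hc), if_neg]
      rintro rfl
      exact hc rfl
  refine b.ExteriorAlgebra.ext_elem fun s => ?_
  have h1 := congrArg (fun L : ExteriorAlgebra ℂ M →ₗ[ℂ] ℂ => L w) (key s)
  simp only [Module.Basis.coord_apply, hw] at h1
  rw [h1, map_zero, Finsupp.zero_apply]

end Exterior

section Forms

variable {x : X} {a u v w : 𝔛} {α β : Π y : X, T01Dual E y}

/-- A `(0,1)`-form is smooth near `x`. -/
def FormNear (α : Π y : X, T01Dual E y) (x : X) : Prop :=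
  ∃ a : 𝔛, SmoothNear E E a x ∧ ∀ᶠ y in 𝓝 x, α y = flat01 (a y)

lemma FormNear.flat01 (ha : SmoothNear E E a x) : FormNear (fun y => flat01 (a y)) x :=
  ⟨a, ha, .of_forall fun _ => rfl⟩

lemma FormNear.eventually (h : FormNear α x) : ∀ᶠ y in 𝓝 x, FormNear α y := by
  obtain ⟨a, ha, haα⟩ := h
  filter_upwards [ha.eventually, haα.eventually_nhds] with y h1 h2 using ⟨a, h1, h2⟩

lemma FormNear.congr (h : FormNear α x) (hβ : ∀ᶠ y in 𝓝 x, β y = α y) : FormNear β x := by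
  obtain ⟨a, ha, haα⟩ := h
  refine ⟨a, ha, ?_⟩
  filter_upwards [haα, hβ] with y h1 h2 using h2.trans h1

lemma FnNear.ofReal {f : X → ℝ} (hf : FnNear E f x) : FnNear E (fun y => (f y : ℂ)) x :=
  hf.clm Complex.ofRealCLM

lemma FnNear.constMul {f : X → ℂ} (c : ℂ) (hf : FnNear E f x) : FnNear E (fun y => c * f y) x :=
  FnNear.mul (FnNear.const c) hf

lemma FormNear.apply (h : FormNear α x) (hv : SmoothNear E E v x) :
    FnNear E (fun y => (α y : 𝕋 y →L[ℝ] ℂ) (v y)) x := by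
  obtain ⟨a, ha, haα⟩ := h
  refine FnNear.congr (((FnNear.inner ha hv).ofReal.add
    ((FnNear.inner ha hv.J).ofReal.constMul I)).constMul (1 / 2)) ?_
  filter_upwards [haα] with y hy
  rw [hy, flat01_apply]

lemma formNear_of_smoothFormOn {U : Set X} (h : SmoothFormOn α U) (hU : IsOpen U) (hx : x ∈ U) :
    FormNear α x := by
  obtain ⟨e, he, ho⟩ := exists_orthonormal_frame E x
  have h1 : ∀ i, FnNear E (fun y => (α y : 𝕋 y →L[ℝ] ℂ) (e i y)) x := by
    intro i
    obtain ⟨W, hW, hxW, hWe⟩ := (he i).exists_open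
    filter_upwards [(hU.inter hW).mem_nhds ⟨hx, hxW⟩] with y hy
    exact (h W (e i) hW (smoothFieldOn_of_smoothNear hWe) y hy).contMDiffAt
      ((hU.inter hW).mem_nhds hy)
  refine ⟨fun y => ∑ i, (2 * ((α y : 𝕋 y →L[ℝ] ℂ) (e i y)).re) • e i y,
    SmoothNear.sum fun i _ => SmoothNear.smul
      (FnNear.mul (FnNear.const 2) ((h1 i).clm reCLM)) (he i), ?_⟩
  filter_upwards [ho] with y hy
  have h2 := sharp01_eq_sum (orthonormalBasisOf hy (by simp)) (α y)
  rw [coe_orthonormalBasisOf] at h2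
  rw [← h2, flat01_sharp01]

lemma smoothFormOn_of_formNear {U : Set X} (h : ∀ y ∈ U, FormNear α y) : SmoothFormOn α U :=
  fun _ _ hW hv y hy => (((h y hy.1).apply
    (smoothNear_of_smoothFieldOn hv hW hy.2)).contMDiffAt).contMDiffWithinAt

/-- The connection on `(0,1)`-forms is induced by `flat01`. -/
lemma IsKahlerMetric.isFormDerivative_iff (hX : IsKahlerMetric E X) (h : IsLeviCivita nablaT)
    (ha : SmoothNear E E a x) (hα : ∀ᶠ y in 𝓝 x, α y = SpinDirac.flat01 (a y))
    (d : 𝕋 x) (β : T01Dual E x) :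
    IsFormDerivative nablaT α x d β ↔ β = SpinDirac.flat01 (nablaT a x d) := by
  have key : ∀ u : 𝔛, SmoothNear E E u x → 𝕕 (fun y => (α y : 𝕋 y →L[ℝ] ℂ) (u y)) x d
        - (α x : 𝕋 x →L[ℝ] ℂ) (nablaT u x d)
      = (SpinDirac.flat01 (nablaT a x d) : 𝕋 x →L[ℝ] ℂ) (u x) := by
    intro u hu
    have h1 : (fun y => (α y : 𝕋 y →L[ℝ] ℂ) (u y)) =ᶠ[𝓝 x] fun y =>
        ((1 / 2 : ℂ) • Complex.ofRealCLM) (inner ℝ (a y) (u y))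
          + ((1 / 2 * I : ℂ) • Complex.ofRealCLM) (inner ℝ (a y) (J E y (u y))) := by
      filter_upwards [hα] with y hy
      rw [hy, flat01_apply]
      simp only [smul_apply, Complex.ofRealCLM_apply, smul_eq_mul]
      ring
    have m1 := FnNear.inner ha hu
    have m2 := FnNear.inner ha hu.J
    rw [mvfderiv_congr h1, mvfderiv_fun_add (m1.clm _).mdiff (m2.clm _).mdiff, add_apply,
      mvfderiv_clm _ m1.mdiff, mvfderiv_clm _ m2.mdiff, h.metric_near ha hu,
      h.metric_near ha hu.J, hX.nabla_J h hu, hα.self_of_nhds, flat01_apply, flat01_apply]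
    simp only [smul_apply, Complex.ofRealCLM_apply, smul_eq_mul]
    push_cast
    ring
  constructor
  · intro hβ
    ext b
    obtain ⟨u, hu, rfl⟩ := exists_field b
    obtain ⟨u', hu', huu⟩ := hu.exists_global
    rw [← huu.self_of_nhds, ← key u' (hu' x)]
    exact hβ u' (smoothFieldOn_of_smoothNear fun y _ => hu' y)
  · rintro rfl u hu
    exact (key u (smoothNear_of_smoothFieldOn hu isOpen_univ trivial)).symm

end Forms

section FiberHermitian

variable {M L V : Type*} [AddCommGroup M] [Module ℂ M]
  [NormedAddCommGroup L] [InnerProductSpace ℂ L] [NormedAddCommGroup V] [InnerProductSpace ℂ V]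

/-- The form `l_1 ⊗ ⋯ ⊗ l_p ↦ ∏ ⟨u, l_i⟩`. -/
def lineForm (p : ℕ) (u : L) : (⨂[ℂ] _ : Fin p, L) →ₗ[ℂ] ℂ :=
  PiTensorProduct.lift ((MultilinearMap.mkPiAlgebra ℂ (Fin p) ℂ).compLinearMap
    fun _ => innerₛₗ ℂ u)

lemma lineForm_tprod (p : ℕ) (u : L) (l : Fin p → L) :
    lineForm p u (tprod ℂ l) = ∏ i, inner ℂ u (l i) := by
  simp [lineForm]

/-- The identification `L^p ⊗ V ≃ V` given by a unit vector of a line `L`. -/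
def twistEquiv (p : ℕ) (u : L) (hu : ‖u‖ = 1) (hL : ∀ l : L, l = (inner ℂ u l : ℂ) • u) :
    ((⨂[ℂ] _ : Fin p, L) ⊗[ℂ] V) ≃ₗ[ℂ] V :=
  LinearEquiv.ofLinearMap
    ((TensorProduct.lid ℂ V).toLinearMap.comp (LinearMap.rTensor V (lineForm p u)))
    (TensorProduct.mk ℂ _ V (tprod ℂ fun _ => u))
    (by
      ext e
      simp [lineForm_tprod, inner_self_eq_norm_sq_to_K, hu])
    (by
      ext l e
      simp only [LinearMap.compMultilinearMap_apply, TensorProduct.AlgebraTensorModule.curry_apply,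
        LinearMap.coe_restrictScalars, TensorProduct.curry_apply, LinearMap.comp_apply,
        LinearMap.rTensor_tmul, LinearEquiv.coe_coe, TensorProduct.lid_tmul, lineForm_tprod,
        TensorProduct.mk_apply, LinearMap.id_apply]
      have h : tprod ℂ l = (∏ i, inner ℂ u (l i) : ℂ) •
          tprod ℂ (fun _ : Fin p => u) := by
        rw [← MultilinearMap.map_smul_univ]
        congr 1
        funext i
        exact hL (l i)
      rw [h, TensorProduct.smul_tmul])

lemma twistEquiv_tmul (p : ℕ) (u : L) (hu : ‖u‖ = 1) (hL : ∀ l : L, l = (inner ℂ u l : ℂ) • u)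
    (l : Fin p → L) (e : V) :
    twistEquiv p u hu hL (tprod ℂ l ⊗ₜ[ℂ] e) = (∏ i, inner ℂ u (l i) : ℂ) • e := by
  simp [twistEquiv, lineForm_tprod]

variable [FiniteDimensional ℂ V] {T : Type*} [AddCommGroup T] [Module ℂ T] (μ : T ≃ₗ[ℂ] V)
  (f : M →ₗ⋆[ℂ] Module.Dual ℂ M)

/-- The coefficient in `ΛM` of a basis vector of `T ≃ V`. -/
def fiberCoeff (k : Fin (finrank ℂ V)) :
    ExteriorAlgebra ℂ M ⊗[ℂ] T →ₗ[ℂ] ExteriorAlgebra ℂ M :=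
  (TensorProduct.rid ℂ _).toLinearMap.comp
    (LinearMap.lTensor _ ((innerₛₗ ℂ (stdOrthonormalBasis ℂ V k)).comp μ.toLinearMap))

lemma fiberCoeff_tmul (k : Fin (finrank ℂ V)) (z : ExteriorAlgebra ℂ M) (t : T) :
    fiberCoeff μ k (z ⊗ₜ[ℂ] t) = (inner ℂ (stdOrthonormalBasis ℂ V k) (μ t) : ℂ) • z := by
  simp [fiberCoeff]

lemma fiberCoeff_rTensor (k : Fin (finrank ℂ V))
    (A : ExteriorAlgebra ℂ M →ₗ[ℂ] ExteriorAlgebra ℂ M) (ξ : ExteriorAlgebra ℂ M ⊗[ℂ] T) :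
    fiberCoeff μ k (LinearMap.rTensor T A ξ) = A (fiberCoeff μ k ξ) := by
  induction ξ using TensorProduct.induction_on with
  | zero => simp
  | tmul z t => rw [LinearMap.rTensor_tmul, fiberCoeff_tmul, fiberCoeff_tmul, map_smul]
  | add ξ η h1 h2 => simp only [map_add, h1, h2]

lemma sum_fiberCoeff (ξ : ExteriorAlgebra ℂ M ⊗[ℂ] T) :
    ∑ k, fiberCoeff μ k ξ ⊗ₜ[ℂ] μ.symm (stdOrthonormalBasis ℂ V k) = ξ := by
  induction ξ using TensorProduct.induction_on with
  | zero => simp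
  | tmul z t =>
    simp only [fiberCoeff_tmul, TensorProduct.smul_tmul]
    rw [← TensorProduct.tmul_sum]
    congr 1
    apply μ.injective
    simp only [map_sum, map_smul, LinearEquiv.apply_symm_apply]
    exact OrthonormalBasis.sum_repr' _ _
  | add ξ η h1 h2 => simp only [map_add, TensorProduct.add_tmul, sum_add_distrib, h1, h2]

/-- The sesquilinear form on `ΛM ⊗ T` induced by a form on `M` and an identification of `T` with a
Hermitian space. -/
def fiberHerm : ExteriorAlgebra ℂ M ⊗[ℂ] T →ₗ⋆[ℂ] ExteriorAlgebra ℂ M ⊗[ℂ] T →ₗ[ℂ] ℂ :=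
  LinearMap.mk₂'ₛₗ (starRingEnd ℂ) (RingHom.id ℂ)
    (fun ξ η => ∑ k, extHerm f (fiberCoeff μ k ξ) (fiberCoeff μ k η))
    (fun ξ ξ' η => by simp only [map_add, LinearMap.add_apply, sum_add_distrib])
    (fun c ξ η => by
      simp only [map_smul, LinearMap.map_smulₛₗ, LinearMap.smul_apply, smul_sum])
    (fun ξ η η' => by simp only [map_add, sum_add_distrib])
    (fun c ξ η => by simp only [map_smul, smul_sum, RingHom.id_apply])

lemma fiberHerm_apply (ξ η : ExteriorAlgebra ℂ M ⊗[ℂ] T) :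
    fiberHerm μ f ξ η = ∑ k, extHerm f (fiberCoeff μ k ξ) (fiberCoeff μ k η) := rfl

lemma fiberHerm_tmul (z w : ExteriorAlgebra ℂ M) (t t' : T) :
    fiberHerm μ f (z ⊗ₜ[ℂ] t) (w ⊗ₜ[ℂ] t') = extHerm f z w * inner ℂ (μ t) (μ t') := by
  rw [fiberHerm_apply, ← (stdOrthonormalBasis ℂ V).sum_inner_mul_inner (μ t) (μ t'), mul_sum]
  refine sum_congr rfl fun k _ => ?_
  rw [fiberCoeff_tmul, fiberCoeff_tmul, LinearMap.map_smul, LinearMap.map_smulₛₗ, LinearMap.smul_apply,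
    smul_eq_mul, smul_eq_mul, inner_conj_symm]
  ring

lemma fiberHerm_mulLeft (m : M) (ξ η : ExteriorAlgebra ℂ M ⊗[ℂ] T) :
    fiberHerm μ f (LinearMap.rTensor T (LinearMap.mulLeft ℂ (ExteriorAlgebra.ι ℂ m)) ξ) η
      = fiberHerm μ f ξ (LinearMap.rTensor T (extContract (f m)) η) := by
  simp only [fiberHerm_apply, fiberCoeff_rTensor, LinearMap.mulLeft_apply, extHerm_ι_mul]

lemma fiberHerm_nondegenerate [FiniteDimensional ℂ M] (hf : Function.Surjective f)
    {η : ExteriorAlgebra ℂ M ⊗[ℂ] T} (h : ∀ ξ, fiberHerm μ f ξ η = 0) : η = 0 := by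
  have h1 : ∀ k, fiberCoeff μ k η = 0 := by
    intro k
    refine extHerm_nondegenerate f hf fun z => ?_
    have h2 := h (z ⊗ₜ[ℂ] μ.symm (stdOrthonormalBasis ℂ V k))
    rw [fiberHerm_apply, sum_eq_single k] at h2
    · rw [fiberCoeff_tmul, LinearEquiv.apply_symm_apply, inner_self_eq_norm_sq_to_K,
        OrthonormalBasis.norm_eq_one] at h2
      simpa using h2
    · intro j _ hj
      rw [fiberCoeff_tmul, LinearEquiv.apply_symm_apply, OrthonormalBasis.inner_eq_zero _ hj]
      simp
    · simp
  rw [← sum_fiberCoeff μ η]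
  simp [h1]

end FiberHermitian

section Abstract

variable {M L V : Type*} [AddCommGroup M] [Module ℂ M] [AddCommGroup L] [Module ℂ L]
  [AddCommGroup V] [Module ℂ V] {p : ℕ}

lemma decomposable_induction {P : ExteriorAlgebra ℂ M ⊗[ℂ] ((⨂[ℂ] _ : Fin p, L) ⊗[ℂ] V) → Prop}
    (h : ∀ q (α : Fin q → M) (l : Fin p → L) (e : V), P (ιMulti ℂ q α ⊗ₜ[ℂ] (tprod ℂ l ⊗ₜ[ℂ] e)))
    (hadd : ∀ ξ η, P ξ → P η → P (ξ + η)) (hzero : P 0)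
    (ξ : ExteriorAlgebra ℂ M ⊗[ℂ] ((⨂[ℂ] _ : Fin p, L) ⊗[ℂ] V)) : P ξ := by
  have hz : ∀ (t : (⨂[ℂ] _ : Fin p, L) ⊗[ℂ] V) q (α : Fin q → M),
      P (ιMulti ℂ q α ⊗ₜ[ℂ] t) := by
    intro t q α
    induction t using TensorProduct.induction_on with
    | zero => simpa using hzero
    | tmul l e =>
      induction l using PiTensorProduct.induction_on with
      | smul_tprod c l => rw [TensorProduct.smul_tmul]; exact h q α l _
      | add l l' h1 h2 => rw [TensorProduct.add_tmul, TensorProduct.tmul_add]; exact hadd _ _ h1 h2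
    | add t t' h1 h2 => rw [TensorProduct.tmul_add]; exact hadd _ _ h1 h2
  induction ξ using TensorProduct.induction_on with
  | zero => exact hzero
  | tmul z t =>
    refine exterior_span_induction
      (P := fun z => ∀ t : (⨂[ℂ] _ : Fin p, L) ⊗[ℂ] V, P (z ⊗ₜ[ℂ] t))
      (fun q α t => hz t q α) (fun z w h1 h2 t => ?_) (fun c z h1 t => ?_) z t
    · rw [TensorProduct.add_tmul]; exact hadd _ _ (h1 t) (h2 t)
    · rw [TensorProduct.smul_tmul]; exact h1 _
  | add ξ η h1 h2 => exact hadd _ _ h1 h2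

lemma sesquilinear_ext {h h' : ExteriorAlgebra ℂ M ⊗[ℂ] ((⨂[ℂ] _ : Fin p, L) ⊗[ℂ] V) →ₗ⋆[ℂ]
      ExteriorAlgebra ℂ M ⊗[ℂ] ((⨂[ℂ] _ : Fin p, L) ⊗[ℂ] V) →ₗ[ℂ] ℂ}
    (H : ∀ q q' (α : Fin q → M) (β : Fin q' → M) (l l' : Fin p → L) (e e' : V),
      h (ιMulti ℂ q α ⊗ₜ[ℂ] (tprod ℂ l ⊗ₜ[ℂ] e)) (ιMulti ℂ q' β ⊗ₜ[ℂ] (tprod ℂ l' ⊗ₜ[ℂ] e'))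
      = h' (ιMulti ℂ q α ⊗ₜ[ℂ] (tprod ℂ l ⊗ₜ[ℂ] e))
        (ιMulti ℂ q' β ⊗ₜ[ℂ] (tprod ℂ l' ⊗ₜ[ℂ] e'))) : h = h' := by
  refine LinearMap.ext fun ξ => LinearMap.ext fun η => ?_
  refine decomposable_induction (P := fun ξ => h ξ η = h' ξ η) (fun q α l e => ?_)
    (fun ξ ξ' h1 h2 => ?_) ?_ ξ
  · refine decomposable_induction (P := fun η => h _ η = h' _ η) (fun q' β l' e' => H q q' α β l l' e e')
      (fun η η' h1 h2 => ?_) ?_ η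
    · rw [map_add, map_add, h1, h2]
    · rw [map_zero, map_zero]
  · rw [map_add, map_add, LinearMap.add_apply, LinearMap.add_apply, h1, h2]
  · rw [map_zero, map_zero]

lemma semilinear_surjective_of_injective [FiniteDimensional ℂ M]
    (f : M →ₗ⋆[ℂ] Module.Dual ℂ M) (hf : ∀ m, f m = 0 → m = 0) : Function.Surjective f := by
  set b := finBasis ℂ M
  let F : M →ₗ[ℂ] (Fin (finrank ℂ M) → ℂ) :=
    { toFun := fun m i => conj (f m (b i))
      map_add' := fun m m' => by funext i; simp
      map_smul' := fun c m => by funext i; simp }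
  have hF : Function.Injective F := by
    rw [injective_iff_map_eq_zero]
    intro m hm
    refine hf m (b.ext fun i => ?_)
    have h1 : conj (f m (b i)) = 0 := congrFun hm i
    simpa using h1
  have hF' : Function.Surjective F :=
    (LinearMap.injective_iff_surjective_of_finrank_eq_finrank (by simp)).1 hF
  intro δ
  obtain ⟨m, hm⟩ := hF' fun i => conj (δ (b i))
  refine ⟨m, b.ext fun i => ?_⟩
  have h1 : conj (f m (b i)) = conj (δ (b i)) := congrFun hm i
  exact (starRingEnd ℂ).injective h1

end Abstract

local instance addCommGroup_T01Dual (x : X) : AddCommGroup (T01Dual E x) :=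
  Submodule.addCommGroup (T01Dual E x)

local instance module_T01Dual (x : X) : Module ℂ (T01Dual E x) := Submodule.module (T01Dual E x)

local instance addCommGroup_formFiber {p : ℕ} {L V : X → Type*} [∀ x, AddCommGroup (L x)]
    [∀ x, Module ℂ (L x)] [∀ x, AddCommGroup (V x)] [∀ x, Module ℂ (V x)] (x : X) :
    AddCommGroup (𝔽 x) := TensorProduct.addCommGroup

local instance module_formFiber {p : ℕ} {L V : X → Type*} [∀ x, AddCommGroup (L x)]
    [∀ x, Module ℂ (L x)] [∀ x, AddCommGroup (V x)] [∀ x, Module ℂ (V x)] (x : X) :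
    Module ℂ (𝔽 x) := TensorProduct.leftModule

section FiberOperators

variable {x : X} {p : ℕ} {L V : X → Type*}
  [∀ x, AddCommGroup (L x)] [∀ x, Module ℂ (L x)] [∀ x, AddCommGroup (V x)] [∀ x, Module ℂ (V x)]

/-- Interior multiplication by the `(0,1)`-part of a real tangent vector. -/
def contr (v : 𝕋 x) : 𝔽 x →ₗ[ℂ] 𝔽 x :=
  interiorMul ⟨(1 / 2 : ℝ) • v, (1 / 2 : ℝ) • J E x v⟩

lemma evalDual_half (v : 𝕋 x) (α : T01Dual E x) :
    evalDual ⟨(1 / 2 : ℝ) • v, (1 / 2 : ℝ) • J E x v⟩ α = (α : 𝕋 x →L[ℝ] ℂ) v := by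
  simp only [evalDual, LinearMap.coe_mk, AddHom.coe_mk, map_smul, Complex.real_smul,
    T01Dual.map_J α]
  push_cast
  linear_combination (-1/2 : ℂ) * (α : 𝕋 x →L[ℝ] ℂ) v * I_sq

lemma wedge_tmul (α : T01Dual E x) (z : ExteriorAlgebra ℂ (T01Dual E x)) (t : TwistFiber p L V x) :
    wedge α (z ⊗ₜ[ℂ] t : 𝔽 x) = (ExteriorAlgebra.ι ℂ α * z) ⊗ₜ[ℂ] t := rfl

lemma interiorMul_tmul (u : ComplexTangent E x) (z : ExteriorAlgebra ℂ (T01Dual E x))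
    (t : TwistFiber p L V x) :
    interiorMul u (z ⊗ₜ[ℂ] t : 𝔽 x) = extContract (evalDual u) z ⊗ₜ[ℂ] t := rfl

lemma actEnd_tmul (A : V x →ₗ[ℂ] V x) (z : ExteriorAlgebra ℂ (T01Dual E x))
    (t : TwistFiber p L V x) : actEnd A (z ⊗ₜ[ℂ] t : 𝔽 x) = z ⊗ₜ[ℂ] LinearMap.lTensor _ A t := rfl

lemma wedge_add (α β : T01Dual E x) (ξ : 𝔽 x) : wedge (α + β) ξ = wedge α ξ + wedge β ξ := by
  induction ξ using TensorProduct.induction_on with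
  | zero => simp
  | tmul z t => simp only [wedge_tmul, map_add, add_mul, TensorProduct.add_tmul]
  | add ξ η h1 h2 => simp only [map_add, h1, h2]; abel

lemma wedge_smul (c : ℂ) (α : T01Dual E x) (ξ : 𝔽 x) : wedge (c • α) ξ = c • wedge α ξ := by
  induction ξ using TensorProduct.induction_on with
  | zero => simp
  | tmul z t => simp only [wedge_tmul, map_smul, smul_mul_assoc, TensorProduct.smul_tmul']
  | add ξ η h1 h2 => simp only [map_add, h1, h2, smul_add]

/-- Exterior multiplication as a linear map of the form. -/
def wedgeHom : T01Dual E x →ₗ[ℂ] 𝔽 x →ₗ[ℂ] 𝔽 x where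
  toFun := wedge
  map_add' α β := LinearMap.ext fun ξ => wedge_add α β ξ
  map_smul' c α := LinearMap.ext fun ξ => wedge_smul c α ξ

lemma wedge_wedge (α β : T01Dual E x) (ξ : 𝔽 x) : wedge α (wedge β ξ) = -wedge β (wedge α ξ) := by
  induction ξ using TensorProduct.induction_on with
  | zero => simp
  | tmul z t => simp only [wedge_tmul, ι_mul_ι_comm α β, TensorProduct.neg_tmul]
  | add ξ η h1 h2 => simp only [map_add, h1, h2, neg_add]

lemma interiorMul_wedge (u : ComplexTangent E x) (α : T01Dual E x) (ξ : 𝔽 x) :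
    interiorMul u (wedge α ξ) = evalDual u α • ξ - wedge α (interiorMul u ξ) := by
  induction ξ using TensorProduct.induction_on with
  | zero => simp
  | tmul z t =>
    simp only [wedge_tmul, interiorMul_tmul, extContract_ι_mul, TensorProduct.sub_tmul,
      TensorProduct.smul_tmul']
  | add ξ η h1 h2 => simp only [map_add, h1, h2, smul_add]; abel

lemma interiorMul_interiorMul (u v : ComplexTangent E x) (ξ : 𝔽 x) :
    interiorMul u (interiorMul v ξ) = -interiorMul v (interiorMul u ξ) := by
  induction ξ using TensorProduct.induction_on with
  | zero => simp
  | tmul z t =>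
    rw [interiorMul_tmul, interiorMul_tmul, extContract_comm, TensorProduct.neg_tmul]
    rfl
  | add ξ η h1 h2 => simp only [map_add, h1, h2, neg_add]

lemma interiorMul_congr {u v : ComplexTangent E x} (c : ℂ)
    (h : ∀ α : T01Dual E x, evalDual u α = c * evalDual v α) (ξ : 𝔽 x) :
    interiorMul u ξ = c • interiorMul v ξ := by
  have h1 : evalDual u = c • evalDual v := LinearMap.ext h
  induction ξ using TensorProduct.induction_on with
  | zero => simp
  | tmul z t => simp only [interiorMul_tmul, h1, extContract_smul, TensorProduct.smul_tmul']
  | add ξ η h1 h2 => simp only [map_add, h1, h2, smul_add]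

lemma contr_wedge (v : 𝕋 x) (α : T01Dual E x) (ξ : 𝔽 x) :
    contr v (wedge α ξ) = (α : 𝕋 x →L[ℝ] ℂ) v • ξ - wedge α (contr v ξ) := by
  rw [contr, interiorMul_wedge, evalDual_half]

lemma contr_contr (u v : 𝕋 x) (ξ : 𝔽 x) :
    contr u (contr v ξ) = -contr v (contr u ξ) := interiorMul_interiorMul _ _ ξ

lemma contr_add (u v : 𝕋 x) (ξ : 𝔽 x) : contr (u + v) ξ = contr u ξ + contr v ξ := by
  have h : evalDual (⟨(1 / 2 : ℝ) • (u + v), (1 / 2 : ℝ) • J E x (u + v)⟩ : ComplexTangent E x)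
      = evalDual ⟨(1 / 2 : ℝ) • u, (1 / 2 : ℝ) • J E x u⟩
        + evalDual ⟨(1 / 2 : ℝ) • v, (1 / 2 : ℝ) • J E x v⟩ := by
    refine LinearMap.ext fun α => ?_
    rw [LinearMap.add_apply, evalDual_half, evalDual_half, evalDual_half, map_add]
  induction ξ using TensorProduct.induction_on with
  | zero => simp
  | tmul z t => simp only [contr, interiorMul_tmul, h, extContract_add, TensorProduct.add_tmul]
  | add ξ η h1 h2 => rw [map_add, h1, h2, map_add, map_add]; abel

lemma contr_smul (r : ℝ) (v : 𝕋 x) (ξ : 𝔽 x) : contr (r • v) ξ = (r : ℂ) • contr v ξ := by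
  refine interiorMul_congr _ (fun α => ?_) ξ
  rw [evalDual_half, evalDual_half, map_smul, Complex.real_smul]

lemma contr_J (v : 𝕋 x) (ξ : 𝔽 x) : contr (J E x v) ξ = (-I) • contr v ξ := by
  refine interiorMul_congr _ (fun α => ?_) ξ
  rw [evalDual_half, evalDual_half, T01Dual.map_J]

lemma actEnd_wedge (A : V x →ₗ[ℂ] V x) (α : T01Dual E x) (ξ : 𝔽 x) :
    actEnd A (wedge α ξ) = wedge α (actEnd A ξ) := by
  induction ξ using TensorProduct.induction_on with
  | zero => simp
  | tmul z t => simp only [wedge_tmul, actEnd_tmul]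
  | add ξ η h1 h2 => simp only [map_add, h1, h2]

lemma actEnd_interiorMul (A : V x →ₗ[ℂ] V x) (u : ComplexTangent E x)
    (ξ : 𝔽 x) : actEnd A (interiorMul u ξ) = interiorMul u (actEnd A ξ) := by
  induction ξ using TensorProduct.induction_on with
  | zero => simp
  | tmul z t => simp only [interiorMul_tmul, actEnd_tmul]
  | add ξ η h1 h2 => simp only [map_add, h1, h2]

/-- The action of endomorphisms as a linear map. -/
def actEndHom : (V x →ₗ[ℂ] V x) →ₗ[ℂ] 𝔽 x →ₗ[ℂ] 𝔽 x :=
  (LinearMap.lTensorHom (ExteriorAlgebra ℂ (T01Dual E x))).comp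
    (LinearMap.lTensorHom (⨂[ℂ] _ : Fin p, L x))

lemma actEndHom_apply (A : V x →ₗ[ℂ] V x) (ξ : 𝔽 x) : actEndHom A ξ = actEnd A ξ := rfl

lemma number_eq_sum {ι : Type*} [Fintype ι] (b : Module.Basis ι ℂ (T01Dual E x))
    (u : ι → ComplexTangent E x) (hu : ∀ i, evalDual (u i) = b.coord i)
    (ξ : 𝔽 x) : number ξ = ∑ i, wedge (b i) (interiorMul (u i) ξ) := by
  induction ξ using TensorProduct.induction_on with
  | zero => simp
  | tmul z t =>
    simp only [wedge_tmul, interiorMul_tmul, hu]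
    rw [← TensorProduct.sum_tmul, ← extNumber_eq_sum]
    rfl
  | add ξ η h1 h2 => simp only [map_add, h1, h2, sum_add_distrib]

/-- Fibers are spanned by decomposable elements. -/
lemma fiber_induction {P : 𝔽 x → Prop}
    (h : ∀ q (α : Fin q → T01Dual E x) (l : Fin p → L x) (e : V x),
      P (ιMulti ℂ q α ⊗ₜ[ℂ] (tprod ℂ l ⊗ₜ[ℂ] e)))
    (hadd : ∀ ξ η, P ξ → P η → P (ξ + η)) (hzero : P 0) (ξ : 𝔽 x) : P ξ :=
  decomposable_induction h hadd hzero ξ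

end FiberOperators

local instance finiteDimensional_T01Dual {x : X} : FiniteDimensional ℂ (T01Dual E x) := by
  have h : FiniteDimensional ℝ (𝕋 x →L[ℝ] ℂ) := inferInstance
  have h1 : FiniteDimensional ℂ (𝕋 x →L[ℝ] ℂ) :=
    Module.Finite.of_restrictScalars_finite ℝ ℂ _
  infer_instance

section InducedHermitian

variable {x : X} {p : ℕ} {L V : X → Type*}
  [∀ x, NormedAddCommGroup (L x)] [∀ x, InnerProductSpace ℂ (L x)]
  [∀ x, NormedAddCommGroup (V x)] [∀ x, InnerProductSpace ℂ (V x)]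

/-- The Hermitian metric of `T^{*(0,1)}` as a sesquilinear map. -/
def formHerm (x : X) : T01Dual E x →ₗ⋆[ℂ] Module.Dual ℂ (T01Dual E x) :=
  LinearMap.mk₂'ₛₗ (starRingEnd ℂ) (RingHom.id ℂ) formMetric
    (fun α α' β => by
      simp only [formMetric, Submodule.coe_add, add_apply, map_add, add_mul, sum_add_distrib])
    (fun c α β => by
      simp only [formMetric, Submodule.coe_smul, smul_apply, smul_eq_mul, map_mul, mul_sum,
        mul_assoc])
    (fun α β β' => by
      simp only [formMetric, Submodule.coe_add, add_apply, mul_add, sum_add_distrib])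
    (fun c α β => by
      simp only [formMetric, Submodule.coe_smul, smul_apply, smul_eq_mul, mul_sum, RingHom.id_apply]
      refine sum_congr rfl fun i _ => ?_
      ring)

lemma formHerm_apply (α β : T01Dual E x) : formHerm x α β = formMetric α β := rfl

lemma formMetric_self_eq_zero {α : T01Dual E x} (h : formMetric α α = 0) : α = 0 := by
  have h1 : ∑ i, ((Complex.normSq ((α : 𝕋 x →L[ℝ] ℂ)
      (stdOrthonormalBasis ℝ (𝕋 x) i)) : ℝ)) = 0 := by
    have h2 : formMetric α α = ((∑ i, Complex.normSq ((α : 𝕋 x →L[ℝ] ℂ)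
      (stdOrthonormalBasis ℝ (𝕋 x) i)) : ℝ) : ℂ) := by
      rw [Complex.ofReal_sum]
      exact sum_congr rfl fun i _ => Complex.normSq_eq_conj_mul_self.symm
    rw [h] at h2
    exact_mod_cast h2.symm
  have h2 := (Finset.sum_eq_zero_iff_of_nonneg fun i _ => Complex.normSq_nonneg _).1 h1
  ext u
  rw [← (stdOrthonormalBasis ℝ (𝕋 x)).sum_repr u, map_sum, map_sum]
  refine sum_congr rfl fun i hi => ?_
  rw [map_smul, map_smul, Complex.normSq_eq_zero.1 (h2 i hi)]
  rfl

lemma formHerm_surjective : Function.Surjective (formHerm (E := E) x) :=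
  semilinear_surjective_of_injective _ fun α hα =>
    formMetric_self_eq_zero (congrArg (fun B : Module.Dual ℂ (T01Dual E x) => B α) hα)

lemma IsInducedHermitian.unique {h h' : 𝔽 x →ₗ⋆[ℂ] 𝔽 x →ₗ[ℂ] ℂ}
    (h1 : IsInducedHermitian h) (h2 : IsInducedHermitian h') : h = h' := by
  refine sesquilinear_ext fun q q' α β l l' e e' => ?_
  by_cases hq : q = q'
  · subst hq
    exact (h1.1 q α β l l' e e').trans (h2.1 q α β l l' e e').symm
  · exact (h1.2 q q' α β _ _ hq).trans (h2.2 q q' α β _ _ hq).symm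

lemma exists_unit_of_finrank_one {H : Type*} [NormedAddCommGroup H] [InnerProductSpace ℂ H]
    (h : finrank ℂ H = 1) : ∃ u : H, ‖u‖ = 1 ∧ ∀ l : H, l = (inner ℂ u l : ℂ) • u := by
  have : FiniteDimensional ℂ H := FiniteDimensional.of_finrank_pos (by omega)
  set b := (stdOrthonormalBasis ℂ H).reindex (finCongr h)
  refine ⟨b 0, b.norm_eq_one 0, fun l => ?_⟩
  conv_lhs => rw [← b.sum_repr' l]
  simp

lemma isInducedHermitian_fiberHerm [FiniteDimensional ℂ (V x)] (u : L x) (hu : ‖u‖ = 1)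
    (hL : ∀ l : L x, l = (inner ℂ u l : ℂ) • u) :
    IsInducedHermitian (fiberHerm (twistEquiv (V := V x) p u hu hL) (formHerm (E := E) x)) := by
  constructor
  · intro q α β l l' e e'
    rw [fiberHerm_tmul, extHerm_ιMulti, twistEquiv_tmul, twistEquiv_tmul, inner_smul_left,
      inner_smul_right, mul_assoc]
    have h1 : ∀ i, (inner ℂ (l i) (l' i) : ℂ) = conj (inner ℂ u (l i) : ℂ) * inner ℂ u (l' i) := by
      intro i
      conv_lhs => rw [hL (l i), inner_smul_left]
    simp only [h1, Finset.prod_mul_distrib, map_prod, formHerm_apply]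
    ring
  · intro q q' α β t t' hq
    rw [fiberHerm_tmul, extHerm_ιMulti_of_ne _ hq, zero_mul]

variable [FiniteDimensional ℂ (V x)] (hL : finrank ℂ (L x) = 1)

include hL

lemma inducedHermitian_spec : IsInducedHermitian (inducedHermitian x : 𝔽 x →ₗ⋆[ℂ] 𝔽 x →ₗ[ℂ] ℂ) := by
  obtain ⟨u, hu, hl⟩ := exists_unit_of_finrank_one hL
  exact Classical.epsilon_spec
    (p := fun h : 𝔽 x →ₗ⋆[ℂ] 𝔽 x →ₗ[ℂ] ℂ => IsInducedHermitian h)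
    ⟨_, isInducedHermitian_fiberHerm u hu hl⟩

lemma inducedHermitian_wedge (hJ : ∀ a b : 𝕋 x, (inner ℝ (J E x a) b : ℝ)
    = -inner ℝ a (J E x b)) (v : 𝕋 x) (ξ η : 𝔽 x) :
    inducedHermitian x (wedge (flat01 v) ξ) η = inducedHermitian x ξ (contr v η) := by
  obtain ⟨u, hu, hl⟩ := exists_unit_of_finrank_one hL
  have h := (inducedHermitian_spec (E := E) (p := p) (V := V) hL).unique
    (isInducedHermitian_fiberHerm (E := E) (V := V) (p := p) u hu hl)
  have h2 : formHerm x (flat01 v)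
      = evalDual ⟨(1 / 2 : ℝ) • v, (1 / 2 : ℝ) • J E x v⟩ := by
    refine LinearMap.ext fun β => ?_
    rw [evalDual_half, formHerm_apply, formMetric_flat01 hJ]
  have h3 := fiberHerm_mulLeft (twistEquiv p u hu hl) (formHerm (E := E) x) (flat01 v) ξ η
  rw [h2] at h3
  rw [h]
  exact h3

lemma inducedHermitian_nondegenerate {η : 𝔽 x} (hη : ∀ ξ, inducedHermitian x ξ η = 0) : η = 0 := by
  obtain ⟨u, hu, hl⟩ := exists_unit_of_finrank_one hL
  have h := (inducedHermitian_spec (E := E) (p := p) (V := V) hL).unique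
    (isInducedHermitian_fiberHerm (E := E) (V := V) (p := p) u hu hl)
  rw [h] at hη
  exact fiberHerm_nondegenerate (twistEquiv p u hu hl) (formHerm (E := E) x)
    (formHerm_surjective (E := E)) hη

end InducedHermitian

section ComplexBundle

variable {F : Type*} [NormedAddCommGroup F] [NormedSpace ℂ F] [FiniteDimensional ℂ F]
  {V : X → Type*} [TopologicalSpace (TotalSpace F V)]
  [∀ x, AddCommGroup (V x)] [∀ x, Module ℂ (V x)] [∀ x, Module ℝ (V x)]
  [∀ x, IsScalarTower ℝ ℂ (V x)]
  [∀ x, TopologicalSpace (V x)] [∀ x, IsTopologicalAddGroup (V x)]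
  [∀ x, ContinuousSMul ℝ (V x)] [FiberBundle F V] [VectorBundle ℂ F V]
  [ContMDiffVectorBundle ∞ F V 𝕀]
  {nabla : CovariantDerivative 𝕀 F V} {s t : Π y : X, V y} {x : X}
  {u v : 𝔛}

lemma SmoothNear.I_smul (h : SmoothNear E F s x) : SmoothNear E F (fun y => I • s y) x := by
  filter_upwards [h.eventually] with y hy
  have h1 := (contMDiffAt_section y).1 hy.contMDiffAt
  refine (contMDiffAt_section y).2 ?_
  have h2 : ContMDiffAt 𝕀 𝓘(ℝ, F) ∞
      (fun z => (I • ContinuousLinearMap.id ℝ F : F →L[ℝ] F)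
        ((trivializationAt F V y) ⟨z, s z⟩).2) y :=
    (ContinuousLinearMap.contMDiff _).contMDiffAt.comp y h1
  refine h2.congr_of_eventuallyEq ?_
  filter_upwards [(trivializationAt F V y).open_baseSet.mem_nhds
    (mem_baseSet_trivializationAt F V y)] with z hz
  exact (Trivialization.linear ℂ (trivializationAt F V y) hz).map_smul I (s z)

lemma complex_smul_eq (c : ℂ) (w : V x) : c • w = c.re • w + c.im • (I • w) := by
  conv_lhs => rw [← Complex.re_add_im c, add_smul, mul_smul]
  congr 1
  · exact (algebraMap_smul ℂ c.re w)
  · exact (algebraMap_smul ℂ c.im _)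

lemma SmoothNear.complex_smul {f : X → ℂ} (hf : FnNear E f x) (h : SmoothNear E F s x) :
    SmoothNear E F (fun y => f y • s y) x := by
  refine SmoothNear.congr ((SmoothNear.smul (hf.clm reCLM) h).add
    (SmoothNear.smul (hf.clm imCLM) h.I_smul)) ?_
  exact .of_forall fun y => complex_smul_eq (f y) (s y)

lemma smoothNear_of_smoothSectionOn {U : Set X} (h : SmoothSectionOn E F s U) (hU : IsOpen U)
    (hx : x ∈ U) : SmoothNear E F s x := smoothNear_of_contMDiffOn hU hx h

lemma smoothSectionOn_of_smoothNear {U : Set X} (h : ∀ y ∈ U, SmoothNear E F s y) :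
    SmoothSectionOn E F s U := contMDiffOn_of_smoothNear h

lemma FnNear.hermitian {h : ∀ x : X, V x → V x → ℂ} (hh : IsSmoothHermitianMetric E F h)
    (hs : SmoothNear E F s x) (ht : SmoothNear E F t x) :
    FnNear E (fun y => h y (s y) (t y)) x := by
  obtain ⟨U, hU, hxU, hUs⟩ := hs.exists_open
  obtain ⟨U', hU', hxU', hUt⟩ := ht.exists_open
  filter_upwards [(hU.inter hU').mem_nhds ⟨hxU, hxU'⟩] with y hy
  exact (hh (U ∩ U') s t (hU.inter hU') (smoothSectionOn_of_smoothNear fun z hz => hUs z hz.1)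
    (smoothSectionOn_of_smoothNear fun z hz => hUt z hz.2) y hy).contMDiffAt
    ((hU.inter hU').mem_nhds hy)

lemma IsComplexConnection.smoothConn (h : IsComplexConnection nabla) : SmoothConn nabla :=
  fun s v hs hv _ => smoothNear_of_smoothSectionOn (U := Set.univ)
    (h.smooth s v (smoothSectionOn_of_smoothNear fun y _ => hs y)
      (smoothFieldOn_of_smoothNear fun y _ => hv y)) isOpen_univ trivial

lemma IsComplexConnection.complex_smul (h : IsComplexConnection nabla) {f : X → ℂ}
    (hf : FnNear E f x) (hs : SmoothNear E F s x) (a : 𝕋 x) : nabla (fun y => f y • s y) x a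
      = f x • nabla s x a + (𝕕 f x a) • s x := by
  have h1 : (fun y => f y • s y) = fun y => reCLM (f y) • s y
      + imCLM (f y) • (I • s y) := funext fun y => complex_smul_eq (f y) (s y)
  have e1 := mvfderiv_clm reCLM hf.mdiff a
  have e2 := mvfderiv_clm imCLM hf.mdiff a
  rw [h1, conn_add nabla (SmoothNear.smul (hf.clm reCLM) hs)
    (SmoothNear.smul (hf.clm imCLM) hs.I_smul),
    conn_smul nabla (hf.clm reCLM) hs, conn_smul nabla (hf.clm imCLM) hs.I_smul,
    h.complex_linear s x hs.mdiff a, e1, e2, complex_smul_eq (f x) (nabla s x a),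
    complex_smul_eq (𝕕 f x a) (s x)]
  simp only [Complex.reCLM_apply, Complex.imCLM_apply]
  abel

lemma IsComplexConnection.I_smul (h : IsComplexConnection nabla)
    (hs : SmoothNear E F s x) (a : 𝕋 x) : nabla (fun y => I • s y) x a = I • nabla s x a :=
  h.complex_linear s x hs.mdiff a

lemma IsHermitianConnection.metric_near {H : ∀ x : X, V x → V x → ℂ}
    (h : IsHermitianConnection H nabla) (hs : SmoothNear E F s x) (ht : SmoothNear E F t x)
    (a : 𝕋 x) : 𝕕 (fun y => H y (s y) (t y)) x a
      = H x (nabla s x a) (t x) + H x (s x) (nabla t x a) := by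
  obtain ⟨s', hs', hss⟩ := hs.exists_global
  obtain ⟨t', ht', htt⟩ := ht.exists_global
  have h1 := h.metric s' t' (smoothSectionOn_of_smoothNear fun y _ => hs' y)
      (smoothSectionOn_of_smoothNear fun y _ => ht' y) x a
  rw [conn_congr nabla hs hss, conn_congr nabla ht htt, hss.self_of_nhds, htt.self_of_nhds] at h1
  rw [← h1]
  refine congrArg (fun B : 𝕋 x →L[ℝ] ℂ => B a) (mvfderiv_congr ?_)
  filter_upwards [hss, htt] with y h1 h2
  rw [h1, h2]

lemma curvTensor_I_smul (h : IsComplexConnection nabla) (a b : 𝕋 x)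
    (c : V x) : curvTensor nabla x a b (I • c) = I • curvTensor nabla x a b c := by
  have hn := h.smoothConn
  obtain ⟨u, hu, rfl⟩ := exists_field a
  obtain ⟨v, hv, rfl⟩ := exists_field b
  obtain ⟨s, hs, rfl⟩ := exists_smoothNear (E := E) (F := F) c
  refine (curvTensor_eq hn hu hv hs.I_smul).trans ?_
  rw [curvTensor_eq hn hu hv hs]
  have key : ∀ {v : 𝔛}, SmoothNear E E v x →
      ∀ a : 𝕋 x, nabla (fun y => nabla (fun z => I • s z) y (v y)) x a
        = I • nabla (fun y => nabla s y (v y)) x a := by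
    intro v hv a
    rw [← h.I_smul (hn.near hs hv)]
    refine congrArg (fun B : 𝕋 x →L[ℝ] V x => B a)
      (conn_congr nabla (hn.near hs hv).I_smul ?_)
    filter_upwards [hs.eventually] with y hy using h.I_smul hy _
  simp only [curvExpr]
  rw [key hu, key hv, h.I_smul hs, smul_sub, smul_sub]

/-- The curvature of a complex connection as a complex linear map. -/
def curvEnd (h : IsComplexConnection nabla) (x : X) (a b : 𝕋 x) :
    V x →ₗ[ℂ] V x where
  toFun := curvTensor nabla x a b
  map_add' c c' := curvTensor_add_section a b c c' h.smoothConn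
  map_smul' z c := by
    rw [complex_smul_eq z c, curvTensor_add_section _ _ _ _ h.smoothConn,
      curvTensor_smul_section _ _ _ h.smoothConn, curvTensor_smul_section _ _ _ h.smoothConn,
      curvTensor_I_smul h, RingHom.id_apply, ← complex_smul_eq]

lemma curvature_apply (h : IsComplexConnection nabla) (a b : 𝕋 x) (c : V x) :
    curvature nabla x a b c = curvTensor nabla x a b c := by
  have h1 : IsCurvature nabla (curvEnd h) := by
    intro U u v s hU hu hv hs x hx
    exact curvTensor_eq h.smoothConn (smoothNear_of_smoothFieldOn hu hU hx)
      (smoothNear_of_smoothFieldOn hv hU hx) (smoothNear_of_smoothSectionOn hs hU hx)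
  have h2 : IsCurvature nabla (curvature nabla) := Classical.epsilon_spec ⟨_, h1⟩
  obtain ⟨u, hu, rfl⟩ := exists_field a
  obtain ⟨v, hv, rfl⟩ := exists_field b
  obtain ⟨s, hs, rfl⟩ := exists_smoothNear (E := E) (F := F) c
  obtain ⟨u', hu', huu⟩ := hu.exists_global
  obtain ⟨v', hv', hvv⟩ := hv.exists_global
  obtain ⟨s', hs', hss⟩ := hs.exists_global
  rw [← huu.self_of_nhds, ← hvv.self_of_nhds, ← hss.self_of_nhds,
    curvTensor_eq h.smoothConn (hu' x) (hv' x) (hs' x)]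
  exact h2 Set.univ u' v' s' isOpen_univ (smoothFieldOn_of_smoothNear fun y _ => hu' y)
    (smoothFieldOn_of_smoothNear fun y _ => hv' y) (smoothSectionOn_of_smoothNear fun y _ => hs' y)
    x trivial

variable {θu θv : X → ℂ}

lemma nabla_nabla_of_eq_smul (hn : IsComplexConnection nabla) (hs : SmoothNear E F s x)
    (hθ : FnNear E θv x) (h : ∀ᶠ y in 𝓝 x, nabla s y (v y) = θv y • s y) (a : 𝕋 x) :
    nabla (fun y => nabla s y (v y)) x a = θv x • nabla s x a + (𝕕 θv x a) • s x := by
  rw [conn_congr nabla (SmoothNear.complex_smul hθ hs) h, hn.complex_smul hθ hs]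

/-- The curvature of a section spanning a parallel line, in terms of the connection form. -/
lemma curvTensor_of_eq_smul (hn : IsComplexConnection nabla) (hs : SmoothNear E F s x)
    (hu : SmoothNear E E u x) (hv : SmoothNear E E v x) (hθu : FnNear E θu x) (hθv : FnNear E θv x)
    (h1 : ∀ᶠ y in 𝓝 x, nabla s y (u y) = θu y • s y)
    (h2 : ∀ᶠ y in 𝓝 x, nabla s y (v y) = θv y • s y) {c : ℂ}
    (h3 : nabla s x (mlieBracket 𝕀 u v x) = c • s x) : curvTensor nabla x (u x) (v x) (s x)
      = (𝕕 θv x (u x) - 𝕕 θu x (v x) - c) • s x := by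
  rw [curvTensor_eq hn.smoothConn hu hv hs, curvExpr, nabla_nabla_of_eq_smul hn hs hθv h2,
    nabla_nabla_of_eq_smul hn hs hθu h1, h3, h1.self_of_nhds, h2.self_of_nhds]
  module

end ComplexBundle

lemma trace_adjugate_mul_eq_sum_det_updateCol {m R : Type*} [Fintype m] [DecidableEq m]
    [CommRing R] (M B : Matrix m m R) :
    (M.adjugate * B).trace = ∑ j, (M.updateCol j (fun i => B i j)).det := by
  rw [Matrix.trace]
  refine sum_congr rfl fun j _ => ?_
  rw [← Matrix.cramer_apply, Matrix.cramer_eq_adjugate_mulVec]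
  rfl

lemma trace_adjugate_mul_eq_sum_det_updateRow {m R : Type*} [Fintype m] [DecidableEq m]
    [CommRing R] (M B : Matrix m m R) :
    (M.adjugate * B).trace = ∑ j, (M.updateRow j (B j)).det := by
  rw [← Matrix.trace_transpose, Matrix.transpose_mul, Matrix.trace_mul_comm,
    Matrix.adjugate_transpose, trace_adjugate_mul_eq_sum_det_updateCol]
  refine sum_congr rfl fun j _ => ?_
  rw [← Matrix.det_transpose, Matrix.updateCol_transpose]
  rfl

section PureForm

variable {x : X} {p q : ℕ} {L V : X → Type*}
  [∀ x, AddCommGroup (L x)] [∀ x, Module ℂ (L x)] [∀ x, AddCommGroup (V x)] [∀ x, Module ℂ (V x)]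

/-- The element `α_1 ∧ ⋯ ∧ α_q ⊗ l_1 ⊗ ⋯ ⊗ l_p ⊗ e` of a fiber. -/
def pureForm (α : Fin q → T01Dual E x) (l : Fin p → L x) (e : V x) : 𝔽 x :=
  ιMulti ℂ q α ⊗ₜ[ℂ] (tprod ℂ l ⊗ₜ[ℂ] e)

variable (α : Fin q → T01Dual E x) (l : Fin p → L x) (e : V x)

lemma wedge_pureForm (β : T01Dual E x) :
    wedge β (pureForm α l e) = pureForm (Fin.cons β α : Fin (q + 1) → T01Dual E x) l e := by
  rw [pureForm, wedge_tmul, pureForm, ExteriorAlgebra.ιMulti_succ_apply]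
  rfl

lemma pureForm_smul (c : ℂ) : pureForm α l (c • e) = c • pureForm α l e := by
  rw [pureForm, pureForm, TensorProduct.tmul_smul, TensorProduct.tmul_smul]

lemma pureForm_add (e' : V x) : pureForm α l (e + e') = pureForm α l e + pureForm α l e' := by
  rw [pureForm, pureForm, pureForm, TensorProduct.tmul_add, TensorProduct.tmul_add]

lemma pureForm_update_add (i : Fin q) (β β' : T01Dual E x) :
    pureForm (Function.update α i (β + β')) l e
      = pureForm (Function.update α i β) l e + pureForm (Function.update α i β') l e := by
  rw [pureForm, AlternatingMap.map_update_add, TensorProduct.add_tmul]; rfl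

lemma pureForm_update_smul (i : Fin q) (c : ℂ) (β : T01Dual E x) :
    pureForm (Function.update α i (c • β)) l e = c • pureForm (Function.update α i β) l e := by
  rw [pureForm, AlternatingMap.map_update_smul, ← TensorProduct.smul_tmul']; rfl

lemma pureForm_updateLine_add (i : Fin p) (m m' : L x) : pureForm α (Function.update l i (m + m')) e
      = pureForm α (Function.update l i m) e + pureForm α (Function.update l i m') e := by
  rw [pureForm, MultilinearMap.map_update_add, TensorProduct.add_tmul, TensorProduct.tmul_add]; rfl

lemma pureForm_updateLine_smul (i : Fin p) (c : ℂ) (m : L x) :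
    pureForm α (Function.update l i (c • m)) e = c • pureForm α (Function.update l i m) e := by
  rw [pureForm, MultilinearMap.map_update_smul, ← TensorProduct.smul_tmul',
    TensorProduct.tmul_smul]; rfl

lemma contr_pureForm (v : 𝕋 x) (α : Fin (q + 1) → T01Dual E x) :
    contr v (pureForm α l e) = ∑ j : Fin (q + 1), pureForm (fun i => α (j.succAbove i)) l
        (((-1 : ℂ) ^ (j : ℕ) * (α j : 𝕋 x →L[ℝ] ℂ) v) • e) := by
  rw [contr, pureForm, interiorMul_tmul, extContract_ιMulti, TensorProduct.sum_tmul]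
  refine sum_congr rfl fun j _ => ?_
  rw [pureForm_smul, evalDual_half, ← TensorProduct.smul_tmul']
  rfl

lemma contr_pureForm_zero (v : 𝕋 x) (α : Fin 0 → T01Dual E x) : contr v (pureForm α l e) = 0 := by
  rw [contr, pureForm, interiorMul_tmul, ExteriorAlgebra.ιMulti_zero_apply, extContract_one,
    TensorProduct.zero_tmul]

lemma actEnd_pureForm (A : V x →ₗ[ℂ] V x) : actEnd A (pureForm α l e) = pureForm α l (A e) := rfl

lemma pureForm_induction {P : 𝔽 x → Prop}
    (h : ∀ q (α : Fin q → T01Dual E x) (l : Fin p → L x) (e : V x), P (pureForm α l e))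
    (hadd : ∀ ξ η, P ξ → P η → P (ξ + η)) (hzero : P 0) (ξ : 𝔽 x) : P ξ :=
  fiber_induction h hadd hzero ξ

lemma Decomposable.val_eq (c : 𝔻) (x : X) :
    c.val x = pureForm (fun i => c.form i x) (fun i => c.line i x) (c.vec x) := rfl

end PureForm

section PureFormHermitian

variable {x : X} {p q : ℕ} {L V : X → Type*}
  [∀ x, NormedAddCommGroup (L x)] [∀ x, InnerProductSpace ℂ (L x)]
  [∀ x, NormedAddCommGroup (V x)] [∀ x, InnerProductSpace ℂ (V x)]

lemma inducedHermitian_pureForm [FiniteDimensional ℂ (V x)]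
    (hL : finrank ℂ (L x) = 1) (α β : Fin q → T01Dual E x) (l m : Fin p → L x) (e f : V x) :
    inducedHermitian x (pureForm α l e) (pureForm β m f)
      = (Matrix.of fun i j => formMetric (α i) (β j)).det * (∏ i, inner ℂ (l i) (m i))
        * inner ℂ e f := (inducedHermitian_spec hL).1 q α β l m e f

lemma inducedHermitian_pureForm_of_ne [FiniteDimensional ℂ (V x)] {q' : ℕ} (hq : q ≠ q')
    (hL : finrank ℂ (L x) = 1) (α : Fin q → T01Dual E x) (β : Fin q' → T01Dual E x)
    (l m : Fin p → L x) (e f : V x) : inducedHermitian x (pureForm α l e) (pureForm β m f) = 0 :=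
  (inducedHermitian_spec hL).2 q q' α β _ _ hq

variable [FiniteDimensional ℂ (V x)] (hL : finrank ℂ (L x) = 1)
  (α β : Fin q → T01Dual E x) (l m : Fin p → L x) (e f : V x)

include hL

lemma sum_inducedHermitian_update_left (γ : Fin q → T01Dual E x) :
    ∑ i, inducedHermitian x (pureForm (Function.update α i (γ i)) l e) (pureForm β m f)
      = ((Matrix.of fun i j => formMetric (α i) (β j)).adjugate
          * Matrix.of fun i j => formMetric (γ i) (β j)).trace
        * (∏ i, inner ℂ (l i) (m i)) * inner ℂ e f := by
  rw [trace_adjugate_mul_eq_sum_det_updateRow, sum_mul, sum_mul]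
  refine sum_congr rfl fun i _ => ?_
  rw [inducedHermitian_pureForm hL]
  congr 3
  ext a b
  by_cases h : a = i
  · subst h; simp [Matrix.updateRow_apply]
  · simp [Matrix.updateRow_apply, h]

lemma sum_inducedHermitian_update_right (γ : Fin q → T01Dual E x) :
    ∑ i, inducedHermitian x (pureForm α l e) (pureForm (Function.update β i (γ i)) m f)
      = ((Matrix.of fun i j => formMetric (α i) (β j)).adjugate
          * Matrix.of fun i j => formMetric (α i) (γ j)).trace
        * (∏ i, inner ℂ (l i) (m i)) * inner ℂ e f := by
  rw [trace_adjugate_mul_eq_sum_det_updateCol, sum_mul, sum_mul]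
  refine sum_congr rfl fun i _ => ?_
  rw [inducedHermitian_pureForm hL]
  congr 3
  ext a b
  by_cases h : b = i
  · subst h; simp
  · simp [h]

lemma sum_inducedHermitian_updateLine_left (k : Fin p → L x) :
    ∑ i, inducedHermitian x (pureForm α (Function.update l i (k i)) e) (pureForm β m f)
      = (Matrix.of fun i j => formMetric (α i) (β j)).det
        * (∑ i, inner ℂ (k i) (m i) * ∏ j ∈ Finset.univ.erase i, inner ℂ (l j) (m j))
        * inner ℂ e f := by
  rw [mul_sum, sum_mul]
  refine sum_congr rfl fun i _ => ?_
  rw [inducedHermitian_pureForm hL, ← Finset.mul_prod_erase _ _ (Finset.mem_univ i),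
    Function.update_self]
  congr 3
  refine Finset.prod_congr rfl fun j hj => ?_
  rw [Function.update_of_ne (Finset.ne_of_mem_erase hj)]

lemma sum_inducedHermitian_updateLine_right (k : Fin p → L x) :
    ∑ i, inducedHermitian x (pureForm α l e) (pureForm β (Function.update m i (k i)) f)
      = (Matrix.of fun i j => formMetric (α i) (β j)).det
        * (∑ i, inner ℂ (l i) (k i) * ∏ j ∈ Finset.univ.erase i, inner ℂ (l j) (m j))
        * inner ℂ e f := by
  rw [mul_sum, sum_mul]
  refine sum_congr rfl fun i _ => ?_
  rw [inducedHermitian_pureForm hL, ← Finset.mul_prod_erase _ _ (Finset.mem_univ i),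
    Function.update_self]
  congr 3
  refine Finset.prod_congr rfl fun j hj => ?_
  rw [Function.update_of_ne (Finset.ne_of_mem_erase hj)]

end PureFormHermitian

lemma contDiff_det {n : WithTop ℕ∞} : ContDiff ℂ n (fun A : E →L[ℂ] E => A.det) := by
  have h : (fun A : E →L[ℂ] E => A.det) = fun A => (Matrix.of fun i j =>
      LinearMap.toContinuousLinearMap ((finBasis ℂ E).coord i)
        (A (finBasis ℂ E j))).det := by
    funext A
    rw [ContinuousLinearMap.det, ← LinearMap.det_toMatrix (finBasis ℂ E)]
    congr 1
    ext i j
    rw [LinearMap.toMatrix_apply]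
    rfl
  rw [h]
  simp only [Matrix.det_apply, Matrix.of_apply]
  fun_prop

local instance isContMDiff_detCore : (detCore E X).IsContMDiff 𝓘(ℂ, E) ω where
  contMDiffOn_coordChange i j := by
    have : (tangentBundleCore 𝓘(ℂ, E) X).IsContMDiff 𝓘(ℂ, E) ω :=
      tangentBundleCore.isContMDiff (n := ω) (h := by simpa)
    have h := (tangentBundleCore 𝓘(ℂ, E) X).contMDiffOn_coordChange (n := ω) 𝓘(ℂ, E) i j
    have h1 : ContMDiffOn 𝓘(ℂ, E) 𝓘(ℂ, ℂ) ω
        (fun y => ((tangentBundleCore 𝓘(ℂ, E) X).coordChange i j y).det)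
        ((tangentBundleCore 𝓘(ℂ, E) X).baseSet i ∩ (tangentBundleCore 𝓘(ℂ, E) X).baseSet j) :=
      contDiff_det.contMDiff.comp_contMDiffOn h
    exact h1.smul contMDiffOn_const

local instance detFiberIsScalarTower (x : X) : IsScalarTower ℝ ℂ ((detCore E X).Fiber x) :=
  inferInstanceAs (IsScalarTower ℝ ℂ ℂ)

section DetBundle

variable {x y : X}

variable (E) in
/-- The section `∂_1 ∧ ⋯ ∧ ∂_n` of `det T^{(1,0)}X` for the coordinates of the chart at `x`. -/
def detSection (x y : X) : (detCore E X).Fiber y :=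
  (trivializationAt ℂ (detCore E X).Fiber x).symm y 1

lemma detSection_eq (hy : y ∈ 𝕌 x) : (detSection E x y : ℂ)
      = ((tangentBundleCore 𝓘(ℂ, E) X).coordChange (achart E x) (achart E y) y).det := by
  refine ((detCore E X).localTriv_symm_apply (i := achart E x) hy (1 : ℂ)).trans ?_
  exact mul_one (M := ℂ) _

lemma detSection_holomorphic : HolomorphicSectionOn E ℂ (detSection E x) 𝕌 x := by
  set e := trivializationAt ℂ (detCore E X).Fiber x
  have h : ContMDiffOn 𝓘(ℂ, E) (𝓘(ℂ, E).prod 𝓘(ℂ, ℂ)) ω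
      (fun y => TotalSpace.mk' ℂ y (detSection E x y)) e.baseSet := by
    rw [e.contMDiffOn_section_baseSet_iff]
    refine (contMDiffOn_const (c := (1 : ℂ))).congr fun y hy => ?_
    exact e.apply_mk_symm hy 1 ▸ rfl
  exact h.mdifferentiableOn (by simp)

lemma detSection_smoothNear (hy : y ∈ 𝕌 x) : SmoothNear E ℂ (detSection E x) y := by
  set e := trivializationAt ℂ (detCore E X).Fiber x
  have h : ContMDiffOn 𝕀 ((𝕀).prod 𝓘(ℝ, ℂ)) ∞
      (fun y => TotalSpace.mk' ℂ y (detSection E x y)) e.baseSet := by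
    have := isLinear_real (F := ℂ) (V := (detCore E X).Fiber) e
    rw [e.contMDiffOn_section_baseSet_iff]
    refine (contMDiffOn_const (c := (1 : ℂ))).congr fun y hy => ?_
    exact e.apply_mk_symm hy 1 ▸ rfl
  exact smoothNear_of_contMDiffOn e.open_baseSet hy h

end DetBundle

section Christoffel

variable {x y : X}

variable (E) in
/-- The components of a tangent vector at `y` in the chart at `x`. -/
def coordRep (x y : X) : 𝕋 y →L[ℝ] E :=
  (trivializationAt E (𝕋) x).continuousLinearMapAt ℝ y

lemma coordField_coordRep (hy : y ∈ 𝕌 x) (v : 𝕋 y) : coordField x (coordRep E x y v) y = v :=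
  Trivialization.symmL_continuousLinearMapAt _ (mem_tangent_baseSet hy) v

lemma coordRep_coordField (hy : y ∈ 𝕌 x) (w : E) : coordRep E x y (coordField x w y) = w :=
  Trivialization.continuousLinearMapAt_symmL _ (mem_tangent_baseSet hy) w

lemma coordRep_J (hy : y ∈ 𝕌 x) (v : 𝕋 y) : coordRep E x y (J E y v) = I • coordRep E x y v := by
  conv_lhs => rw [← coordField_coordRep hy v, J_coordField hy, coordRep_coordField hy]

lemma coordField_sum {ι : Type*} (S : Finset ι) (w : ι → E) :
    coordField x (∑ i ∈ S, w i) y = ∑ i ∈ S, coordField x (w i) y :=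
  map_sum _ _ _

lemma SmoothNear.coordRep {v : 𝔛} (hv : SmoothNear E E v x) :
    FnNear E (fun y => SpinDirac.coordRep E x y (v y)) x := by
  obtain ⟨c, hc, h⟩ := exists_coordField_expansion (mem_chart_source E x) (finBasis ℝ E) hv
  refine (FnNear.sum (S := Finset.univ) (g := fun i y => c i y • finBasis ℝ E i)
    fun i _ => (hc i).smul (FnNear.const _)).congr ?_
  filter_upwards [h, (chartAt E x).open_source.mem_nhds (mem_chart_source E x)] with y hy hyx
  rw [hy, map_sum]
  exact sum_congr rfl fun i _ => by rw [map_smul, coordRep_coordField hyx]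

lemma coordField_eq_sum (f : E) :
    coordField x f y = ∑ i, (finBasis ℝ E).repr f i • coordField x (finBasis ℝ E i) y := by
  conv_lhs => rw [← (finBasis ℝ E).sum_repr f]
  rw [coordField_sum]
  exact sum_congr rfl fun i _ => coordField_smul _ _

variable (nablaT) in
/-- The Christoffel symbols of the chart at `x`. -/
def christoffel (x : X) (c w : E) (y : X) : E :=
  coordRep E x y (nablaT (coordField x w) y (coordField x c y))

lemma nabla_coordField (hy : y ∈ 𝕌 x) (c w : E) :
    nablaT (coordField x w) y (coordField x c y) = coordField x (christoffel nablaT x c w y) y :=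
  (coordField_coordRep hy _).symm

lemma christoffel_fnNear (h : IsLeviCivita nablaT) (c w : E) :
    FnNear E (christoffel nablaT x c w) x :=
  SmoothNear.coordRep (h.smoothConn.near (coordField_smoothNear_self w)
    (coordField_smoothNear_self c))

lemma christoffel_symm (h : IsLeviCivita nablaT) (hy : y ∈ 𝕌 x) (c w : E) :
    christoffel nablaT x c w y = christoffel nablaT x w c y :=
  congrArg _ (h.coordField_symm hy w c)

/-- The Christoffel symbols as endomorphisms: the connection commutes with `J`. -/
def christoffelHom (hX : IsKahlerMetric E X) (h : IsLeviCivita nablaT)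
    (hy : y ∈ 𝕌 x) (c : E) : E →ₗ[ℂ] E where
  toFun w := christoffel nablaT x c w y
  map_add' w w' := by
    have h1 := conn_add nablaT (coordField_smoothNear hy w) (coordField_smoothNear hy w')
      (coordField x c y)
    have h2 : coordField x (w + w') = fun y => coordField x w y + coordField x w' y :=
      funext fun y => coordField_add w w'
    unfold christoffel
    rw [h2]
    exact (congrArg _ h1).trans (map_add _ _ _)
  map_smul' z w := by
    have hJ : ∀ᶠ y' in 𝓝 y, coordField x (I • w) y' = J E y' (coordField x w y') := by
      filter_upwards [(chartAt E x).open_source.mem_nhds hy] with y' hy'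
      exact (J_coordField hy' w).symm
    have h1 := conn_add nablaT ((coordField_smoothNear hy w).const_smul z.re)
      ((coordField_smoothNear hy w).J.const_smul z.im) (coordField x c y)
    rw [conn_const_smul nablaT _ (coordField_smoothNear hy w),
      conn_const_smul nablaT _ (coordField_smoothNear hy w).J,
      hX.nabla_J h (coordField_smoothNear hy w)] at h1
    have h2 : ∀ᶠ y' in 𝓝 y, coordField x (z • w) y'
        = z.re • coordField x w y' + z.im • J E y' (coordField x w y') := by
      filter_upwards [hJ] with y' hy'
      rw [← hy', ← coordField_smul, ← coordField_smul, ← coordField_add]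
      exact congrArg (fun w => coordField x w y') (complex_smul_eq (V := fun _ : X => E) (x := y) z w)
    have h3 := conn_congr nablaT (((coordField_smoothNear hy w).const_smul z.re).add
      ((coordField_smoothNear hy w).J.const_smul z.im)) h2
    unfold christoffel
    rw [h3, h1, map_add, map_smul, map_smul, coordRep_J hy, RingHom.id_apply,
      complex_smul_eq (V := fun _ : X => E) (x := y) z]

lemma christoffel_I (hX : IsKahlerMetric E X) (h : IsLeviCivita nablaT) (hy : y ∈ 𝕌 x) (c w : E) :
    christoffel nablaT x (I • c) w y = I • christoffel nablaT x c w y := by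
  rw [christoffel_symm h hy, christoffel_symm h hy c]
  exact map_smul (christoffelHom hX h hy w) I c

lemma nabla_coordField_fun (hX : IsKahlerMetric E X) (h : IsLeviCivita nablaT) {f : X → E}
    (hy : y ∈ 𝕌 x) (hf : FnNear E f y) (a : E) :
    nablaT (fun z => coordField x (f z) z) y (coordField x a y)
      = coordField x (𝕕 f y (coordField x a y) + christoffel nablaT x a (f y) y) y := by
  set β := finBasis ℝ E
  let r : Fin (finrank ℝ E) → E →L[ℝ] ℝ := fun i => LinearMap.toContinuousLinearMap (β.coord i)
  have hr : ∀ i, FnNear E (fun y => r i (f y)) y := fun i => hf.clm (r i)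
  have h1 : (fun y => coordField x (f y) y) = fun y => ∑ i, r i (f y) • coordField x (β i) y :=
    funext fun y => coordField_eq_sum (f y)
  rw [h1, conn_sum nablaT _ fun i _ => (coordField_smoothNear hy (β i)).smul (hr i)]
  have h2 : ∀ i, nablaT (fun y => r i (f y) • coordField x (β i) y) y (coordField x a y)
      = coordField x (r i (f y) • christoffel nablaT x a (β i) y
        + r i (𝕕 f y (coordField x a y)) • β i) y := by
    intro i
    rw [conn_smul nablaT (hr i) (coordField_smoothNear hy (β i)), mvfderiv_clm (r i) hf.mdiff,
      nabla_coordField hy, coordField_add, coordField_smul, coordField_smul]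
  rw [sum_congr rfl fun i _ => h2 i, ← coordField_sum, sum_add_distrib, add_comm]
  congr 2
  · exact β.sum_repr _
  · have h4 := congrArg (christoffelHom hX h hy a) (β.sum_repr (f y))
    rw [map_sum] at h4
    refine (sum_congr rfl fun i _ => ?_).trans h4
    exact (LinearMap.map_smul_of_tower (christoffelHom hX h hy a) _ _).symm

lemma curvTensor_christoffel (hX : IsKahlerMetric E X) (h : IsLeviCivita nablaT) (a b c : E) :
    coordRep E x x (curvTensor nablaT x (coordField x a x) (coordField x b x) (coordField x c x))
      = (𝕕 (christoffel nablaT x b c) x (coordField x a x)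
          + christoffel nablaT x a (christoffel nablaT x b c x) x)
        - (𝕕 (christoffel nablaT x a c) x (coordField x b x)
          + christoffel nablaT x b (christoffel nablaT x a c x) x) := by
  have hx := mem_chart_source E x
  have h1 : ∀ a b : E, nablaT (fun y => nablaT (coordField x c) y (coordField x b y)) x
      (coordField x a x)
      = coordField x (𝕕 (christoffel nablaT x b c) x (coordField x a x)
        + christoffel nablaT x a (christoffel nablaT x b c x) x) x := by
    intro a b
    rw [← nabla_coordField_fun hX h hx (christoffel_fnNear h b c)]
    refine congrArg (fun B : 𝕋 x →L[ℝ] 𝕋 x =>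
      B (coordField x a x)) ?_
    refine (conn_congr nablaT (h.smoothConn.near (coordField_smoothNear_self c)
      (coordField_smoothNear_self b)) ?_).symm
    filter_upwards [(chartAt E x).open_source.mem_nhds hx] with y hy
    exact (nabla_coordField hy b c).symm
  have := FiniteDimensional.complete ℝ E
  rw [curvTensor_eq h.smoothConn (coordField_smoothNear_self a) (coordField_smoothNear_self b)
    (coordField_smoothNear_self c), curvExpr, h1, h1, mlieBracket_coordField hx, map_zero, sub_zero,
    map_sub, coordRep_coordField hx, coordRep_coordField hx]

variable (E) in
/-- The coordinates of the model space as real linear maps. -/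
def basisCoord (i : Fin (finrank ℂ E)) : E →L[ℝ] ℂ :=
  (LinearMap.toContinuousLinearMap ((finBasis ℂ E).coord i)).restrictScalars ℝ

lemma basisCoord_apply (i : Fin (finrank ℂ E)) (w : E) :
    basisCoord E i w = (finBasis ℂ E).repr w i := rfl

lemma trace_eq_sum_coord (A : E →ₗ[ℂ] E) :
    trace ℂ E A = ∑ i, basisCoord E i (A (finBasis ℂ E i)) := by
  rw [LinearMap.trace_eq_matrix_trace ℂ (finBasis ℂ E), Matrix.trace]
  simp [LinearMap.toMatrix_apply, basisCoord_apply]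

variable (nablaT) in
/-- The trace of the Christoffel symbols. -/
def christoffelTrace (x : X) (c : E) (y : X) : ℂ :=
  ∑ i, basisCoord E i (christoffel nablaT x c (finBasis ℂ E i) y)

lemma christoffelTrace_fnNear (h : IsLeviCivita nablaT) (c : E) :
    FnNear E (christoffelTrace nablaT x c) x :=
  FnNear.sum fun i _ => (christoffel_fnNear h c _).clm (basisCoord E i)

lemma mvfderiv_christoffelTrace (h : IsLeviCivita nablaT) (b : E) (v : 𝕋 x) :
    𝕕 (christoffelTrace nablaT x b) x v = ∑ i, basisCoord E i (𝕕
      (christoffel nablaT x b (finBasis ℂ E i)) x v) := by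
  refine (mvfderiv_sum_apply Finset.univ
    (g := fun i y => basisCoord E i (christoffel nablaT x b (finBasis ℂ E i) y))
    (fun i _ => ((christoffel_fnNear h b _).clm (basisCoord E i)).mdiff) _).trans ?_
  exact sum_congr rfl fun i _ =>
    mvfderiv_clm (basisCoord E i) (christoffel_fnNear h b _).mdiff _

lemma sum_christoffel_comm (hX : IsKahlerMetric E X) (h : IsLeviCivita nablaT)
    (hy : y ∈ 𝕌 x) (a b : E) : ∑ i, basisCoord E i (christoffel nablaT x a
        (christoffel nablaT x b (finBasis ℂ E i) y) y) = ∑ i, basisCoord E i (christoffel nablaT x b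
        (christoffel nablaT x a (finBasis ℂ E i) y) y) := by
  have hc := LinearMap.trace_mul_comm ℂ (christoffelHom hX h hy a) (christoffelHom hX h hy b)
  rw [trace_eq_sum_coord, trace_eq_sum_coord] at hc
  exact hc

lemma sum_coord_curvTensor (hX : IsKahlerMetric E X) (h : IsLeviCivita nablaT) (a b : E) :
    ∑ i, basisCoord E i (coordRep E x x (curvTensor nablaT x (coordField x a x)
        (coordField x b x) (coordField x (finBasis ℂ E i) x)))
      = 𝕕 (christoffelTrace nablaT x b) x (coordField x a x)
        - 𝕕 (christoffelTrace nablaT x a) x (coordField x b x) := by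
  rw [mvfderiv_christoffelTrace h, mvfderiv_christoffelTrace h]
  simp only [curvTensor_christoffel hX h, map_sub, map_add, sum_sub_distrib, sum_add_distrib]
  rw [sum_christoffel_comm hX h (mem_chart_source E x) a b]
  ring

end Christoffel

section Sesquilinear

variable {W ι : Type*} [AddCommGroup W] [Module ℂ W] [Fintype ι] [DecidableEq ι]
  (β : Module.Basis ι ℂ W) (S : W →ₗ[ℂ] W →ₗ⋆[ℂ] ℂ) (A : W →ₗ[ℂ] W)

/-- The Gram matrix of a sesquilinear form. -/
def gram : Matrix ι ι ℂ := Matrix.of fun i j => S (β i) (β j)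

lemma gram_apply_left :
    (Matrix.of fun i j => S (A (β i)) (β j)) = (LinearMap.toMatrix β β A).transpose * gram β S := by
  ext i j
  rw [Matrix.mul_apply, Matrix.of_apply]
  refine (congrArg (fun w => S w (β j)) (β.sum_repr (A (β i)))).symm.trans ?_
  simp only [gram, LinearMap.toMatrix_apply, map_sum, map_smul, LinearMap.sum_apply,
    LinearMap.smul_apply, Matrix.transpose_apply, Matrix.of_apply, smul_eq_mul]

lemma gram_apply_right : (Matrix.of fun i j => S (β i) (A (β j)))
      = gram β S * (LinearMap.toMatrix β β A).map (starRingEnd ℂ) := by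
  ext i j
  rw [Matrix.mul_apply, Matrix.of_apply]
  refine (congrArg (S (β i)) (β.sum_repr (A (β j)))).symm.trans ?_
  simp only [gram, LinearMap.toMatrix_apply, map_sum, LinearMap.map_smulₛₗ, Matrix.map_apply,
    Matrix.of_apply, smul_eq_mul, mul_comm]

lemma gram_apply_both : (Matrix.of fun i j => S (A (β i)) (A (β j)))
      = (LinearMap.toMatrix β β A).transpose * gram β S
        * (LinearMap.toMatrix β β A).map (starRingEnd ℂ) := by
  have h := gram_apply_right β (S.comp A) A
  refine h.trans (congrArg (· * _) ?_)
  exact gram_apply_left β S A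

lemma det_gram_apply : (Matrix.of fun i j => S (A (β i)) (A (β j))).det
      = conj (LinearMap.det A) * LinearMap.det A * (gram β S).det := by
  rw [gram_apply_both, Matrix.det_mul, Matrix.det_mul, Matrix.det_transpose, LinearMap.det_toMatrix]
  have h : ((LinearMap.toMatrix β β A).map (starRingEnd ℂ)).det = conj (LinearMap.det A) := by
    rw [← LinearMap.det_toMatrix β A]
    exact (RingHom.map_det (starRingEnd ℂ) _).symm
  rw [h]
  ring

lemma trace_adjugate_gram :
    ((gram β S).adjugate * Matrix.of fun i j => S (A (β i)) (β j) + S (β i) (A (β j))).trace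
      = (gram β S).det * (trace ℂ W A + conj (trace ℂ W A)) := by
  have h : (Matrix.of fun i j => S (A (β i)) (β j) + S (β i) (A (β j)))
      = (LinearMap.toMatrix β β A).transpose * gram β S
        + gram β S * (LinearMap.toMatrix β β A).map (starRingEnd ℂ) := by
    rw [← gram_apply_left, ← gram_apply_right]
    rfl
  have h2 : ((LinearMap.toMatrix β β A).map (starRingEnd ℂ)).trace
      = conj (trace ℂ W A) := by
    rw [LinearMap.trace_eq_matrix_trace ℂ β, Matrix.trace, Matrix.trace, map_sum]
    rfl
  rw [h, Matrix.mul_add, Matrix.trace_add, Matrix.trace_mul_comm, Matrix.mul_assoc,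
    Matrix.mul_adjugate, ← Matrix.mul_assoc, Matrix.adjugate_mul, Matrix.mul_smul,
    Matrix.mul_one, Matrix.smul_mul, Matrix.one_mul, Matrix.trace_smul, Matrix.trace_smul,
    Matrix.trace_transpose, h2, ← LinearMap.trace_eq_matrix_trace, smul_eq_mul, smul_eq_mul,
    mul_add]

lemma det_gram_ne_zero (h : ∀ w, S w w = 0 → w = 0) : (gram β S).det ≠ 0 := by
  intro h0
  obtain ⟨v, hv, hv0⟩ := Matrix.exists_mulVec_eq_zero_iff.2 h0
  set u := ∑ j, conj (v j) • β j with hu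
  have h1 : ∀ i, S (β i) u = 0 := by
    intro i
    have := congrFun hv0 i
    rw [hu, map_sum]
    simpa [Matrix.mulVec, dotProduct, gram, mul_comm] using this
  have h2 : S u u = 0 := by
    have h3 : S u u = ∑ j, conj (v j) • S (β j) u := by
      refine (congrArg (fun w => S w u) hu).trans ?_
      simp only [map_sum, map_smul, LinearMap.sum_apply, LinearMap.smul_apply]
    simp [h3, h1]
  refine hv (funext fun j => ?_)
  have h4 := congrArg (fun w => β.repr w j) ((h u h2).symm.trans hu)
  rw [β.repr_sum_self] at h4
  simpa using h4.symm

end Sesquilinear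

section DetMetric

variable {x y : X}

/-- The pairing of `u - i J u` and `v + i J v`, up to a factor. -/
def hermC (u v : 𝕋 x) : ℂ := (flat01 u : 𝕋 x →L[ℝ] ℂ) v

lemma hermC_eq (u v : 𝕋 x) : hermC u v = (1 / 2 : ℂ) * (((inner ℝ u v : ℝ) : ℂ)
      + I * ((inner ℝ u (J E x v) : ℝ) : ℂ)) := flat01_apply u v

lemma hermC_add_left (u u' v : 𝕋 x) : hermC (u + u') v = hermC u v + hermC u' v := by
  unfold hermC
  rw [map_add]
  rfl

lemma hermC_add_right (u v v' : 𝕋 x) : hermC u (v + v') = hermC u v + hermC u v' := map_add _ _ _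

lemma hermC_smul_left (r : ℝ) (u v : 𝕋 x) : hermC (r • u) v = (r : ℂ) * hermC u v := by
  unfold hermC
  rw [flat01_smul]
  rfl

lemma hermC_smul_right (r : ℝ) (u v : 𝕋 x) : hermC u (r • v) = (r : ℂ) * hermC u v := map_smul _ _ _

lemma hermC_J_right (u v : 𝕋 x) : hermC u (J E x v) = -I * hermC u v := (flat01 u).2 v

lemma hermC_J_left (hX : IsKahlerMetric E X) (u v : 𝕋 x) : hermC (J E x u) v = I * hermC u v := by
  unfold hermC
  rw [flat01_J (fun a b => hX.inner_J a b)]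
  rfl

lemma metricC_eq_hermC (hX : IsKahlerMetric E X) (u v : 𝕋 x) :
    metricC (⟨(1 / 2 : ℝ) • u, -((1 / 2 : ℝ) • J E x u)⟩ : ComplexTangent E x)
      (⟨(1 / 2 : ℝ) • v, -((1 / 2 : ℝ) • J E x v)⟩ : ComplexTangent E x).conjugate = hermC u v := by
  have h1 := hX.invariant x u v
  have h2 := hX.inner_J u v
  simp only [metricC, complexify₂, ComplexTangent.conjugate, inner_smul_left, inner_smul_right,
    inner_neg_left, inner_neg_right, neg_neg, hermC_eq, h1, h2, smul_eq_mul, RCLike.conj_to_real]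
  push_cast
  ring

lemma hermC_self_re (u : 𝕋 x) : (hermC u u).re = 1 / 2 * inner ℝ u u := by
  rw [hermC_eq, ← Complex.ofReal_one, ← Complex.ofReal_ofNat, ← Complex.ofReal_div,
    Complex.re_ofReal_mul, Complex.add_re, Complex.ofReal_re, Complex.re_mul_ofReal, Complex.I_re]
  ring

/-- The metric in the coordinates of the chart at `x`. -/
def coordHerm (hX : IsKahlerMetric E X) (hy : y ∈ 𝕌 x) : E →ₗ[ℂ] E →ₗ⋆[ℂ] ℂ :=
  LinearMap.mk₂'ₛₗ (RingHom.id ℂ) (starRingEnd ℂ)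
    (fun w w' => hermC (coordField x w y) (coordField x w' y))
    (fun w w' v => by rw [coordField_add, hermC_add_left])
    (fun z w v => by
      conv_lhs => rw [complex_smul_eq (V := fun _ : X => E) (x := y) z w]
      rw [coordField_add, coordField_smul, coordField_smul, ← J_coordField hy, hermC_add_left,
        hermC_smul_left, hermC_smul_left, hermC_J_left hX, RingHom.id_apply, smul_eq_mul]
      conv_rhs => rw [← Complex.re_add_im z]
      ring)
    (fun v w w' => by rw [coordField_add, hermC_add_right])
    (fun z v w => by
      conv_lhs => rw [complex_smul_eq (V := fun _ : X => E) (x := y) z w]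
      rw [coordField_add, coordField_smul, coordField_smul, ← J_coordField hy, hermC_add_right,
        hermC_smul_right, hermC_smul_right, hermC_J_right, smul_eq_mul]
      conv_rhs => rw [← Complex.re_add_im z]
      simp only [map_add, map_mul, Complex.conj_ofReal, Complex.conj_I]
      ring)

lemma coordHerm_apply (hX : IsKahlerMetric E X) (hy : y ∈ 𝕌 x) (w w' : E) :
    coordHerm hX hy w w' = hermC (coordField x w y) (coordField x w' y) := rfl

lemma coordHerm_definite (hX : IsKahlerMetric E X) (hy : y ∈ 𝕌 x) (w : E)
    (h : coordHerm hX hy w w = 0) : w = 0 := by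
  rw [coordHerm_apply, hermC_eq] at h
  have h1 := congrArg Complex.re h
  have h2 : coordField x w y = 0 := by
    have h3 := hermC_self_re (coordField x w y)
    rw [hermC_eq] at h3
    rw [← inner_self_eq_zero (𝕜 := ℝ)]
    rw [h3, Complex.zero_re] at h1
    linarith
  rw [← coordRep_coordField hy w, h2, map_zero]

lemma detMetric_eq (hX : IsKahlerMetric E X) (a b : (detCore E X).Fiber y) :
    detMetric y a b = conj (show ℂ from a) * (show ℂ from b)
      * (gram (finBasis ℂ E) (coordHerm hX (mem_chart_source E y))).det := by
  refine congrArg (fun M : Matrix _ _ ℂ => conj (show ℂ from a) * (show ℂ from b) * M.det) ?_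
  ext i j
  rw [gram, Matrix.of_apply, Matrix.of_apply, metricC_eq_hermC hX, coordHerm_apply, coordField_self, coordField_self, tangentBasis, tangentBasis]

lemma detMetric_detSection (hX : IsKahlerMetric E X) (hy : y ∈ 𝕌 x) :
    detMetric y (detSection E x y) (detSection E x y)
      = (gram (finBasis ℂ E) (coordHerm hX hy)).det := by
  set C := (tangentBundleCore 𝓘(ℂ, E) X).coordChange (achart E x) (achart E y) y
  have h1 := det_gram_apply (finBasis ℂ E) (coordHerm hX (mem_chart_source E y))
    (C : E →ₗ[ℂ] E)
  rw [detMetric_eq hX]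
  have h2 : gram (finBasis ℂ E) (coordHerm hX hy) = Matrix.of fun i j =>
      coordHerm hX (mem_chart_source E y) ((C : E →ₗ[ℂ] E) (finBasis ℂ E i))
        ((C : E →ₗ[ℂ] E) (finBasis ℂ E j)) := by
    unfold gram
    congr 1
    funext i j
    rw [coordHerm_apply, coordHerm_apply, coordField_self, coordField_self,
      coordField_eq_coordChange hy, coordField_eq_coordChange hy]
    rfl
  rw [h2, h1]
  have h3 := detSection_eq hy
  exact congrArg (fun z : ℂ => conj z * z * _) h3

end DetMetric

section DetCurvature

variable {x y : X} {u v : 𝔛}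
  {nablaDet : CovariantDerivative 𝕀 ℂ (detCore E X).Fiber}

lemma FnNear.hermC (hu : SmoothNear E E u x) (hv : SmoothNear E E v x) :
    FnNear E (fun y => SpinDirac.hermC (u y) (v y)) x :=
  (FormNear.flat01 hu).apply hv

lemma mvfderiv_hermC (hX : IsKahlerMetric E X) (h : IsLeviCivita nablaT)
    (hu : SmoothNear E E u x) (hv : SmoothNear E E v x) (a : 𝕋 x) :
    𝕕 (fun y => hermC (u y) (v y)) x a
      = hermC (nablaT u x a) (v x) + hermC (u x) (nablaT v x a) := by
  obtain ⟨v', hv', hvv⟩ := hv.exists_global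
  have h1 := (hX.isFormDerivative_iff h hu (.of_forall fun y => rfl) a _).2 rfl v'
    (smoothFieldOn_of_smoothNear fun y _ => hv' y)
  have h2 : 𝕕 (fun y => hermC (u y) (v' y)) x
      = 𝕕 (fun y => hermC (u y) (v y)) x :=
    mvfderiv_congr (by filter_upwards [hvv] with y hy; rw [hy])
  rw [conn_congr nablaT hv hvv, hvv.self_of_nhds] at h1
  exact (sub_eq_iff_eq_add.1 ((congrArg (fun B : 𝕋 x →L[ℝ] ℂ =>
    B a - hermC (u x) (nablaT v x a)) h2.symm).trans h1.symm))

lemma mvfderiv_gram (hX : IsKahlerMetric E X) (h : IsLeviCivita nablaT) (hy : y ∈ 𝕌 x) (c : E) :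
    𝕕 (fun z => detMetric z (detSection E x z) (detSection E x z)) y (coordField x c y)
      = detMetric y (detSection E x y) (detSection E x y)
        * (christoffelTrace nablaT x c y + conj (christoffelTrace nablaT x c y)) := by
  set β := finBasis ℂ E
  have h1 : ∀ᶠ z in 𝓝 y, detMetric z (detSection E x z) (detSection E x z)
      = (Matrix.of fun i j => hermC (coordField x (β i) z) (coordField x (β j) z)).det := by
    filter_upwards [(chartAt E x).open_source.mem_nhds hy] with z hz
    rw [detMetric_detSection hX hz]
    rfl
  have hs := fun i => coordField_smoothNear hy (β i)
  rw [mvfderiv_congr h1, (mvfderiv_det_apply (g := fun z => Matrix.of fun i j =>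
    hermC (coordField x (β i) z) (coordField x (β j) z)) (fun i j => FnNear.hermC (hs i) (hs j)) _).2,
    detMetric_detSection hX hy]
  have h2 := trace_adjugate_gram β (coordHerm hX hy) (christoffelHom hX h hy c)
  rw [trace_eq_sum_coord] at h2
  refine Eq.trans ?_ h2
  congr 3
  ext i j
  refine (mvfderiv_hermC hX h (hs i) (hs j) _).trans ?_
  rw [nabla_coordField hy, nabla_coordField hy]
  rfl

lemma nablaDet_detSection (hX : IsKahlerMetric E X) (h : IsLeviCivita nablaT)
    (hD : IsChernConnection detMetric nablaDet) (hy : y ∈ 𝕌 x) (c : E) :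
    nablaDet (detSection E x) y (coordField x c y)
      = christoffelTrace nablaT x c y • detSection E x y := by
  set G := detMetric y (detSection E x y) (detSection E x y) with hG
  have hG0 : G ≠ 0 := by
    rw [hG, detMetric_detSection hX hy]
    exact det_gram_ne_zero _ _ (coordHerm_definite hX hy)
  have hs0 : (detSection E x y : ℂ) ≠ 0 := by
    intro h0
    apply hG0
    rw [hG, detMetric_eq hX]
    refine mul_eq_zero_of_left (mul_eq_zero_of_right _ h0) _
  have hex : ∀ w : E, ∃ z : ℂ, nablaDet (detSection E x) y (coordField x w y)
      = z • detSection E x y := fun w =>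
    ⟨(show ℂ from nablaDet (detSection E x) y (coordField x w y))
        / (show ℂ from detSection E x y), (div_mul_cancel₀ (G₀ := ℂ) _ hs0).symm⟩
  choose z hz using hex
  have hre : ∀ w, (z w).re = (christoffelTrace nablaT x w y).re := by
    intro w
    have h1 := hD.toIsHermitianConnection.metric_near (detSection_smoothNear hy)
      (detSection_smoothNear hy) (coordField x w y)
    rw [mvfderiv_gram hX h hy, hz, detMetric_eq hX, detMetric_eq hX, detMetric_eq hX] at h1
    rw [detMetric_eq hX] at hG
    have h2 : G * (christoffelTrace nablaT x w y + conj (christoffelTrace nablaT x w y))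
        = G * (z w + conj (z w)) := by
      rw [hG]
      refine h1.trans ?_
      have e : ∀ (ζ σ D : ℂ), conj (ζ * σ) * σ * D + conj σ * (ζ * σ) * D
          = conj σ * σ * D * (ζ + conj ζ) := by
        intro ζ σ D
        rw [map_mul]
        ring
      exact e _ _ _
    have h3 := congrArg Complex.re (mul_left_cancel₀ hG0 h2)
    simp only [Complex.add_re, Complex.conj_re] at h3
    linarith
  have hI : z (I • c) = I * z c := by
    have h1 := hD.holomorphic _ _ (chartAt E x).open_source detSection_holomorphic y hy
      (coordField x c y)
    rw [J_coordField hy, hz, hz] at h1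
    have h2 : (z c + I * z (I • c)) * (show ℂ from detSection E x y) = 0 := by
      refine Eq.trans ?_ h1
      have e : ∀ (a b σ : ℂ), (a + I * b) * σ = a * σ + I * (b * σ) := by
        intro a b σ
        ring
      exact e _ _ _
    have h3 := (mul_eq_zero.1 h2).resolve_right hs0
    linear_combination (-I) * h3 + z (I • c) * I_sq
  have hI' : christoffelTrace nablaT x (I • c) y
      = I * christoffelTrace nablaT x c y := by
    unfold christoffelTrace
    rw [mul_sum]
    refine sum_congr rfl fun i _ => ?_
    rw [christoffel_I hX h hy, basisCoord_apply, basisCoord_apply, map_smul]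
    rfl
  rw [hz]
  congr 1
  refine Complex.ext (hre c) ?_
  have h1 := hre (I • c)
  rw [hI, hI'] at h1
  simpa using h1

lemma curvTensor_nablaDet (hX : IsKahlerMetric E X) (h : IsLeviCivita nablaT)
    (hD : IsChernConnection detMetric nablaDet) (a b : E) :
    curvTensor nablaDet x (coordField x a x) (coordField x b x) (detSection E x x)
      = (∑ i, basisCoord E i (coordRep E x x (curvTensor nablaT x (coordField x a x)
        (coordField x b x) (coordField x (finBasis ℂ E i) x)))) • detSection E x x := by
  have hx := mem_chart_source E x
  have := FiniteDimensional.complete ℝ E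
  have hev : ∀ c : E, ∀ᶠ y in 𝓝 x, nablaDet (detSection E x) y (coordField x c y)
      = christoffelTrace nablaT x c y • detSection E x y := by
    intro c
    filter_upwards [(chartAt E x).open_source.mem_nhds hx] with y hy
    exact nablaDet_detSection hX h hD hy c
  have h1 := curvTensor_of_eq_smul (c := 0) hD.toIsComplexConnection (detSection_smoothNear hx)
    (coordField_smoothNear_self a) (coordField_smoothNear_self b) (christoffelTrace_fnNear h a)
    (christoffelTrace_fnNear h b) (hev a) (hev b)
    (by rw [mlieBracket_coordField hx, map_zero, zero_smul])
  rw [h1, sub_zero, sum_coord_curvTensor hX h]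

lemma trace_curvature_nablaDet (hX : IsKahlerMetric E X) (h : IsLeviCivita nablaT)
    (hD : IsChernConnection detMetric nablaDet) (a b : 𝕋 x) : trace ℂ _ (curvature nablaDet x a b)
      = ∑ i, basisCoord E i (coordRep E x x (curvTensor nablaT x a b
          (coordField x (finBasis ℂ E i) x))) := by
  have hx := mem_chart_source E x
  have h1 := curvTensor_nablaDet hX h hD (x := x) (coordRep E x x a) (coordRep E x x b)
  rw [coordField_coordRep hx, coordField_coordRep hx,
    ← curvature_apply hD.toIsComplexConnection] at h1
  have h2 : (show ℂ from detSection E x x) = 1 := by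
    refine (detSection_eq hx).trans ?_
    have h : (tangentBundleCore 𝓘(ℂ, E) X).coordChange (achart E x) (achart E x) x
        = ContinuousLinearMap.id ℂ E :=
      ContinuousLinearMap.ext fun w => (tangentBundleCore 𝓘(ℂ, E) X).coordChange_self (achart E x) x hx w
    rw [h]
    exact LinearMap.det_id (A := ℂ) (M := E)
  have h3 : ∀ (A : ℂ →ₗ[ℂ] ℂ) (κ σ : ℂ), σ = 1 → A σ = κ • σ → trace ℂ ℂ A = κ := by
    intro A κ σ hσ hA
    rw [hσ] at hA
    rw [LinearMap.trace_eq_matrix_trace ℂ (Module.Basis.singleton Unit ℂ)]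
    simp [Matrix.trace, LinearMap.toMatrix_apply, hA]
  exact h3 _ _ _ h2 h1

end DetCurvature

section Fock

variable {M ι : Type*} [AddCommGroup M] [Module ℂ M] [Fintype ι] [DecidableEq ι]
  {cr an : ι → M →ₗ[ℂ] M}

lemma sum_anticommutator (h : ∀ j k ξ, an j (cr k ξ) = (if j = k then 1 else 0 : ℂ) • ξ - cr k (an j ξ))
    (B : ι → ι → M) :
    ∑ j, ∑ k, an j (cr k (B j k)) = ∑ j, B j j - ∑ j, ∑ k, cr k (an j (B j k)) := by
  simp only [h, sum_sub_distrib, ite_smul, one_smul, zero_smul, Finset.sum_ite_eq,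
    Finset.mem_univ, if_true]

lemma sum_symm_anticomm (h : ∀ j k ξ, cr j (cr k ξ) = -cr k (cr j ξ)) (B : ι → ι → M)
    (hB : ∀ j k, B j k = B k j) : ∑ j, ∑ k, cr j (cr k (B j k)) = 0 := by
  have h1 : ∑ j, ∑ k, cr j (cr k (B j k)) = -∑ j, ∑ k, cr j (cr k (B j k)) := by
    conv_lhs => rw [sum_comm]
    rw [← sum_neg_distrib]
    refine sum_congr rfl fun j _ => ?_
    rw [← sum_neg_distrib]
    refine sum_congr rfl fun k _ => ?_
    rw [hB, h]
  have h2 : (2 : ℂ) • ∑ j, ∑ k, cr j (cr k (B j k)) = 0 := by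
    rw [two_smul]
    nth_rewrite 1 [h1]
    exact neg_add_cancel _
  exact (smul_eq_zero.1 h2).resolve_left two_ne_zero

/-- The curvature term of a Kähler curvature tensor in the Lichnerowicz formula. -/
lemma sum_kahler_curvature (ξ : M)
    (h : ∀ j k ξ, an j (cr k ξ) = (if j = k then 1 else 0 : ℂ) • ξ - cr k (an j ξ))
    (hc : ∀ j k ξ, cr j (cr k ξ) = -cr k (cr j ξ)) (ρ : ι → ι → ι → ι → ℂ)
    (hbianchi : ∀ l m j k, ρ l m j k = ρ l j m k) (hpair : ∀ l m j k, ρ l m j k = ρ k j m l) :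
    (2 : ℂ) • ∑ j, ∑ k, cr k (an j (∑ l, ∑ m, ρ l m j k • cr l (an m ξ)))
        - ∑ j, ∑ l, ∑ m, ρ l m j j • cr l (an m ξ)
      = ∑ k, ∑ m, (∑ l, ρ l l m k) • cr k (an m ξ) := by
  have hkl : ∀ l m j k, ρ l m j k = ρ k m j l := fun l m j k => by
    rw [hpair, hbianchi]
  have h1 : ∑ j, ∑ l, ∑ m, ρ l m j j • cr l (an m ξ)
      = ∑ k, ∑ m, (∑ l, ρ l l m k) • cr k (an m ξ) := by
    rw [sum_comm]
    refine sum_congr rfl fun k _ => ?_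
    rw [sum_comm]
    refine sum_congr rfl fun m _ => ?_
    rw [sum_smul]
    exact sum_congr rfl fun j _ => by rw [hpair]
  have h2 : ∑ j, ∑ k, cr k (an j (∑ l, ∑ m, ρ l m j k • cr l (an m ξ)))
      = ∑ k, ∑ m, (∑ l, ρ l l m k) • cr k (an m ξ) := by
    have e1 : ∀ j k, cr k (an j (∑ l, ∑ m, ρ l m j k • cr l (an m ξ)))
        = ∑ m, ρ j m j k • cr k (an m ξ)
          - ∑ l, cr k (cr l (∑ m, ρ l m j k • an j (an m ξ))) := by
      intro j k
      simp only [map_sum, map_smul, h, map_sub, smul_sub, sum_sub_distrib, ite_smul, one_smul,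
        zero_smul]
      congr 1
      rw [sum_eq_single j]
      · simp
      · intro l _ hl
        simp [hl.symm]
      · simp
    simp only [e1, sum_sub_distrib]
    have e2 : ∀ j, ∑ k, ∑ l, cr k (cr l (∑ m, ρ l m j k • an j (an m ξ))) = 0 := fun j =>
      sum_symm_anticomm hc (fun k l => ∑ m, ρ l m j k • an j (an m ξ)) fun k l =>
        sum_congr rfl fun m _ => by rw [hkl]
    simp only [e2, Finset.sum_const_zero, sub_zero]
    rw [sum_comm]
    refine sum_congr rfl fun k _ => ?_
    rw [sum_comm]
    refine sum_congr rfl fun m _ => ?_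
    rw [sum_smul]
    exact sum_congr rfl fun j _ => by rw [hbianchi]
  rw [h1, h2, two_smul, add_sub_cancel_right]

end Fock

section UnitaryFrame

/-- An `ℝ`-bilinear map into a complex vector space. -/
structure IsRealBilinear {T M : Type*} [AddCommGroup T] [Module ℝ T] [AddCommGroup M] [Module ℂ M]
    (Φ : T → T → M) : Prop where
  add_left : ∀ a a' b, Φ (a + a') b = Φ a b + Φ a' b
  smul_left : ∀ (r : ℝ) a b, Φ (r • a) b = (r : ℂ) • Φ a b
  add_right : ∀ a b b', Φ a (b + b') = Φ a b + Φ a b'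
  smul_right : ∀ (r : ℝ) a b, Φ a (r • b) = (r : ℂ) • Φ a b

namespace IsRealBilinear

variable {T M : Type*} [AddCommGroup T] [Module ℝ T] [AddCommGroup M] [Module ℂ M]
  {Φ : T → T → M} (h : IsRealBilinear Φ)
include h

lemma neg_left (a b : T) : Φ (-a) b = -Φ a b := by
  have := h.smul_left (-1) a b
  simpa using this

lemma neg_right (a b : T) : Φ a (-b) = -Φ a b := by
  have := h.smul_right (-1) a b
  simpa using this

/-- The associated bilinear map. -/
def toLin : T →ₗ[ℝ] T →ₗ[ℝ] M :=
  LinearMap.mk₂ ℝ Φ h.add_left (fun r a b => (h.smul_left r a b).trans (Complex.coe_smul r _))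
    h.add_right (fun r a b => (h.smul_right r a b).trans (Complex.coe_smul r _))

end IsRealBilinear

variable {x : X}

/-- The vector `a - i J a` of type `(1,0)`. -/
def hol (a : 𝕋 x) : ComplexTangent E x := ⟨a, -J E x a⟩

section Complexify

variable {M : Type*} [AddCommGroup M] [Module ℂ M]
  {B : 𝕋 x → 𝕋 x → M} (hB : IsRealBilinear B)
  (a b : 𝕋 x)
include hB

lemma complexify₂_hol_hol : complexify₂ B (hol a) (hol b)
    = (B a b - B (J E x a) (J E x b)) - I • (B a (J E x b) + B (J E x a) b) := by
  simp only [complexify₂, hol, hB.neg_left, hB.neg_right, neg_neg]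
  module

lemma complexify₂_hol_conj : complexify₂ B (hol a) (hol b).conjugate
    = (B a b + B (J E x a) (J E x b)) + I • (B a (J E x b) - B (J E x a) b) := by
  simp only [complexify₂, hol, ComplexTangent.conjugate, hB.neg_left, neg_neg]
  module

lemma complexify₂_conj_conj : complexify₂ B (hol a).conjugate (hol b).conjugate
    = (B a b - B (J E x a) (J E x b)) + I • (B a (J E x b) + B (J E x a) b) := by
  simp only [complexify₂, hol, ComplexTangent.conjugate, neg_neg]

end Complexify

lemma complexify₂_linear {M N : Type*} [AddCommGroup M] [Module ℂ M] [AddCommGroup N]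
    [Module ℂ N] (f : M →ₗ[ℂ] N) (B : 𝕋 x → 𝕋 x → M) (u v : ComplexTangent E x) :
    complexify₂ (fun a b => f (B a b)) u v = f (complexify₂ B u v) := by
  simp only [complexify₂, map_add, map_sub, map_smul]

/-- The vectors `a_j - i J a_j` are orthonormal. -/
def IsUnitary {n : ℕ} (a : Fin n → 𝕋 x) : Prop :=
  ∀ j k, (inner ℝ (a j) (a k) : ℝ) = (if j = k then 1 / 2 else 0) ∧
    (inner ℝ (a j) (J E x (a k)) : ℝ) = 0

variable {n : ℕ} {a : Fin n → 𝕋 x}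

lemma IsUnitary.exists_orthonormalBasis (ha : IsUnitary a) (hX : IsKahlerMetric E X)
    (hn : finrank ℂ E = n) : ∃ f : OrthonormalBasis (Fin n ⊕ Fin n) ℝ (𝕋 x),
      (∀ j, f (Sum.inl j) = Real.sqrt 2 • a j) ∧ ∀ j, f (Sum.inr j) = Real.sqrt 2 • J E x (a j) := by
  have h2 : Real.sqrt 2 * Real.sqrt 2 = 2 := Real.mul_self_sqrt (by norm_num)
  have ho : Orthonormal ℝ (Sum.elim (fun j => Real.sqrt 2 • a j)
      (fun j => Real.sqrt 2 • J E x (a j)) : Fin n ⊕ Fin n → 𝕋 x) := by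
    rw [orthonormal_iff_ite]
    rintro (j | j) (k | k)
    · simp only [Sum.elim_inl, inner_smul_left, inner_smul_right, (ha j k).1, Sum.inl.injEq]
      split_ifs <;> simp [h2, ← mul_assoc]
    · simp only [Sum.elim_inl, Sum.elim_inr, inner_smul_left, inner_smul_right, (ha j k).2]
      simp
    · simp only [Sum.elim_inl, Sum.elim_inr, inner_smul_left, inner_smul_right, real_inner_comm,
        (ha k j).2]
      simp
    · simp only [Sum.elim_inr, inner_smul_left, inner_smul_right, hX.invariant, (ha j k).1,
        Sum.inr.injEq]
      split_ifs <;> simp [h2, ← mul_assoc]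
  have hc : Fintype.card (Fin n ⊕ Fin n) = finrank ℝ E := by
    rw [Fintype.card_sum, Fintype.card_fin, finrank_real_of_complex, hn, two_mul]
  refine ⟨orthonormalBasisOf ho hc, fun j => ?_, fun j => ?_⟩ <;> rw [coe_orthonormalBasisOf] <;> rfl

lemma IsUnitary.sum_eq (ha : IsUnitary a) (hX : IsKahlerMetric E X)
    (hn : finrank ℂ E = n) {ι : Type*} [Fintype ι]
    (e : OrthonormalBasis ι ℝ (𝕋 x)) {M : Type*} [AddCommGroup M] [Module ℂ M]
    {Φ : 𝕋 x → 𝕋 x → M} (h : IsRealBilinear Φ) :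
    ∑ i, Φ (e i) (e i) = ∑ j, (2 : ℂ) • (Φ (a j) (a j) + Φ (J E x (a j)) (J E x (a j))) := by
  obtain ⟨f, h1, h2⟩ := ha.exists_orthonormalBasis hX hn
  have h3 : ((Real.sqrt 2 : ℝ) : ℂ) * ((Real.sqrt 2 : ℝ) : ℂ) = 2 := by
    rw [← Complex.ofReal_mul, Real.mul_self_sqrt (by norm_num)]
    norm_num
  refine (sum_orthonormalBasis_eq e f h.toLin).trans ?_
  change ∑ i, Φ (f i) (f i) = _
  rw [Fintype.sum_sum_type, ← sum_add_distrib]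
  refine sum_congr rfl fun j _ => ?_
  rw [h1, h2, h.smul_left, h.smul_right, h.smul_left, h.smul_right, smul_smul, smul_smul, h3,
    smul_add]

lemma IsUnitary.expand (ha : IsUnitary a) (hX : IsKahlerMetric E X)
    (hn : finrank ℂ E = n) (v : 𝕋 x) :
    v = ∑ l, ((2 * inner ℝ v (a l) : ℝ) • a l + (2 * inner ℝ v (J E x (a l)) : ℝ) • J E x (a l)) := by
  obtain ⟨f, h1, h2⟩ := ha.exists_orthonormalBasis hX hn
  have h3 : Real.sqrt 2 * Real.sqrt 2 = 2 := Real.mul_self_sqrt (by norm_num)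
  conv_lhs => rw [← f.sum_repr' v, Fintype.sum_sum_type, ← sum_add_distrib]
  refine sum_congr rfl fun l _ => ?_
  rw [h1, h2, inner_smul_left, inner_smul_left, smul_smul, smul_smul, real_inner_comm v,
    real_inner_comm v, RCLike.conj_to_real, mul_right_comm, h3, mul_right_comm, h3]

end UnitaryFrame

section Sesquilinear

variable {S : Type*} [AddCommGroup S] [Module ℂ S] (h : S →ₗ⋆[ℂ] S →ₗ[ℂ] ℂ)

lemma sesq_add_left (a b c : S) : h (a + b) c = h a c + h b c := by
  rw [map_add, LinearMap.add_apply]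

lemma sesq_sum_left {ι : Type*} (T : Finset ι) (f : ι → S) (c : S) :
    h (∑ i ∈ T, f i) c = ∑ i ∈ T, h (f i) c := by
  rw [map_sum, LinearMap.sum_apply]

lemma sesq_sum_right {ι : Type*} (T : Finset ι) (c : S) (f : ι → S) :
    h c (∑ i ∈ T, f i) = ∑ i ∈ T, h c (f i) := map_sum _ _ _

lemma sesq_add_right (a b c : S) : h a (b + c) = h a b + h a c := map_add _ _ _

lemma sesq_smul_right (r : ℂ) (a b : S) : h a (r • b) = r * h a b := map_smul _ _ _

end Sesquilinear

section Calculus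

variable {E : Type*} [NormedAddCommGroup E] [NormedSpace ℝ E]
  {X : Type*} [TopologicalSpace X] [ChartedSpace E X]

variable (E) in
/-- Sections that are locally sums of elementary sections, which are differentiated by a rule
compatible with a nondegenerate sesquilinear form. -/
structure SectionCalculus (S : X → Type*) [∀ x, AddCommGroup (S x)] [∀ x, Module ℂ (S x)]
    (D : Type*) where
  /-- The section of the bundle. -/
  val : D → Π y : X, S y
  /-- Smoothness near a point. -/
  near : D → X → Prop
  /-- The derivative of an elementary section. -/
  deriv : D → Π y : X, 𝕋 y → S y
  /-- The sesquilinear form. -/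
  herm : ∀ y : X, S y →ₗ⋆[ℂ] S y →ₗ[ℂ] ℂ
  metric : ∀ c c' x, near c x → near c' x → ∀ v : 𝕋 x,
    FnNear E (fun y => herm y (val c y) (val c' y)) x ∧ 𝕕 (fun y => herm y (val c y) (val c' y)) x v
      = herm x (deriv c x v) (val c' x) + herm x (val c x) (deriv c' x v)
  ext : ∀ (x : X) (ξ η : S x), (∀ c, near c x → herm x (val c x) ξ = herm x (val c x) η) → ξ = η

variable {S : X → Type*} [∀ x, AddCommGroup (S x)] [∀ x, Module ℂ (S x)]
  {D : Type*} (K : SectionCalculus E S D) {r s t : Π y : X, S y} {x : X}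
  {v : 𝕋 x}

/-- The derivative of `s` along `v` is `ξ`. -/
def SectionCalculus.HasDeriv (s : Π y : X, S y) (x : X) (v : 𝕋 x) (ξ : S x) :
    Prop :=
  ∃ (m : ℕ) (c : Fin m → D), (∀ k, K.near (c k) x) ∧
    (∀ᶠ y in 𝓝 x, s y = ∑ k, K.val (c k) y) ∧ ξ = ∑ k, K.deriv (c k) x v

variable {K}

lemma SectionCalculus.HasDeriv.metric_left {ξ : S x} (hs : K.HasDeriv s x v ξ) {c : D}
    (hc : K.near c x) : FnNear E (fun y => K.herm y (K.val c y) (s y)) x ∧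
    𝕕 (fun y => K.herm y (K.val c y) (s y)) x v
      = K.herm x (K.deriv c x v) (s x) + K.herm x (K.val c x) ξ := by
  obtain ⟨m, d, hd, hs, rfl⟩ := hs
  have h1 : (fun y => K.herm y (K.val c y) (s y)) =ᶠ[𝓝 x]
      fun y => ∑ k, K.herm y (K.val c y) (K.val (d k) y) := by
    filter_upwards [hs] with y hy
    rw [hy, sesq_sum_right]
  have hn : ∀ k ∈ (Finset.univ : Finset (Fin m)), _ := fun k _ => (K.metric c (d k) x hc (hd k) v).1
  have h2 := mvfderiv_sum_apply Finset.univ (fun k hk => (hn k hk).mdiff) v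
  refine ⟨(FnNear.sum hn).congr h1, ?_⟩
  rw [mvfderiv_congr h1]
  refine h2.trans ?_
  rw [hs.self_of_nhds, sesq_sum_right, sesq_sum_right, ← sum_add_distrib]
  exact sum_congr rfl fun k _ => (K.metric c (d k) x hc (hd k) v).2

lemma SectionCalculus.HasDeriv.metric {ρ ξ : S x} (hr : K.HasDeriv r x v ρ)
    (hs : K.HasDeriv s x v ξ) : FnNear E (fun y => K.herm y (r y) (s y)) x ∧
    𝕕 (fun y => K.herm y (r y) (s y)) x v = K.herm x ρ (s x) + K.herm x (r x) ξ := by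
  obtain ⟨m, d, hd, hr, rfl⟩ := hr
  have h1 : (fun y => K.herm y (r y) (s y)) =ᶠ[𝓝 x]
      fun y => ∑ k, K.herm y (K.val (d k) y) (s y) := by
    filter_upwards [hr] with y hy
    rw [hy, sesq_sum_left]
  have hn : ∀ k ∈ (Finset.univ : Finset (Fin m)), _ := fun k _ => (hs.metric_left (hd k)).1
  have h2 := mvfderiv_sum_apply Finset.univ (fun k hk => (hn k hk).mdiff) v
  refine ⟨(FnNear.sum hn).congr h1, ?_⟩
  rw [mvfderiv_congr h1]
  refine h2.trans ?_
  rw [hr.self_of_nhds, sesq_sum_left, sesq_sum_left, ← sum_add_distrib]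
  exact sum_congr rfl fun k _ => (hs.metric_left (hd k)).2

lemma SectionCalculus.HasDeriv.unique {ξ η : S x} (hs : K.HasDeriv s x v ξ)
    (hs' : K.HasDeriv s x v η) : ξ = η :=
  K.ext x ξ η fun _ hc => add_left_cancel
    ((hs.metric_left hc).2.symm.trans (hs'.metric_left hc).2)

lemma SectionCalculus.HasDeriv.congr {ξ : S x} (hs : K.HasDeriv s x v ξ)
    (h : ∀ᶠ y in 𝓝 x, t y = s y) : K.HasDeriv t x v ξ := by
  obtain ⟨m, d, hd, hs, rfl⟩ := hs
  refine ⟨m, d, hd, ?_, rfl⟩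
  filter_upwards [hs, h] with y h1 h2 using h2.trans h1

lemma SectionCalculus.near.hasDeriv {c : D} (hc : K.near c x) :
    K.HasDeriv (K.val c) x v (K.deriv c x v) :=
  ⟨1, fun _ => c, fun _ => hc, .of_forall fun y => by simp, by simp⟩

lemma SectionCalculus.HasDeriv.eq_of_metric {ξ η : S x} (hs : K.HasDeriv s x v ξ)
    (h : ∀ c, K.near c x → 𝕕 (fun y => K.herm y (K.val c y) (s y)) x v
      = K.herm x (K.deriv c x v) (s x) + K.herm x (K.val c x) η) : ξ = η :=
  K.ext x ξ η fun c hc => add_left_cancel ((hs.metric_left hc).2.symm.trans (h c hc))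

lemma SectionCalculus.HasDeriv.add {ξ η ζ : S x} (hs : K.HasDeriv s x v ξ)
    (ht : K.HasDeriv t x v η) (h : K.HasDeriv (fun y => s y + t y) x v ζ) : ζ = ξ + η := by
  refine h.eq_of_metric fun c hc => ?_
  have h1 := hs.metric_left hc
  have h2 := ht.metric_left hc
  have e1 : (fun y => K.herm y (K.val c y) (s y + t y)) = fun y =>
      K.herm y (K.val c y) (s y) + K.herm y (K.val c y) (t y) :=
    funext fun y => sesq_add_right _ _ _ _
  rw [e1, mvfderiv_fun_add h1.1.mdiff h2.1.mdiff, add_apply, h1.2, h2.2, sesq_add_right,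
    sesq_add_right]
  ring

lemma SectionCalculus.HasDeriv.smul {ξ ζ : S x} (hs : K.HasDeriv s x v ξ) {f : X → ℂ}
    (hf : FnNear E f x) (h : K.HasDeriv (fun y => f y • s y) x v ζ) :
    ζ = f x • ξ + (𝕕 f x v) • s x := by
  refine h.eq_of_metric fun c hc => ?_
  have h1 := hs.metric_left hc
  have e1 : (fun y => K.herm y (K.val c y) (f y • s y)) = fun y =>
      f y * K.herm y (K.val c y) (s y) := funext fun y => sesq_smul_right _ _ _ _
  rw [e1, mvfderiv_mul_apply hf.mdiff h1.1.mdiff, h1.2, sesq_add_right,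
    sesq_smul_right, sesq_smul_right, sesq_smul_right]
  ring

/-- The derivative of the adjoint `I` of an operator `W` with a known derivative. -/
lemma SectionCalculus.HasDeriv.adjoint {W I : ∀ y, S y → S y} {W' I' : S x → S x}
    (hW : ∀ y ξ η, K.herm y (W y ξ) η = K.herm y ξ (I y η))
    (hW' : ∀ ξ η, K.herm x (W' ξ) η = K.herm x ξ (I' η))
    (hd : ∀ c, K.near c x → K.HasDeriv (fun y => W y (K.val c y)) x v
      (W' (K.val c x) + W x (K.deriv c x v)))
    {ξ ζ : S x} (hs : K.HasDeriv s x v ξ) (h : K.HasDeriv (fun y => I y (s y)) x v ζ) :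
    ζ = I' (s x) + I x ξ := by
  refine h.eq_of_metric fun c hc => ?_
  have h1 : (fun y => K.herm y (K.val c y) (I y (s y)))
      = fun y => K.herm y (W y (K.val c y)) (s y) := funext fun y => (hW _ _ _).symm
  rw [h1, ((hd c hc).metric hs).2, sesq_add_left, hW, hW, hW', sesq_add_right]
  ring

end Calculus

section Clifford

/-- The value at `v` of the `(0,1)`-form `flat01 a`. -/
def pairing {x : X} (a v : 𝕋 x) : ℂ :=
  (1 / 2 : ℂ) * (((inner ℝ a v : ℝ) : ℂ) + I * ((inner ℝ a (J E x v) : ℝ) : ℂ))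

/-- A bundle with a Hermitian form and a connection, on which tangent vectors act by exterior and
interior multiplication. -/
structure CliffordCalculus
    (nablaT : CovariantDerivative 𝕀 E (fun x : X => 𝕋 x))
    (S : X → Type*) [∀ x, AddCommGroup (S x)] [∀ x, Module ℂ (S x)] where
  /-- Smoothness of a section near a point. -/
  sec : (Π y : X, S y) → X → Prop
  /-- The connection. -/
  cd : (Π y : X, S y) → Π x : X, 𝕋 x → S x
  /-- The Hermitian form. -/
  herm : Π x : X, S x →ₗ⋆[ℂ] S x →ₗ[ℂ] ℂ
  /-- Exterior multiplication. -/
  wedge : Π x : X, 𝕋 x → S x →ₗ[ℂ] S x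
  /-- Interior multiplication. -/
  contr : Π x : X, 𝕋 x → S x →ₗ[ℂ] S x
  sec_congr : ∀ {s t : Π y : X, S y} {x : X}, sec s x → (∀ᶠ y in 𝓝 x, t y = s y) → sec t x
  sec_eventually : ∀ {s : Π y : X, S y} {x : X}, sec s x → ∀ᶠ y in 𝓝 x, sec s y
  sec_add : ∀ {s t : Π y : X, S y} {x : X}, sec s x → sec t x → sec (fun y => s y + t y) x
  sec_smul : ∀ {s : Π y : X, S y} {x : X} {f : X → ℂ}, FnNear E f x → sec s x →
    sec (fun y => f y • s y) x
  sec_wedge : ∀ {s : Π y : X, S y} {x : X} {a : 𝔛},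
    SmoothNear E E a x → sec s x → sec (fun y => wedge y (a y) (s y)) x
  sec_contr : ∀ {s : Π y : X, S y} {x : X} {a : 𝔛},
    SmoothNear E E a x → sec s x → sec (fun y => contr y (a y) (s y)) x
  sec_cd : ∀ {s : Π y : X, S y} {x : X} {a : 𝔛},
    SmoothNear E E a x → sec s x → sec (fun y => cd s y (a y)) x
  exists_sec : ∀ {x : X} (ξ : S x), ∃ s, sec s x ∧ s x = ξ
  cd_congr : ∀ {s t : Π y : X, S y} {x : X}, sec s x → (∀ᶠ y in 𝓝 x, t y = s y) →
    ∀ v, cd t x v = cd s x v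
  cd_add : ∀ {s t : Π y : X, S y} {x : X}, sec s x → sec t x → ∀ v,
    cd (fun y => s y + t y) x v = cd s x v + cd t x v
  cd_smul : ∀ {s : Π y : X, S y} {x : X} {f : X → ℂ}, FnNear E f x → sec s x → ∀ v,
    cd (fun y => f y • s y) x v = f x • cd s x v + (𝕕 f x v) • s x
  cd_add_right : ∀ {s : Π y : X, S y} {x : X}, sec s x → ∀ v w, cd s x (v + w) = cd s x v + cd s x w
  cd_smul_right : ∀ {s : Π y : X, S y} {x : X}, sec s x → ∀ (c : ℝ) v,
    cd s x (c • v) = (c : ℂ) • cd s x v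
  cd_wedge : ∀ {s : Π y : X, S y} {x : X} {a : 𝔛},
    SmoothNear E E a x → sec s x → ∀ v, cd (fun y => wedge y (a y) (s y)) x v
      = wedge x (nablaT a x v) (s x) + wedge x (a x) (cd s x v)
  cd_contr : ∀ {s : Π y : X, S y} {x : X} {a : 𝔛},
    SmoothNear E E a x → sec s x → ∀ v, cd (fun y => contr y (a y) (s y)) x v
      = contr x (nablaT a x v) (s x) + contr x (a x) (cd s x v)
  herm_near : ∀ {s t : Π y : X, S y} {x : X}, sec s x → sec t x →
    FnNear E (fun y => herm y (s y) (t y)) x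
  herm_cd : ∀ {s t : Π y : X, S y} {x : X}, sec s x → sec t x → ∀ v,
    𝕕 (fun y => herm y (s y) (t y)) x v
      = herm x (cd s x v) (t x) + herm x (s x) (cd t x v)
  herm_wedge : ∀ {x : X} (a : 𝕋 x) (ξ η : S x), herm x (wedge x a ξ) η = herm x ξ (contr x a η)
  nondegenerate : ∀ {x : X} {η : S x}, (∀ ξ, herm x ξ η = 0) → η = 0
  wedge_add : ∀ {x : X} (a b : 𝕋 x) (ξ : S x), wedge x (a + b) ξ = wedge x a ξ + wedge x b ξ
  wedge_smul : ∀ {x : X} (r : ℝ) (a : 𝕋 x) (ξ : S x), wedge x (r • a) ξ = (r : ℂ) • wedge x a ξ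
  wedge_J : ∀ {x : X} (a : 𝕋 x) (ξ : S x), wedge x (J E x a) ξ = I • wedge x a ξ
  contr_add : ∀ {x : X} (a b : 𝕋 x) (ξ : S x), contr x (a + b) ξ = contr x a ξ + contr x b ξ
  contr_smul : ∀ {x : X} (r : ℝ) (a : 𝕋 x) (ξ : S x), contr x (r • a) ξ = (r : ℂ) • contr x a ξ
  contr_J : ∀ {x : X} (a : 𝕋 x) (ξ : S x), contr x (J E x a) ξ = (-I) • contr x a ξ
  wedge_wedge : ∀ {x : X} (a b : 𝕋 x) (ξ : S x), wedge x a (wedge x b ξ) = -wedge x b (wedge x a ξ)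
  contr_contr : ∀ {x : X} (a b : 𝕋 x) (ξ : S x), contr x a (contr x b ξ) = -contr x b (contr x a ξ)
  contr_wedge : ∀ {x : X} (v a : 𝕋 x) (ξ : S x),
    contr x v (wedge x a ξ) = pairing a v • ξ - wedge x a (contr x v ξ)

variable {nablaT : CovariantDerivative 𝕀 E (fun x : X => 𝕋 x)}
  {S : X → Type*} [∀ x, AddCommGroup (S x)] [∀ x, Module ℂ (S x)]
  (K : CliffordCalculus nablaT S) {s t : Π y : X, S y} {x : X}
  {u v a : 𝔛}

namespace CliffordCalculus

variable {K} in
lemma sec_neg (hs : K.sec s x) : K.sec (fun y => -s y) x :=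
  K.sec_congr (K.sec_smul (FnNear.const (-1 : ℂ)) hs)
    (.of_forall fun y => (neg_one_smul ℂ _).symm)

variable {K} in
lemma sec_zero (hs : K.sec s x) : K.sec (fun _ => 0) x :=
  K.sec_congr (K.sec_smul (FnNear.const (0 : ℂ)) hs)
    (.of_forall fun y => (zero_smul ℂ _).symm)

lemma cd_const_smul (c : ℂ) (hs : K.sec s x) (w : 𝕋 x) :
    K.cd (fun y => c • s y) x w = c • K.cd s x w := by
  rw [K.cd_smul (FnNear.const c) hs, mvfderiv_const]
  exact (congrArg _ (zero_smul ℂ (s x))).trans (add_zero _)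

variable {K} in
lemma sec_sum {ι : Type*} (T : Finset ι) {f : ι → Π y : X, S y} (h : ∀ i, K.sec (f i) x)
    (hs : K.sec s x) : K.sec (fun y => ∑ i ∈ T, f i y) x := by
  classical
  induction T using Finset.induction_on with
  | empty => simpa using sec_zero hs
  | insert a T ha ih =>
    simp only [sum_insert ha]
    exact K.sec_add (h a) ih

lemma cd_zero (hs : K.sec s x) (w : 𝕋 x) : K.cd (fun _ => 0) x w = 0 := by
  have h := K.cd_const_smul 0 hs w
  simpa using h

lemma cd_sum {ι : Type*} (T : Finset ι) {f : ι → Π y : X, S y} (h : ∀ i, K.sec (f i) x)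
    (hs : K.sec s x) (w : 𝕋 x) : K.cd (fun y => ∑ i ∈ T, f i y) x w = ∑ i ∈ T, K.cd (f i) x w := by
  classical
  induction T using Finset.induction_on with
  | empty => simpa using K.cd_zero hs w
  | insert a T ha ih =>
    simp only [sum_insert ha]
    rw [K.cd_add (h a) (sec_sum T h hs), ih]

lemma cd_neg_right (hs : K.sec s x) (w : 𝕋 x) : K.cd s x (-w) = -K.cd s x w := by
  have h := K.cd_smul_right hs (-1) w
  simpa using h

lemma wedge_neg {x : X} (a : 𝕋 x) (ξ : S x) : K.wedge x (-a) ξ = -K.wedge x a ξ := by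
  have h := K.wedge_smul (-1) a ξ
  simpa using h

lemma wedge_sub {x : X} (a b : 𝕋 x) (ξ : S x) :
    K.wedge x (a - b) ξ = K.wedge x a ξ - K.wedge x b ξ := by
  rw [sub_eq_add_neg, K.wedge_add, K.wedge_neg, sub_eq_add_neg]

/-- The curvature expression of the connection. -/
def curv (u v : 𝔛) (s : Π y : X, S y) (x : X) : S x :=
  K.cd (fun y => K.cd s y (v y)) x (u x) - K.cd (fun y => K.cd s y (u y)) x (v x)
    - K.cd s x (mlieBracket 𝕀 u v x)

lemma curv_congr (hu : SmoothNear E E u x) (hv : SmoothNear E E v x) (hs : K.sec s x)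
    (h : ∀ᶠ y in 𝓝 x, t y = s y) : K.curv u v t x = K.curv u v s x := by
  have h1 : ∀ w : 𝔛, ∀ᶠ y in 𝓝 x,
      K.cd t y (w y) = K.cd s y (w y) := by
    intro w
    filter_upwards [K.sec_eventually hs, h.eventually_nhds] with y h1 h2
    exact K.cd_congr h1 h2 _
  rw [curv, curv, K.cd_congr (K.sec_cd hv hs) (h1 v), K.cd_congr (K.sec_cd hu hs) (h1 u),
    K.cd_congr hs h]

lemma curv_add (hu : SmoothNear E E u x) (hv : SmoothNear E E v x) (hs : K.sec s x)
    (ht : K.sec t x) : K.curv u v (fun y => s y + t y) x = K.curv u v s x + K.curv u v t x := by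
  have h1 : ∀ w : 𝔛, ∀ᶠ y in 𝓝 x,
      K.cd (fun z => s z + t z) y (w y) = K.cd s y (w y) + K.cd t y (w y) := by
    intro w
    filter_upwards [K.sec_eventually hs, K.sec_eventually ht] with y h1 h2
    exact K.cd_add h1 h2 _
  rw [curv, curv, curv, K.cd_congr (K.sec_add (K.sec_cd hv hs) (K.sec_cd hv ht)) (h1 v),
    K.cd_congr (K.sec_add (K.sec_cd hu hs) (K.sec_cd hu ht)) (h1 u), K.cd_add hs ht,
    K.cd_add (K.sec_cd hv hs) (K.sec_cd hv ht), K.cd_add (K.sec_cd hu hs) (K.sec_cd hu ht)]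
  abel

lemma curv_wedge (hn : SmoothConn nablaT) (hu : SmoothNear E E u x) (hv : SmoothNear E E v x)
    (ha : SmoothNear E E a x) (hs : K.sec s x) : K.curv u v (fun y => K.wedge y (a y) (s y)) x
      = K.wedge x (curvTensor nablaT x (u x) (v x) (a x)) (s x)
        + K.wedge x (a x) (K.curv u v s x) := by
  have h1 : ∀ w : 𝔛, ∀ᶠ y in 𝓝 x, K.cd (fun z => K.wedge z (a z) (s z)) y (w y)
        = K.wedge y (nablaT a y (w y)) (s y) + K.wedge y (a y) (K.cd s y (w y)) := by
    intro w
    filter_upwards [K.sec_eventually hs, ha.eventually] with y h1 h2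
    exact K.cd_wedge h2 h1 _
  have h2 : ∀ {w w' : 𝔛}, SmoothNear E E w x → SmoothNear E E w' x →
      K.cd (fun y => K.cd (fun z => K.wedge z (a z) (s z)) y (w y)) x (w' x)
      = K.wedge x (nablaT (fun y => nablaT a y (w y)) x (w' x)) (s x)
        + K.wedge x (nablaT a x (w x)) (K.cd s x (w' x))
        + (K.wedge x (nablaT a x (w' x)) (K.cd s x (w x))
        + K.wedge x (a x) (K.cd (fun y => K.cd s y (w y)) x (w' x))) := by
    intro w w' hw hw'
    have e1 := K.sec_wedge (hn.near ha hw) hs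
    have e2 := K.sec_wedge ha (K.sec_cd hw hs)
    rw [K.cd_congr (K.sec_add e1 e2) (h1 w), K.cd_add e1 e2, K.cd_wedge (hn.near ha hw) hs,
      K.cd_wedge ha (K.sec_cd hw hs)]
  rw [curv, h2 hv hu, h2 hu hv, K.cd_wedge ha hs, curvTensor_eq hn hu hv ha, curvExpr, curv,
    K.wedge_sub, K.wedge_sub, map_sub, map_sub]
  abel

end CliffordCalculus

end Clifford

section CliffordModules

variable {S : X → Type*} [∀ x, AddCommGroup (S x)] [∀ x, Module ℂ (S x)]

lemma _root_.OrthonormalBasis.eq_sum_of_real_linear {H M ι : Type*} [NormedAddCommGroup H]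
    [InnerProductSpace ℝ H] [AddCommGroup M] [Module ℂ M] [Fintype ι] (e : OrthonormalBasis ι ℝ H)
    {f : H → M} (hadd : ∀ a b, f (a + b) = f a + f b)
    (hsmul : ∀ (r : ℝ) a, f (r • a) = (r : ℂ) • f a) (v : H) :
    f v = ∑ i, ((inner ℝ (e i) v : ℝ) : ℂ) • f (e i) := by
  conv_lhs => rw [← e.sum_repr' v]
  exact (map_sum (AddMonoidHom.mk' f hadd) _ _).trans (sum_congr rfl fun i _ => hsmul _ _)

section Dirac

variable (K : CliffordCalculus nablaT S) {s t : Π y : X, S y} {x : X}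
  {u v a : 𝔛} {ι : Type*} [Fintype ι]

namespace CliffordCalculus

/-- Exterior multiplication composed with the connection, `∑ e_i ∧ ∇_{e_i}`. -/
def dbar (s : Π y : X, S y) (x : X) : S x :=
  ∑ i, K.wedge x (stdOrthonormalBasis ℝ (𝕋 x) i)
    (K.cd s x (stdOrthonormalBasis ℝ (𝕋 x) i))

/-- Interior multiplication composed with the connection, `-∑ i_{e_i} ∇_{e_i}`. -/
def dbarStar (s : Π y : X, S y) (x : X) : S x :=
  -∑ i, K.contr x (stdOrthonormalBasis ℝ (𝕋 x) i)
    (K.cd s x (stdOrthonormalBasis ℝ (𝕋 x) i))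

lemma dbar_eq (hs : K.sec s x) (e : OrthonormalBasis ι ℝ (𝕋 x)) :
    K.dbar s x = ∑ i, K.wedge x (e i) (K.cd s x (e i)) := by
  refine sum_orthonormalBasis_eq _ e (LinearMap.mk₂ ℝ (fun a b => K.wedge x a (K.cd s x b))
    (fun a b c => K.wedge_add a b _) (fun r a c => ?_) (fun a b c => ?_) fun r a b => ?_)
  · exact (K.wedge_smul r a _).trans (Complex.coe_smul r _)
  · rw [K.cd_add_right hs, map_add]
  · rw [K.cd_smul_right hs, map_smul]
    exact Complex.coe_smul r _

lemma dbarStar_eq (hs : K.sec s x) (e : OrthonormalBasis ι ℝ (𝕋 x)) :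
    K.dbarStar s x = -∑ i, K.contr x (e i) (K.cd s x (e i)) := by
  refine congrArg Neg.neg (sum_orthonormalBasis_eq _ e (LinearMap.mk₂ ℝ
    (fun a b => K.contr x a (K.cd s x b))
    (fun a b c => K.contr_add a b _) (fun r a c => ?_) (fun a b c => ?_) fun r a b => ?_))
  · exact (K.contr_smul r a _).trans (Complex.coe_smul r _)
  · rw [K.cd_add_right hs, map_add]
  · rw [K.cd_smul_right hs, map_smul]
    exact Complex.coe_smul r _

/-- Clifford multiplication, up to the factor `√2`. -/
def cliff (x : X) (a : 𝕋 x) : S x →ₗ[ℂ] S x := K.wedge x a - K.contr x a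

lemma cliff_apply (a : 𝕋 x) (ξ : S x) : K.cliff x a ξ = K.wedge x a ξ - K.contr x a ξ := rfl

lemma cliff_add (a b : 𝕋 x) (ξ : S x) : K.cliff x (a + b) ξ = K.cliff x a ξ + K.cliff x b ξ := by
  rw [cliff_apply, cliff_apply, cliff_apply, K.wedge_add, K.contr_add]
  abel

lemma cliff_smul (r : ℝ) (a : 𝕋 x) (ξ : S x) : K.cliff x (r • a) ξ = (r : ℂ) • K.cliff x a ξ := by
  rw [cliff_apply, cliff_apply, K.wedge_smul, K.contr_smul, smul_sub]

lemma cliff_cliff (hX : IsKahlerMetric E X) (a b : 𝕋 x) (ξ : S x) :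
    K.cliff x a (K.cliff x b ξ) + K.cliff x b (K.cliff x a ξ) = -((inner ℝ a b : ℝ) : ℂ) • ξ := by
  have h1 : pairing a b + pairing b a = ((inner ℝ a b : ℝ) : ℂ) := by
    have h2 : (inner ℝ b (J E x a) : ℝ) = -inner ℝ a (J E x b) := by
      rw [real_inner_comm, hX.inner_J]
    rw [pairing, pairing, real_inner_comm a b, h2]
    push_cast
    ring
  rw [← h1]
  simp only [cliff_apply, map_sub, K.contr_wedge, K.wedge_wedge a b, K.contr_contr a b]
  module

lemma sec_cliff (ha : SmoothNear E E a x) (hs : K.sec s x) :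
    K.sec (fun y => K.cliff y (a y) (s y)) x := by
  refine K.sec_congr (K.sec_add (K.sec_wedge ha hs) (sec_neg (K.sec_contr ha hs)))
    (.of_forall fun y => ?_)
  rw [cliff_apply, sub_eq_add_neg]

lemma cd_cliff (ha : SmoothNear E E a x) (hs : K.sec s x) (w : 𝕋 x) :
    K.cd (fun y => K.cliff y (a y) (s y)) x w
      = K.cliff x (nablaT a x w) (s x) + K.cliff x (a x) (K.cd s x w) := by
  have e1 := K.sec_wedge ha hs
  have e2 := K.sec_smul (FnNear.const (-1 : ℂ)) (K.sec_contr ha hs)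
  have h1 : ∀ᶠ y in 𝓝 x, K.cliff y (a y) (s y)
      = K.wedge y (a y) (s y) + (-1 : ℂ) • K.contr y (a y) (s y) :=
    .of_forall fun y => by rw [cliff_apply, neg_one_smul, sub_eq_add_neg]
  rw [K.cd_congr (K.sec_add e1 e2) h1, K.cd_add e1 e2, K.cd_wedge ha hs,
    K.cd_const_smul _ (K.sec_contr ha hs), K.cd_contr ha hs, cliff_apply, cliff_apply]
  module

/-- The Dirac operator, up to the factor `√2`. -/
def dirac (s : Π y : X, S y) (x : X) : S x := K.dbar s x + K.dbarStar s x

lemma dirac_eq (hs : K.sec s x) (e : OrthonormalBasis ι ℝ (𝕋 x)) :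
    K.dirac s x = ∑ i, K.cliff x (e i) (K.cd s x (e i)) := by
  rw [dirac, K.dbar_eq hs e, K.dbarStar_eq hs e, ← sub_eq_add_neg, ← sum_sub_distrib]
  rfl

variable {e : ι → 𝔛}

lemma dirac_eventually (hs : K.sec s x) (ho : ∀ᶠ y in 𝓝 x, Orthonormal ℝ (fun i => e i y))
    (hc : Fintype.card ι = finrank ℝ E) :
    ∀ᶠ y in 𝓝 x, K.dirac s y = ∑ i, K.cliff y (e i y) (K.cd s y (e i y)) := by
  filter_upwards [K.sec_eventually hs, ho] with y h1 h2
  rw [K.dirac_eq h1 (orthonormalBasisOf h2 hc), coe_orthonormalBasisOf]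

variable (nablaT) in
/-- The second covariant derivative. -/
def second (K : CliffordCalculus nablaT S) (u v : 𝔛)
    (s : Π y : X, S y) (x : X) : S x :=
  K.cd (fun y => K.cd s y (v y)) x (u x) - K.cd s x (nablaT v x (u x))

lemma second_sub (hT : IsLeviCivita nablaT) (hu : SmoothNear E E u x)
    (hv : SmoothNear E E v x) (hs : K.sec s x) :
    second nablaT K u v s x - second nablaT K v u s x = K.curv u v s x := by
  rw [second, second, curv, ← hT.torsion_near hu hv, sub_eq_add_neg (nablaT v x (u x)),
    K.cd_add_right hs, K.cd_neg_right hs]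
  abel

lemma nabla_skew (hT : IsLeviCivita nablaT) (he : ∀ i, SmoothNear E E (e i) x)
    (ho : ∀ᶠ y in 𝓝 x, Orthonormal ℝ (fun i => e i y)) (i k : ι) (w : 𝕋 x) :
    (inner ℝ (nablaT (e i) x w) (e k x) : ℝ) = -inner ℝ (nablaT (e k) x w) (e i x) := by
  classical
  have h1 : (fun y => (inner ℝ (e i y) (e k y) : ℝ)) =ᶠ[𝓝 x] fun _ => if i = k then 1 else 0 := by
    filter_upwards [ho] with y hy
    exact orthonormal_iff_ite.1 hy i k
  have h2 := hT.metric_near (he i) (he k) w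
  rw [mvfderiv_congr h1, mvfderiv_const] at h2
  rw [real_inner_comm (e i x)]
  have h3 : (0 : ℝ) = inner ℝ (nablaT (e i) x w) (e k x) + inner ℝ (e i x) (nablaT (e k) x w) := h2
  linarith

lemma sum_cliff_nabla (hT : IsLeviCivita nablaT) (he : ∀ i, SmoothNear E E (e i) x)
    (ho : ∀ᶠ y in 𝓝 x, Orthonormal ℝ (fun i => e i y))
    (hc : Fintype.card ι = finrank ℝ E) (hs : K.sec s x) (w : 𝕋 x) :
    ∑ j, K.cliff x (nablaT (e j) x w) (K.cd s x (e j x))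
      = -∑ j, K.cliff x (e j x) (K.cd s x (nablaT (e j) x w)) := by
  have hb : ∀ {f : 𝕋 x → S x} (v), (∀ a b, f (a + b) = f a + f b) →
      (∀ (r : ℝ) a, f (r • a) = (r : ℂ) • f a) →
      f v = ∑ k, ((inner ℝ (e k x) v : ℝ) : ℂ) • f (e k x) := fun v h1 h2 => by
    have h := (orthonormalBasisOf ho.self_of_nhds hc).eq_sum_of_real_linear h1 h2 v
    rwa [coe_orthonormalBasisOf] at h
  have h1 : ∀ j, K.cliff x (nablaT (e j) x w) (K.cd s x (e j x)) = _ := fun j =>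
    hb (f := fun a => K.cliff x a (K.cd s x (e j x))) _ (fun a b => K.cliff_add a b _)
      fun r a => K.cliff_smul r a _
  have h2 : ∀ j, K.cliff x (e j x) (K.cd s x (nablaT (e j) x w)) = _ := fun j =>
    hb (f := fun a => K.cliff x (e j x) (K.cd s x a)) _
      (fun a b => by rw [K.cd_add_right hs, map_add]) fun r a => by rw [K.cd_smul_right hs, map_smul]
  rw [sum_congr rfl fun j _ => h1 j, sum_congr rfl fun j _ => h2 j, sum_comm, ← sum_neg_distrib]
  refine sum_congr rfl fun k _ => ?_
  rw [← sum_neg_distrib]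
  refine sum_congr rfl fun j _ => ?_
  rw [real_inner_comm, nabla_skew hT he ho j k, real_inner_comm]
  push_cast
  rw [neg_smul]

lemma dirac_dirac (hT : IsLeviCivita nablaT) (he : ∀ i, SmoothNear E E (e i) x)
    (ho : ∀ᶠ y in 𝓝 x, Orthonormal ℝ (fun i => e i y))
    (hc : Fintype.card ι = finrank ℝ E) (hs : K.sec s x) :
    K.sec (K.dirac s) x ∧ K.dirac (K.dirac s) x
      = ∑ i, ∑ j, K.cliff x (e i x) (K.cliff x (e j x) (second nablaT K (e i) (e j) s x)) := by
  have h1 := K.dirac_eventually hs ho hc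
  have hj : ∀ j, K.sec (fun y => K.cliff y (e j y) (K.cd s y (e j y))) x := fun j =>
    K.sec_cliff (he j) (K.sec_cd (he j) hs)
  have hd : K.sec (K.dirac s) x := K.sec_congr (sec_sum _ hj hs) h1
  refine ⟨hd, ?_⟩
  rw [(K.dirac_eventually hd ho hc).self_of_nhds]
  refine sum_congr rfl fun i _ => ?_
  rw [K.cd_congr (sec_sum _ hj hs) h1, K.cd_sum _ hj hs, ← map_sum]
  congr 1
  have h2 : ∀ j, K.cd (fun y => K.cliff y (e j y) (K.cd s y (e j y))) x (e i x)
      = K.cliff x (nablaT (e j) x (e i x)) (K.cd s x (e j x))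
        + K.cliff x (e j x) (K.cd (fun y => K.cd s y (e j y)) x (e i x)) := fun j =>
    K.cd_cliff (he j) (K.sec_cd (he j) hs) _
  simp only [h2, second, map_sub, sum_add_distrib, sum_sub_distrib]
  rw [K.sum_cliff_nabla hT he ho hc hs]
  abel

/-- The Lichnerowicz formula. -/
lemma two_smul_dirac_dirac (hX : IsKahlerMetric E X) (hT : IsLeviCivita nablaT)
    (he : ∀ i, SmoothNear E E (e i) x) (ho : ∀ᶠ y in 𝓝 x, Orthonormal ℝ (fun i => e i y))
    (hc : Fintype.card ι = finrank ℝ E) (hs : K.sec s x) : (2 : ℂ) • K.dirac (K.dirac s) x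
      = -∑ i, second nablaT K (e i) (e i) s x
        + ∑ i, ∑ j, K.cliff x (e i x) (K.cliff x (e j x) (K.curv (e i) (e j) s x)) := by
  classical
  rw [(K.dirac_dirac hT he ho hc hs).2, two_smul]
  have h1 : ∑ i, ∑ j, K.cliff x (e i x) (K.cliff x (e j x) (K.curv (e i) (e j) s x))
      = ∑ i, ∑ j, K.cliff x (e i x) (K.cliff x (e j x) (second nablaT K (e i) (e j) s x))
        - ∑ i, ∑ j, K.cliff x (e i x) (K.cliff x (e j x) (second nablaT K (e j) (e i) s x)) := by
    simp only [← sum_sub_distrib, ← map_sub, K.second_sub hT (he _) (he _) hs]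
  have h2 : ∑ i, second nablaT K (e i) (e i) s x
      = ∑ i, ∑ j, (((if i = j then 1 else 0 : ℝ)) : ℂ) • second nablaT K (e i) (e j) s x := by
    refine sum_congr rfl fun i _ => ?_
    rw [sum_eq_single i]
    · simp
    · intro j _ hj
      simp [hj.symm]
    · simp
  have h3 : ∀ i j, (((if i = j then 1 else 0 : ℝ)) : ℂ) • second nablaT K (e i) (e j) s x
      = -(K.cliff x (e i x) (K.cliff x (e j x) (second nablaT K (e i) (e j) s x))
        + K.cliff x (e j x) (K.cliff x (e i x) (second nablaT K (e i) (e j) s x))) := by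
    intro i j
    rw [K.cliff_cliff hX, ← orthonormal_iff_ite.1 ho.self_of_nhds i j, neg_smul, neg_neg]
  rw [h2, h1]
  simp only [h3, sum_neg_distrib, sum_add_distrib]
  rw [sum_comm (f := fun i j =>
    K.cliff x (e j x) (K.cliff x (e i x) (second nablaT K (e i) (e j) s x)))]
  abel

end CliffordCalculus

end Dirac

section Divergence

variable {x x₀ y : X} {Z : 𝔛}

/-- The coordinate fields of `finBasis ℝ E`. -/
def chartField (x₀ : X) (i : Fin (finrank ℝ E)) (y : X) : 𝕋 y :=
  coordField x₀ (finBasis ℝ E i) y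

/-- The coordinate fields at `y` as a basis. -/
def chartBasis (hy : y ∈ 𝕌 x₀) :
    Module.Basis (Fin (finrank ℝ E)) ℝ (𝕋 y) :=
  (finBasis ℝ E).map (coordEquiv hy).toLinearEquiv

lemma chartBasis_apply (hy : y ∈ 𝕌 x₀) (i : Fin (finrank ℝ E)) :
    chartBasis hy i = chartField x₀ i y := by
  rw [chartBasis, Module.Basis.map_apply]
  exact coordEquiv_apply hy _

lemma chartField_smoothNear (hy : y ∈ 𝕌 x₀) (i : Fin (finrank ℝ E)) :
    SmoothNear E E (chartField x₀ i) y := coordField_smoothNear hy _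

/-- The Gram determinant of the coordinate fields. -/
def chartGram (x₀ y : X) :
    Matrix (Fin (finrank ℝ E)) (Fin (finrank ℝ E)) ℝ :=
  Matrix.of fun i j => (inner ℝ (chartField x₀ i y) (chartField x₀ j y) : ℝ)

lemma det_chartGram_pos (hy : y ∈ 𝕌 x₀) : 0 < (chartGram (E := E) x₀ y).det := by
  have h : LinearIndependent ℝ (fun i => chartField (E := E) x₀ i y) := by
    have h := (chartBasis hy).linearIndependent
    rwa [show ⇑(chartBasis hy) = fun i => chartField x₀ i y from
      funext fun i => chartBasis_apply hy i] at h
  exact (Matrix.posDef_gram_iff_linearIndependent.2 h).det_pos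

lemma fnNear_chartGram (hy : y ∈ 𝕌 x₀) (i j : Fin (finrank ℝ E)) :
    FnNear E (fun z => chartGram (E := E) x₀ z i j) y :=
  FnNear.inner (chartField_smoothNear hy i) (chartField_smoothNear hy j)

variable (E) in
/-- The Riemannian density as a function on the manifold. -/
def chartDensity (x₀ y : X) : ℝ := Real.sqrt (chartGram (E := E) x₀ y).det

lemma chartDensity_pos (hy : y ∈ 𝕌 x₀) : 0 < chartDensity E x₀ y :=
  Real.sqrt_pos.2 (det_chartGram_pos hy)

lemma fnNear_chartDensity (hy : y ∈ 𝕌 x₀) : FnNear E (chartDensity E x₀) y :=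
  FnNear.sqrt (mvfderiv_det_apply (fnNear_chartGram hy) 0).1 (det_chartGram_pos hy).ne'

/-- The divergence of a vector field. -/
def divergence (nablaT : CovariantDerivative 𝕀 E (fun x : X => 𝕋 x))
    (Z : 𝔛) (y : X) : ℝ :=
  trace ℝ (𝕋 y) (nablaT Z y).toLinearMap

lemma mvfderiv_det_chartGram (hT : IsLeviCivita nablaT) (hy : y ∈ 𝕌 x₀) (l : Fin (finrank ℝ E)) :
    𝕕 (fun z => (chartGram (E := E) x₀ z).det) y (chartField x₀ l y)
      = 2 * (chartGram (E := E) x₀ y).det * divergence nablaT (chartField x₀ l) y := by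
  set A : Matrix (Fin (finrank ℝ E)) (Fin (finrank ℝ E)) ℝ :=
    Matrix.of fun k m => (chartBasis hy).repr (nablaT (chartField x₀ m) y (chartField x₀ l y)) k
    with hA
  have h1 : ∀ m, nablaT (chartField x₀ m) y (chartField x₀ l y)
      = ∑ k, A k m • chartField x₀ k y := by
    intro m
    have h := (chartBasis hy).sum_repr (nablaT (chartField x₀ m) y (chartField x₀ l y))
    simp only [chartBasis_apply] at h
    exact h.symm
  have h2 : divergence nablaT (chartField x₀ l) y = A.trace := by
    rw [divergence, LinearMap.trace_eq_matrix_trace ℝ (chartBasis hy), Matrix.trace, Matrix.trace]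
    refine sum_congr rfl fun m _ => ?_
    rw [Matrix.diag_apply, LinearMap.toMatrix_apply, chartBasis_apply, Matrix.diag_apply, hA,
      Matrix.of_apply]
    exact congrArg (fun b => (chartBasis hy).repr b m) (hT.coordField_symm hy _ _)
  have h3 : (Matrix.of fun i j => 𝕕 (fun z => chartGram (E := E) x₀ z i j) y
      (chartField x₀ l y)) = A.transpose * chartGram x₀ y + chartGram x₀ y * A := by
    ext i j
    rw [Matrix.of_apply, Matrix.add_apply, Matrix.mul_apply, Matrix.mul_apply]
    refine (hT.metric_near (chartField_smoothNear hy i) (chartField_smoothNear hy j) _).trans ?_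
    rw [h1, h1, sum_inner, inner_sum]
    simp only [real_inner_smul_left, real_inner_smul_right]
    congr 1
    refine sum_congr rfl fun k _ => ?_
    rw [mul_comm]
    rfl
  rw [(mvfderiv_det_apply (fnNear_chartGram hy) _).2, h3, h2, Matrix.mul_add, Matrix.trace_add,
    ← Matrix.mul_assoc, ← Matrix.mul_assoc, Matrix.adjugate_mul, Matrix.trace_mul_comm,
    ← Matrix.mul_assoc, Matrix.mul_adjugate]
  simp only [Matrix.smul_mul, Matrix.one_mul, Matrix.trace_smul, Matrix.trace_transpose,
    smul_eq_mul]
  ring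

lemma density_mul_divergence (hT : IsLeviCivita nablaT) (hy : y ∈ 𝕌 x₀)
    {c : Fin (finrank ℝ E) → X → ℝ} (hc : ∀ i, FnNear E (c i) y)
    (hZ : ∀ᶠ z in 𝓝 y, Z z = ∑ i, c i z • chartField x₀ i z) :
    chartDensity E x₀ y * divergence nablaT Z y
      = ∑ l, 𝕕 (fun z => chartDensity E x₀ z * c l z) y (chartField x₀ l y) := by
  have hρ := fnNear_chartDensity (E := E) hy
  have hs : ∀ i, SmoothNear E E (fun z => c i z • chartField x₀ i z) y := fun i =>
    SmoothNear.smul (hc i) (chartField_smoothNear hy i)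
  have hdiv : divergence nablaT Z y = ∑ l, (c l y * divergence nablaT (chartField x₀ l) y
      + 𝕕 (c l) y (chartField x₀ l y)) := by
    have h1 : ∀ a, nablaT Z y a = ∑ l, (c l y • nablaT (chartField x₀ l) y a
        + 𝕕 (c l) y a • chartField x₀ l y) := by
      intro a
      rw [conn_congr nablaT (SmoothNear.sum fun i _ => hs i) hZ, conn_sum nablaT _ fun i _ => hs i]
      exact sum_congr rfl fun l _ =>
        conn_smul nablaT (hc l) (chartField_smoothNear hy l) a
    have h2 : (nablaT Z y).toLinearMap = ∑ l, (c l y • (nablaT (chartField x₀ l) y).toLinearMap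
        + LinearMap.smulRight (𝕕 (c l) y).toLinearMap (chartField x₀ l y)) := by
      refine LinearMap.ext fun a => ?_
      rw [LinearMap.sum_apply]
      exact h1 a
    rw [divergence, h2, map_sum]
    refine sum_congr rfl fun l _ => ?_
    rw [map_add, map_smul, LinearMap.trace_smulRight]
    rfl
  have hdρ : ∀ l, 𝕕 (chartDensity E x₀) y (chartField x₀ l y)
      = chartDensity E x₀ y * divergence nablaT (chartField x₀ l) y := by
    intro l
    have h1 : (fun z => (chartGram (E := E) x₀ z).det) =ᶠ[𝓝 y]
        fun z => chartDensity E x₀ z * chartDensity E x₀ z := by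
      filter_upwards [(chartAt E x₀).open_source.mem_nhds hy] with z hz
      exact (Real.mul_self_sqrt (det_chartGram_pos hz).le).symm
    have h2 := mvfderiv_det_chartGram hT hy l
    rw [mvfderiv_congr h1, mvfderiv_mul_apply hρ.mdiff hρ.mdiff, show (chartGram (E := E) x₀ y).det = _ from h1.self_of_nhds] at h2
    have h3 := (chartDensity_pos (E := E) hy).ne'
    apply mul_left_cancel₀ h3
    linear_combination h2 / 2
  rw [hdiv, mul_sum]
  refine sum_congr rfl fun l _ => ?_
  rw [mvfderiv_mul_apply hρ.mdiff (hc l).mdiff, hdρ l]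
  ring

end Divergence

section Integration

variable [MeasurableSpace E] [BorelSpace E] [MeasurableSpace X] [BorelSpace X]
  {x x₀ y : X} {Z : 𝔛} {vol : Measure X}

lemma integral_fderiv_eq_zero (μ : Measure E) [μ.IsAddHaarMeasure] {u : E → ℝ}
    (hu : ContDiff ℝ 1 u) (hc : HasCompactSupport u) (v : E) : ∫ z, fderiv ℝ u z v ∂μ = 0 := by
  have h1 : Integrable (fun z => fderiv ℝ u z v) μ := by
    refine Continuous.integrable_of_hasCompactSupport
      ((hu.continuous_fderiv one_ne_zero).clm_apply continuous_const) ?_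
    exact (hc.fderiv (𝕜 := ℝ)).comp_left (g := fun A : E →L[ℝ] ℝ => A v) (by simp)
  have h := integral_mul_fderiv_eq_neg_fderiv_mul_of_integrable (μ := μ) (f := fun _ => (1 : ℝ))
    (g := u) (v := v) (by simp) (by simpa using h1)
    (by simpa using hu.continuous.integrable_of_hasCompactSupport hc)
    (fun _ _ => differentiableAt_const _) (fun z _ => (hu.differentiable one_ne_zero) z)
  simpa using h

lemma mfderiv_extChartAt_symm {z : E} (hz : z ∈ (φ₀).target) (w : E) : mfderiv 𝕀 𝕀 (φ₀).symm z w
      = coordField x₀ w ((φ₀).symm z) := by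
  have hy : (φ₀).symm z ∈ (φ₀).source :=
    (φ₀).map_target hz
  have h := mfderivWithin_extChartAt_symm_comp_mfderiv_extChartAt' (I := 𝕀) hy
  have h2 := congrArg (fun A => A (coordField x₀ w ((φ₀).symm z))) h
  rw [extChartAt_source] at hy
  simp only [ContinuousLinearMap.comp_apply] at h2
  rw [mfderiv_extChartAt_coordField hy] at h2
  rw [(φ₀).right_inv hz] at h2
  rw [modelWithCornersSelf_coe, Set.range_id, mfderivWithin_univ] at h2
  exact h2

lemma volumeDensity_eq {z : E} (hz : z ∈ (φ₀).target) :
    volumeDensity x₀ z = chartDensity E x₀ ((φ₀).symm z) := by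
  unfold volumeDensity chartDensity chartGram chartField
  simp only [mfderiv_extChartAt_symm hz]

lemma continuousOn_volumeDensity : ContinuousOn (volumeDensity (E := E) x₀) (φ₀).target := by
  have h : ContinuousOn (fun z => chartDensity E x₀ ((φ₀).symm z))
      (φ₀).target := by
    refine ContinuousOn.comp (g := chartDensity E x₀) (t := (φ₀).source)
      (fun y hy => ?_) (continuousOn_extChartAt_symm x₀) (φ₀).mapsTo_symm
    rw [extChartAt_source] at hy
    exact (fnNear_chartDensity hy).contMDiffAt.continuousAt.continuousWithinAt
  exact h.congr fun z hz => volumeDensity_eq hz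

lemma isOpen_chart_target : IsOpen (φ₀).target := isOpen_extChartAt_target x₀

lemma IsRiemannianVolume.restrict_chart (hvol : IsRiemannianVolume E vol) (x₀ : X) :
    vol.restrict 𝕌 x₀ = Measure.map (φ₀).symm
        (((finBasis ℝ E).addHaar.restrict (φ₀).target).withDensity
          fun z => ENNReal.ofReal (volumeDensity x₀ z)) := by
  have hT : MeasurableSet (φ₀).target := isOpen_chart_target.measurableSet
  have hm : AEMeasurable (φ₀).symm
      (((finBasis ℝ E).addHaar.restrict (φ₀).target).withDensity
          fun z => ENNReal.ofReal (volumeDensity x₀ z)) :=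
    ((continuousOn_extChartAt_symm x₀).aemeasurable hT).mono_ac (withDensity_absolutelyContinuous _ _)
  ext A hA
  rw [Measure.restrict_apply hA, Measure.map_apply_of_aemeasurable hm hA, withDensity_apply',
    Measure.restrict_restrict' hT, hvol x₀ _
      (hA.inter (chartAt E x₀).open_source.measurableSet) Set.inter_subset_right,
    PartialEquiv.image_eq_target_inter_inv_preimage _ (by
      rw [extChartAt_source]; exact Set.inter_subset_right)]
  congr 2
  ext z
  simp only [Set.mem_inter_iff, Set.mem_preimage]
  constructor
  · rintro ⟨h1, h2, _⟩; exact ⟨h2, h1⟩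
  · rintro ⟨h1, h2⟩
    refine ⟨h2, h1, ?_⟩
    have := (φ₀).map_target h2
    rwa [extChartAt_source] at this

lemma IsRiemannianVolume.setIntegral_chart (hvol : IsRiemannianVolume E vol) (x₀ : X) {f : X → ℝ}
    (hf : Continuous f) : ∫ x in 𝕌 x₀, f x ∂vol = ∫ z in (φ₀).target,
          chartDensity E x₀ ((φ₀).symm z) * f ((φ₀).symm z) ∂(finBasis ℝ E).addHaar := by
  have hT : MeasurableSet (φ₀).target := isOpen_chart_target.measurableSet
  have hm : AEMeasurable (φ₀).symm
      (((finBasis ℝ E).addHaar.restrict (φ₀).target).withDensity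
          fun z => ENNReal.ofReal (volumeDensity x₀ z)) :=
    ((continuousOn_extChartAt_symm x₀).aemeasurable hT).mono_ac (withDensity_absolutelyContinuous _ _)
  rw [hvol.restrict_chart x₀, integral_map hm hf.measurable.aestronglyMeasurable,
    integral_withDensity_eq_integral_toReal_smul₀
      (continuousOn_volumeDensity.aemeasurable hT).ennreal_ofReal (by simp)]
  refine setIntegral_congr_fun hT fun z hz => ?_
  rw [volumeDensity_eq hz, ENNReal.toReal_ofReal (show 0 ≤ chartDensity E x₀ _ from Real.sqrt_nonneg _),
    smul_eq_mul]

lemma IsRiemannianVolume.isFiniteMeasureOnCompacts (hvol : IsRiemannianVolume E vol) :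
    IsFiniteMeasureOnCompacts vol := by
  have h : IsLocallyFiniteMeasure vol := by
    refine ⟨fun x₀ => ?_⟩
    set φ := φ₀
    have hT : φ.target ∈ 𝓝 (φ x₀) := extChartAt_target_mem_nhds x₀
    have hρ := (continuousOn_volumeDensity (E := E) (x₀ := x₀)).continuousAt hT
    obtain ⟨r, hr, hb⟩ := Metric.mem_nhds_iff.1 (Filter.inter_mem hT
      (hρ.eventually (eventually_lt_nhds (lt_add_one (volumeDensity x₀ (φ x₀))))))
    have ho : IsOpen (φ.source ∩ φ ⁻¹' Metric.ball (φ x₀) r) :=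
      (continuousOn_extChartAt x₀).isOpen_inter_preimage (isOpen_extChartAt_source x₀)
        Metric.isOpen_ball
    refine ⟨φ.source ∩ φ ⁻¹' Metric.ball (φ x₀) r,
      ho.mem_nhds ⟨mem_extChartAt_source x₀, Metric.mem_ball_self hr⟩, ?_⟩
    rw [hvol x₀ _ ho.measurableSet (by
      rw [← extChartAt_source 𝕀]; exact Set.inter_subset_left)]
    have hsub : φ '' (φ.source ∩ φ ⁻¹' Metric.ball (φ x₀) r) ⊆ Metric.ball (φ x₀) r := by
      rintro _ ⟨z, hz, rfl⟩; exact hz.2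
    calc _ ≤ ∫⁻ z in Metric.ball (φ x₀) r, ENNReal.ofReal (volumeDensity x₀ z)
              ∂(finBasis ℝ E).addHaar := lintegral_mono_set hsub
      _ ≤ ∫⁻ z in Metric.ball (φ x₀) r, ENNReal.ofReal (volumeDensity x₀ (φ x₀) + 1)
              ∂(finBasis ℝ E).addHaar :=
        setLIntegral_mono' measurableSet_ball fun z hz =>
          ENNReal.ofReal_le_ofReal (hb hz).2.le
      _ < ⊤ := by
        rw [setLIntegral_const]
        exact ENNReal.mul_lt_top ENNReal.ofReal_lt_top measure_ball_lt_top
  infer_instance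

lemma IsRiemannianVolume.isOpenPosMeasure (hvol : IsRiemannianVolume E vol) :
    vol.IsOpenPosMeasure := by
  refine ⟨fun W hW ⟨x₀, hx₀⟩ h0 => ?_⟩
  set φ := φ₀
  have ho : IsOpen (W ∩ 𝕌 x₀) := hW.inter (chartAt E x₀).open_source
  have h1 : vol (W ∩ 𝕌 x₀) = 0 := measure_mono_null Set.inter_subset_left h0
  rw [hvol x₀ _ ho.measurableSet Set.inter_subset_right] at h1
  have hsub : W ∩ 𝕌 x₀ ⊆ φ.source := by
    rw [extChartAt_source]; exact Set.inter_subset_right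
  have hi := PartialEquiv.image_eq_target_inter_inv_preimage φ hsub
  have hio : IsOpen (φ '' (W ∩ 𝕌 x₀)) := by
    rw [hi]
    exact (continuousOn_extChartAt_symm x₀).isOpen_inter_preimage isOpen_chart_target ho
  have hsubT : φ '' (W ∩ 𝕌 x₀) ⊆ φ.target := by
    rw [hi]; exact Set.inter_subset_left
  rw [lintegral_eq_zero_iff'
    ((continuousOn_volumeDensity.mono hsubT).aemeasurable hio.measurableSet).ennreal_ofReal,
    Filter.EventuallyEq, ae_restrict_iff' hio.measurableSet] at h1
  have h2 : (finBasis ℝ E).addHaar (φ '' (W ∩ 𝕌 x₀)) = 0 := by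
    rw [← MeasureTheory.compl_mem_ae_iff]
    filter_upwards [h1] with z hz hz'
    have h3 := hz hz'
    rw [Pi.zero_apply, ENNReal.ofReal_eq_zero, volumeDensity_eq (hsubT hz')] at h3
    refine absurd (chartDensity_pos ?_) (not_lt.2 h3)
    have := φ.map_target (hsubT hz')
    rwa [extChartAt_source] at this
  exact (hio.measure_pos _ ⟨φ x₀, x₀, ⟨hx₀, mem_chart_source E x₀⟩, rfl⟩).ne' h2

/-- The components of a vector field in the chart at `x₀`. -/
def chartComponent (x₀ : X) (Z : 𝔛) (l : Fin (finrank ℝ E))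
    (y : X) : ℝ :=
  open Classical in if hy : y ∈ 𝕌 x₀ then (chartBasis hy).repr (Z y) l else 0

lemma sum_chartComponent (hy : y ∈ 𝕌 x₀) :
    Z y = ∑ l, chartComponent x₀ Z l y • chartField x₀ l y := by
  simp only [chartComponent, dif_pos hy, ← chartBasis_apply hy]
  exact ((chartBasis hy).sum_repr (Z y)).symm

lemma fnNear_chartComponent (hy : y ∈ 𝕌 x₀) (hZ : SmoothNear E E Z y)
    (l : Fin (finrank ℝ E)) : FnNear E (chartComponent x₀ Z l) y := by
  obtain ⟨c, hc, h⟩ := exists_coordField_expansion hy (finBasis ℝ E) hZ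
  refine (hc l).congr ?_
  filter_upwards [h, (chartAt E x₀).open_source.mem_nhds hy] with z hz hz'
  rw [chartComponent, dif_pos hz', hz]
  have h2 : ∀ i, coordField x₀ (finBasis ℝ E i) z = chartBasis hz' i := fun i =>
    (chartBasis_apply hz' i).symm
  simp only [h2]
  rw [(chartBasis hz').repr_sum_self (fun i => c i z)]

lemma fnNear_divergence (hT : IsLeviCivita nablaT) (hZ : SmoothNear E E Z y) :
    FnNear E (divergence nablaT Z) y := by
  have hy := mem_chart_source E y
  have h : FnNear E (fun z => (chartDensity E y z)⁻¹ *
      ∑ l, 𝕕 (fun z => chartDensity E y z * chartComponent y Z l z) z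
        (chartField y l z)) y := by
    refine FnNear.mul ?_ (FnNear.sum fun l _ => FnNear.mvfderiv_coordField hy
      ((fnNear_chartDensity hy).mul (fnNear_chartComponent hy hZ l)) _)
    filter_upwards [(fnNear_chartDensity hy).eventually,
      (chartAt E y).open_source.mem_nhds hy] with z hz hz'
    exact ContMDiffAt.inv₀ hz.contMDiffAt (chartDensity_pos hz').ne'
  refine h.congr ?_
  filter_upwards [hZ.eventually, (chartAt E y).open_source.mem_nhds hy] with z hz hz'
  rw [← density_mul_divergence hT hz' (fun l => fnNear_chartComponent hz' hz l)
    (Filter.eventually_of_mem ((chartAt E y).open_source.mem_nhds hz') fun a ha =>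
      sum_chartComponent ha)]
  field_simp [(chartDensity_pos hz').ne']

lemma divergence_eq_zero (hZ : ∀ᶠ z in 𝓝 y, Z z = 0) : divergence nablaT Z y = 0 := by
  have h : nablaT Z y = 0 := by
    ext a
    have h1 := conn_congr nablaT (s := fun _ => 0) (t := Z) SmoothNear.zero hZ
    have h2 := conn_smul nablaT (x := y) (f := fun _ => 0) (s := fun _ => 0) (FnNear.const 0)
      SmoothNear.zero a
    simp only [smul_zero, zero_smul, add_zero] at h2
    rw [h1, h2]; rfl
  simp [divergence, h]

lemma integral_divergence_of_chart (hvol : IsRiemannianVolume E vol) [CompactSpace X]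
    (hT : IsLeviCivita nablaT) (hZ : ∀ y, SmoothNear E E Z y) (x₀ : X) {K : Set X}
    (hK : IsClosed K) (hKs : K ⊆ 𝕌 x₀) (hZK : ∀ y ∉ K, Z y = 0) :
    ∫ y, divergence nablaT Z y ∂vol = 0 := by
  set φ := φ₀ with hφ
  have hsrc : φ.source = 𝕌 x₀ := extChartAt_source _ _
  have hcont : Continuous (divergence nablaT Z) := continuous_iff_continuousAt.2 fun y =>
    (fnNear_divergence hT (hZ y)).contMDiffAt.continuousAt
  have h0 : ∀ y ∉ K, divergence nablaT Z y = 0 := fun y hy => divergence_eq_zero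
    (Filter.eventually_of_mem (hK.isOpen_compl.mem_nhds hy) hZK)
  rw [← setIntegral_eq_integral_of_forall_compl_eq_zero (s := 𝕌 x₀)
    fun y hy => h0 y fun h => hy (hKs h), hvol.setIntegral_chart x₀ hcont]
  have hcomp0 : ∀ y ∉ K, ∀ l, chartComponent x₀ Z l y = 0 := by
    intro y hy l
    unfold chartComponent
    split_ifs
    · rw [hZK y hy]; simp
    · rfl
  let u : Fin (finrank ℝ E) → E → ℝ := fun l => φ.target.indicator
    fun z => chartDensity E x₀ (φ.symm z) * chartComponent x₀ Z l (φ.symm z)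
  have hKc : IsCompact (φ '' K) := hK.isCompact.image_of_continuousOn
    ((continuousOn_extChartAt x₀).mono (by rw [extChartAt_source]; exact hKs))
  have hu0 : ∀ l, ∀ z ∉ φ '' K, u l z = 0 := by
    intro l z hz
    by_cases hzT : z ∈ φ.target
    · have : φ.symm z ∉ K := fun h => hz ⟨_, h, φ.right_inv hzT⟩
      simp [u, hzT, hcomp0 _ this]
    · simp [u, hzT]
  have huT : ∀ l, ∀ z ∈ φ.target, u l =ᶠ[𝓝 z]
      (fun y => chartDensity E x₀ y * chartComponent x₀ Z l y) ∘ φ.symm := by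
    intro l z hz
    filter_upwards [(isOpen_chart_target (E := E) (x₀ := x₀)).mem_nhds hz] with a ha
    exact Set.indicator_of_mem ha _
  have hfn : ∀ l, ∀ z ∈ φ.target,
      FnNear E (fun y => chartDensity E x₀ y * chartComponent x₀ Z l y) (φ.symm z) := by
    intro l z hz
    have hy : φ.symm z ∈ 𝕌 x₀ := hsrc ▸ φ.map_target hz
    exact (fnNear_chartDensity hy).mul (fnNear_chartComponent hy (hZ _) l)
  have hus : ∀ l, ContDiff ℝ 1 (u l) := by
    intro l
    rw [contDiff_iff_contDiffAt]
    intro z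
    by_cases hzT : z ∈ φ.target
    · have hy : φ.symm z ∈ 𝕌 x₀ := hsrc ▸ φ.map_target hzT
      have h := contDiffAt_comp_symm (n := 1) hy ((hfn l z hzT).contMDiffAt.of_le (by simp))
      rw [← hφ, φ.right_inv hzT] at h
      exact h.congr_of_eventuallyEq (huT l z hzT)
    · have hz : z ∉ φ '' K := by
        rintro ⟨y, hy, rfl⟩
        exact hzT (φ.map_source (hsrc ▸ hKs hy))
      refine contDiffAt_const (c := (0 : ℝ)).congr_of_eventuallyEq ?_
      filter_upwards [hKc.isClosed.isOpen_compl.mem_nhds hz] with a ha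
      exact hu0 l a ha
  have key : ∀ z ∈ φ.target, chartDensity E x₀ (φ.symm z) * divergence nablaT Z (φ.symm z)
      = ∑ l, fderiv ℝ (u l) z (finBasis ℝ E l) := by
    intro z hz
    have hy : φ.symm z ∈ 𝕌 x₀ := hsrc ▸ φ.map_target hz
    rw [density_mul_divergence hT hy (fun l => fnNear_chartComponent hy (hZ _) l)
      (Filter.eventually_of_mem ((chartAt E x₀).open_source.mem_nhds hy) fun a ha =>
        sum_chartComponent ha)]
    refine sum_congr rfl fun l _ => ?_
    rw [chartField, mvfderiv_coordField hy ((hfn l z hz).contMDiffAt.of_le (by simp)), ← hφ,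
      φ.right_inv hz, (huT l z hz).fderiv_eq]
  have hcs : ∀ l, HasCompactSupport (u l) := fun l => HasCompactSupport.intro hKc (hu0 l)
  rw [setIntegral_congr_fun (isOpen_chart_target (E := E) (x₀ := x₀)).measurableSet key,
    setIntegral_eq_integral_of_forall_compl_eq_zero, integral_finsetSum]
  · exact sum_eq_zero fun l _ => integral_fderiv_eq_zero _ (hus l) (hcs l) _
  · intro l _
    refine Continuous.integrable_of_hasCompactSupport
      (((hus l).continuous_fderiv one_ne_zero).clm_apply continuous_const) ?_
    exact ((hcs l).fderiv (𝕜 := ℝ)).comp_left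
      (g := fun A : E →L[ℝ] ℝ => A (finBasis ℝ E l)) (by simp)
  · intro z hz
    refine sum_eq_zero fun l _ => ?_
    have hz' : z ∉ φ '' K := by
      rintro ⟨y, hy, rfl⟩
      exact hz (φ.map_source (hsrc ▸ hKs hy))
    have : u l =ᶠ[𝓝 z] fun _ => 0 := by
      filter_upwards [hKc.isClosed.isOpen_compl.mem_nhds hz'] with a ha
      exact hu0 l a ha
    rw [this.fderiv_eq]; simp

/-- The divergence theorem on a compact manifold. -/
lemma integral_divergence (hvol : IsRiemannianVolume E vol) [CompactSpace X]
    (hT : IsLeviCivita nablaT) (hZ : ∀ y, SmoothNear E E Z y) :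
    ∫ y, divergence nablaT Z y ∂vol = 0 := by
  have := hvol.isFiniteMeasureOnCompacts
  obtain ⟨f, hf⟩ := SmoothPartitionOfUnity.exists_isSubordinate_chartAt_source 𝕀 X
  have hfin : {i | (Function.support (f i)).Nonempty}.Finite :=
    f.locallyFinite.finite_nonempty_of_compact
  have hfs : ∀ i y, FnNear E (fun z => f i z) y := fun i y =>
    .of_forall fun z => (f i).contMDiff z
  have hs : ∀ y, ∑ i ∈ hfin.toFinset, f i y = 1 := by
    intro y
    rw [← f.sum_eq_one (Set.mem_univ y), finsum_eq_sum_of_support_subset]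
    intro i hi
    rw [Set.Finite.coe_toFinset]
    exact ⟨y, hi⟩
  have hsm : ∀ i y, SmoothNear E E (fun z => f i z • Z z) y := fun i y =>
    SmoothNear.smul (hfs i y) (hZ y)
  have hdiv : ∀ y, divergence nablaT Z y
      = ∑ i ∈ hfin.toFinset, divergence nablaT (fun z => f i z • Z z) y := by
    intro y
    have h1 : nablaT Z y = ∑ i ∈ hfin.toFinset, nablaT (fun z => f i z • Z z) y := by
      ext a
      rw [_root_.sum_apply, ← conn_sum nablaT _ (fun i _ => hsm i y)]
      congr 2
      funext z
      rw [← sum_smul, hs, one_smul]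
    simp only [divergence, h1]
    simp
  simp only [hdiv]
  rw [integral_finsetSum]
  · refine sum_eq_zero fun i _ => integral_divergence_of_chart hvol hT (hsm i) i
      (isClosed_tsupport (f i)) (hf i) fun y hy => ?_
    rw [image_eq_zero_of_notMem_tsupport hy, zero_smul]
  · intro i _
    refine Continuous.integrable_of_hasCompactSupport (continuous_iff_continuousAt.2 fun y =>
      (fnNear_divergence hT (hsm i y)).contMDiffAt.continuousAt) (HasCompactSupport.of_compactSpace _)

end Integration

section Green

variable (K : CliffordCalculus nablaT S) {r s t : Π y : X, S y} {x : X}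

namespace CliffordCalculus

/-- The real linear form `v ↦ Re ⟨ξ, i_v η⟩`. -/
def hermContr (x : X) (ξ η : S x) : 𝕋 x →ₗ[ℝ] ℝ where
  toFun v := (K.herm x ξ (K.contr x v η)).re
  map_add' a b := by rw [K.contr_add, map_add, Complex.add_re]
  map_smul' c a := by
    rw [K.contr_smul, map_smul, smul_eq_mul, Complex.re_ofReal_mul]; rfl

/-- The vector field dual to `v ↦ Re ⟨r, i_v s⟩`. -/
def greenField (r s : Π y : X, S y) (x : X) : 𝕋 x :=
  ∑ i, K.hermContr x (r x) (s x) (stdOrthonormalBasis ℝ (𝕋 x) i) • stdOrthonormalBasis ℝ (𝕋 x) i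

lemma greenField_eq {ι : Type*} [Fintype ι] (e : OrthonormalBasis ι ℝ (𝕋 x)) :
    K.greenField r s x = ∑ i, K.hermContr x (r x) (s x) (e i) • e i :=
  sum_orthonormalBasis_eq (stdOrthonormalBasis ℝ _) e
    (LinearMap.toSpanSingleton ℝ _ LinearMap.id ∘ₗ K.hermContr x (r x) (s x))

lemma exists_greenField_expansion (hr : K.sec r x) (hs : K.sec s x) : ∃ e : Fin (finrank ℝ E) → 𝔛,
      (∀ i, SmoothNear E E (e i) x) ∧ (∀ᶠ y in 𝓝 x, Orthonormal ℝ (fun i => e i y)) ∧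
      (∀ i, FnNear E (fun y => K.herm y (r y) (K.contr y (e i y) (s y))) x) ∧
      ∀ᶠ y in 𝓝 x, K.greenField r s y
        = ∑ i, (K.herm y (r y) (K.contr y (e i y) (s y))).re • e i y := by
  obtain ⟨e, he, ho⟩ := exists_orthonormal_frame E x
  refine ⟨e, he, ho, fun i => K.herm_near hr (K.sec_contr (he i) hs), ?_⟩
  filter_upwards [ho] with y hy
  have := K.greenField_eq (r := r) (s := s) (orthonormalBasisOf hy (by simp))
  simp only [coe_orthonormalBasisOf] at this
  exact this

lemma smoothNear_greenField (hr : K.sec r x) (hs : K.sec s x) :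
    SmoothNear E E (K.greenField r s) x := by
  obtain ⟨e, he, _, hf, h⟩ := K.exists_greenField_expansion hr hs
  exact (SmoothNear.sum fun i _ => SmoothNear.smul ((hf i).clm reCLM) (he i)).congr h

lemma divergence_greenField (hT : IsLeviCivita nablaT) (hr : K.sec r x) (hs : K.sec s x) :
    divergence nablaT (K.greenField r s) x
      = (K.herm x (K.dbar r x) (s x) - K.herm x (r x) (K.dbarStar s x)).re := by
  obtain ⟨e, he, ho, hf, h⟩ := K.exists_greenField_expansion hr hs
  have hre : ∀ i, FnNear E (fun y => (K.herm y (r y) (K.contr y (e i y) (s y))).re) x :=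
    fun i => (hf i).clm reCLM
  have hsm := fun i => SmoothNear.smul (hre i) (he i)
  set b := orthonormalBasisOf ho.self_of_nhds (by simp) with hb
  have hbe : ∀ i, b i = e i x := fun i => by rw [hb, coe_orthonormalBasisOf]
  have hder : ∀ i v, 𝕕 (fun y => (K.herm y (r y) (K.contr y (e i y) (s y))).re) x v
      = (K.herm x (K.cd r x v) (K.contr x (e i x) (s x))).re
        + K.hermContr x (r x) (s x) (nablaT (e i) x v)
        + (K.herm x (r x) (K.contr x (e i x) (K.cd s x v))).re := by
    intro i v
    have h1 := mvfderiv_clm reCLM (hf i).mdiff v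
    have h2 := K.herm_cd hr (K.sec_contr (he i) hs) v
    rw [h2, K.cd_contr (he i) hs, map_add, map_add, map_add] at h1
    refine h1.trans ?_
    simp only [Complex.reCLM_apply, hermContr, LinearMap.coe_mk, AddHom.coe_mk]
    ring
  have hexp : ∀ k, K.hermContr x (r x) (s x) (nablaT (e k) x (e k x))
      = ∑ i, (inner ℝ (e i x) (nablaT (e k) x (e k x)) : ℝ)
        * K.hermContr x (r x) (s x) (e i x) := by
    intro k
    conv_lhs => rw [← b.sum_repr' (nablaT (e k) x (e k x))]
    simp only [map_sum, map_smul, smul_eq_mul, hbe]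
  rw [divergence, LinearMap.trace_eq_sum_inner _ b, K.dbar_eq hr b, K.dbarStar_eq hs b,
    conn_congr nablaT (SmoothNear.sum fun i _ => hsm i) h]
  simp only [hbe, ContinuousLinearMap.coe_coe]
  have h1 : ∀ k, (inner ℝ (e k x) (nablaT (fun y => ∑ i,
      (K.herm y (r y) (K.contr y (e i y) (s y))).re • e i y) x (e k x)) : ℝ)
      = 𝕕 (fun y => (K.herm y (r y) (K.contr y (e k y) (s y))).re) x (e k x)
        - K.hermContr x (r x) (s x) (nablaT (e k) x (e k x)) := by
    intro k
    rw [conn_sum nablaT _ fun i _ => hsm i, inner_sum, hexp k, sub_eq_add_neg, ← sum_neg_distrib]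
    have h2 : ∀ i, (inner ℝ (e k x) (nablaT (fun y =>
        (K.herm y (r y) (K.contr y (e i y) (s y))).re • e i y) x (e k x)) : ℝ)
        = (if k = i then 𝕕
            (fun y => (K.herm y (r y) (K.contr y (e i y) (s y))).re) x (e k x) else 0)
          + -((inner ℝ (e i x) (nablaT (e k) x (e k x)) : ℝ)
            * K.hermContr x (r x) (s x) (e i x)) := by
      intro i
      have h3 : (inner ℝ (e k x) (e i x) : ℝ) = if k = i then 1 else 0 :=
        orthonormal_iff_ite.1 ho.self_of_nhds k i
      rw [conn_smul nablaT (hre i) (he i), inner_add_right, inner_smul_right, inner_smul_right, h3,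
        real_inner_comm, nabla_skew hT he ho i k (e k x),
        real_inner_comm (nablaT (e k) x (e k x)) (e i x)]
      change (K.hermContr x (r x) (s x) (e i x)) * _ + _ = _
      split_ifs <;> ring
    simp only [h2, sum_add_distrib, Finset.sum_ite_eq, Finset.mem_univ, if_true]
  simp only [h1, hder]
  rw [map_sum, LinearMap.sum_apply, map_neg, map_sum]
  simp only [K.herm_wedge, sub_neg_eq_add]
  rw [← sum_add_distrib, Complex.re_sum]
  exact sum_congr rfl fun k _ => by rw [Complex.add_re]; ring

variable {K}

lemma sec_dbar (hs : K.sec s x) : K.sec (K.dbar s) x := by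
  obtain ⟨e, he, ho⟩ := exists_orthonormal_frame E x
  refine K.sec_congr (sec_sum Finset.univ (fun i => K.sec_wedge (he i) (K.sec_cd (he i) hs)) hs) ?_
  filter_upwards [ho, K.sec_eventually hs] with y hy hsy
  have := K.dbar_eq hsy (orthonormalBasisOf hy (by simp))
  simp only [coe_orthonormalBasisOf] at this
  exact this

lemma sec_dbarStar (hs : K.sec s x) : K.sec (K.dbarStar s) x := by
  obtain ⟨e, he, ho⟩ := exists_orthonormal_frame E x
  refine K.sec_congr
    (sec_neg (sec_sum Finset.univ (fun i => K.sec_contr (he i) (K.sec_cd (he i) hs)) hs)) ?_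
  filter_upwards [ho, K.sec_eventually hs] with y hy hsy
  have := K.dbarStar_eq hsy (orthonormalBasisOf hy (by simp))
  simp only [coe_orthonormalBasisOf] at this
  exact this

lemma dbarStar_const_smul (c : ℂ) (hs : K.sec s x) :
    K.dbarStar (fun y => c • s y) x = c • K.dbarStar s x := by
  rw [K.dbarStar_eq (K.sec_smul (FnNear.const c) hs) (stdOrthonormalBasis ℝ _),
    K.dbarStar_eq hs (stdOrthonormalBasis ℝ _), smul_neg, smul_sum]
  simp only [K.cd_const_smul c hs, map_smul]

variable [CompactSpace X] [MeasurableSpace E] [BorelSpace E] [MeasurableSpace X] [BorelSpace X]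
  {vol : Measure X}

lemma continuous_herm (hr : ∀ x, K.sec r x) (hs : ∀ x, K.sec s x) :
    Continuous fun x => K.herm x (r x) (s x) := continuous_iff_continuousAt.2 fun x =>
  (K.herm_near (hr x) (hs x)).contMDiffAt.continuousAt

/-- `dbarStar` is the formal adjoint of `dbar`. -/
lemma integral_herm_dbar (hvol : IsRiemannianVolume E vol) (hT : IsLeviCivita nablaT)
    (hr : ∀ x, K.sec r x) (hs : ∀ x, K.sec s x) :
    ∫ x, K.herm x (K.dbar r x) (s x) ∂vol = ∫ x, K.herm x (r x) (K.dbarStar s x) ∂vol := by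
  have := hvol.isFiniteMeasureOnCompacts
  have hc1 := continuous_herm (fun x => sec_dbar (hr x)) hs
  have hc2 := continuous_herm hr (fun x => sec_dbarStar (hs x))
  have hi1 : Integrable _ vol :=
    hc1.integrable_of_hasCompactSupport (HasCompactSupport.of_compactSpace _)
  have hi2 : Integrable _ vol :=
    hc2.integrable_of_hasCompactSupport (HasCompactSupport.of_compactSpace _)
  have key : ∀ t : Π y : X, S y, (∀ x, K.sec t x) →
      ∫ x, (K.herm x (K.dbar r x) (t x) - K.herm x (r x) (K.dbarStar t x)).re ∂vol = 0 := by
    intro t ht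
    simp only [← K.divergence_greenField hT (hr _) (ht _)]
    exact integral_divergence hvol hT fun x => K.smoothNear_greenField (hr x) (ht x)
  rw [← sub_eq_zero, ← integral_sub hi1 hi2]
  apply Complex.ext
  · exact (reCLM.integral_comp_comm (hi1.sub hi2)).symm.trans (key s hs)
  · refine (imCLM.integral_comp_comm (hi1.sub hi2)).symm.trans ?_
    rw [Complex.zero_im, ← key (fun y => (-I) • s y)
      fun x => K.sec_smul (FnNear.const _) (hs x)]
    refine integral_congr_ae (.of_forall fun x => ?_)
    simp only [dbarStar_const_smul _ (hs x), map_smul, ← smul_sub]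
    simp

lemma eq_zero_of_integral_herm (hvol : IsRiemannianVolume E vol) (ht : ∀ x, K.sec t x)
    (h : ∀ r : Π y : X, S y, (∀ x, K.sec r x) → ∫ x, K.herm x (r x) (t x) ∂vol = 0) (x : X) :
    t x = 0 := by
  have := hvol.isFiniteMeasureOnCompacts
  have := hvol.isOpenPosMeasure
  refine K.nondegenerate fun ξ => ?_
  by_contra h0
  obtain ⟨r, hr, hrx⟩ := K.exists_sec ξ
  obtain ⟨U, hUr, hUo, hxU⟩ := eventually_nhds_iff.1 (K.sec_eventually hr)
  obtain ⟨χ, hχ, hχs⟩ :=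
    (SmoothBumpFunction.nhds_basis_tsupport (I := 𝕀) x).mem_iff.1 (hUo.mem_nhds hxU)
  have hχn : ∀ y, FnNear E (fun z => ((χ z : ℝ) : ℂ)) y := fun y =>
    FnNear.clm Complex.ofRealCLM (.of_forall fun z => χ.contMDiff.contMDiffAt)
  set ρ : Π y : X, S y := fun y => ((χ y : ℂ) * K.herm y (r y) (t y)) • r y with hρ
  have hρs : ∀ y, K.sec ρ y := by
    intro y
    by_cases hy : y ∈ tsupport χ
    · have hry := hUr y (hχs hy)
      exact K.sec_smul ((hχn y).mul (K.herm_near hry (ht y))) hry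
    · refine K.sec_congr (sec_zero (ht y)) ?_
      filter_upwards [(isClosed_tsupport χ).isOpen_compl.mem_nhds hy] with z hz
      rw [hρ]
      simp [image_eq_zero_of_notMem_tsupport hz]
  have hval : ∀ y, K.herm y (ρ y) (t y)
      = ((χ y * Complex.normSq (K.herm y (r y) (t y)) : ℝ) : ℂ) := by
    intro y
    simp only [hρ, map_smulₛₗ, LinearMap.smul_apply, smul_eq_mul, map_mul, Complex.conj_ofReal,
      Complex.ofReal_mul, Complex.normSq_eq_conj_mul_self]
    ring
  have hint := h ρ hρs
  simp only [hval] at hint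
  rw [integral_complex_ofReal, Complex.ofReal_eq_zero] at hint
  have hcont : Continuous fun y => χ y * Complex.normSq (K.herm y (r y) (t y)) := by
    have := Complex.continuous_re.comp (continuous_herm hρs ht)
    simpa only [Function.comp_def, hval, Complex.ofReal_re] using this
  have hpos := hcont.integral_pos_of_hasCompactSupport_nonneg_nonzero (μ := vol) (x := x)
    (HasCompactSupport.of_compactSpace _)
    (fun y => mul_nonneg χ.nonneg (Complex.normSq_nonneg _)) (by
      rw [hrx, χ.eq_one, one_mul]
      exact fun h1 => h0 (Complex.normSq_eq_zero.1 h1))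
  exact hpos.ne' hint

end CliffordCalculus

end Green

section Gradient

variable {x : X} {f : X → ℝ} {a : 𝔛}

variable (E) in
/-- The gradient of a real function. -/
def gradient (f : X → ℝ) (x : X) : 𝕋 x :=
  ∑ i, 𝕕 f x (stdOrthonormalBasis ℝ (𝕋 x) i) • stdOrthonormalBasis ℝ (𝕋 x) i

lemma gradient_eq {ι : Type*} [Fintype ι] (e : OrthonormalBasis ι ℝ (𝕋 x)) :
    gradient E f x = ∑ i, 𝕕 f x (e i) • e i :=
  sum_orthonormalBasis_eq (stdOrthonormalBasis ℝ _) e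
    (LinearMap.toSpanSingleton ℝ _ LinearMap.id ∘ₗ (𝕕 f x).toLinearMap)

lemma inner_gradient (v : 𝕋 x) : (inner ℝ (gradient E f x) v : ℝ) = 𝕕 f x v := by
  conv_rhs => rw [← (stdOrthonormalBasis ℝ (𝕋 x)).sum_repr' v]
  simp only [gradient, sum_inner, real_inner_smul_left, map_sum, map_smul, smul_eq_mul]
  exact sum_congr rfl fun i _ => mul_comm _ _

lemma smoothNear_gradient (hf : FnNear E f x) : SmoothNear E E (gradient E f) x := by
  obtain ⟨e, he, ho⟩ := exists_orthonormal_frame E x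
  refine (SmoothNear.sum (S := Finset.univ)
    fun i _ => SmoothNear.smul (hf.mvfderiv (he i)) (he i)).congr ?_
  filter_upwards [ho] with y hy
  have := gradient_eq (f := f) (orthonormalBasisOf hy (by simp))
  simp only [coe_orthonormalBasisOf] at this
  exact this

lemma inner_nabla_gradient (hT : IsLeviCivita nablaT) (hf : FnNear E f x) (a b : 𝕋 x) :
    (inner ℝ (nablaT (gradient E f) x a) b : ℝ) = inner ℝ (nablaT (gradient E f) x b) a := by
  have hx := mem_chart_source E x
  have key : ∀ a b : E, (inner ℝ (nablaT (gradient E f) x (coordField x a x)) (coordField x b x) : ℝ)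
      = 𝕕 (fun z => 𝕕 f z (coordField x b z)) x (coordField x a x)
        - 𝕕 f x (nablaT (coordField x b) x (coordField x a x)) := by
    intro a b
    have h := hT.metric_near (smoothNear_gradient hf) (coordField_smoothNear hx b)
      (coordField x a x)
    simp only [inner_gradient] at h
    rw [h]; ring
  have key' : ∀ a b : E,
      (inner ℝ (nablaT (gradient E f) x (coordField x a x)) (coordField x b x) : ℝ)
      = inner ℝ (nablaT (gradient E f) x (coordField x b x)) (coordField x a x) := by
    intro a b
    rw [key, key, mvfderiv_coordField_comm hx hf b a, hT.coordField_symm hx b a]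
  have hs : ∀ c : 𝕋 x, coordField x (show E from c) x = c :=
    fun c => coordField_self (E := E) c
  have h := key' a b
  rwa [hs a, hs b] at h

lemma dbarFun_eq (hX : IsKahlerMetric E X) {f : X → ℂ} (hf : FnNear E f x) :
    dbarFun f x = flat01 (gradient E (fun y => (f y).re) x
      + J E x (gradient E (fun y => (f y).im) x)) := by
  refine Subtype.ext (ContinuousLinearMap.ext fun v => ?_)
  have hd : ∀ v, 𝕕 f x v
      = ((𝕕 (fun y => (f y).re) x v : ℝ) : ℂ)
        + I * ((𝕕 (fun y => (f y).im) x v : ℝ) : ℂ) := by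
    intro v
    have e1 : 𝕕 (fun y => (f y).re) x v = (𝕕 f x v).re :=
      mvfderiv_clm reCLM hf.mdiff v
    have e2 : 𝕕 (fun y => (f y).im) x v = (𝕕 f x v).im :=
      mvfderiv_clm imCLM hf.mdiff v
    rw [e1, e2, mul_comm, Complex.re_add_im]
  have e1 : ((dbarFun f x : T01Dual E x) : 𝕋 x →L[ℝ] ℂ) v
      = (1 / 2 : ℂ) * (𝕕 f x v
        + I * 𝕕 f x (J E x v)) := rfl
  rw [e1, flat01_apply]
  simp only [inner_add_left, hX.inner_J, inner_gradient, J_J, map_neg, hd]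
  push_cast
  linear_combination (1 / 2 : ℂ)
    * ((𝕕 (fun y => (f y).im) x (J E x v) : ℝ) : ℂ) * I_sq

variable {S : X → Type*} [∀ x, AddCommGroup (S x)] [∀ x, Module ℂ (S x)]
  (K : CliffordCalculus nablaT S) {s t : Π y : X, S y}

namespace CliffordCalculus

lemma dbar_congr (hs : K.sec s x) (h : ∀ᶠ y in 𝓝 x, t y = s y) : K.dbar t x = K.dbar s x := by
  rw [K.dbar_eq (K.sec_congr hs h) (stdOrthonormalBasis ℝ _), K.dbar_eq hs (stdOrthonormalBasis ℝ _)]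
  simp only [K.cd_congr hs h]

lemma dbar_sum {ι : Type*} (T : Finset ι) {f : ι → Π y : X, S y} (h : ∀ i, K.sec (f i) x)
    (hs : K.sec s x) : K.dbar (fun y => ∑ i ∈ T, f i y) x = ∑ i ∈ T, K.dbar (f i) x := by
  rw [K.dbar_eq (sec_sum T h hs) (stdOrthonormalBasis ℝ _)]
  simp only [K.cd_sum T h hs, map_sum, K.dbar_eq (h _) (stdOrthonormalBasis ℝ _)]
  exact sum_comm

lemma dbar_wedge (ha : SmoothNear E E a x) (hs : K.sec s x) {ι : Type*} [Fintype ι]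
    (e : OrthonormalBasis ι ℝ (𝕋 x)) : K.dbar (fun y => K.wedge y (a y) (s y)) x
      = ∑ i, K.wedge x (e i) (K.wedge x (nablaT a x (e i)) (s x))
        - K.wedge x (a x) (K.dbar s x) := by
  rw [K.dbar_eq (K.sec_wedge ha hs) e, K.dbar_eq hs e, map_sum, ← sum_sub_distrib]
  refine sum_congr rfl fun i _ => ?_
  rw [K.cd_wedge ha hs, map_add, K.wedge_wedge (e i) (a x), sub_eq_add_neg]

lemma sum_wedge_nabla_gradient (hT : IsLeviCivita nablaT) (hf : FnNear E f x)
    {ι : Type*} [Fintype ι] (e : OrthonormalBasis ι ℝ (𝕋 x)) (ξ : S x) :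
    ∑ i, K.wedge x (e i) (K.wedge x (nablaT (gradient E f) x (e i)) ξ) = 0 := by
  have hexp : ∀ v : 𝕋 x, K.wedge x v ξ = ∑ j, ((inner ℝ (e j) v : ℝ) : ℂ) • K.wedge x (e j) ξ :=
    e.eq_sum_of_real_linear (fun a b => K.wedge_add a b ξ) fun r a => K.wedge_smul r a ξ
  have h1 : ∑ i, K.wedge x (e i) (K.wedge x (nablaT (gradient E f) x (e i)) ξ)
      = ∑ i, ∑ j, ((inner ℝ (e j) (nablaT (gradient E f) x (e i)) : ℝ) : ℂ) •
        K.wedge x (e i) (K.wedge x (e j) ξ) := by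
    refine sum_congr rfl fun i _ => ?_
    rw [hexp, map_sum]
    simp only [map_smul]
  have h2 : ∑ i, K.wedge x (e i) (K.wedge x (nablaT (gradient E f) x (e i)) ξ)
      = -∑ i, K.wedge x (e i) (K.wedge x (nablaT (gradient E f) x (e i)) ξ) := by
    conv_lhs => rw [h1, sum_comm]
    rw [h1, ← sum_neg_distrib]
    refine sum_congr rfl fun i _ => ?_
    rw [← sum_neg_distrib]
    refine sum_congr rfl fun j _ => ?_
    rw [K.wedge_wedge (e j) (e i), smul_neg, real_inner_comm,
      inner_nabla_gradient hT hf, real_inner_comm]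
  have h3 : (2 : ℂ) • ∑ i, K.wedge x (e i) (K.wedge x (nablaT (gradient E f) x (e i)) ξ) = 0 := by
    rw [two_smul, ← eq_neg_iff_add_eq_zero]; exact h2
  exact (smul_eq_zero.1 h3).resolve_left two_ne_zero

lemma dbar_wedge_dbarFun (hX : IsKahlerMetric E X) (hT : IsLeviCivita nablaT) {g : X → ℝ}
    (hf : FnNear E f x) (hg : FnNear E g x) (hs : K.sec s x) :
    K.dbar (fun y => K.wedge y (gradient E f y + J E y (gradient E g y)) (s y)) x
      = -K.wedge x (gradient E f x + J E x (gradient E g x)) (K.dbar s x) := by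
  have h1 := smoothNear_gradient hf
  have h2 := smoothNear_gradient hg
  rw [K.dbar_wedge (h1.add h2.J) hs (stdOrthonormalBasis ℝ _), sub_eq_neg_self]
  have h3 : ∀ v, nablaT (fun y => gradient E f y + J E y (gradient E g y)) x v
      = nablaT (gradient E f) x v + J E x (nablaT (gradient E g) x v) := fun v => by
    rw [conn_add nablaT h1 h2.J, hX.nabla_J hT h2]
  simp only [h3, K.wedge_add, K.wedge_J, map_add, map_smul, sum_add_distrib,
    ← smul_sum, K.sum_wedge_nabla_gradient hT hf, K.sum_wedge_nabla_gradient hT hg,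
    smul_zero, add_zero]

end CliffordCalculus

end Gradient

section CliffordSum

variable {x : X} {n : ℕ} {a : Fin n → 𝕋 x}

lemma IsUnitary.pairing (ha : IsUnitary a) (j k : Fin n) :
    pairing ((2 : ℝ) • a k) ((2 : ℝ) • a j) = if j = k then 1 else 0 := by
  rw [SpinDirac.pairing, map_smul, inner_smul_left, inner_smul_right, inner_smul_left,
    inner_smul_right, (ha k j).1, (ha k j).2]
  by_cases h : j = k
  · rw [if_pos h, if_pos h.symm]
    simp
  · rw [if_neg h, if_neg (Ne.symm h)]
    simp

namespace CliffordCalculus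

variable (K : CliffordCalculus nablaT S)

/-- Exterior multiplication by the `(0,1)`-form dual to the conjugate of `a - i J a`. -/
def creation (a : 𝕋 x) : S x →ₗ[ℂ] S x := K.wedge x ((2 : ℝ) • a)

/-- Interior multiplication by the conjugate of `a - i J a`. -/
def annihilation (a : 𝕋 x) : S x →ₗ[ℂ] S x := K.contr x ((2 : ℝ) • a)

lemma annihilation_creation (ha : IsUnitary a) (j k : Fin n) (ξ : S x) :
    K.annihilation (a j) (K.creation (a k) ξ)
      = (if j = k then 1 else 0 : ℂ) • ξ - K.creation (a k) (K.annihilation (a j) ξ) := by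
  rw [annihilation, creation, K.contr_wedge, ha.pairing]

lemma creation_creation (b c : 𝕋 x) (ξ : S x) :
    K.creation b (K.creation c ξ) = -K.creation c (K.creation b ξ) := K.wedge_wedge _ _ _

lemma cliff_eq (b : 𝕋 x) (ξ : S x) :
    K.cliff x b ξ = (1 / 2 : ℂ) • (K.creation b ξ - K.annihilation b ξ) := by
  rw [cliff_apply, creation, annihilation, K.wedge_smul, K.contr_smul]
  push_cast
  module

lemma cliff_J (b : 𝕋 x) (ξ : S x) :
    K.cliff x (J E x b) ξ = (I / 2) • (K.creation b ξ + K.annihilation b ξ) := by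
  rw [cliff_apply, creation, annihilation, K.wedge_smul, K.contr_smul, K.wedge_J, K.contr_J]
  push_cast
  module

lemma cliff_cliff_sum (b c : 𝕋 x) (B₁ B₂ B₃ B₄ : S x) :
    (4 : ℂ) • (K.cliff x b (K.cliff x c B₁) + K.cliff x b (K.cliff x (J E x c) B₂)
      + K.cliff x (J E x b) (K.cliff x c B₃) + K.cliff x (J E x b) (K.cliff x (J E x c) B₄))
    = K.creation b (K.creation c ((B₁ - B₄) + I • (B₂ + B₃)))
      + K.annihilation b (K.annihilation c ((B₁ - B₄) - I • (B₂ + B₃)))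
      - K.annihilation b (K.creation c ((B₁ + B₄) + I • (B₂ - B₃)))
      - K.creation b (K.annihilation c ((B₁ + B₄) - I • (B₂ - B₃))) := by
  have h4 : ∀ η : S x, K.cliff x (J E x b) (K.cliff x (J E x c) η)
      = -((1 / 4 : ℂ) • (K.creation b (K.creation c η + K.annihilation c η)
        + K.annihilation b (K.creation c η + K.annihilation c η))) := by
    intro η
    rw [cliff_J, cliff_J, map_smul, map_smul, ← smul_add, smul_smul, ← neg_smul]
    congr 1
    linear_combination (1 / 4 : ℂ) * I_sq
  rw [h4]
  simp only [cliff_J]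
  simp only [cliff_eq, map_add, map_sub, map_smul]
  module

lemma sum_cliff_cliff (ha : IsUnitary a) (hX : IsKahlerMetric E X)
    (hn : finrank ℂ E = n) {ι : Type*} [Fintype ι] (e : OrthonormalBasis ι ℝ (𝕋 x))
    {B : 𝕋 x → 𝕋 x → S x} (hB : IsRealBilinear B) (hskew : ∀ b c, B b c = -B c b) :
    ∑ i, ∑ j, K.cliff x (e i) (K.cliff x (e j) (B (e i) (e j)))
      = ∑ j, ∑ k, K.creation (a j) (K.creation (a k)
          (complexify₂ B (hol (a j)).conjugate (hol (a k)).conjugate))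
        + ∑ j, ∑ k, K.annihilation (a j) (K.annihilation (a k)
          (complexify₂ B (hol (a j)) (hol (a k))))
        + ((2 : ℂ) • ∑ j, ∑ k, K.creation (a k) (K.annihilation (a j)
          (complexify₂ B (hol (a j)) (hol (a k)).conjugate))
        - ∑ j, complexify₂ B (hol (a j)) (hol (a j)).conjugate) := by
  have b2 : ∀ b, IsRealBilinear (fun c c' => K.cliff x b (K.cliff x c (B b c'))) := fun b =>
    { add_left := fun c c' d => by rw [cliff_add, map_add]
      smul_left := fun r c d => by rw [cliff_smul, map_smul]
      add_right := fun c d d' => by rw [hB.add_right, map_add, map_add]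
      smul_right := fun r c d => by rw [hB.smul_right, map_smul, map_smul] }
  have b1 : IsRealBilinear (fun b b' => ∑ j, K.cliff x b (K.cliff x (e j) (B b' (e j)))) :=
    { add_left := fun c c' d => by simp only [cliff_add, sum_add_distrib]
      smul_left := fun r c d => by simp only [cliff_smul, smul_sum]
      add_right := fun c d d' => by simp only [hB.add_left, map_add, sum_add_distrib]
      smul_right := fun r c d => by simp only [hB.smul_left, map_smul, smul_sum] }
  have h2 : ∀ j k, (B (a j) (a k) + B (J E x (a j)) (J E x (a k)))
      - I • (B (a j) (J E x (a k)) - B (J E x (a j)) (a k))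
      = -complexify₂ B (hol (a k)) (hol (a j)).conjugate := by
    intro j k
    rw [complexify₂_hol_conj hB, hskew (a j) (a k), hskew (J E x (a j)) (J E x (a k)),
      hskew (a j) (J E x (a k)), hskew (J E x (a j)) (a k)]
    module
  have h3 : ∑ i, ∑ j, K.cliff x (e i) (K.cliff x (e j) (B (e i) (e j)))
      = ∑ j, ∑ k, (K.creation (a j) (K.creation (a k)
          (complexify₂ B (hol (a j)).conjugate (hol (a k)).conjugate))
        + K.annihilation (a j) (K.annihilation (a k) (complexify₂ B (hol (a j)) (hol (a k))))
        - K.annihilation (a j) (K.creation (a k)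
          (complexify₂ B (hol (a j)) (hol (a k)).conjugate))
        + K.creation (a j) (K.annihilation (a k)
          (complexify₂ B (hol (a k)) (hol (a j)).conjugate))) := by
    refine (ha.sum_eq hX hn e b1).trans (sum_congr rfl fun j _ => ?_)
    have e1 := ha.sum_eq hX hn e (b2 (a j))
    have e2 := ha.sum_eq hX hn e (b2 (J E x (a j)))
    refine (congrArg₂ (fun p q => (2 : ℂ) • (p + q)) e1 e2).trans ?_
    rw [← sum_add_distrib, smul_sum]
    refine sum_congr rfl fun k _ => ?_
    have e3 := K.cliff_cliff_sum (a j) (a k) (B (a j) (a k)) (B (a j) (J E x (a k)))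
      (B (J E x (a j)) (a k)) (B (J E x (a j)) (J E x (a k)))
    rw [h2, ← complexify₂_hol_hol hB, ← complexify₂_hol_conj hB, ← complexify₂_conj_conj hB,
      map_neg, map_neg, sub_neg_eq_add] at e3
    rw [← e3]
    module
  rw [h3]
  simp only [sum_add_distrib, sum_sub_distrib]
  rw [sum_anticommutator (cr := fun j => K.creation (a j)) (an := fun j => K.annihilation (a j))
    (fun j k ξ => K.annihilation_creation ha j k ξ), sum_comm (f := fun j k =>
    K.creation (a j) (K.annihilation (a k) (complexify₂ B (hol (a k)) (hol (a j)).conjugate)))]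
  module

end CliffordCalculus

end CliffordSum

/-- The curvature as an endomorphism. -/
def curvTensorHom {x : X} (hT : SmoothConn nablaT) (u v : 𝕋 x) :
    𝕋 x →ₗ[ℝ] 𝕋 x where
  toFun := curvTensor nablaT x u v
  map_add' _ _ := curvTensor_add_section _ _ _ _ hT
  map_smul' r _ := curvTensor_smul_section _ _ _ hT r

section CurvatureTerms

variable {x : X} {n : ℕ} {a : Fin n → 𝕋 x} {ι : Type*} [Fintype ι]

lemma trace_eq_sum_dual {W : Type*} [AddCommGroup W] [Module ℂ W] [FiniteDimensional ℂ W]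
    (A : W →ₗ[ℂ] W) {b : Fin n → W} {φ : Fin n → W →ₗ[ℂ] ℂ} (hn : finrank ℂ W = n)
    (h : ∀ l m, φ l (b m) = if l = m then 1 else 0) : trace ℂ W A = ∑ l, φ l (A (b l)) := by
  have hli : LinearIndependent ℂ b := by
    rw [Fintype.linearIndependent_iff]
    intro g hg i
    have := congrArg (φ i) hg
    simpa [h] using this
  by_cases h0 : Nonempty (Fin n)
  · let β := basisOfLinearIndependentOfCardEqFinrank hli (by rw [Fintype.card_fin, hn])
    have hβ : ∀ l, β l = b l := fun l => by
      rw [coe_basisOfLinearIndependentOfCardEqFinrank]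
    have hr : ∀ l w, β.repr w l = φ l w := by
      intro l w
      have : β.coord l = φ l := β.ext fun m => by
        rw [hβ, h, ← hβ, Module.Basis.coord_apply, β.repr_self, Finsupp.single_apply]
        exact if_congr eq_comm rfl rfl
      exact congrArg (fun f => f w) this
    rw [LinearMap.trace_eq_matrix_trace ℂ β, Matrix.trace]
    simp [LinearMap.toMatrix_apply, hr, hβ]
  · rw [not_nonempty_iff] at h0
    have : n = 0 := by
      rcases n with _ | n
      · rfl
      · exact h0.elim 0
    have hW : Subsingleton W := Module.finrank_zero_iff.1 (hn.trans this)
    rw [Subsingleton.elim A 0]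
    simp

lemma complexify₂_sum_smul {M κ : Type*} [AddCommGroup M] [Module ℂ M] (T : Finset κ)
    (r : κ → 𝕋 x → 𝕋 x → ℂ) (v : κ → M) (u w : ComplexTangent E x) :
    complexify₂ (fun b c => ∑ i ∈ T, r i b c • v i) u w = ∑ i ∈ T, complexify₂ (r i) u w • v i := by
  simp only [complexify₂, ← sum_sub_distrib, ← sum_add_distrib, smul_sum]
  refine sum_congr rfl fun i _ => ?_
  rw [smul_eq_mul]
  module

namespace CliffordCalculus

variable (K : CliffordCalculus nablaT S)

lemma sum_cliff_kahlerForm (ha : IsUnitary a) (hX : IsKahlerMetric E X)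
    (hn : finrank ℂ E = n) (e : OrthonormalBasis ι ℝ (𝕋 x)) (c : ℂ) (ξ : S x) :
    ∑ i, ∑ j, K.cliff x (e i) (K.cliff x (e j) ((c * ((kahlerForm x (e i) (e j) : ℝ) : ℂ)) • ξ))
      = (c * I) • ((2 : ℂ) • ∑ j, K.creation (a j) (K.annihilation (a j) ξ) - (n : ℂ) • ξ) := by
  have hB : IsRealBilinear (fun u v : 𝕋 x =>
      (c * ((kahlerForm x u v : ℝ) : ℂ)) • ξ) :=
    { add_left := fun u u' v => by
        rw [kahlerForm, map_add, inner_add_left, ← add_smul, kahlerForm, kahlerForm]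
        push_cast
        rw [mul_add]
      smul_left := fun r u v => by
        rw [kahlerForm, map_smul, inner_smul_left, smul_smul, kahlerForm]
        simp only [RCLike.conj_to_real]
        push_cast
        congr 1
        ring
      add_right := fun u v v' => by
        rw [kahlerForm, inner_add_right, ← add_smul, kahlerForm, kahlerForm]
        push_cast
        rw [mul_add]
      smul_right := fun r u v => by
        rw [kahlerForm, inner_smul_right, smul_smul, kahlerForm]
        push_cast
        congr 1
        ring }
  have hJ : ∀ j k, kahlerForm x (a j) (a k) = 0 := fun j k => by
    rw [kahlerForm, hX.inner_J, (ha j k).2, neg_zero]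
  have hJ2 : ∀ j k, kahlerForm x (J E x (a j)) (J E x (a k)) = 0 := fun j k => by
    rw [kahlerForm, hX.invariant, ← kahlerForm, hJ]
  have hJ3 : ∀ j k, kahlerForm x (a j) (J E x (a k)) = if j = k then 1 / 2 else 0 := fun j k => by
    rw [kahlerForm, hX.invariant, (ha j k).1]
  have hJ4 : ∀ j k, kahlerForm x (J E x (a j)) (a k) = -if j = k then 1 / 2 else 0 := fun j k => by
    rw [kahlerForm, J_J, inner_neg_left, (ha j k).1]
  rw [K.sum_cliff_cliff ha hX hn e hB fun u v => by
    rw [kahlerForm, kahlerForm, hX.inner_J, real_inner_comm, ← neg_smul]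
    push_cast
    rw [mul_neg]]
  have h1 : ∀ j k, complexify₂ (fun u v : 𝕋 x =>
      (c * ((kahlerForm x u v : ℝ) : ℂ)) • ξ) (hol (a j)).conjugate (hol (a k)).conjugate = 0 := by
    intro j k
    rw [complexify₂_conj_conj hB, hJ, hJ2, hJ3, hJ4]
    push_cast
    module
  have h2 : ∀ j k, complexify₂ (fun u v : 𝕋 x =>
      (c * ((kahlerForm x u v : ℝ) : ℂ)) • ξ) (hol (a j)) (hol (a k)) = 0 := by
    intro j k
    rw [complexify₂_hol_hol hB, hJ, hJ2, hJ3, hJ4]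
    push_cast
    module
  have h3 : ∀ j k, complexify₂ (fun u v : 𝕋 x =>
      (c * ((kahlerForm x u v : ℝ) : ℂ)) • ξ) (hol (a j)) (hol (a k)).conjugate
        = if j = k then (c * I) • ξ else 0 := by
    intro j k
    rw [complexify₂_hol_conj hB, hJ, hJ2, hJ3, hJ4]
    split_ifs
    · push_cast
      module
    · push_cast
      module
  have h4 : ∀ j, ∑ k, K.creation (a k) (K.annihilation (a j)
      (if j = k then (c * I) • ξ else 0))
      = (c * I) • K.creation (a j) (K.annihilation (a j) ξ) := by
    intro j
    rw [sum_eq_single j, if_pos rfl, map_smul, map_smul]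
    · intro k _ hk
      rw [if_neg hk.symm, map_zero, map_zero]
    · simp
  simp only [h1, h2, h3, h4, map_zero, Finset.sum_const_zero, zero_add, if_true,
    ← smul_sum, Finset.sum_const, Finset.card_univ, Fintype.card_fin]
  rw [← Nat.cast_smul_eq_nsmul ℂ]
  module

end CliffordCalculus

/-- The matrix of a complex linear endomorphism in a unitary frame. -/
def unitaryCoeff (a : Fin n → 𝕋 x) (l : Fin n) (v : 𝕋 x) : ℂ :=
  2 * (((inner ℝ v (a l) : ℝ) : ℂ) + I * ((inner ℝ v (J E x (a l)) : ℝ) : ℂ))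

lemma unitaryCoeff_eq (l : Fin n) (v : 𝕋 x) : unitaryCoeff a l v = 4 * hermC v (a l) := by
  rw [unitaryCoeff, hermC_eq]
  ring

lemma unitaryCoeff_add (l : Fin n) (v w : 𝕋 x) :
    unitaryCoeff a l (v + w) = unitaryCoeff a l v + unitaryCoeff a l w := by
  simp only [unitaryCoeff_eq, hermC_add_left, mul_add]

lemma unitaryCoeff_smul (l : Fin n) (r : ℝ) (v : 𝕋 x) :
    unitaryCoeff a l (r • v) = r * unitaryCoeff a l v := by
  simp only [unitaryCoeff_eq, hermC_smul_left]
  ring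

lemma CliffordCalculus.wedge_eq_sum (K : CliffordCalculus nablaT S) (ha : IsUnitary a)
    (hX : IsKahlerMetric E X) (hn : finrank ℂ E = n) (v : 𝕋 x) (ξ : S x) :
    (2 : ℂ) • K.wedge x v ξ = ∑ l, unitaryCoeff a l v • K.creation (a l) ξ := by
  have h : ∀ (T : Finset (Fin n)) (w : Fin n → 𝕋 x),
      K.wedge x (∑ l ∈ T, w l) ξ = ∑ l ∈ T, K.wedge x (w l) ξ := by
    intro T w
    have h0 : K.wedge x 0 ξ = 0 := by simpa using K.wedge_smul 0 (0 : 𝕋 x) ξ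
    exact map_sum (⟨⟨fun v => K.wedge x v ξ, h0⟩, fun v w => K.wedge_add v w ξ⟩ :
      𝕋 x →+ S x) w T
  conv_lhs => rw [ha.expand hX hn v]
  rw [h, smul_sum]
  refine sum_congr rfl fun l _ => ?_
  rw [K.wedge_add, K.wedge_smul, K.wedge_smul, K.wedge_J, unitaryCoeff, creation, K.wedge_smul]
  push_cast
  module

lemma sum_wedge_contr (K : CliffordCalculus nablaT S) (ha : IsUnitary a)
    (hX : IsKahlerMetric E X) (hn : finrank ℂ E = n) (e : OrthonormalBasis ι ℝ (𝕋 x))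
    (A : 𝕋 x →ₗ[ℝ] 𝕋 x) (hA : ∀ v, A (J E x v) = J E x (A v)) (ξ : S x) :
    ∑ i, K.wedge x (A (e i)) (K.contr x (e i) ξ)
      = ∑ l, ∑ m, unitaryCoeff a l (A (a m)) • K.creation (a l) (K.annihilation (a m) ξ) := by
  have hB : IsRealBilinear (fun u v => K.wedge x (A u) (K.contr x v ξ)) :=
    { add_left := fun u u' v => by rw [map_add, K.wedge_add]
      smul_left := fun r u v => by rw [map_smul, K.wedge_smul]
      add_right := fun u v v' => by rw [K.contr_add, map_add]
      smul_right := fun r u v => by rw [K.contr_smul, map_smul] }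
  rw [ha.sum_eq hX hn e hB, sum_comm]
  refine sum_congr rfl fun m _ => ?_
  rw [← K.wedge_eq_sum ha hX hn, CliffordCalculus.annihilation, hA, K.wedge_J, K.contr_J,
    K.contr_smul, map_smul, map_smul, smul_smul, mul_neg, Complex.I_mul_I]
  push_cast
  module

section Curvature

variable (ha : IsUnitary a) (hX : IsKahlerMetric E X) (hT : IsLeviCivita nablaT)

variable (nablaT a) in
/-- The Levi-Civita curvature in a unitary frame. -/
def curvCoeff (l m : Fin n) (b c : 𝕋 x) : ℂ :=
  unitaryCoeff a l (curvTensor nablaT x b c (a m))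

include hT in
lemma curvCoeff_isRealBilinear (l m : Fin n) : IsRealBilinear (curvCoeff nablaT a l m) where
  add_left b b' c := by
    rw [curvCoeff, curvTensor_add_left _ _ _ _ hT.smoothConn, unitaryCoeff_add]; rfl
  smul_left r b c := by
    rw [curvCoeff, curvTensor_smul_left _ _ _ hT.smoothConn, unitaryCoeff_smul]; rfl
  add_right b c c' := by
    rw [curvCoeff, curvTensor_add_right _ _ _ _ hT.smoothConn, unitaryCoeff_add]; rfl
  smul_right r b c := by
    rw [curvCoeff, curvTensor_smul_right _ _ _ hT.smoothConn, unitaryCoeff_smul]; rfl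

include hX hT

lemma curvTensor_J_left (b c d : 𝕋 x) :
    curvTensor nablaT x (J E x b) c d = -curvTensor nablaT x b (J E x c) d := by
  have h := hX.curvTensor_J_J (J E x b) c d hT
  rw [J_J] at h
  have h2 := curvTensor_smul_left b (J E x c) d hT.smoothConn (-1)
  rw [neg_one_smul, neg_one_smul] at h2
  exact h.symm.trans h2

variable (nablaT a) in
/-- The complexified curvature in a unitary frame. -/
lemma complexify₂_curvCoeff (l m j k : Fin n) :
    complexify₂ (curvCoeff nablaT a l m) (hol (a j)) (hol (a k)).conjugate
      = 2 * (curvCoeff nablaT a l m (a j) (a k)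
        + I * curvCoeff nablaT a l m (a j) (J E x (a k))) := by
  have h1 : curvCoeff nablaT a l m (J E x (a j)) (J E x (a k))
      = curvCoeff nablaT a l m (a j) (a k) := by
    rw [curvCoeff, hX.curvTensor_J_J _ _ _ hT]; rfl
  have h2 : curvCoeff nablaT a l m (J E x (a j)) (a k)
      = -curvCoeff nablaT a l m (a j) (J E x (a k)) := by
    rw [curvCoeff, curvTensor_J_left hX hT, ← neg_one_smul ℝ, unitaryCoeff_smul, curvCoeff]
    push_cast
    ring
  rw [complexify₂_hol_conj (curvCoeff_isRealBilinear hT l m), h1, h2, smul_eq_mul]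
  ring

lemma complexify₂_curvCoeff_pair (l m j k : Fin n) :
    complexify₂ (curvCoeff nablaT a l m) (hol (a j)) (hol (a k)).conjugate
      = complexify₂ (curvCoeff nablaT a k j) (hol (a m)) (hol (a l)).conjugate := by
  rw [complexify₂_curvCoeff nablaT a hX hT, complexify₂_curvCoeff nablaT a hX hT]
  simp only [curvCoeff, unitaryCoeff]
  rw [hT.curvTensor_pair (a j) (a k) (a m) (a l), hT.curvTensor_pair (a j) (a k) (a m) (J E x (a l)),
    hT.curvTensor_pair (a j) (J E x (a k)) (a m) (a l),
    hT.curvTensor_pair (a j) (J E x (a k)) (a m) (J E x (a l))]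
  ring

lemma complexify₂_curvCoeff_bianchi (l m j k : Fin n) :
    complexify₂ (curvCoeff nablaT a l m) (hol (a j)) (hol (a k)).conjugate
      = complexify₂ (curvCoeff nablaT a l j) (hol (a m)) (hol (a k)).conjugate := by
  have hb : ∀ c : 𝕋 x, curvTensor nablaT x (a j) c (a m)
      = curvTensor nablaT x (a m) c (a j) + curvTensor nablaT x (a j) (a m) c := by
    intro c
    have h1 := hT.bianchi (a j) c (a m)
    rw [curvTensor_swap c (a m) (a j) hT.smoothConn, curvTensor_swap (a m) (a j) c hT.smoothConn]
      at h1
    rw [← sub_eq_zero, ← h1]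
    abel
  rw [complexify₂_curvCoeff nablaT a hX hT, complexify₂_curvCoeff nablaT a hX hT]
  simp only [curvCoeff]
  rw [hb, hb, unitaryCoeff_add, unitaryCoeff_add, hX.curvTensor_J _ _ _ hT]
  have h2 : ∀ Q : 𝕋 x, unitaryCoeff a l (J E x Q)
      = I * unitaryCoeff a l Q := by
    intro Q
    rw [unitaryCoeff_eq, unitaryCoeff_eq, hermC_J_left hX]
    ring
  rw [h2]
  linear_combination (2 * unitaryCoeff a l (curvTensor nablaT x (a j) (a m) (a k))) * I_sq

include ha in
lemma CliffordCalculus.sum_cliff_curvTensor (K : CliffordCalculus nablaT S) (hn : finrank ℂ E = n)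
    (e : OrthonormalBasis ι ℝ (𝕋 x))
    {κ : Type*} [Fintype κ] (f : OrthonormalBasis κ ℝ (𝕋 x)) (ξ : S x) :
    ∑ i, ∑ j, K.cliff x (e i) (K.cliff x (e j)
        (∑ k, K.wedge x (curvTensor nablaT x (e i) (e j) (f k)) (K.contr x (f k) ξ)))
      = ∑ k, ∑ m, complexify₂ (fun b c => ∑ l, curvCoeff nablaT a l l b c) (hol (a m))
          (hol (a k)).conjugate • K.creation (a k) (K.annihilation (a m) ξ) := by
  have hΛ : ∀ b c : 𝕋 x, ∑ k, K.wedge x (curvTensor nablaT x b c (f k)) (K.contr x (f k) ξ)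
      = ∑ lm : Fin n × Fin n, curvCoeff nablaT a lm.1 lm.2 b c
        • K.creation (a lm.1) (K.annihilation (a lm.2) ξ) := by
    intro b c
    refine (sum_wedge_contr K ha hX hn f (curvTensorHom hT.smoothConn b c)
      (hX.curvTensor_J b c · hT) ξ).trans ?_
    rw [Fintype.sum_prod_type]
    rfl
  have hB : IsRealBilinear (fun b c => ∑ lm : Fin n × Fin n, curvCoeff nablaT a lm.1 lm.2 b c
        • K.creation (a lm.1) (K.annihilation (a lm.2) ξ)) :=
    { add_left := fun b b' c => by
        simp only [(curvCoeff_isRealBilinear hT _ _).add_left, add_smul, sum_add_distrib]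
      smul_left := fun r b c => by
        simp only [(curvCoeff_isRealBilinear hT _ _).smul_left, smul_sum, smul_smul, smul_eq_mul]
      add_right := fun b c c' => by
        simp only [(curvCoeff_isRealBilinear hT _ _).add_right, add_smul, sum_add_distrib]
      smul_right := fun r b c => by
        simp only [(curvCoeff_isRealBilinear hT _ _).smul_right, smul_sum, smul_smul, smul_eq_mul] }
  have hskew : ∀ l m b c, curvCoeff nablaT a l m b c = -curvCoeff nablaT a l m c b := by
    intro l m b c
    rw [curvCoeff, curvTensor_swap _ _ _ hT.smoothConn, ← neg_one_smul ℝ, unitaryCoeff_smul,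
      curvCoeff]
    push_cast
    ring
  have hJJ : ∀ l m b c, curvCoeff nablaT a l m (J E x b) (J E x c) = curvCoeff nablaT a l m b c := by
    intro l m b c
    rw [curvCoeff, hX.curvTensor_J_J _ _ _ hT, curvCoeff]
  have hJ : ∀ l m b c, curvCoeff nablaT a l m (J E x b) c = -curvCoeff nablaT a l m b (J E x c) := by
    intro l m b c
    rw [curvCoeff, curvTensor_J_left hX hT, ← neg_one_smul ℝ, unitaryCoeff_smul, curvCoeff]
    push_cast
    ring
  have hzero : ∀ (r : Fin n × Fin n → ℂ) , (∀ lm, r lm = 0) →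
      ∑ lm : Fin n × Fin n, r lm • K.creation (a lm.1) (K.annihilation (a lm.2) ξ) = 0 :=
    fun r hr => sum_eq_zero fun lm _ => by rw [hr, zero_smul]
  simp only [hΛ]
  rw [K.sum_cliff_cliff ha hX hn e hB fun b c => by
    rw [← sum_neg_distrib]
    exact sum_congr rfl fun lm _ => by rw [hskew, neg_smul]]
  have hcc : ∀ j k, complexify₂ (fun b c => ∑ lm : Fin n × Fin n, curvCoeff nablaT a lm.1 lm.2 b c
      • K.creation (a lm.1) (K.annihilation (a lm.2) ξ)) (hol (a j)).conjugate
        (hol (a k)).conjugate = 0 := by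
    intro j k
    rw [complexify₂_sum_smul]
    refine hzero _ fun lm => ?_
    rw [complexify₂_conj_conj (curvCoeff_isRealBilinear hT _ _), hJJ, hJ, sub_self, add_neg_cancel,
      smul_zero, add_zero]
  have hhh : ∀ j k, complexify₂ (fun b c => ∑ lm : Fin n × Fin n, curvCoeff nablaT a lm.1 lm.2 b c
      • K.creation (a lm.1) (K.annihilation (a lm.2) ξ)) (hol (a j)) (hol (a k)) = 0 := by
    intro j k
    rw [complexify₂_sum_smul]
    refine hzero _ fun lm => ?_
    rw [complexify₂_hol_hol (curvCoeff_isRealBilinear hT _ _), hJJ, hJ, sub_self, add_neg_cancel,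
      smul_zero, sub_zero]
  have htr : ∀ k m, complexify₂ (fun b c => ∑ l, curvCoeff nablaT a l l b c) (hol (a m))
      (hol (a k)).conjugate
      = ∑ l, complexify₂ (curvCoeff nablaT a l l) (hol (a m)) (hol (a k)).conjugate := by
    intro k m
    have := complexify₂_sum_smul Finset.univ (fun l => curvCoeff nablaT a l l) (fun _ => (1 : ℂ))
      (hol (a m)) (hol (a k)).conjugate
    simpa only [smul_eq_mul, mul_one] using this
  simp only [hcc, hhh, map_zero, Finset.sum_const_zero, zero_add, htr]
  simp only [complexify₂_sum_smul]
  simp only [Fintype.sum_prod_type]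
  exact sum_kahler_curvature (cr := fun j => K.creation (a j)) (an := fun j => K.annihilation (a j))
    ξ (fun j k ξ => K.annihilation_creation ha j k ξ) (fun j k ξ => K.creation_creation _ _ ξ)
    (fun l m j k => complexify₂ (curvCoeff nablaT a l m) (hol (a j)) (hol (a k)).conjugate)
    (complexify₂_curvCoeff_bianchi hX hT) (complexify₂_curvCoeff_pair hX hT)

include ha in
lemma trace_curvature_nablaDet_eq_sum {nablaDet : CovariantDerivative 𝕀 ℂ (detCore E X).Fiber}
    (hD : IsChernConnection detMetric nablaDet) (hn : finrank ℂ E = n) (b c : 𝕋 x) :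
    trace ℂ _ (curvature nablaDet x b c) = ∑ l, curvCoeff nablaT a l l b c := by
  have hx := mem_chart_source E x
  have hJ : ∀ (z : ℂ) (w : E), coordField x (z • w) x
      = z.re • coordField x w x + z.im • J E x (coordField x w x) := by
    intro z w
    rw [J_coordField hx, ← coordField_smul, ← coordField_smul, ← coordField_add]
    exact congrArg (fun w => coordField x w x) (complex_smul_eq (V := fun _ : X => E) (x := x) z w)
  let A : E →ₗ[ℂ] E :=
    { toFun := fun w => coordRep E x x (curvTensor nablaT x b c (coordField x w x))
      map_add' := fun w w' => by
        rw [coordField_add, curvTensor_add_section _ _ _ _ hT.smoothConn, map_add]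
      map_smul' := fun z w => by
        rw [hJ, curvTensor_add_section _ _ _ _ hT.smoothConn,
          curvTensor_smul_section _ _ _ hT.smoothConn, curvTensor_smul_section _ _ _ hT.smoothConn,
          hX.curvTensor_J _ _ _ hT, map_add, map_smul, map_smul, coordRep_J hx, RingHom.id_apply]
        exact (complex_smul_eq (V := fun _ : X => E) (x := x) z _).symm }
  let φ : Fin n → E →ₗ[ℂ] ℂ := fun l =>
    { toFun := fun w => unitaryCoeff a l (coordField x w x)
      map_add' := fun w w' => by rw [coordField_add, unitaryCoeff_add]
      map_smul' := fun z w => by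
        rw [hJ, unitaryCoeff_add, unitaryCoeff_smul, unitaryCoeff_smul, unitaryCoeff_eq,
          unitaryCoeff_eq, hermC_J_left hX, RingHom.id_apply, smul_eq_mul]
        conv_rhs => rw [← Complex.re_add_im z]
        ring }
  have hφ : ∀ l m, φ l (coordRep E x x (a m)) = if l = m then 1 else 0 := by
    intro l m
    change unitaryCoeff a l (coordField x (coordRep E x x (a m)) x) = _
    rw [coordField_coordRep hx, unitaryCoeff, (ha m l).1, (ha m l).2]
    by_cases h : l = m
    · rw [if_pos h, if_pos h.symm]
      simp
    · rw [if_neg h, if_neg (Ne.symm h)]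
      simp
  rw [trace_curvature_nablaDet hX hT hD]
  refine (trace_eq_sum_coord A).symm.trans ((trace_eq_sum_dual A hn hφ).trans ?_)
  refine sum_congr rfl fun l _ => ?_
  change unitaryCoeff a l (coordField x (coordRep E x x (curvTensor nablaT x b c
    (coordField x (coordRep E x x (a l)) x))) x) = _
  rw [coordField_coordRep hx, coordField_coordRep hx, curvCoeff]

end Curvature

end CurvatureTerms

section Twisted

variable {x : X} {n : ℕ} {a : Fin n → 𝕋 x} {ι : Type*} [Fintype ι]

namespace CliffordCalculus

variable (K : CliffordCalculus nablaT S)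

lemma dirac_const_smul {s : Π y : X, S y} (c : ℂ) (hs : K.sec s x) :
    K.dirac (fun y => c • s y) x = c • K.dirac s x := by
  rw [K.dirac_eq (K.sec_smul (FnNear.const c) hs) (stdOrthonormalBasis ℝ _),
    K.dirac_eq hs (stdOrthonormalBasis ℝ _), smul_sum]
  exact sum_congr rfl fun i _ => by rw [K.cd_const_smul c hs, map_smul]

lemma sum_cliff_act {N : Type*} [AddCommGroup N] [Module ℂ N] (act : N →ₗ[ℂ] S x →ₗ[ℂ] S x)
    (hw : ∀ A v ξ, act A (K.wedge x v ξ) = K.wedge x v (act A ξ))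
    (hc : ∀ A v ξ, act A (K.contr x v ξ) = K.contr x v (act A ξ))
    (ha : IsUnitary a) (hX : IsKahlerMetric E X)
    (hn : finrank ℂ E = n) (e : OrthonormalBasis ι ℝ (𝕋 x))
    {R : 𝕋 x → 𝕋 x → N} (hR : IsRealBilinear R) (hskew : ∀ b c, R b c = -R c b) (ξ : S x) :
    ∑ i, ∑ j, K.cliff x (e i) (K.cliff x (e j) (act (R (e i) (e j)) ξ))
      = ∑ j, ∑ k, act (complexify₂ R (hol (a j)).conjugate (hol (a k)).conjugate)
          (K.creation (a j) (K.creation (a k) ξ))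
        + ∑ j, ∑ k, act (complexify₂ R (hol (a j)) (hol (a k)))
          (K.annihilation (a j) (K.annihilation (a k) ξ))
        + ((2 : ℂ) • ∑ j, ∑ k, act (complexify₂ R (hol (a j)) (hol (a k)).conjugate)
          (K.creation (a k) (K.annihilation (a j) ξ))
        - ∑ j, act (complexify₂ R (hol (a j)) (hol (a j)).conjugate) ξ) := by
  have hB : IsRealBilinear (fun b c => act (R b c) ξ) :=
    { add_left := fun b b' c => by rw [hR.add_left, map_add, LinearMap.add_apply]
      smul_left := fun r b c => by rw [hR.smul_left, map_smul, LinearMap.smul_apply]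
      add_right := fun b c c' => by rw [hR.add_right, map_add, LinearMap.add_apply]
      smul_right := fun r b c => by rw [hR.smul_right, map_smul, LinearMap.smul_apply] }
  have hcx : ∀ u v, complexify₂ (fun b c => act (R b c) ξ) u v = act (complexify₂ R u v) ξ :=
    fun u v => complexify₂_linear (act.flip ξ) R u v
  rw [K.sum_cliff_cliff ha hX hn e hB fun b c => by rw [hskew, map_neg, LinearMap.neg_apply]]
  simp only [hcx, creation, annihilation, hw, hc]

/-- The Lichnerowicz formula, with the curvature of the twisting line bundle proportional to the
Kähler form. -/
lemma sum_cliff_twist {N : Type*} [AddCommGroup N] [Module ℂ N] (act : N →ₗ[ℂ] S x →ₗ[ℂ] S x)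
    (hw : ∀ A v ξ, act A (K.wedge x v ξ) = K.wedge x v (act A ξ))
    (hc : ∀ A v ξ, act A (K.contr x v ξ) = K.contr x v (act A ξ))
    (ha : IsUnitary a) (hX : IsKahlerMetric E X) (hT : IsLeviCivita nablaT)
    {nablaDet : CovariantDerivative 𝕀 ℂ (detCore E X).Fiber}
    (hD : IsChernConnection detMetric nablaDet)
    (hn : finrank ℂ E = n) (e : OrthonormalBasis ι ℝ (𝕋 x))
    {κ : Type*} [Fintype κ] (f : OrthonormalBasis κ ℝ (𝕋 x))
    {R : 𝕋 x → 𝕋 x → N} (hR : IsRealBilinear R) (hskew : ∀ b c, R b c = -R c b) (c : ℂ) (ξ : S x) :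
    ∑ i, ∑ j, K.cliff x (e i) (K.cliff x (e j) ((c * ((kahlerForm x (e i) (e j) : ℝ) : ℂ)) • ξ
        + act (R (e i) (e j)) ξ
        + ∑ k, K.wedge x (curvTensor nablaT x (e i) (e j) (f k)) (K.contr x (f k) ξ)))
      = -∑ j, act (complexify₂ R (hol (a j)) (hol (a j)).conjugate) ξ - (c * I * n) • ξ
        + (2 * (c * I)) • ∑ j, K.creation (a j) (K.annihilation (a j) ξ)
        + (2 : ℂ) • ∑ l, ∑ m, (act (complexify₂ R (hol (a l)) (hol (a m)).conjugate)
            (K.creation (a m) (K.annihilation (a l) ξ))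
          + ((1 / 2 : ℂ) * complexify₂ (fun b c => trace ℂ _ (curvature nablaDet x b c))
            (hol (a l)) (hol (a m)).conjugate) • K.creation (a m) (K.annihilation (a l) ξ))
        + ∑ l, ∑ m, act (complexify₂ R (hol (a l)) (hol (a m)))
          (K.annihilation (a l) (K.annihilation (a m) ξ))
        + ∑ l, ∑ m, act (complexify₂ R (hol (a l)).conjugate (hol (a m)).conjugate)
          (K.creation (a l) (K.creation (a m) ξ)) := by
  simp only [map_add, sum_add_distrib]
  rw [K.sum_cliff_kahlerForm ha hX hn e, K.sum_cliff_act act hw hc ha hX hn e hR hskew,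
    CliffordCalculus.sum_cliff_curvTensor ha hX hT K hn e f]
  have h1 : (fun b c : 𝕋 x => ∑ l, curvCoeff nablaT a l l b c)
      = fun b c => trace ℂ _ (curvature nablaDet x b c) :=
    funext fun b => funext fun c => (trace_curvature_nablaDet_eq_sum ha hX hT hD hn b c).symm
  rw [h1, sum_comm (f := fun k m => complexify₂ (fun b c => trace ℂ _
    (curvature nablaDet x b c)) (hol (a m)) (hol (a k)).conjugate
      • K.creation (a k) (K.annihilation (a m) ξ))]
  have h2 : ∑ l, ∑ m, ((1 / 2 : ℂ) * complexify₂ (fun b c => trace ℂ _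
      (curvature nablaDet x b c)) (hol (a l)) (hol (a m)).conjugate)
        • K.creation (a m) (K.annihilation (a l) ξ)
      = (1 / 2 : ℂ) • ∑ l, ∑ m, complexify₂ (fun b c => trace ℂ _
      (curvature nablaDet x b c)) (hol (a l)) (hol (a m)).conjugate
        • K.creation (a m) (K.annihilation (a l) ξ) := by
    simp only [smul_sum, smul_smul]
  rw [h2]
  module

end CliffordCalculus

end Twisted

section Frames

variable {x : X} {n p : ℕ} {a : Fin n → 𝕋 x} {w : Fin n → ComplexTangent E x}
  {wbar : Fin n → T01Dual E x} {L V : X → Type*}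
  [∀ x, AddCommGroup (L x)] [∀ x, Module ℂ (L x)] [∀ x, AddCommGroup (V x)] [∀ x, Module ℂ (V x)]

lemma eq_hol_of_isType10 {u : ComplexTangent E x} (h : u.IsType10) : u = hol u.re := by
  rw [hol, h.1, neg_neg]

lemma isRealBilinear_inner : IsRealBilinear (fun u v : 𝕋 x => ((inner ℝ u v : ℝ) : ℂ)) where
  add_left u u' v := by rw [inner_add_left, Complex.ofReal_add]
  smul_left r u v := by simp [inner_smul_left]
  add_right u v v' := by rw [inner_add_right, Complex.ofReal_add]
  smul_right r u v := by simp [inner_smul_right]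

lemma isUnitary_of_metricC (hX : IsKahlerMetric E X)
    (hw : ∀ j k, metricC (hol (a j)) (hol (a k)).conjugate = if j = k then 1 else 0) :
    IsUnitary a := by
  intro j k
  have h1 := hw j k
  rw [metricC, complexify₂_hol_conj isRealBilinear_inner, hX.invariant, hX.inner_J] at h1
  have h2 : (((2 * inner ℝ (a j) (a k) : ℝ) : ℂ)
      + ((2 * inner ℝ (a j) (J E x (a k)) : ℝ) : ℂ) * I)
      = (((if j = k then 1 else 0 : ℝ)) : ℂ) + ((0 : ℝ) : ℂ) * I := by
    rw [Complex.ofReal_zero, zero_mul, add_zero, apply_ite Complex.ofReal, Complex.ofReal_one,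
      Complex.ofReal_zero, ← h1, smul_eq_mul]
    push_cast
    ring
  have hre := congrArg Complex.re h2
  have him := congrArg Complex.im h2
  simp only [Complex.add_re, Complex.ofReal_re, Complex.mul_re, Complex.I_re, Complex.I_im,
    Complex.ofReal_im, mul_zero, mul_one, sub_zero, add_zero] at hre
  simp only [Complex.add_im, Complex.ofReal_im, Complex.mul_im, Complex.I_re, Complex.I_im,
    Complex.ofReal_re, mul_zero, mul_one, zero_add, add_zero] at him
  refine ⟨?_, by linarith⟩
  split_ifs at hre ⊢ <;> linarith

lemma evalDual_hol_conj (b : 𝕋 x) (α : T01Dual E x) :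
    evalDual (hol b).conjugate α = (α : 𝕋 x →L[ℝ] ℂ) ((2 : ℝ) • b) := by
  change (α : 𝕋 x →L[ℝ] ℂ) b
    + I * (α : 𝕋 x →L[ℝ] ℂ) (- -J E x b) = _
  rw [neg_neg, α.2 b, map_smul, Complex.real_smul, Complex.ofReal_ofNat]
  linear_combination -((α : 𝕋 x →L[ℝ] ℂ) b) * I_sq

lemma interiorMul_hol_conj (b : 𝕋 x) (ξ : 𝔽 x) :
    interiorMul (hol b).conjugate ξ = contr ((2 : ℝ) • b) ξ := by
  have h := interiorMul_congr (u := (hol b).conjugate)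
    (v := ⟨(1 / 2 : ℝ) • (2 : ℝ) • b, (1 / 2 : ℝ) • J E x ((2 : ℝ) • b)⟩) 1 (fun α => by
      rw [evalDual_half, evalDual_hol_conj, one_mul]) ξ
  rw [h, one_smul]
  rfl

lemma IsUnitary.form_eq_sum (ha : IsUnitary a) (hX : IsKahlerMetric E X)
    (hn : finrank ℂ E = n) (α : T01Dual E x) :
    α = ∑ j, (α : 𝕋 x →L[ℝ] ℂ) ((2 : ℝ) • a j) • flat01 ((2 : ℝ) • a j) := by
  refine Subtype.ext (ContinuousLinearMap.ext fun v => ?_)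
  rw [AddSubmonoidClass.coe_finsetSum, sum_apply]
  conv_lhs => rw [ha.expand hX hn v, map_sum]
  refine sum_congr rfl fun j _ => ?_
  rw [map_add, map_smul, map_smul, α.2, Submodule.coe_smul, smul_apply, flat01_apply, map_smul,
    inner_smul_left, inner_smul_left]
  have h1 : (inner ℝ (a j) (J E x v) : ℝ) = -inner ℝ v (J E x (a j)) := by
    rw [real_inner_comm, hX.inner_J]
  have h2 : (inner ℝ (a j) v : ℝ) = inner ℝ v (a j) := real_inner_comm _ _
  rw [h1, h2]
  simp only [Complex.real_smul, smul_eq_mul]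
  push_cast
  simp only [conj_trivial]
  push_cast
  ring

lemma IsUnitary.eq_flat01 (ha : IsUnitary a) (hX : IsKahlerMetric E X) (hn : finrank ℂ E = n)
    (h : ∀ j k, evalDual (hol (a k)).conjugate (wbar j) = if j = k then 1 else 0) (m : Fin n) :
    wbar m = flat01 ((2 : ℝ) • a m) := by
  rw [ha.form_eq_sum hX hn (wbar m), sum_eq_single m]
  · rw [← evalDual_hol_conj, h, if_pos rfl, one_smul]
  · intro j _ hj
    rw [← evalDual_hol_conj, h, if_neg hj.symm, zero_smul]
  · simp

lemma IsUnitary.number_eq_sum (ha : IsUnitary a) (hX : IsKahlerMetric E X) (hn : finrank ℂ E = n)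
    (h : ∀ j k, evalDual (hol (a k)).conjugate (wbar j) = if j = k then 1 else 0) (ξ : 𝔽 x) :
    number ξ = ∑ j, wedge (wbar j) (interiorMul (hol (a j)).conjugate ξ) := by
  have hli : LinearIndependent ℂ wbar := by
    refine Fintype.linearIndependent_iff.2 fun g hg k => ?_
    have h1 := congrArg (evalDual (hol (a k)).conjugate) hg
    rw [map_sum, map_zero] at h1
    simpa [h] using h1
  have hsp : ⊤ ≤ Submodule.span ℂ (Set.range wbar) := fun α _ => by
    rw [ha.form_eq_sum hX hn α]
    refine Submodule.sum_mem _ fun j _ => Submodule.smul_mem _ _ ?_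
    rw [← ha.eq_flat01 hX hn h]
    exact Submodule.subset_span ⟨j, rfl⟩
  have h2 := SpinDirac.number_eq_sum (Module.Basis.mk hli hsp) (fun j => (hol (a j)).conjugate)
    (fun i => (Module.Basis.mk hli hsp).ext fun j => by
      rw [Module.Basis.mk_apply, h, Module.Basis.mk_coord_apply]) ξ
  simpa only [Module.Basis.mk_apply] using h2

end Frames

end CliffordModules

/-- A shortcut for instance search. -/
lemma continuousSMul_real {M : Type*} [NormedAddCommGroup M] [InnerProductSpace ℂ M] :
    ContinuousSMul ℝ M := inferInstance

/-- A shortcut for instance search. -/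
lemma vectorBundle_real {X : Type*} [TopologicalSpace X] {F : Type*} [NormedAddCommGroup F]
    [NormedSpace ℂ F] {V : X → Type*} [∀ x, NormedAddCommGroup (V x)]
    [∀ x, InnerProductSpace ℂ (V x)] [TopologicalSpace (TotalSpace F V)] [FiberBundle F V]
    [VectorBundle ℂ F V] : VectorBundle ℝ F V := inferInstance

attribute [local instance] continuousSMul_real vectorBundle_real

variable {p : ℕ}
  {L : X → Type*} [∀ x, NormedAddCommGroup (L x)] [∀ x, InnerProductSpace ℂ (L x)]
  [TopologicalSpace (TotalSpace ℂ L)] [FiberBundle ℂ L] [VectorBundle ℂ ℂ L]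
  [ContMDiffVectorBundle ∞ ℂ L 𝕀]
  {F : Type*} [NormedAddCommGroup F] [NormedSpace ℂ F] [FiniteDimensional ℂ F]
  {V : X → Type*} [∀ x, NormedAddCommGroup (V x)] [∀ x, InnerProductSpace ℂ (V x)]
  [TopologicalSpace (TotalSpace F V)] [FiberBundle F V] [VectorBundle ℂ F V]
  [ContMDiffVectorBundle ∞ F V 𝕀]
  {nablaL : CovariantDerivative 𝕀 ℂ L} {nablaV : CovariantDerivative 𝕀 F V}

section Sharp

variable {x : X}

lemma sharp01_flat01 (v : 𝕋 x) : sharp01 (flat01 v) = v := by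
  refine ext_inner_right ℝ fun u => ?_
  rw [inner_sharp01, flat01_apply]
  simp

end Sharp

section Germs

variable (nablaT nablaL nablaV)
  {x : X} {α β : Π y : X, T01Dual E y} {a : 𝔛}

lemma formNear_iff_sharp01 : FormNear α x ↔ SmoothNear E E (fun y => sharp01 (α y)) x := by
  constructor
  · rintro ⟨a, ha, hα⟩
    refine ha.congr ?_
    filter_upwards [hα] with y hy
    rw [hy, sharp01_flat01]
  · intro h
    exact ⟨_, h, .of_forall fun y => (flat01_sharp01 _).symm⟩

/-- The covariant derivative of a smooth `(0,1)`-form. -/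
def formDeriv (α : Π y : X, T01Dual E y) (x : X) (v : 𝕋 x) : T01Dual E x :=
  flat01 (nablaT (fun y => sharp01 (α y)) x v)

lemma formDeriv_flat01 (a : 𝔛) (v : 𝕋 x) :
    formDeriv nablaT (fun y => flat01 (a y)) x v = flat01 (nablaT a x v) := by
  simp only [formDeriv, sharp01_flat01]

lemma FormNear.metric (hX : IsKahlerMetric E X) (hT : IsLeviCivita nablaT)
    (hα : FormNear α x) (hβ : FormNear β x) (v : 𝕋 x) :
    FnNear E (fun y => formMetric (α y) (β y)) x ∧ 𝕕 (fun y => formMetric (α y) (β y)) x v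
      = formMetric (formDeriv nablaT α x v) (β x) + formMetric (α x) (formDeriv nablaT β x v) := by
  have ha := formNear_iff_sharp01.1 hα
  have hb := formNear_iff_sharp01.1 hβ
  have e : (fun y => formMetric (α y) (β y)) = fun y =>
      (1 / 2 : ℂ) * (((inner ℝ (sharp01 (β y)) (sharp01 (α y)) : ℝ) : ℂ) + I *
        ((inner ℝ (sharp01 (β y)) (J E y (sharp01 (α y))) : ℝ) : ℂ)) := by
    funext y
    have h := formMetric_flat01 (fun a b => hX.inner_J a b) (sharp01 (α y)) (β y)
    rw [flat01_sharp01] at h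
    rw [h, ← flat01_apply, flat01_sharp01]
  have h1 := (FnNear.inner hb ha)
  have h2 := (FnNear.inner hb ha.J)
  have h3 := (h1.ofReal.add (h2.ofReal.constMul I)).constMul (1 / 2)
  rw [e]
  refine ⟨h3, ?_⟩
  have e1 : (𝕕 (fun y => ((inner ℝ (sharp01 (β y)) (sharp01 (α y)) : ℝ) : ℂ)) x v)
      = ((𝕕 (fun y => (inner ℝ (sharp01 (β y)) (sharp01 (α y)) : ℝ)) x v : ℝ) : ℂ) :=
    mvfderiv_clm Complex.ofRealCLM h1.mdiff v
  have e2 : (𝕕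
        (fun y => ((inner ℝ (sharp01 (β y)) (J E y (sharp01 (α y))) : ℝ) : ℂ)) x v)
      = ((𝕕
        (fun y => (inner ℝ (sharp01 (β y)) (J E y (sharp01 (α y))) : ℝ)) x v : ℝ) : ℂ) :=
    mvfderiv_clm Complex.ofRealCLM h2.mdiff v
  have e3 : 𝕕 (fun y =>
      (1 / 2 : ℂ) * (((inner ℝ (sharp01 (β y)) (sharp01 (α y)) : ℝ) : ℂ) + I *
        ((inner ℝ (sharp01 (β y)) (J E y (sharp01 (α y))) : ℝ) : ℂ))) x v
      = (1 / 2 : ℂ) * 𝕕 (fun y =>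
        ((inner ℝ (sharp01 (β y)) (sharp01 (α y)) : ℝ) : ℂ) + I *
        ((inner ℝ (sharp01 (β y)) (J E y (sharp01 (α y))) : ℝ) : ℂ)) x v :=
    mvfderiv_clm ((1 / 2 : ℂ) • ContinuousLinearMap.id ℝ ℂ)
      (h1.ofReal.add (h2.ofReal.constMul I)).mdiff v
  have e4 : 𝕕 (fun y =>
        ((inner ℝ (sharp01 (β y)) (sharp01 (α y)) : ℝ) : ℂ) + I *
        ((inner ℝ (sharp01 (β y)) (J E y (sharp01 (α y))) : ℝ) : ℂ)) x v
      = 𝕕 (fun y => ((inner ℝ (sharp01 (β y)) (sharp01 (α y)) : ℝ) : ℂ)) x v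
      + 𝕕 (fun y => I *
        ((inner ℝ (sharp01 (β y)) (J E y (sharp01 (α y))) : ℝ) : ℂ)) x v := by
    rw [mvfderiv_fun_add h1.ofReal.mdiff (h2.ofReal.constMul I).mdiff, add_apply]
  have e5 : 𝕕 (fun y => I * ((inner ℝ (sharp01 (β y)) (J E y (sharp01 (α y))) : ℝ) : ℂ)) x v
      = I * 𝕕 (fun y =>
        ((inner ℝ (sharp01 (β y)) (J E y (sharp01 (α y))) : ℝ) : ℂ)) x v :=
    mvfderiv_clm (I • ContinuousLinearMap.id ℝ ℂ) h2.ofReal.mdiff v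
  rw [e3, e4, e5, e1, e2, hT.metric_near hb ha, hT.metric_near hb ha.J, hX.nabla_J hT ha]
  have f1 := formMetric_flat01 (fun a b => hX.inner_J a b)
    (nablaT (fun y => sharp01 (α y)) x v) (β x)
  have f2 := formMetric_flat01 (fun a b => hX.inner_J a b) (sharp01 (α x))
    (SpinDirac.flat01 (nablaT (fun y => sharp01 (β y)) x v))
  rw [flat01_sharp01] at f2
  rw [formDeriv, formDeriv, f1, f2, flat01_apply, ← flat01_sharp01 (β x), flat01_apply,
    flat01_sharp01]
  push_cast
  ring

end Germs

section Rank

variable {X : Type*} [TopologicalSpace X] {F : Type*} [NormedAddCommGroup F] [NormedSpace ℂ F]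
  {V : X → Type*} [∀ x, NormedAddCommGroup (V x)] [∀ x, InnerProductSpace ℂ (V x)]
  [TopologicalSpace (TotalSpace F V)] [FiberBundle F V] [VectorBundle ℂ F V]

variable (F) in
/-- A fiber of a vector bundle is isomorphic to the model fiber. -/
def fiberEquiv (x : X) : V x ≃ₗ[ℂ] F :=
  ((trivializationAt F V x).continuousLinearEquivAt ℂ x
    (mem_baseSet_trivializationAt F V x)).toLinearEquiv

end Rank

lemma mvfderiv_mul_mul_apply {E : Type*} [NormedAddCommGroup E] [NormedSpace ℝ E]
    {X : Type*} [TopologicalSpace X] [ChartedSpace E X] {x : X} {f g k : X → ℂ}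
    (hf : FnNear E f x) (hg : FnNear E g x) (hk : FnNear E k x) (v : 𝕋 x) :
    𝕕 (fun y => f y * g y * k y) x v = 𝕕 f x v * g x * k x + f x * 𝕕 g x v * k x
        + f x * g x * 𝕕 k x v := by
  rw [mvfderiv_mul_apply (hf.mul hg).mdiff hk.mdiff, mvfderiv_mul_apply hf.mdiff hg.mdiff]
  ring

section Decomposables

variable (nablaT nablaL nablaV)
  {x : X} {α β : Π y : X, T01Dual E y} {a : 𝔛}

variable (F) in
/-- The factors of a decomposable section are smooth near `x`. -/
structure DecNear (c : 𝔻) (x : X) : Prop where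
  form : ∀ i, FormNear (c.form i) x
  line : ∀ i, SmoothNear E ℂ (c.line i) x
  vec : SmoothNear E F c.vec x

lemma DecNear.eventually {c : 𝔻} (h : DecNear F c x) : ∀ᶠ y in 𝓝 x, DecNear F c y := by
  filter_upwards [Filter.eventually_all.2 fun i => (h.form i).eventually,
    Filter.eventually_all.2 fun i => (h.line i).eventually, h.vec.eventually] with y h1 h2 h3
    using ⟨h1, h2, h3⟩

lemma Decomposable.SmoothOn.decNear {c : 𝔻} {U : Set X}
    (h : c.SmoothOn F U) (hU : IsOpen U) (hx : x ∈ U) : DecNear F c x :=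
  ⟨fun i => formNear_of_smoothFormOn (h.1 i) hU hx,
    fun i => smoothNear_of_smoothSectionOn (h.2.1 i) hU hx,
    smoothNear_of_smoothSectionOn h.2.2 hU hx⟩

lemma Decomposable.smoothOn_of_decNear {c : 𝔻} {U : Set X}
    (h : ∀ y ∈ U, DecNear F c y) : c.SmoothOn F U :=
  ⟨fun i => smoothFormOn_of_formNear fun y hy => (h y hy).form i,
    fun i => smoothSectionOn_of_smoothNear fun y hy => (h y hy).line i,
    smoothSectionOn_of_smoothNear fun y hy => (h y hy).vec⟩

/-- The covariant derivative of a decomposable section, by the Leibniz rule. -/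
def Decomposable.deriv (c : 𝔻) (x : X) (v : 𝕋 x) :
    𝔽 x :=
  (∑ i, pureForm (Function.update (fun j => c.form j x) i (formDeriv nablaT (c.form i) x v))
      (fun j => c.line j x) (c.vec x))
    + (∑ i, pureForm (fun j => c.form j x)
        (Function.update (fun j => c.line j x) i (nablaL (c.line i) x v)) (c.vec x))
    + pureForm (fun j => c.form j x) (fun j => c.line j x) (nablaV c.vec x v)

lemma Decomposable.deriv_add (c : 𝔻) (v w : 𝕋 x) : c.deriv nablaT nablaL nablaV x (v + w)
      = c.deriv nablaT nablaL nablaV x v + c.deriv nablaT nablaL nablaV x w := by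
  simp only [Decomposable.deriv, formDeriv, map_add, pureForm_update_add, pureForm_updateLine_add,
    pureForm_add, sum_add_distrib]
  abel

lemma Decomposable.deriv_smul (c : 𝔻) (r : ℝ) (v : 𝕋 x) :
    c.deriv nablaT nablaL nablaV x (r • v) = (r : ℂ) • c.deriv nablaT nablaL nablaV x v := by
  have h1 : ∀ i, nablaL (c.line i) x (r • v) = (r : ℂ) • nablaL (c.line i) x v := fun i => by
    rw [map_smul]; rfl
  have h2 : nablaV c.vec x (r • v) = (r : ℂ) • nablaV c.vec x v := by
    rw [map_smul]; rfl
  have h3 : ∀ i, formDeriv nablaT (c.form i) x (r • v)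
      = (r : ℂ) • formDeriv nablaT (c.form i) x v := fun i => by
    rw [formDeriv, map_smul, flat01_smul]; rfl
  simp only [Decomposable.deriv, h1, h2, h3, pureForm_update_smul, pureForm_updateLine_smul,
    pureForm_smul, smul_sum, smul_add]

/-- The standing assumptions on the metrics and connections. -/
structure HermitianData : Prop where
  kahler : IsKahlerMetric E X
  leviCivita : IsLeviCivita nablaT
  metL : IsSmoothHermitianMetric E ℂ (fun x (a b : L x) => inner ℂ a b)
  connL : IsHermitianConnection (fun x (a b : L x) => inner ℂ a b) nablaL
  metV : IsSmoothHermitianMetric E F (fun x (a b : V x) => inner ℂ a b)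
  connV : IsHermitianConnection (fun x (a b : V x) => inner ℂ a b) nablaV

variable {nablaT nablaL nablaV}

lemma DecNear.metric (H : ℍ) {c c' : 𝔻} (h : DecNear F c x) (h' : DecNear F c' x) (v : 𝕋 x) :
    FnNear E (fun y => inducedHermitian y (c.val y) (c'.val y)) x ∧
    𝕕 (fun y => inducedHermitian y (c.val y) (c'.val y)) x v
      = inducedHermitian x (c.deriv nablaT nablaL nablaV x v) (c'.val x)
        + inducedHermitian x (c.val x) (c'.deriv nablaT nablaL nablaV x v) := by
  have hF : ∀ y, FiniteDimensional ℂ (V y) := fun y => (fiberEquiv F y).symm.finiteDimensional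
  have hL : ∀ y, finrank ℂ (L y) = 1 := fun y => by
    rw [(fiberEquiv ℂ y).finrank_eq, Module.finrank_self]
  obtain ⟨q, α, l, e⟩ := c
  obtain ⟨q', α', l', e'⟩ := c'
  by_cases hq : q = q'
  · subst hq
    have hM : ∀ i j, _ := fun i j =>
      (h.form i).metric nablaT H.kahler H.leviCivita (h'.form j) v
    have hA := mvfderiv_det_apply (x := x)
      (g := fun y => Matrix.of fun i j => formMetric (α i y) (α' j y))
      (fun i j => (hM i j).1) v
    have hB := mvfderiv_prod_apply (x := x) (Finset.univ : Finset (Fin p))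
      (g := fun i y => (inner ℂ (l i y) (l' i y) : ℂ))
      (fun i _ => FnNear.hermitian H.metL (h.line i) (h'.line i)) v
    have hC : FnNear E (fun y => (inner ℂ (e y) (e' y) : ℂ)) x :=
      FnNear.hermitian H.metV h.vec h'.vec
    have e0 : ∀ y, inducedHermitian (E := E) (p := p) y
        ((⟨q, α, l, e⟩ : 𝔻).val y)
        ((⟨q, α', l', e'⟩ : 𝔻).val y) = (Matrix.of fun i j => formMetric (α i y) (α' j y)).det
          * (∏ i, inner ℂ (l i y) (l' i y)) * inner ℂ (e y) (e' y) := fun y =>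
      inducedHermitian_pureForm (hL y) _ _ _ _ _ _
    have hM2 : (Matrix.of fun i j => 𝕕 (fun y => formMetric (α i y) (α' j y)) x v)
        = (Matrix.of fun i j => formMetric (formDeriv nablaT (α i) x v) (α' j x))
          + Matrix.of fun i j => formMetric (α i x) (formDeriv nablaT (α' j) x v) := by
      ext i j
      exact (hM i j).2
    have hB2 : ∀ i, 𝕕 (fun y => (inner ℂ (l i y) (l' i y) : ℂ)) x v
        = inner ℂ (nablaL (l i) x v) (l' i x) + inner ℂ (l i x) (nablaL (l' i) x v) := fun i =>
      H.connL.metric_near (h.line i) (h'.line i) v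
    have hC2 : 𝕕 (fun y => (inner ℂ (e y) (e' y) : ℂ)) x v
        = inner ℂ (nablaV e x v) (e' x) + inner ℂ (e x) (nablaV e' x v) :=
      H.connV.metric_near h.vec h'.vec v
    have d1 := mvfderiv_mul_mul_apply hA.1 hB.1 hC v
    have hA2 := hA.2
    have hB3 := hB.2
    simp only [Matrix.of_apply] at hA2
    rw [hM2, Matrix.mul_add, Matrix.trace_add] at hA2
    simp only [hB2, add_mul, sum_add_distrib] at hB3
    rw [hA2, hB3, hC2] at d1
    refine ⟨((hA.1.mul hB.1).mul hC).congr (.of_forall e0), ?_⟩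
    rw [mvfderiv_congr (.of_forall e0), d1]
    simp only [Decomposable.deriv, Decomposable.val_eq, map_add, map_sum, LinearMap.add_apply,
      LinearMap.sum_apply, sum_inducedHermitian_update_left (hL x),
      sum_inducedHermitian_update_right (hL x), sum_inducedHermitian_updateLine_left (hL x),
      sum_inducedHermitian_updateLine_right (hL x)]
    simp only [inducedHermitian_pureForm (hL x)]
    ring
  · have e0 : ∀ y, inducedHermitian (E := E) (p := p) y
        ((⟨q, α, l, e⟩ : 𝔻).val y)
        ((⟨q', α', l', e'⟩ : 𝔻).val y) = 0 := fun y =>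
      inducedHermitian_pureForm_of_ne hq (hL y) _ _ _ _ _ _
    refine ⟨(FnNear.const 0).congr (.of_forall e0), ?_⟩
    rw [mvfderiv_congr (.of_forall e0)]
    have z1 : ∀ (γ : Fin q → T01Dual E x) (k : Fin p → L x) (f : V x),
        inducedHermitian x (pureForm γ k f) (pureForm (fun i => α' i x) (fun i => l' i x) (e' x))
          = 0 := fun γ k f => inducedHermitian_pureForm_of_ne hq (hL x) _ _ _ _ _ _
    have z2 : ∀ (γ : Fin q' → T01Dual E x) (k : Fin p → L x) (f : V x),
        inducedHermitian x (pureForm (fun i => α i x) (fun i => l i x) (e x)) (pureForm γ k f)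
          = 0 := fun γ k f => inducedHermitian_pureForm_of_ne hq (hL x) _ _ _ _ _ _
    simp only [Decomposable.deriv, Decomposable.val_eq, map_add, map_sum, LinearMap.add_apply,
      LinearMap.sum_apply]
    simp only [z1, z2, Finset.sum_const_zero, add_zero]
    rw [mvfderiv_const]
    rfl

end Decomposables

section SectionGerms

variable (nablaT nablaL nablaV)
  {x : X} {α β : Π y : X, T01Dual E y} {a : 𝔛}

variable {s t : Π y : X, 𝔽 y}

variable (F) in
/-- The section `s` is a finite sum of smooth decomposable sections near `x`. -/
def SecNear (s : Π y : X, 𝔽 y) (x : X) : Prop :=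
  ∃ (m : ℕ) (c : Fin m → 𝔻), (∀ k, DecNear F (c k) x) ∧ ∀ᶠ y in 𝓝 x, s y = ∑ k, (c k).val y

lemma secNear_of_fintype {ι : Type*} [Fintype ι] (c : ι → 𝔻)
    (hc : ∀ k, DecNear F (c k) x) (h : ∀ᶠ y in 𝓝 x, s y = ∑ k, (c k).val y) : SecNear F s x := by
  refine ⟨Fintype.card ι, fun k => c ((Fintype.equivFin ι).symm k), fun k => hc _, ?_⟩
  filter_upwards [h] with y hy
  rw [hy]
  exact (Equiv.sum_comp (Fintype.equivFin ι).symm fun k => (c k).val y).symm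

lemma DecNear.secNear {c : 𝔻} (h : DecNear F c x) : SecNear F c.val x :=
  secNear_of_fintype (fun _ : Unit => c) (fun _ => h) (.of_forall fun y => by simp)

lemma SecNear.congr (h : SecNear F s x) (ht : ∀ᶠ y in 𝓝 x, t y = s y) : SecNear F t x := by
  obtain ⟨m, c, hc, hs⟩ := h
  refine ⟨m, c, hc, ?_⟩
  filter_upwards [hs, ht] with y h1 h2 using h2.trans h1

lemma SecNear.eventually (h : SecNear F s x) : ∀ᶠ y in 𝓝 x, SecNear F s y := by
  obtain ⟨m, c, hc, hs⟩ := h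
  filter_upwards [Filter.eventually_all.2 fun k => (hc k).eventually, hs.eventually_nhds]
    with y h1 h2 using ⟨m, c, h1, h2⟩

lemma SecNear.sum {ι : Type*} [Fintype ι] {s : ι → Π y : X, 𝔽 y}
    (h : ∀ i, SecNear F (s i) x) : SecNear F (fun y => ∑ i, s i y) x := by
  choose m c hc hs using h
  refine secNear_of_fintype (fun k : (i : ι) × Fin (m i) => c k.1 k.2) (fun k => hc _ _) ?_
  filter_upwards [Filter.eventually_all.2 hs] with y hy
  rw [Fintype.sum_sigma]
  exact sum_congr rfl fun i _ => hy i

lemma SecNear.add (hs : SecNear F s x) (ht : SecNear F t x) : SecNear F (fun y => s y + t y) x := by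
  obtain ⟨m, c, hc, hs⟩ := hs
  obtain ⟨m', c', hc', ht⟩ := ht
  refine secNear_of_fintype (Sum.elim c c') (fun k => ?_) ?_
  · rcases k with k | k
    exacts [hc k, hc' k]
  · filter_upwards [hs, ht] with y h1 h2
    rw [h1, h2, Fintype.sum_sum_type]
    rfl

/-- Properties of germs of sections may be checked on decomposable sections. -/
lemma SecNear.induction {P : (Π y : X, 𝔽 y) → Prop} (hdec : ∀ c : 𝔻, DecNear F c x → P c.val)
    (hzero : P (fun _ => 0))
    (hadd : ∀ s t, SecNear F s x → SecNear F t x → P s → P t → P (fun y => s y + t y))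
    (hcongr : ∀ s t, SecNear F s x → (∀ᶠ y in 𝓝 x, t y = s y) → P s → P t)
    (hs : SecNear F s x) : P s := by
  obtain ⟨m, c, hc, hs⟩ := hs
  have h1 : ∀ S : Finset (Fin m), SecNear F (fun y => ∑ k ∈ S, (c k).val y) x ∧
      P (fun y => ∑ k ∈ S, (c k).val y) := by
    intro S
    classical
    induction S using Finset.induction_on with
    | empty =>
      simp only [Finset.sum_empty]
      exact ⟨secNear_of_fintype (fun i : Empty => i.elim) (fun i => i.elim)
        (.of_forall fun y => by simp), hzero⟩
    | insert a S ha ih =>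
      simp only [sum_insert ha]
      exact ⟨(hc a).secNear.add ih.1, hadd _ _ (hc a).secNear ih.1 (hdec _ (hc a)) ih.2⟩
  exact hcongr _ _ (h1 Finset.univ).1 hs (h1 Finset.univ).2

lemma DecNear.smul {c : 𝔻} (h : DecNear F c x) {f : X → ℂ} (hf : FnNear E f x) :
    DecNear F { c with vec := fun y => f y • c.vec y } x :=
  ⟨h.form, h.line, h.vec.complex_smul hf⟩

lemma Decomposable.val_smul (c : 𝔻) (f : X → ℂ) (y : X) :
    ({ c with vec := fun y => f y • c.vec y } : 𝔻).val y = f y • c.val y :=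
  pureForm_smul _ _ _ _

lemma SecNear.smul {f : X → ℂ} (hf : FnNear E f x) (hs : SecNear F s x) :
    SecNear F (fun y => f y • s y) x := by
  obtain ⟨m, c, hc, hs⟩ := hs
  refine ⟨m, fun k => { c k with vec := fun y => f y • (c k).vec y }, fun k => (hc k).smul hf, ?_⟩
  filter_upwards [hs] with y hy
  rw [hy, smul_sum]
  exact sum_congr rfl fun k _ => ((c k).val_smul f y).symm

variable (F) in
lemma exists_decNear (x : X) {q : ℕ} (α : Fin q → T01Dual E x) (l : Fin p → L x) (e : V x) :
    ∃ c : 𝔻, DecNear F c x ∧ c.val x = pureForm α l e := by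
  have h1 : ∀ i, ∃ a : 𝔛, SmoothNear E E a x ∧ a x = sharp01 (α i) := fun i => exists_smoothNear _
  have h2 : ∀ i, ∃ s : Π y : X, L y, SmoothNear E ℂ s x ∧ s x = l i := fun i =>
    exists_smoothNear _
  have : FiniteDimensional ℝ F := FiniteDimensional.complexToReal F
  obtain ⟨e', he', hex⟩ := exists_smoothNear (E := E) (F := F) (x := x) e
  choose a ha hax using h1
  choose s hs hsx using h2
  refine ⟨⟨q, fun i y => flat01 (a i y), s, e'⟩, ⟨fun i => FormNear.flat01 (ha i), hs, he'⟩, ?_⟩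
  rw [Decomposable.val_eq]
  simp only [hax, hsx, hex, flat01_sharp01]

lemma exists_secNear (ξ : 𝔽 x) : ∃ s : Π y : X, 𝔽 y, SecNear F s x ∧ s x = ξ := by
  induction ξ using pureForm_induction with
  | h q α l e =>
    obtain ⟨c, hc, h⟩ := exists_decNear F x α l e
    exact ⟨c.val, hc.secNear, h⟩
  | hadd ξ η h1 h2 =>
    obtain ⟨s, hs, rfl⟩ := h1
    obtain ⟨t, ht, rfl⟩ := h2
    exact ⟨_, hs.add ht, rfl⟩
  | hzero =>
    exact ⟨fun y => 0, secNear_of_fintype (fun i : Empty => i.elim) (fun i => i.elim)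
        (.of_forall fun y => by simp), rfl⟩

lemma isSmoothForm_iff : IsSmoothForm F s ↔ ∀ x, SecNear F s x := by
  constructor
  · intro h x
    obtain ⟨U, hU, hx, m, c, hc, hs⟩ := h x
    exact ⟨m, c, fun k => (hc k).decNear hU hx, Filter.eventually_of_mem (hU.mem_nhds hx) hs⟩
  · intro h x
    obtain ⟨m, c, hc, hs⟩ := h x
    obtain ⟨U, hU, hUo, hx⟩ := eventually_nhds_iff.1
      ((Filter.eventually_all.2 fun k => (hc k).eventually).and hs)
    exact ⟨U, hUo, hx, m, c, fun k => Decomposable.smoothOn_of_decNear fun y hy => (hU y hy).1 k,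
      fun y hy => (hU y hy).2⟩

variable {nablaT nablaL nablaV}

lemma hasCovariantDerivative_iff (H : ℍ) (v : 𝕋 x) (ξ : 𝔽 x) :
    HasCovariantDerivative nablaT nablaL nablaV s x v ξ ↔
      ∃ (m : ℕ) (c : Fin m → 𝔻), (∀ k, DecNear F (c k) x) ∧ (∀ᶠ y in 𝓝 x, s y = ∑ k, (c k).val y) ∧
        ξ = ∑ k, (c k).deriv nablaT nablaL nablaV x v := by
  have key : ∀ (c : 𝔻) (β : Fin c.deg → T01Dual E x), DecNear F c x →
      (∀ i, IsFormDerivative nablaT (c.form i) x v (β i)) → (∑ i, ιMulti ℂ c.deg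
            (Function.update (fun j => c.form j x) i (β i))) ⊗ₜ[ℂ]
          (tprod ℂ (fun j => c.line j x) ⊗ₜ[ℂ] c.vec x)
        + ιMulti ℂ c.deg (fun j => c.form j x) ⊗ₜ[ℂ]
            twistDerivative nablaL nablaV c x v = c.deriv nablaT nablaL nablaV x v := by
    intro c β hc hβ
    have h1 : ∀ i, β i = formDeriv nablaT (c.form i) x v := fun i =>
      (H.kahler.isFormDerivative_iff H.leviCivita (formNear_iff_sharp01.1 (hc.form i))
        (.of_forall fun y => (flat01_sharp01 _).symm) v (β i)).1 (hβ i)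
    rw [Decomposable.deriv, twistDerivative, TensorProduct.tmul_add, TensorProduct.sum_tmul,
      TensorProduct.sum_tmul, TensorProduct.tmul_sum, ← add_assoc]
    simp only [h1]
    rfl
  constructor
  · rintro ⟨U, hU, hx, m, c, β, hc, hs, hβ, hξ⟩
    refine ⟨m, c, fun k => (hc k).decNear hU hx, Filter.eventually_of_mem (hU.mem_nhds hx) hs, ?_⟩
    rw [hξ]
    exact sum_congr rfl fun k _ => key _ _ ((hc k).decNear hU hx) (hβ k)
  · rintro ⟨m, c, hc, hs, hξ⟩
    obtain ⟨U, hU, hUo, hx⟩ := eventually_nhds_iff.1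
      ((Filter.eventually_all.2 fun k => (hc k).eventually).and hs)
    have hβ : ∀ k i, IsFormDerivative nablaT ((c k).form i) x v
        (formDeriv nablaT ((c k).form i) x v) := fun k i =>
      (H.kahler.isFormDerivative_iff H.leviCivita (formNear_iff_sharp01.1 ((hc k).form i))
        (.of_forall fun y => (flat01_sharp01 _).symm) v _).2 rfl
    refine ⟨U, hUo, hx, m, c, fun k i => formDeriv nablaT ((c k).form i) x v,
      fun k => Decomposable.smoothOn_of_decNear fun y hy => (hU y hy).1 k,
      fun y hy => (hU y hy).2, hβ, ?_⟩
    rw [hξ]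
    exact sum_congr rfl fun k _ => (key _ _ (hc k) (hβ k)).symm

/-- The metric of the bundle takes smooth values on smooth sections. -/
lemma SecNear.fnNear_herm (H : ℍ) (hs : SecNear F s x)
    (ht : SecNear F t x) : FnNear E (fun y => inducedHermitian y (s y) (t y)) x := by
  obtain ⟨m, c, hc, hs⟩ := hs
  obtain ⟨m', c', hc', ht⟩ := ht
  have h1 : FnNear E (fun y => ∑ k, ∑ k', inducedHermitian y ((c k).val y) ((c' k').val y)) x :=
    FnNear.sum fun k _ => FnNear.sum fun k' _ => ((hc k).metric H (hc' k') 0).1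
  refine h1.congr ?_
  filter_upwards [hs, ht] with y h2 h3
  rw [h2, h3]
  simp only [map_sum, LinearMap.sum_apply]
  rw [sum_comm]

end SectionGerms

section ConnectionRules

variable {x : X} {α β : Π y : X, T01Dual E y} {a : 𝔛}

variable {r s t : Π y : X, 𝔽 y}

lemma HermitianData.finrank_line (_ : ℍ) (y : X) : finrank ℂ (L y) = 1 := by
  rw [(fiberEquiv ℂ y).finrank_eq, Module.finrank_self]

lemma HermitianData.finiteDimensional (_ : ℍ) (y : X) :
    FiniteDimensional ℂ (V y) := (fiberEquiv F y).symm.finiteDimensional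

lemma HermitianData.herm_wedge (H : ℍ) (a : 𝕋 x) (ξ η : 𝔽 x) :
    inducedHermitian x (wedge (flat01 a) ξ) η = inducedHermitian x ξ (contr a η) := by
  have := H.finiteDimensional x
  exact inducedHermitian_wedge (H.finrank_line x) (fun a b => H.kahler.inner_J a b) a ξ η

/-- An element of a fiber is determined by its products with values of decomposable sections. -/
lemma HermitianData.ext_herm (H : ℍ) {ξ η : 𝔽 x} (h : ∀ c : 𝔻, DecNear F c x →
      inducedHermitian x (c.val x) ξ = inducedHermitian x (c.val x) η) : ξ = η := by
  have := H.finiteDimensional x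
  have h2 : ξ - η = 0 := by
    refine inducedHermitian_nondegenerate (H.finrank_line x) fun ζ => ?_
    induction ζ using pureForm_induction with
    | h q α l e =>
      obtain ⟨c, hc, hcx⟩ := exists_decNear F x α l e
      rw [← hcx, map_sub, h c hc, sub_self]
    | hadd ζ ζ' h1 h2 => rw [sesq_add_left, h1, h2, add_zero]
    | hzero => rw [map_zero, LinearMap.zero_apply]
  exact sub_eq_zero.1 h2

/-- The covariant derivative of sections. -/
abbrev HermitianData.cd (_ : ℍ)
    (s : Π y : X, 𝔽 y) (x : X) (v : 𝕋 x) :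
    𝔽 x := covariantDerivative nablaT nablaL nablaV s x v

/-- The calculus of sections of `Λ^{0,•}(T^*X) ⊗ L^p ⊗ V`. -/
def HermitianData.calculus (H : ℍ) (p : ℕ) :
    SectionCalculus E (𝔽) (𝔻) where
  val := Decomposable.val
  near := DecNear F
  deriv c x v := c.deriv nablaT nablaL nablaV x v
  herm := inducedHermitian
  metric _ _ _ hc hc' v := hc.metric H hc' v
  ext _ _ _ h := H.ext_herm h

lemma HermitianData.hasDeriv_cd (H : ℍ) (hs : SecNear F s x)
    (v : 𝕋 x) : (H.calculus p).HasDeriv s x v (H.cd s x v) := by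
  obtain ⟨m, d, hd, hs⟩ := hs
  have h : HasCovariantDerivative nablaT nablaL nablaV s x v
      (∑ k, (d k).deriv nablaT nablaL nablaV x v) :=
    (hasCovariantDerivative_iff H v _).2 ⟨m, d, hd, hs, rfl⟩
  exact (hasCovariantDerivative_iff H v _).1 (Classical.epsilon_spec ⟨_, h⟩)

lemma HermitianData.cd_eq_sum (H : ℍ) (v : 𝕋 x) {m : ℕ}
    {d : Fin m → 𝔻} (hd : ∀ k, DecNear F (d k) x) (hs : ∀ᶠ y in 𝓝 x, s y = ∑ k, (d k).val y) :
    H.cd s x v = ∑ k, (d k).deriv nablaT nablaL nablaV x v :=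
  (H.hasDeriv_cd ⟨m, d, hd, hs⟩ v).unique ⟨m, d, hd, hs, rfl⟩

lemma HermitianData.cd_dec (H : ℍ) {c : 𝔻} (hc : DecNear F c x) (v : 𝕋 x) :
    H.cd c.val x v = c.deriv nablaT nablaL nablaV x v :=
  (H.hasDeriv_cd hc.secNear v).unique (SectionCalculus.near.hasDeriv (K := H.calculus p) hc)

lemma HermitianData.cd_metric (H : ℍ) (hr : SecNear F r x) (hs : SecNear F s x) (v : 𝕋 x) :
    𝕕 (fun y => inducedHermitian y (r y) (s y)) x v
      = inducedHermitian x (H.cd r x v) (s x) + inducedHermitian x (r x) (H.cd s x v) :=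
  ((H.hasDeriv_cd hr v).metric (H.hasDeriv_cd hs v)).2

lemma HermitianData.cd_congr (H : ℍ) (hs : SecNear F s x)
    (h : ∀ᶠ y in 𝓝 x, t y = s y) (v : 𝕋 x) : H.cd t x v = H.cd s x v :=
  (H.hasDeriv_cd (hs.congr h) v).unique ((H.hasDeriv_cd hs v).congr h)

lemma HermitianData.cd_add (H : ℍ) (hs : SecNear F s x) (ht : SecNear F t x) (v : 𝕋 x) :
    H.cd (fun y => s y + t y) x v = H.cd s x v + H.cd t x v :=
  (H.hasDeriv_cd hs v).add (H.hasDeriv_cd ht v) (H.hasDeriv_cd (hs.add ht) v)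

lemma HermitianData.cd_smul (H : ℍ) (hs : SecNear F s x) {f : X → ℂ} (hf : FnNear E f x) (v : 𝕋 x) :
    H.cd (fun y => f y • s y) x v = f x • H.cd s x v + (𝕕 f x v) • s x :=
  (H.hasDeriv_cd hs v).smul hf (H.hasDeriv_cd (hs.smul hf) v)

lemma HermitianData.cd_add_right (H : ℍ) (hs : SecNear F s x)
    (v w : 𝕋 x) : H.cd s x (v + w) = H.cd s x v + H.cd s x w := by
  obtain ⟨m, d, hd, hs⟩ := hs
  rw [H.cd_eq_sum _ hd hs, H.cd_eq_sum v hd hs, H.cd_eq_sum w hd hs, ← sum_add_distrib]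
  exact sum_congr rfl fun k _ => (d k).deriv_add _ _ _ v w

lemma HermitianData.cd_smul_right (H : ℍ) (hs : SecNear F s x)
    (c : ℝ) (v : 𝕋 x) : H.cd s x (c • v) = (c : ℂ) • H.cd s x v := by
  obtain ⟨m, d, hd, hs⟩ := hs
  rw [H.cd_eq_sum _ hd hs, H.cd_eq_sum v hd hs, smul_sum]
  exact sum_congr rfl fun k _ => (d k).deriv_smul _ _ _ c v

/-- The decomposable section `α ∧ c`. -/
def Decomposable.cons (α : Π y : X, T01Dual E y) (c : 𝔻) :
    𝔻 :=
  ⟨c.deg + 1, fun i y => (Fin.cons (α y) (fun j => c.form j y) : Fin (c.deg + 1) → T01Dual E y) i,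
    c.line, c.vec⟩

lemma Decomposable.cons_val (α : Π y : X, T01Dual E y) (c : 𝔻) (y : X) :
    (c.cons α).val y = wedge (α y) (c.val y) :=
  (wedge_pureForm _ _ _ _).symm

lemma DecNear.cons {c : 𝔻} (hc : DecNear F c x) (hα : FormNear α x) : DecNear F (c.cons α) x := by
  refine ⟨fun i => ?_, hc.line, hc.vec⟩
  change Fin (c.deg + 1) at i
  refine Fin.cases ?_ (fun j => ?_) i
  · exact hα
  · exact hc.form j

lemma Decomposable.deriv_cons (α : Π y : X, T01Dual E y) (c : 𝔻) (v : 𝕋 x) :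
    (c.cons α).deriv nablaT nablaL nablaV x v = wedge (formDeriv nablaT α x v) (c.val x)
        + wedge (α x) (c.deriv nablaT nablaL nablaV x v) := by
  have e1 : (c.cons α).deriv nablaT nablaL nablaV x v =
      (∑ i : Fin (c.deg + 1), pureForm (Function.update
        (Fin.cons (α x) (fun j => c.form j x) : Fin (c.deg + 1) → T01Dual E x) i
          (formDeriv nablaT ((c.cons α).form i) x v)) (fun j => c.line j x) (c.vec x))
    + (∑ i, pureForm (Fin.cons (α x) (fun j => c.form j x) : Fin (c.deg + 1) → T01Dual E x)
        (Function.update (fun j => c.line j x) i (nablaL (c.line i) x v)) (c.vec x))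
    + pureForm (Fin.cons (α x) (fun j => c.form j x) : Fin (c.deg + 1) → T01Dual E x)
        (fun j => c.line j x) (nablaV c.vec x v) := rfl
  rw [e1, Fin.sum_univ_succ, Fin.update_cons_zero]
  simp only [← Fin.cons_update, ← wedge_pureForm]
  have e2 : formDeriv nablaT ((c.cons α).form (0 : Fin (c.deg + 1))) x v
      = formDeriv nablaT α x v := rfl
  have e3 : ∀ i : Fin c.deg, formDeriv nablaT ((c.cons α).form i.succ) x v
      = formDeriv nablaT (c.form i) x v := fun i => rfl
  simp only [e2, e3, Decomposable.deriv, map_add, map_sum]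
  rw [c.val_eq]
  abel

lemma SecNear.wedge (hα : FormNear α x) (hs : SecNear F s x) :
    SecNear F (fun y => wedge (α y) (s y)) x := by
  obtain ⟨m, d, hd, hs⟩ := hs
  refine ⟨m, fun k => (d k).cons α, fun k => (hd k).cons hα, ?_⟩
  filter_upwards [hs] with y hy
  rw [hy, map_sum]
  exact sum_congr rfl fun k _ => ((d k).cons_val α y).symm

lemma HermitianData.cd_wedge (H : ℍ) (hα : FormNear α x) (hs : SecNear F s x) (v : 𝕋 x) :
    H.cd (fun y => SpinDirac.wedge (α y) (s y)) x v = SpinDirac.wedge (formDeriv nablaT α x v) (s x)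
        + SpinDirac.wedge (α x) (H.cd s x v) := by
  obtain ⟨m, d, hd, hs⟩ := hs
  have hs' : ∀ᶠ y in 𝓝 x, SpinDirac.wedge (α y) (s y) = ∑ k, ((d k).cons α).val y := by
    filter_upwards [hs] with y hy
    rw [hy, map_sum]
    exact sum_congr rfl fun k _ => ((d k).cons_val α y).symm
  rw [H.cd_eq_sum v hd hs, H.cd_eq_sum v (fun k => (hd k).cons hα) hs', hs.self_of_nhds, map_sum,
    map_sum, ← sum_add_distrib]
  exact sum_congr rfl fun k _ => (d k).deriv_cons α v

lemma DecNear.secNear_contr {c : 𝔻} (hc : DecNear F c x)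
    (ha : SmoothNear E E a x) : SecNear F (fun y => contr (a y) (c.val y)) x := by
  obtain ⟨q, form, line, vec⟩ := c
  cases q with
  | zero =>
    refine secNear_of_fintype (fun i : Empty => i.elim) (fun i => i.elim)
      (.of_forall fun y => ?_)
    rw [Decomposable.val_eq]
    exact (contr_pureForm_zero _ _ _ _).trans (by simp)
  | succ q =>
    have hv : ∀ j : Fin (q + 1), SmoothNear E F (fun y => ((-1 : ℂ) ^ (j : ℕ) *
        (form j y : 𝕋 y →L[ℝ] ℂ) (a y)) • vec y) x := fun j =>
      SmoothNear.complex_smul ((FormNear.apply (hc.form j) ha).constMul _) hc.vec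
    refine secNear_of_fintype (fun j : Fin (q + 1) => (⟨q, fun i => form (j.succAbove i), line,
        fun y => ((-1 : ℂ) ^ (j : ℕ) * (form j y : 𝕋 y →L[ℝ] ℂ) (a y)) • vec y⟩ :
        𝔻)) (fun j => ⟨fun i => hc.form (j.succAbove i), hc.line, hv j⟩)
      (.of_forall fun y => ?_)
    exact contr_pureForm _ _ _ _

lemma SecNear.contr (ha : SmoothNear E E a x) (hs : SecNear F s x) :
    SecNear F (fun y => contr (a y) (s y)) x := by
  obtain ⟨m, d, hd, hs⟩ := hs
  refine (SecNear.sum fun k => (hd k).secNear_contr ha).congr ?_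
  filter_upwards [hs] with y hy
  rw [hy, map_sum]

lemma HermitianData.cd_contr (H : ℍ) (ha : SmoothNear E E a x) (hs : SecNear F s x) (v : 𝕋 x) :
    H.cd (fun y => SpinDirac.contr (a y) (s y)) x v
      = SpinDirac.contr (nablaT a x v) (s x) + SpinDirac.contr (a x) (H.cd s x v) := by
  refine SectionCalculus.HasDeriv.adjoint (K := H.calculus p)
    (W := fun y ξ => SpinDirac.wedge (flat01 (a y)) ξ) (I := fun y ξ => SpinDirac.contr (a y) ξ)
    (W' := fun ξ => SpinDirac.wedge (flat01 (nablaT a x v)) ξ)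
    (I' := fun ξ => SpinDirac.contr (nablaT a x v) ξ)
    (fun y ξ η => H.herm_wedge _ ξ η) (fun ξ η => H.herm_wedge _ ξ η) (fun c hc => ?_)
    (H.hasDeriv_cd hs v) (H.hasDeriv_cd (hs.contr ha) v)
  have h1 := H.cd_wedge (FormNear.flat01 ha) (DecNear.secNear (F := F) hc) v
  rw [formDeriv_flat01, H.cd_dec hc] at h1
  have h2 := H.hasDeriv_cd ((DecNear.secNear (F := F) hc).wedge (FormNear.flat01 ha)) v
  rw [h1] at h2
  exact h2

lemma update_forall {ι A : Type*} [DecidableEq ι] {P : A → Prop} {f : ι → A} {i : ι} {a : A}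
    (ha : P a) (hf : ∀ j, P (f j)) (j : ι) : P (Function.update f i a j) := by
  rcases eq_or_ne j i with rfl | hj
  · rwa [Function.update_self]
  · rw [Function.update_of_ne hj]
    exact hf j

lemma pureForm_congr {q : ℕ} {α α' : Fin q → T01Dual E x} {l l' : Fin p → L x} {e : V x}
    (h : ∀ j, α j = α' j) (h' : ∀ j, l j = l' j) : pureForm α l e = pureForm α' l' e := by
  rw [funext h, funext h']

lemma DecNear.secNear_deriv (H : ℍ) {c : 𝔻} (hc : DecNear F c x) (ha : SmoothNear E E a x) :
    SecNear F (fun y => c.deriv nablaT nablaL nablaV y (a y)) x := by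
  have h1 : ∀ i, FormNear (fun y => formDeriv nablaT (c.form i) y (a y)) x := fun i =>
    FormNear.flat01 (H.leviCivita.smoothConn.near (formNear_iff_sharp01.1 (hc.form i)) ha)
  have h2 : ∀ i, SmoothNear E ℂ (fun y => nablaL (c.line i) y (a y)) x := fun i =>
    H.connL.toIsComplexConnection.smoothConn.near (hc.line i) ha
  have h3 : SmoothNear E F (fun y => nablaV c.vec y (a y)) x :=
    H.connV.toIsComplexConnection.smoothConn.near hc.vec ha
  have s1 : ∀ i, SecNear F (fun y => pureForm
      (Function.update (fun j => c.form j y) i (formDeriv nablaT (c.form i) y (a y)))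
      (fun j => c.line j y) (c.vec y)) x := by
    intro i
    have hd : DecNear F (⟨c.deg, Function.update c.form i
        (fun y => formDeriv nablaT (c.form i) y (a y)), c.line, c.vec⟩ : 𝔻) x :=
       ⟨fun j => update_forall (P := fun α => FormNear α x) (h1 i) hc.form j, hc.line, hc.vec⟩
    refine hd.secNear.congr (.of_forall fun y => ?_)
    refine pureForm_congr (fun j => ?_) fun j => rfl
    by_cases hj : j = i
    · subst hj; simp
    · simp [hj]
  have s2 : ∀ i, SecNear F (fun y => pureForm (L := L) (fun j => c.form j y)
      (Function.update (β := fun _ => L y) (fun j => c.line j y) i (nablaL (c.line i) y (a y)))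
      (c.vec y)) x := by
    intro i
    have hd : DecNear F (⟨c.deg, c.form, Function.update c.line i
        (fun y => nablaL (c.line i) y (a y)), c.vec⟩ : 𝔻) x :=
       ⟨hc.form, fun j => update_forall (P := fun l => SmoothNear E ℂ l x) (h2 i) hc.line j, hc.vec⟩
    refine hd.secNear.congr (.of_forall fun y => ?_)
    refine pureForm_congr (fun j => rfl) fun j => ?_
    by_cases hj : j = i
    · subst hj; simp
    · simp [hj]
  have s3 : DecNear F (⟨c.deg, c.form, c.line, fun y => nablaV c.vec y (a y)⟩ :
      𝔻) x := ⟨hc.form, hc.line, h3⟩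
  exact ((SecNear.sum s1).add (SecNear.sum s2)).add s3.secNear

lemma SecNear.cd (H : ℍ) (hs : SecNear F s x)
    (ha : SmoothNear E E a x) : SecNear F (fun y => H.cd s y (a y)) x := by
  obtain ⟨m, d, hd, hs⟩ := hs
  refine (SecNear.sum fun k => (hd k).secNear_deriv H ha).congr ?_
  filter_upwards [Filter.eventually_all.2 fun k => (hd k).eventually, hs.eventually_nhds]
    with y h1 h2
  exact H.cd_eq_sum (a y) h1 h2

end ConnectionRules

section Instance

variable {x : X} {α β : Π y : X, T01Dual E y} {a : 𝔛}

variable {r s t : Π y : X, 𝔽 y}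

lemma pairing_eq {x : X} (a v : 𝕋 x) :
    pairing a v = (flat01 a : 𝕋 x →L[ℝ] ℂ) v := (flat01_apply a v).symm

/-- The bundle `Λ^{0,•}(T^*X) ⊗ L^p ⊗ V` as a Clifford module bundle. -/
def HermitianData.clifford (H : ℍ) (p : ℕ) :
    CliffordCalculus nablaT (𝔽) where
  sec := SecNear F
  cd := covariantDerivative nablaT nablaL nablaV
  herm := inducedHermitian
  wedge _ a := wedge (flat01 a)
  contr _ a := contr a
  sec_congr h h' := h.congr h'
  sec_eventually h := h.eventually
  sec_add h h' := h.add h'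
  sec_smul hf h := h.smul hf
  sec_wedge ha h := h.wedge (FormNear.flat01 ha)
  sec_contr ha h := h.contr ha
  sec_cd ha h := h.cd H ha
  exists_sec ξ := exists_secNear ξ
  cd_congr h h' v := H.cd_congr h h' v
  cd_add h h' v := H.cd_add h h' v
  cd_smul hf h v := H.cd_smul h hf v
  cd_add_right h v w := H.cd_add_right h v w
  cd_smul_right h c v := H.cd_smul_right h c v
  cd_wedge {s x a} ha h v := by
    have h1 := H.cd_wedge (FormNear.flat01 ha) h v
    rw [formDeriv_flat01] at h1
    exact h1
  cd_contr ha h v := H.cd_contr ha h v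
  herm_near h h' := h.fnNear_herm H h'
  herm_cd h h' v := H.cd_metric h h' v
  herm_wedge a ξ η := H.herm_wedge a ξ η
  nondegenerate {x η} h := by
    have := H.finiteDimensional x
    exact inducedHermitian_nondegenerate (H.finrank_line x) h
  wedge_add a b ξ := by rw [map_add, wedge_add]
  wedge_smul r a ξ := by rw [flat01_smul, SpinDirac.wedge_smul]
  wedge_J a ξ := by rw [flat01_J (fun a b => H.kahler.inner_J a b), SpinDirac.wedge_smul]
  contr_add a b ξ := SpinDirac.contr_add a b ξ
  contr_smul r a ξ := SpinDirac.contr_smul r a ξ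
  contr_J a ξ := SpinDirac.contr_J a ξ
  wedge_wedge a b ξ := wedge_wedge _ _ ξ
  contr_contr a b ξ := contr_contr a b ξ
  contr_wedge v a ξ := by rw [pairing_eq]; exact contr_wedge v _ ξ

end Instance

section AntilinearForms

variable {x : X}

lemma antilinear_eq_sum (β : E →ₗ[ℝ] ℂ) (hβ : ∀ w, β (I • w) = -I * β w) (w : E) :
    β w = ∑ j, conj ((finBasis ℂ E).coord j w) * β (finBasis ℂ E j) := by
  have h : ∀ (c : ℂ) (w : E), β (c • w) = conj c * β w := by
    intro c w
    have h1 : c • w = c.re • w + c.im • (I • w) := by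
      conv_lhs => rw [← Complex.re_add_im c, add_smul, mul_smul]
      simp
    rw [h1, map_add, map_smul, map_smul, hβ]
    simp only [Complex.real_smul]
    rw [show conj c = (c.re : ℂ) - c.im * I from Complex.ext (by simp) (by simp)]
    ring
  conv_lhs => rw [← (finBasis ℂ E).sum_repr w]
  rw [map_sum]
  exact sum_congr rfl fun j _ => h _ _

lemma T01Dual.eq_sum (α : T01Dual E x) :
    α = ∑ j, (α : 𝕋 x →L[ℝ] ℂ) (tangentBasis E x j) • conjDualBasis E x j := by
  refine Subtype.ext (ContinuousLinearMap.ext fun v => ?_)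
  refine (antilinear_eq_sum (E := E)
    (show E →ₗ[ℝ] ℂ from (α : 𝕋 x →L[ℝ] ℂ).toLinearMap) α.2 v).trans ?_
  rw [AddSubmonoidClass.coe_finsetSum, sum_apply]
  exact sum_congr rfl fun j _ => mul_comm _ _

end AntilinearForms

section ConjCoordinates

variable {x₀ y : X}

/-- The complex conjugates of the holomorphic coordinates. -/
def conjCoord (x₀ : X) (j : Fin (finrank ℂ E)) (y : X) : ℂ :=
  ((Complex.conjCLE : ℂ →L[ℝ] ℂ).comp
      ((LinearMap.toContinuousLinearMap ((finBasis ℂ E).coord j)).restrictScalars ℝ :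
        E →L[ℝ] ℂ)) (φ₀ y)

lemma fnNear_conjCoord (hy : y ∈ 𝕌 x₀) (j : Fin (finrank ℂ E)) : FnNear E (conjCoord x₀ j) y := by
  refine FnNear.clm _ ?_
  filter_upwards [(chartAt E x₀).open_source.mem_nhds hy] with z hz
  exact contMDiffAt_extChartAt' hz

lemma dbarFun_conjCoord (hy : y ∈ 𝕌 x₀) (j : Fin (finrank ℂ E)) (w : E) :
    ((dbarFun (conjCoord x₀ j) y : T01Dual E y) : 𝕋 y →L[ℝ] ℂ)
      (coordField x₀ w y) = conj ((finBasis ℂ E).coord j w) := by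
  have h : ∀ w : E, 𝕕 (conjCoord x₀ j) y (coordField x₀ w y)
      = conj ((finBasis ℂ E).coord j w) := by
    intro w
    rw [mvfderiv_coordField hy ((fnNear_conjCoord hy j).contMDiffAt.of_le (by simp))]
    have h1 : conjCoord x₀ j ∘ (φ₀).symm
        =ᶠ[𝓝 (φ₀ y)] ((Complex.conjCLE : ℂ →L[ℝ] ℂ).comp
      ((LinearMap.toContinuousLinearMap ((finBasis ℂ E).coord j)).restrictScalars ℝ :
        E →L[ℝ] ℂ)) := by
      have hT : φ₀ y ∈ (φ₀).target :=
        (φ₀).map_source (by rwa [extChartAt_source])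
      filter_upwards [(isOpen_extChartAt_target x₀).mem_nhds hT] with z hz
      rw [Function.comp_apply, conjCoord, (φ₀).right_inv hz]
    rw [h1.fderiv_eq, ContinuousLinearMap.fderiv]
    rfl
  have e1 : ((dbarFun (conjCoord x₀ j) y : T01Dual E y) : 𝕋 y →L[ℝ] ℂ)
      (coordField x₀ w y) = (1 / 2 : ℂ) * (𝕕 (conjCoord x₀ j) y (coordField x₀ w y)
        + I * 𝕕 (conjCoord x₀ j) y (J E y (coordField x₀ w y))) := rfl
  rw [e1, J_coordField hy, h, h, map_smul, smul_eq_mul, map_mul, Complex.conj_I]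
  linear_combination (-1 / 2 : ℂ) * conj ((finBasis ℂ E).coord j w) * I_sq

lemma formNear_dbarFun (hX : IsKahlerMetric E X) {f : X → ℂ} (hf : FnNear E f y) :
    FormNear (fun z => (dbarFun f z : T01Dual E z)) y := by
  refine (FormNear.flat01 ((smoothNear_gradient (hf.clm reCLM)).add
    (smoothNear_gradient (hf.clm imCLM)).J)).congr ?_
  filter_upwards [hf.eventually] with z hz
  exact dbarFun_eq hX hz

lemma FormNear.exists_dbarFun_expansion {α : Π y : X, T01Dual E y} {x : X} (hα : FormNear α x) :
    ∃ g : Fin (finrank ℂ E) → X → ℂ, (∀ j, FnNear E (g j) x) ∧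
      ∀ᶠ y in 𝓝 x, α y = ∑ j, g j y • (dbarFun (conjCoord x j) y : T01Dual E y) := by
  have hx := mem_chart_source E x
  refine ⟨fun j y => (α y : 𝕋 y →L[ℝ] ℂ)
    (coordField x (finBasis ℂ E j) y), fun j => hα.apply (coordField_smoothNear hx _), ?_⟩
  filter_upwards [(chartAt E x).open_source.mem_nhds hx] with y hy
  refine Subtype.ext (ContinuousLinearMap.ext fun v => ?_)
  obtain ⟨w, rfl⟩ := (coordEquiv hy).surjective v
  rw [coordEquiv_apply, AddSubmonoidClass.coe_finsetSum, sum_apply]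
  have h := antilinear_eq_sum (E := E)
    (((α y : 𝕋 y →L[ℝ] ℂ).comp (coordEquiv hy : E →L[ℝ] _)) : E →ₗ[ℝ] ℂ)
    (fun w => by
      simp only [ContinuousLinearMap.coe_coe, ContinuousLinearMap.comp_apply,
        ContinuousLinearEquiv.coe_coe, coordEquiv_apply]
      rw [← J_coordField hy, T01Dual.map_J]) w
  simp only [ContinuousLinearMap.coe_coe, ContinuousLinearMap.comp_apply,
        ContinuousLinearEquiv.coe_coe, coordEquiv_apply] at h
  rw [h]
  refine sum_congr rfl fun j _ => ?_
  rw [Submodule.coe_smul, smul_apply, dbarFun_conjCoord hy, smul_eq_mul, mul_comm]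

end ConjCoordinates

section Dolbeault

variable {x : X} {α β : Π y : X, T01Dual E y} {a : 𝔛}

variable {s t : Π y : X, 𝔽 y}

lemma wedge_sum_smul {ι : Type*} (T : Finset ι) (g : ι → ℂ) (β : ι → T01Dual E x) (ξ : 𝔽 x) :
    wedge (∑ j ∈ T, g j • β j) ξ = ∑ j ∈ T, g j • wedge (β j) ξ := by
  have h2 := congrArg (fun A => A ξ)
    (map_sum (wedgeHom (p := p) (L := L) (V := V) (x := x)) (fun j => g j • β j) T)
  simp only [LinearMap.sum_apply, map_smul, LinearMap.smul_apply] at h2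
  exact h2

/-- Removing the first form of a decomposable section. -/
def Decomposable.tail {q : ℕ} (form : Fin (q + 1) → Π x : X, T01Dual E x) (l : Fin p → Π x : X, L x)
    (e : Π x : X, V x) : 𝔻 := ⟨q, fun i => form i.succ, l, e⟩

lemma Decomposable.val_succ {q : ℕ} (form : Fin (q + 1) → Π x : X, T01Dual E x)
    (l : Fin p → Π x : X, L x) (e : Π x : X, V x) (y : X) : (⟨q + 1, form, l, e⟩ : 𝔻).val y
      = SpinDirac.wedge (form 0 y) ((Decomposable.tail form l e).val y) := by
  rw [Decomposable.val_eq, Decomposable.val_eq, wedge_pureForm]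
  exact pureForm_congr (fun j => by refine Fin.cases ?_ (fun i => ?_) j <;> rfl) fun _ => rfl

lemma DecNear.tail {q : ℕ} {form : Fin (q + 1) → Π x : X, T01Dual E x}
    {l : Fin p → Π x : X, L x} {e : Π x : X, V x} (h : DecNear F (⟨q + 1, form, l, e⟩ : 𝔻) x) :
    DecNear F (Decomposable.tail form l e) x := ⟨fun i => h.form i.succ, h.line, h.vec⟩

/-- Smooth sections are generated by sections of degree zero and exterior products. -/
lemma SecNear.wedge_induction {P : (Π y : X, 𝔽 y) → Prop}
    (hbase : ∀ (form : Fin 0 → Π x : X, T01Dual E x) (l : Fin p → Π x : X, L x) (e : Π x : X, V x),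
      DecNear F (⟨0, form, l, e⟩ : 𝔻) x → P (⟨0, form, l, e⟩ : 𝔻).val)
    (hwedge : ∀ (β : Π y : X, T01Dual E y) (s : Π y : X, 𝔽 y), FormNear β x →
      SecNear F s x → P s → P (fun y => SpinDirac.wedge (β y) (s y))) (hzero : P (fun _ => 0))
    (hadd : ∀ s t, SecNear F s x → SecNear F t x → P s → P t → P (fun y => s y + t y))
    (hcongr : ∀ s t, SecNear F s x → (∀ᶠ y in 𝓝 x, t y = s y) → P s → P t)
    (hs : SecNear F s x) : P s := by
  refine SecNear.induction ?_ hzero hadd hcongr hs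
  rintro ⟨q, form, l, e⟩
  induction q with
  | zero => exact hbase form l e
  | succ q ih =>
    intro h
    have h1 : (⟨q + 1, form, l, e⟩ : 𝔻).val
        = fun y => SpinDirac.wedge (form 0 y) ((Decomposable.tail form l e).val y) :=
      funext fun y => Decomposable.val_succ form l e y
    rw [h1]
    exact hwedge _ _ (h.form 0) h.tail.secNear (ih _ h.tail)

/-- Decomposable sections whose forms are `∂̄`-exact. -/
def IsExactDec (F : Type*) [NormedAddCommGroup F] [NormedSpace ℂ F] [TopologicalSpace (TotalSpace F V)]
    [FiberBundle F V] (c : 𝔻) (x : X) : Prop :=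
  DecNear F c x ∧ ∃ f : Fin c.deg → X → ℂ, ∀ i, FnNear E (f i) x ∧
    ∀ᶠ y in 𝓝 x, c.form i y = dbarFun (f i) y

lemma SecNear.exists_exact (H : ℍ) (hs : SecNear F s x) :
    ∃ (ι : Type) (_ : Fintype ι) (c : ι → 𝔻), (∀ k, IsExactDec F (c k) x) ∧
      ∀ᶠ y in 𝓝 x, s y = ∑ k, (c k).val y := by
  refine SecNear.wedge_induction (P := fun s => ∃ (ι : Type) (_ : Fintype ι)
    (c : ι → 𝔻), (∀ k, IsExactDec F (c k) x) ∧
      ∀ᶠ y in 𝓝 x, s y = ∑ k, (c k).val y) ?_ ?_ ?_ ?_ ?_ hs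
  · intro form l e h
    exact ⟨Unit, inferInstance, fun _ => ⟨0, form, l, e⟩, fun _ => ⟨h, fun i => i.elim0,
      fun i => i.elim0⟩, .of_forall fun y => by simp⟩
  · rintro β s hβ hs ⟨ι, _, c, hc, h⟩
    obtain ⟨g, hg, hβg⟩ := hβ.exists_dbarFun_expansion
    have hd := fun j => fnNear_conjCoord (E := E) (mem_chart_source E x) j
    refine ⟨ι × Fin (finrank ℂ E), inferInstance, fun k =>
      ({ c k.1 with vec := fun y => g k.2 y • (c k.1).vec y } : 𝔻).cons
        (fun y => dbarFun (conjCoord x k.2) y), fun k => ?_, ?_⟩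
    · obtain ⟨h1, f, hf⟩ := hc k.1
      refine ⟨(h1.smul (hg k.2)).cons (formNear_dbarFun H.kahler (hd k.2)),
        (Fin.cons (conjCoord x k.2) f : Fin ((c k.1).deg + 1) → X → ℂ), fun i => ?_⟩
      change Fin ((c k.1).deg + 1) at i
      refine Fin.cases ?_ (fun j => ?_) i
      · exact ⟨hd k.2, .of_forall fun y => rfl⟩
      · exact hf j
    · filter_upwards [h, hβg] with y hy hy'
      rw [hy, hy', map_sum, Fintype.sum_prod_type]
      refine sum_congr rfl fun k _ => ?_
      rw [wedge_sum_smul]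
      refine sum_congr rfl fun j _ => ?_
      rw [Decomposable.cons_val, Decomposable.val_smul, map_smul]
  · exact ⟨Empty, inferInstance, fun k => k.elim, fun k => k.elim, .of_forall fun y => by simp⟩
  · rintro s t hs ht ⟨ι, _, c, hc, h⟩ ⟨ι', _, c', hc', h'⟩
    refine ⟨ι ⊕ ι', inferInstance, Sum.elim c c', ?_, ?_⟩
    · rintro (k | k)
      · exact hc k
      · exact hc' k
    · filter_upwards [h, h'] with y h1 h2
      rw [h1, h2, Fintype.sum_sum_type]
      rfl
  · rintro s t hs hst ⟨ι, _, c, hc, h⟩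
    refine ⟨ι, inferInstance, c, hc, ?_⟩
    filter_upwards [h, hst] with y h1 h2
    rw [h2, h1]

end Dolbeault

section Dolbeault

variable {x : X} {α β : Π y : X, T01Dual E y} {a : 𝔛}

variable {s t : Π y : X, 𝔽 y}

lemma CliffordCalculus.cd_eq_sum_inner {S : X → Type*} [∀ x, AddCommGroup (S x)]
    [∀ x, Module ℂ (S x)] (K : CliffordCalculus nablaT S) {s : Π y : X, S y} (hs : K.sec s x)
    {ι : Type*} [Fintype ι] (e : OrthonormalBasis ι ℝ (𝕋 x)) (v : 𝕋 x) :
    K.cd s x v = ∑ i, ((inner ℝ (e i) v : ℝ) : ℂ) • K.cd s x (e i) :=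
  e.eq_sum_of_real_linear (fun _ _ => K.cd_add_right hs _ _) (fun _ _ => K.cd_smul_right hs _ _) v

lemma HermitianData.dbar_eq_sum (H : ℍ) (hs : SecNear F s x) :
    (H.clifford p).dbar s x = ∑ j, wedge (conjDualBasis E x j) ((1 / 2 : ℂ) •
      (H.cd s x (tangentBasis E x j) + I • H.cd s x (J E x (tangentBasis E x j)))) := by
  set e := stdOrthonormalBasis ℝ (𝕋 x)
  have h1 : ∀ v, H.cd s x v = ∑ i, ((inner ℝ (e i) v : ℝ) : ℂ) • H.cd s x (e i) :=
    fun v => (H.clifford p).cd_eq_sum_inner hs e v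
  have h2 : ∀ j, (1 / 2 : ℂ) •
      (H.cd s x (tangentBasis E x j) + I • H.cd s x (J E x (tangentBasis E x j)))
      = ∑ i, ((flat01 (e i) : 𝕋 x →L[ℝ] ℂ) (tangentBasis E x j)) •
        H.cd s x (e i) := by
    intro j
    rw [h1 (tangentBasis E x j), h1 (J E x (tangentBasis E x j)), smul_sum,
      ← sum_add_distrib, smul_sum]
    refine sum_congr rfl fun i _ => ?_
    rw [flat01_apply, smul_smul, ← add_smul, smul_smul]
  refine ((H.clifford p).dbar_eq hs e).trans ?_
  simp only [h2, map_sum, map_smul]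
  rw [sum_comm]
  refine sum_congr rfl fun i _ => ?_
  rw [← wedge_sum_smul, ← T01Dual.eq_sum]
  rfl

variable (nablaL nablaV) in
/-- The value of `∂̄` on a decomposable section with closed forms. -/
def dolbeaultTerm (c : 𝔻) (x : X) : 𝔽 x :=
  (-1 : ℂ) ^ c.deg • ∑ j, (ιMulti ℂ c.deg (fun i => c.form i x)
          * ExteriorAlgebra.ι ℂ (conjDualBasis E x j)) ⊗ₜ[ℂ]
        ((1 / 2 : ℂ) • (twistDerivative nablaL nablaV c x (tangentBasis E x j)
          + I • twistDerivative nablaL nablaV c x (J E x (tangentBasis E x j))))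

lemma dolbeaultTerm_succ {q : ℕ} (form : Fin (q + 1) → Π x : X, T01Dual E x)
    (l : Fin p → Π x : X, L x) (e : Π x : X, V x) :
    dolbeaultTerm nablaL nablaV (⟨q + 1, form, l, e⟩ : 𝔻) x
      = -wedge (form 0 x) (dolbeaultTerm nablaL nablaV (Decomposable.tail form l e) x) := by
  rw [dolbeaultTerm, dolbeaultTerm, map_smul, map_sum, pow_succ, mul_neg_one, neg_smul]
  refine congrArg Neg.neg (congrArg _ (sum_congr rfl fun j _ => ?_))
  rw [wedge_tmul, ← mul_assoc, ExteriorAlgebra.ιMulti_succ_apply]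
  rfl

lemma deriv_zero_deg (form : Fin 0 → Π x : X, T01Dual E x)
    (l : Fin p → Π x : X, L x) (e : Π x : X, V x) (v : 𝕋 x) :
    (⟨0, form, l, e⟩ : 𝔻).deriv nablaT nablaL nablaV x v
      = (1 : ExteriorAlgebra ℂ (T01Dual E x)) ⊗ₜ[ℂ]
        twistDerivative nablaL nablaV (⟨0, form, l, e⟩ : 𝔻) x v := by
  rw [Decomposable.deriv, sum_eq_zero (fun i _ => i.elim0), zero_add, twistDerivative,
    TensorProduct.tmul_add, TensorProduct.sum_tmul, TensorProduct.tmul_sum]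
  simp only [pureForm, ExteriorAlgebra.ιMulti_zero_apply]

lemma IsExactDec.dbar_eq (H : ℍ) {c : 𝔻}
    (hc : IsExactDec F c x) : (H.clifford p).dbar c.val x = dolbeaultTerm nablaL nablaV c x := by
  obtain ⟨q, form, l, e⟩ := c
  induction q with
  | zero =>
    obtain ⟨hd, -⟩ := hc
    rw [H.dbar_eq_sum hd.secNear, dolbeaultTerm, pow_zero, one_smul]
    refine sum_congr rfl fun j _ => ?_
    rw [H.cd_dec hd, H.cd_dec hd, deriv_zero_deg, deriv_zero_deg, ← TensorProduct.tmul_smul,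
      ← TensorProduct.tmul_add, ← TensorProduct.tmul_smul, wedge_tmul, mul_one,
      ExteriorAlgebra.ιMulti_zero_apply, one_mul]
  | succ q ih =>
    obtain ⟨hd, f, hf⟩ := hc
    have hf0 : FnNear E (f 0) x := (hf 0).1
    have h1 : ∀ᶠ y in 𝓝 x, (⟨q + 1, form, l, e⟩ : 𝔻).val y
        = (H.clifford p).wedge y (gradient E (fun y => (f 0 y).re) y
          + J E y (gradient E (fun y => (f 0 y).im) y)) ((Decomposable.tail form l e).val y) := by
      filter_upwards [(hf 0).2, hf0.eventually] with y hy hy'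
      rw [Decomposable.val_succ]
      exact congrArg (fun β => wedge β ((Decomposable.tail form l e).val y))
        (hy.trans (dbarFun_eq H.kahler hy'))
    have hre := hf0.clm reCLM
    have him := hf0.clm imCLM
    have ih' : (H.clifford p).dbar (Decomposable.tail form l e).val x
        = dolbeaultTerm nablaL nablaV (Decomposable.tail form l e) x :=
      ih _ ⟨hd.tail, fun i => f i.succ, fun i => hf i.succ⟩
    rw [(H.clifford p).dbar_congr ((H.clifford p).sec_wedge
      ((smoothNear_gradient hre).add (smoothNear_gradient him).J) hd.tail.secNear) h1,
      (H.clifford p).dbar_wedge_dbarFun H.kahler H.leviCivita hre him hd.tail.secNear,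
      ih', dolbeaultTerm_succ]
    refine congrArg Neg.neg (congrArg (fun β => wedge β (dolbeaultTerm nablaL nablaV
      (Decomposable.tail form l e) x)) ?_)
    exact ((hf 0).2.self_of_nhds.trans (dbarFun_eq H.kahler hf0)).symm

lemma HermitianData.hasDolbeault_iff (H : ℍ) (hs : SecNear F s x) (ξ : 𝔽 x) :
    HasDolbeault nablaL nablaV s x ξ ↔ ξ = (H.clifford p).dbar s x := by
  have key : ∀ {m : ℕ} {c : Fin m → 𝔻}, (∀ k, IsExactDec F (c k) x) →
      (∀ᶠ y in 𝓝 x, s y = ∑ k, (c k).val y) →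
      (H.clifford p).dbar s x = ∑ k, dolbeaultTerm nablaL nablaV (c k) x := by
    intro m c hc h
    have h1 : ∀ k, (H.clifford p).sec (c k).val x := fun k => (hc k).1.secNear
    rw [(H.clifford p).dbar_congr (CliffordCalculus.sec_sum Finset.univ h1 hs) h,
      (H.clifford p).dbar_sum _ h1 hs]
    exact sum_congr rfl fun k _ => (hc k).dbar_eq H
  constructor
  · rintro ⟨U, hU, hx, m, c, f, hc, hs', hf, hcf, rfl⟩
    refine (key (fun k => ⟨(hc k).decNear hU hx, f k, fun i => ⟨?_, ?_⟩⟩)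
      (Filter.eventually_of_mem (hU.mem_nhds hx) hs')).symm
    · filter_upwards [hU.mem_nhds hx] with y hy
      exact (hf k i).contMDiffAt (hU.mem_nhds hy)
    · exact Filter.eventually_of_mem (hU.mem_nhds hx) (hcf k i)
  · rintro rfl
    obtain ⟨ι, _, c, hc, h⟩ := hs.exists_exact H
    choose hd f hf using hc
    set ε := (Fintype.equivFin ι).symm
    have h' : ∀ᶠ y in 𝓝 x, s y = ∑ k, (c (ε k)).val y := by
      filter_upwards [h] with y hy
      rw [hy]; exact (Equiv.sum_comp ε fun k => (c k).val y).symm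
    obtain ⟨U, hU, hUo, hx⟩ := eventually_nhds_iff.1
      ((((Filter.eventually_all.2 fun k => (hd k).eventually).and h').and
        (Filter.eventually_all.2 fun k => Filter.eventually_all.2 fun i => (hf k i).1.eventually)).and
        (Filter.eventually_all.2 fun k => Filter.eventually_all.2 fun i => (hf k i).2))
    refine ⟨U, hUo, hx, Fintype.card ι, fun k => c (ε k), fun k => f (ε k),
      fun k => Decomposable.smoothOn_of_decNear fun y hy => (hU y hy).1.1.1 _,
      fun y hy => (hU y hy).1.1.2,
      fun k i y hy => ((hU y hy).1.2 _ i).contMDiffAt.contMDiffWithinAt,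
      fun k i y hy => (hU y hy).2 _ i, key (fun k => ⟨hd _, f _, hf _⟩) h'⟩

lemma HermitianData.dolbeault_eq (H : ℍ)
    (hs : SecNear F s x) : dolbeault nablaL nablaV s x = (H.clifford p).dbar s x :=
  (H.hasDolbeault_iff hs _).1
    (Classical.epsilon_spec ⟨_, (H.hasDolbeault_iff hs _).2 rfl⟩)

variable [CompactSpace X] [MeasurableSpace E] [BorelSpace E] [MeasurableSpace X] [BorelSpace X]
  {vol : Measure X}

lemma HermitianData.isDolbeaultAdjoint_iff (H : ℍ)
    (hvol : IsRiemannianVolume E vol) (hs : IsSmoothForm F s) :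
    IsDolbeaultAdjoint vol nablaL nablaV s t ↔ t = (H.clifford p).dbarStar s := by
  have hs' : ∀ x, (H.clifford p).sec s x := isSmoothForm_iff.1 hs
  have hstar : ∀ x, (H.clifford p).sec ((H.clifford p).dbarStar s) x :=
    fun x => CliffordCalculus.sec_dbarStar (hs' x)
  have hadj : ∀ r : Π x : X, 𝔽 x, IsSmoothForm F r →
      l2Product vol (dolbeault nablaL nablaV r) s = l2Product vol r ((H.clifford p).dbarStar s) := by
    intro r hr
    have hr' : ∀ x, (H.clifford p).sec r x := isSmoothForm_iff.1 hr
    have h1 : dolbeault nablaL nablaV r = (H.clifford p).dbar r :=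
      funext fun x => H.dolbeault_eq (hr' x)
    rw [h1]
    exact CliffordCalculus.integral_herm_dbar hvol H.leviCivita hr' hs'
  constructor
  · rintro ⟨ht, h⟩
    have ht' : ∀ x, (H.clifford p).sec t x := isSmoothForm_iff.1 ht
    have hd : ∀ x, (H.clifford p).sec (fun y => t y + -(H.clifford p).dbarStar s y) x :=
      fun x => (H.clifford p).sec_add (ht' x) (CliffordCalculus.sec_neg (hstar x))
    funext x
    rw [← add_neg_eq_zero]
    refine CliffordCalculus.eq_zero_of_integral_herm hvol hd (fun r hr => ?_) x
    have h1 := (h r (isSmoothForm_iff.2 hr)).symm.trans (hadj r (isSmoothForm_iff.2 hr))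
    have := hvol.isFiniteMeasureOnCompacts
    have hi : ∀ {t : Π x : X, 𝔽 x}, (∀ x, (H.clifford p).sec t x) →
        Integrable (fun x => (H.clifford p).herm x (r x) (t x)) vol := fun ht =>
      (CliffordCalculus.continuous_herm hr ht).integrable_of_hasCompactSupport
        (HasCompactSupport.of_compactSpace _)
    have h2 := integral_sub (hi ht') (hi hstar)
    have h3 : ∀ x, (H.clifford p).herm x (r x) (t x + -(H.clifford p).dbarStar s x)
        = (H.clifford p).herm x (r x) (t x)
          - (H.clifford p).herm x (r x) ((H.clifford p).dbarStar s x) := fun x => by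
      rw [← sub_eq_add_neg, map_sub]
    simp only [h3]
    rw [h2]
    exact sub_eq_zero.2 h1
  · rintro rfl
    exact ⟨isSmoothForm_iff.2 hstar, hadj⟩

lemma HermitianData.dolbeaultAdjoint_eq (H : ℍ)
    (hvol : IsRiemannianVolume E vol) (hs : IsSmoothForm F s) :
    dolbeaultAdjoint vol nablaL nablaV s = (H.clifford p).dbarStar s :=
  (H.isDolbeaultAdjoint_iff hvol hs).1
    (Classical.epsilon_spec ⟨_, (H.isDolbeaultAdjoint_iff hvol hs).2 rfl⟩)

lemma HermitianData.dirac_eq (H : ℍ) (hvol : IsRiemannianVolume E vol) (hs : IsSmoothForm F s) :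
    dirac vol nablaL nablaV s = fun x => ((Real.sqrt 2 : ℝ) : ℂ) • (H.clifford p).dirac s x := by
  funext x
  rw [dirac, H.dolbeault_eq (isSmoothForm_iff.1 hs x), H.dolbeaultAdjoint_eq hvol hs]
  rfl

end Dolbeault

section TwistCurvature

variable {x : X} {α β : Π y : X, T01Dual E y} {a : 𝔛}

variable {u v : 𝔛} {s t : Π y : X, 𝔽 y}

/-- Local frames of a line bundle. -/
lemma HermitianData.line_coeff (H : ℍ) {m l : Π y : X, L y}
    (hm : SmoothNear E ℂ m x) (h0 : m x ≠ 0) (hl : SmoothNear E ℂ l x) :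
    ∃ f : X → ℂ, FnNear E f x ∧ ∀ᶠ y in 𝓝 x, l y = f y • m y := by
  have h1 := FnNear.hermitian H.metL hm hm
  have h2 := FnNear.hermitian H.metL hm hl
  have h1x : (inner ℂ (m x) (m x) : ℂ) ≠ 0 := inner_self_ne_zero.2 h0
  have hne : ∀ᶠ y in 𝓝 x, (inner ℂ (m y) (m y) : ℂ) ≠ 0 :=
    h1.contMDiffAt.continuousAt.eventually_ne h1x
  have h3 : FnNear E (fun y => (inner ℂ (m y) (m y) : ℂ)⁻¹) x :=
    h1.comp_contDiffAt (φ := fun z : ℂ => z⁻¹) (by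
      filter_upwards [isOpen_ne.mem_nhds h1x] with z hz
      exact (contDiffAt_inv ℝ hz))
  refine ⟨_, h3.mul h2, ?_⟩
  filter_upwards [hne] with y hy
  obtain ⟨c, hc⟩ := (finrank_eq_one_iff_of_nonzero' (m y) (inner_self_ne_zero.1 hy)).1
    (H.finrank_line y) (l y)
  rw [← hc, inner_smul_right, mul_comm c, inv_mul_cancel_left₀ hy]

/-- The section `m ⊗ ⋯ ⊗ m ⊗ e`. -/
def powSection (p : ℕ) (m : Π y : X, L y) (e : Π y : X, V y) : 𝔻 :=
  ⟨0, fun i => i.elim0, fun _ => m, e⟩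

lemma decNear_powSection {m : Π y : X, L y} {e : Π y : X, V y}
    (hm : SmoothNear E ℂ m x) (he : SmoothNear E F e x) :
    DecNear F (powSection p m e : 𝔻) x := ⟨fun i => i.elim0, fun _ => hm, he⟩

lemma HermitianData.cd_powSection (H : ℍ) {m : Π y : X, L y} {e : Π y : X, V y}
    (hm : SmoothNear E ℂ m x) (he : SmoothNear E F e x) {w : 𝕋 x} {c : ℂ}
    (hc : nablaL m x w = c • m x) :
    H.cd (powSection p m e).val x w = pureForm (fun i : Fin 0 => i.elim0) (fun _ => m x)
      (nablaV e x w + ((p : ℂ) * c) • e x) := by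
  rw [H.cd_dec (decNear_powSection hm he), Decomposable.deriv,
    sum_eq_zero (fun i _ => i.elim0), zero_add, pureForm_add, add_comm, pureForm_smul]
  have h1 : ∀ i : Fin p, pureForm (E := E) (V := V) (x := x) (fun i : Fin 0 => i.elim0)
      (Function.update (fun _ : Fin p => m x) i (nablaL m x w)) (e x)
      = c • pureForm (fun i : Fin 0 => i.elim0) (fun _ => m x) (e x) := by
    intro i
    rw [hc, pureForm_updateLine_smul, Function.update_eq_self]
  have h2 : (∑ i : Fin p, pureForm (E := E) (V := V) (x := x) (fun i : Fin 0 => i.elim0)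
      (Function.update (fun _ : Fin p => m x) i (nablaL m x w)) (e x))
      = ((p : ℂ) * c) • pureForm (fun i : Fin 0 => i.elim0) (fun _ => m x) (e x) := by
    rw [sum_congr rfl fun i _ => h1 i, Finset.sum_const, Finset.card_univ, Fintype.card_fin,
      mul_smul, Nat.cast_smul_eq_nsmul]
  have h3 : ∀ {ξ η ζ : 𝔽 x}, ξ = η → ζ + ξ = ζ + η := fun h => by rw [h]
  exact h3 h2

lemma HermitianData.curv_powSection (H : ℍ)
    (hu : SmoothNear E E u x) (hv : SmoothNear E E v x) {m : Π y : X, L y} {e : Π y : X, V y}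
    (hm : SmoothNear E ℂ m x) (h0 : m x ≠ 0) (he : SmoothNear E F e x) {κ : ℂ}
    (hκ : curvTensor nablaL x (u x) (v x) (m x) = κ • m x) :
    (H.clifford p).curv u v (powSection p m e).val x
      = pureForm (fun i : Fin 0 => i.elim0) (fun _ => m x)
        (curvTensor nablaV x (u x) (v x) (e x) + ((p : ℂ) * κ) • e x) := by
  have hL := H.connL.toIsComplexConnection
  have hV := H.connV.toIsComplexConnection
  obtain ⟨θu, hθu, h1⟩ := H.line_coeff hm h0 (hL.smoothConn.near hm hu)
  obtain ⟨θv, hθv, h2⟩ := H.line_coeff hm h0 (hL.smoothConn.near hm hv)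
  obtain ⟨c, hc⟩ := (finrank_eq_one_iff_of_nonzero' (m x) h0).1 (H.finrank_line x)
    (nablaL m x (mlieBracket 𝕀 u v x))
  have hκ' : κ = 𝕕 θv x (u x) - 𝕕 θu x (v x) - c := by
    rw [curvTensor_of_eq_smul hL hm hu hv hθu hθv h1 h2 hc.symm] at hκ
    exact (smul_left_injective ℂ h0 hκ).symm
  have hcd : ∀ {w : 𝔛} {θ : X → ℂ}, (∀ᶠ y in 𝓝 x, nablaL m y (w y) = θ y • m y) →
      ∀ᶠ y in 𝓝 x, H.cd (powSection p m e).val y (w y)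
        = (powSection p m (fun y => nablaV e y (w y) + ((p : ℂ) * θ y) • e y)).val y := by
    intro w θ h
    filter_upwards [h, hm.eventually, he.eventually] with y hy hmy hey
    exact H.cd_powSection hmy hey hy
  have hsm : ∀ {w : 𝔛} {θ : X → ℂ}, SmoothNear E E w x →
      FnNear E θ x → SmoothNear E F (fun y => nablaV e y (w y) + ((p : ℂ) * θ y) • e y) x :=
    fun hw hθ => (hV.smoothConn.near he hw).add (SmoothNear.complex_smul (hθ.constMul _) he)
  have hnn : ∀ {w w' : 𝔛} {θ θ' : X → ℂ}, SmoothNear E E w x →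
      FnNear E θ x → (∀ᶠ y in 𝓝 x, nablaL m y (w y) = θ y • m y) →
      (∀ᶠ y in 𝓝 x, nablaL m y (w' y) = θ' y • m y) →
      H.cd (fun y => H.cd (powSection p m e).val y (w y)) x (w' x)
        = pureForm (fun i : Fin 0 => i.elim0) (fun _ => m x)
          (nablaV (fun y => nablaV e y (w y)) x (w' x) + ((p : ℂ) * θ x) • nablaV e x (w' x)
            + ((p : ℂ) * 𝕕 θ x (w' x)) • e x
            + ((p : ℂ) * θ' x) • (nablaV e x (w x) + ((p : ℂ) * θ x) • e x)) := by
    intro w w' θ θ' hw hθ h h'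
    have e1 : 𝕕 (fun y => (p : ℂ) * θ y) x (w' x)
        = (p : ℂ) * 𝕕 θ x (w' x) :=
      mvfderiv_clm ((p : ℂ) • ContinuousLinearMap.id ℝ ℂ) hθ.mdiff (w' x)
    rw [H.cd_congr (decNear_powSection hm (hsm hw hθ)).secNear (hcd h),
      H.cd_powSection hm (hsm hw hθ) h'.self_of_nhds, conn_add nablaV (hV.smoothConn.near he hw)
        (SmoothNear.complex_smul (hθ.constMul _) he), hV.complex_smul (hθ.constMul _) he, e1,
      ← add_assoc]
  have e0 : ∀ {a b c d : 𝔽 x} {e₁ e₂ e₃ e₄ : V x}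
      {f : V x → 𝔽 x}, (∀ a b, f (a - b) = f a - f b) → a = f e₁ → b = f e₂ →
      c = f e₃ → e₁ - e₂ - e₃ = e₄ → a - b - c = f e₄ := by
    rintro a b c d e₁ e₂ e₃ e₄ f hf rfl rfl rfl rfl
    rw [hf, hf]
  refine e0 (f := pureForm (fun i : Fin 0 => i.elim0) (fun _ => m x)) (d := 0) (fun a b => ?_)
    (hnn hv hθv h2 h1) (hnn hu hθu h1 h2) (H.cd_powSection hm he hc.symm) ?_
  · rw [sub_eq_add_neg, ← neg_one_smul ℂ b, pureForm_add, pureForm_smul, neg_one_smul,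
      sub_eq_add_neg]
  · rw [hκ', curvTensor_eq hV.smoothConn hu hv he, curvExpr]
    module

lemma pureForm_line_smul {q : ℕ} (γ : Fin q → T01Dual E x) (f : Fin p → ℂ) (m : L x) (e : V x) :
    pureForm γ (fun i => f i • m) e = pureForm γ (fun _ => m) ((∏ i, f i) • e) := by
  rw [pureForm_smul, pureForm, MultilinearMap.map_smul_univ, ← TensorProduct.smul_tmul',
    TensorProduct.tmul_smul]
  rfl

lemma HermitianData.exists_powSection (H : ℍ)
    {form : Fin 0 → Π x : X, T01Dual E x} {l : Fin p → Π x : X, L x} {e : Π x : X, V x}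
    (h : DecNear F (⟨0, form, l, e⟩ : 𝔻) x) :
    ∃ (m : Π y : X, L y) (e' : Π y : X, V y), SmoothNear E ℂ m x ∧ m x ≠ 0 ∧ SmoothNear E F e' x ∧
      ∀ᶠ y in 𝓝 x, (⟨0, form, l, e⟩ : 𝔻).val y = (powSection p m e' : 𝔻).val y := by
  obtain ⟨l₀, hl₀⟩ : ∃ l₀ : L x, l₀ ≠ 0 := by
    have := Module.nontrivial_of_finrank_pos (R := ℂ) (M := L x) (by rw [H.finrank_line x]; simp)
    exact exists_ne 0
  obtain ⟨m, hm, hmx⟩ := exists_smoothNear (E := E) (F := ℂ) l₀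
  have h0 : m x ≠ 0 := hmx ▸ hl₀
  choose f hf hl using fun i => H.line_coeff hm h0 (h.line i)
  refine ⟨m, fun y => (∏ i, f i y) • e y, hm, h0, SmoothNear.complex_smul ?_ h.vec, ?_⟩
  · exact (mvfderiv_prod_apply Finset.univ (fun i _ => hf i) 0).1
  · filter_upwards [Filter.eventually_all.2 hl] with y hy
    have h1 : (fun i => l i y) = fun i => f i y • m y := funext fun i => hy i
    rw [Decomposable.val_eq, Decomposable.val_eq]
    change pureForm _ (fun i => l i y) _ = pureForm _ (fun _ => m y) ((∏ i, f i y) • e y)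
    rw [h1]
    exact (pureForm_line_smul _ _ _ _).trans (congrArg (fun α => pureForm α _ _) (funext fun i => i.elim0))

variable (nablaT nablaV) in
/-- The curvature of `Λ^{0,•}(T^*X) ⊗ L^p ⊗ V` if the curvature of `L` is `κ`. -/
def twistCurv (u v : 𝕋 x) (κ : ℂ) (ξ : 𝔽 x) :
    𝔽 x :=
  ((p : ℂ) * κ) • ξ + actEnd (curvature nablaV x u v) ξ
    + ∑ i, wedge (flat01 (curvTensor nablaT x u v
        (stdOrthonormalBasis ℝ (𝕋 x) i)))
      (contr (stdOrthonormalBasis ℝ (𝕋 x) i) ξ)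

lemma flat01_commute (A : 𝕋 x →ₗ[ℝ] 𝕋 x)
    (hX : IsKahlerMetric E X) (hA : ∀ a, A (J E x a) = J E x (A a))
    {ι : Type*} [Fintype ι] (e : OrthonormalBasis ι ℝ (𝕋 x)) (a : 𝕋 x) :
    ∑ i, (flat01 a : 𝕋 x →L[ℝ] ℂ) (e i) • flat01 (A (e i)) = flat01 (A a) := by
  have h1 : ∀ b : 𝕋 x,
      ∑ i, ((inner ℝ b (e i) : ℝ) : ℂ) • flat01 (A (e i)) = flat01 (A b) := by
    intro b
    conv_rhs => rw [← e.sum_repr' b, map_sum, map_sum]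
    refine sum_congr rfl fun i _ => ?_
    rw [map_smul, flat01_smul, real_inner_comm]
  have h2 : ∀ i, (flat01 a : 𝕋 x →L[ℝ] ℂ) (e i) • flat01 (A (e i))
      = (1 / 2 : ℂ) • (((inner ℝ a (e i) : ℝ) : ℂ) • flat01 (A (e i)))
        - (1 / 2 * I) • (((inner ℝ (J E x a) (e i) : ℝ) : ℂ) • flat01 (A (e i))) := by
    intro i
    rw [flat01_apply, hX.inner_J, smul_smul, smul_smul, ← sub_smul]
    congr 1
    push_cast
    ring
  rw [sum_congr rfl fun i _ => h2 i, sum_sub_distrib, ← smul_sum,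
    ← smul_sum, h1, h1, hA, flat01_J (fun a b => hX.inner_J a b), smul_smul, ← sub_smul]
  rw [show (1 / 2 : ℂ) - 1 / 2 * I * I = 1 by
    rw [mul_assoc, Complex.I_mul_I]; norm_num, one_smul]

lemma sum_comp_of_anticomm {M ι : Type*} [Fintype ι] [AddCommGroup M] [Module ℂ M]
    (W C : ι → M →ₗ[ℂ] M) (w A : M →ₗ[ℂ] M) (c : ι → ℂ) (κ : ℂ) (ξ : M)
    (hA : A (w ξ) = w (A ξ)) (hC : ∀ i, C i (w ξ) = c i • ξ - w (C i ξ))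
    (hW : ∀ i η, W i (w η) = -w (W i η)) : κ • w ξ + A (w ξ) + ∑ i, W i (C i (w ξ))
      = ∑ i, c i • W i ξ + w (κ • ξ + A ξ + ∑ i, W i (C i ξ)) := by
  simp only [hA, hC, map_sub, map_smul, hW, map_add, map_sum, sub_neg_eq_add, sum_add_distrib]
  abel

lemma twistCurv_wedge (H : ℍ) (u v a : 𝕋 x) (κ : ℂ) (ξ : 𝔽 x) :
    twistCurv nablaT nablaV u v κ (wedge (flat01 a) ξ)
      = wedge (flat01 (curvTensor nablaT x u v a)) ξ
        + wedge (flat01 a) (twistCurv nablaT nablaV u v κ ξ) := by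
  set e := stdOrthonormalBasis ℝ (𝕋 x) with he
  have h1 := flat01_commute (curvTensorHom H.leviCivita.smoothConn u v) H.kahler
    (H.kahler.curvTensor_J u v · H.leviCivita) e a
  have h2 : wedge (flat01 (curvTensor nablaT x u v a)) ξ = ∑ i, (flat01 a : 𝕋 x →L[ℝ] ℂ) (e i) •
        wedge (flat01 (curvTensor nablaT x u v (e i))) ξ := by
    rw [← wedge_sum_smul]
    exact congrArg (fun β => wedge β ξ) h1.symm
  rw [h2]
  exact sum_comp_of_anticomm (fun i => wedge (flat01 (curvTensor nablaT x u v (e i))))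
    (fun i => contr (e i)) (wedge (flat01 a)) (actEnd (curvature nablaV x u v)) _ _ ξ
    (actEnd_wedge _ _ _) (fun i => contr_wedge _ _ _) (fun i η => wedge_wedge _ _ _)

lemma HermitianData.curv_eq (H : ℍ) (hu : SmoothNear E E u x) (hv : SmoothNear E E v x) {κ : ℂ}
    (hκ : ∀ l : L x, curvature nablaL x (u x) (v x) l = κ • l) (hs : SecNear F s x) :
    (H.clifford p).curv u v s x = twistCurv nablaT nablaV (u x) (v x) κ (s x) := by
  refine SecNear.wedge_induction (P := fun s => (H.clifford p).curv u v s x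
    = twistCurv nablaT nablaV (u x) (v x) κ (s x)) ?_ ?_ ?_ ?_ ?_ hs
  · intro form l e h
    obtain ⟨m, e', hm, h0, he, hval⟩ := H.exists_powSection h
    rw [(H.clifford p).curv_congr hu hv (decNear_powSection hm he).secNear hval,
      H.curv_powSection hu hv hm h0 he ((curvature_apply H.connL.toIsComplexConnection _ _ _).symm.trans
        (hκ (m x))), hval.self_of_nhds, twistCurv,
      sum_eq_zero, add_zero, Decomposable.val_eq, actEnd_pureForm, pureForm_add,
      pureForm_smul, curvature_apply H.connV.toIsComplexConnection, add_comm]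
    · rfl
    · intro i _
      rw [Decomposable.val_eq]
      exact (congrArg _ (contr_pureForm_zero _ _ _ _)).trans (map_zero _)
  · intro β s hβ hs ih
    have ha := formNear_iff_sharp01.1 hβ
    have h1 : (fun y => wedge (β y) (s y))
        = fun y => (H.clifford p).wedge y (sharp01 (β y)) (s y) :=
      funext fun y => congrArg (fun γ => wedge γ (s y)) (flat01_sharp01 (β y)).symm
    rw [h1, (H.clifford p).curv_wedge H.leviCivita.smoothConn hu hv ha hs, ih]
    exact (twistCurv_wedge H _ _ _ _ _).symm
  · have h0 : (H.clifford p).curv u v (fun _ => 0) x = 0 := by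
      have h1 : ∀ w : 𝔛, ∀ᶠ y in 𝓝 x,
          (H.clifford p).cd (fun _ => 0) y (w y) = 0 := by
        intro w
        filter_upwards [SecNear.eventually hs] with y hy
        exact (H.clifford p).cd_zero hy _
      have hz : (H.clifford p).sec (fun _ => 0) x := CliffordCalculus.sec_zero hs
      rw [CliffordCalculus.curv, (H.clifford p).cd_congr hz (h1 v), (H.clifford p).cd_congr hz (h1 u),
        (H.clifford p).cd_zero hs, (H.clifford p).cd_zero hs, (H.clifford p).cd_zero hs]
      simp
    rw [h0, twistCurv]
    simp
  · intro s t hs ht h1 h2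
    rw [(H.clifford p).curv_add hu hv hs ht, h1, h2]
    simp only [twistCurv, map_add, smul_add, sum_add_distrib]
    abel
  · intro s t hs hst h
    rw [(H.clifford p).curv_congr hu hv hs hst, h, hst.self_of_nhds]

end TwistCurvature

section Main

variable {x : X} {n : ℕ} {a : Fin n → 𝕋 x} {wbar : Fin n → T01Dual E x}
  {s : Π y : X, 𝔽 y}

lemma curvature_isRealBilinear (h : IsComplexConnection nablaV) (x : X) :
    IsRealBilinear (curvature nablaV x) where
  add_left b b' c := LinearMap.ext fun s => by
    rw [LinearMap.add_apply, curvature_apply h, curvature_apply h, curvature_apply h,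
      curvTensor_add_left _ _ _ _ h.smoothConn]
  smul_left r b c := LinearMap.ext fun s => by
    rw [LinearMap.smul_apply, curvature_apply h, curvature_apply h,
      curvTensor_smul_left _ _ _ h.smoothConn]
    exact (algebraMap_smul ℂ r _).symm
  add_right b c c' := LinearMap.ext fun s => by
    rw [LinearMap.add_apply, curvature_apply h, curvature_apply h, curvature_apply h,
      curvTensor_add_right _ _ _ _ h.smoothConn]
  smul_right r b c := LinearMap.ext fun s => by
    rw [LinearMap.smul_apply, curvature_apply h, curvature_apply h,
      curvTensor_smul_right _ _ _ h.smoothConn]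
    exact (algebraMap_smul ℂ r _).symm

lemma curvature_swap (h : IsComplexConnection nablaV) {x : X}
    (b c : 𝕋 x) : curvature nablaV x b c = -curvature nablaV x c b :=
  LinearMap.ext fun s => by
    rw [LinearMap.neg_apply, curvature_apply h, curvature_apply h,
      curvTensor_swap _ _ _ h.smoothConn]

lemma HermitianData.creation_eq (H : ℍ) (ha : IsUnitary a) (hn : finrank ℂ E = n)
    (h : ∀ j k, evalDual (hol (a k)).conjugate (wbar j) = if j = k then 1 else 0) (j : Fin n)
    (ξ : 𝔽 x) : (H.clifford p).creation (a j) ξ = wedge (wbar j) ξ :=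
  congrArg (fun α => wedge α ξ) (ha.eq_flat01 H.kahler hn h j).symm

lemma HermitianData.annihilation_eq (H : ℍ) (b : 𝕋 x) (ξ : 𝔽 x) :
    (H.clifford p).annihilation b ξ = interiorMul (hol b).conjugate ξ :=
  (interiorMul_hol_conj b ξ).symm

lemma actEndHom_id (ξ : 𝔽 x) : actEndHom LinearMap.id ξ = ξ := by
  rw [actEndHom_apply, actEnd, LinearMap.lTensor_id, LinearMap.lTensor_id, LinearMap.id_apply]

lemma HermitianData.sec_dirac (H : ℍ)
    (hs : (H.clifford p).sec s x) : (H.clifford p).sec ((H.clifford p).dirac s) x :=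
  (H.clifford p).sec_add (CliffordCalculus.sec_dbar hs) (CliffordCalculus.sec_dbarStar hs)

lemma HermitianData.isSmoothForm_dolbeault (H : ℍ)
    (hs : IsSmoothForm F s) : IsSmoothForm F (dolbeault nablaL nablaV s) := by
  have hs' : ∀ x, (H.clifford p).sec s x := isSmoothForm_iff.1 hs
  have h1 : dolbeault nablaL nablaV s = (H.clifford p).dbar s :=
    funext fun x => H.dolbeault_eq (hs' x)
  rw [h1]
  exact isSmoothForm_iff.2 fun x => CliffordCalculus.sec_dbar (hs' x)

lemma HermitianData.dirac_dirac_eq [CompactSpace X] [MeasurableSpace E] [BorelSpace E]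
    [MeasurableSpace X] [BorelSpace X] {vol : Measure X} (H : ℍ) (hvol : IsRiemannianVolume E vol)
    (hs : IsSmoothForm F s) : dirac vol nablaL nablaV (dirac vol nablaL nablaV s) x
      = (2 : ℂ) • (H.clifford p).dirac ((H.clifford p).dirac s) x := by
  have hs' : ∀ x, (H.clifford p).sec s x := isSmoothForm_iff.1 hs
  have h1 : ∀ x, (H.clifford p).sec
      (fun y => ((Real.sqrt 2 : ℝ) : ℂ) • (H.clifford p).dirac s y) x := fun x =>
    (H.clifford p).sec_smul (FnNear.const _) (H.sec_dirac (hs' x))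
  have h2 : ((Real.sqrt 2 : ℝ) : ℂ) * ((Real.sqrt 2 : ℝ) : ℂ) = 2 := by
    rw [← Complex.ofReal_mul, Real.mul_self_sqrt zero_le_two, Complex.ofReal_ofNat]
  rw [H.dirac_eq hvol hs, H.dirac_eq hvol (isSmoothForm_iff.2 h1)]
  refine (congrArg _ (CliffordCalculus.dirac_const_smul _ _ (H.sec_dirac (hs' x)))).trans ?_
  rw [smul_smul, h2]

/-- The curvature of the twisted bundle, for a prequantum line bundle. -/
lemma HermitianData.curv_prequantum (H : ℍ) (hL : ∀ (x : X) (u v : 𝕋 x) (l : L x),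
      ((kahlerForm x u v : ℝ) : ℂ) • l = (I / (2 * (Real.pi : ℂ))) • curvature nablaL x u v l)
    {u v : 𝔛} (hu : SmoothNear E E u x) (hv : SmoothNear E E v x) (hs : (H.clifford p).sec s x) :
    (H.clifford p).curv u v s x
      = ((p * -(2 * Real.pi * I)) * ((kahlerForm x (u x) (v x) : ℝ) : ℂ)) • s x
        + actEndHom (curvature nablaV x (u x) (v x)) (s x)
        + ∑ i, (H.clifford p).wedge x (curvTensor nablaT x (u x) (v x)
            (stdOrthonormalBasis ℝ (𝕋 x) i))
          ((H.clifford p).contr x (stdOrthonormalBasis ℝ (𝕋 x) i) (s x)) := by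
  have hκ : ∀ l : L x, curvature nablaL x (u x) (v x) l
      = (-(2 * Real.pi * I) * ((kahlerForm x (u x) (v x) : ℝ) : ℂ)) • l := fun l => by
    have hpi : (Real.pi : ℂ) ≠ 0 := Complex.ofReal_ne_zero.2 Real.pi_ne_zero
    rw [mul_smul, hL, smul_smul]
    have : -(2 * Real.pi * I) * (I / (2 * Real.pi)) = 1 := by
      field_simp
      rw [I_sq]
      ring
    rw [this, one_smul]
  exact (H.curv_eq hu hv hκ hs).trans (congrArg (fun c : ℂ => c • s x
    + actEnd (curvature nablaV x (u x) (v x)) (s x)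
    + ∑ i, wedge (flat01 (curvTensor nablaT x (u x) (v x)
        (stdOrthonormalBasis ℝ (𝕋 x) i)))
      (contr (stdOrthonormalBasis ℝ (𝕋 x) i) (s x))) (mul_assoc _ _ _).symm)

lemma combine_terms {M : Type*} [AddCommGroup M] [Module ℂ M] {y z b A A' B C C' D D' P P' Q Q' : M}
    (h : y = -b + z) (hz : z = -A - B + C + (2 : ℂ) • D + P + Q) (hA : A = A') (hC : C = C') (hD : D = D')
    (hP : P = P') (hQ : Q = Q') : y = -b - A' - B + C' + (2 : ℂ) • D' + P' + Q' := by
  rw [h, hz, ← hA, ← hC, ← hD, ← hP, ← hQ]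
  abel

lemma actEnd_add_smul_id (A : V x →ₗ[ℂ] V x) (c : ℂ) (ξ : 𝔽 x) :
    actEnd (A + c • LinearMap.id) ξ = actEnd A ξ + c • ξ := by
  rw [← actEndHom_apply, map_add, map_smul, LinearMap.add_apply, LinearMap.smul_apply,
    actEndHom_id, actEndHom_apply]

/-- The Lichnerowicz formula for `(∂̄ + ∂̄^*)²`. -/
lemma HermitianData.dirac_sq (H : ℍ) (hL : ∀ (x : X) (u v : 𝕋 x) (l : L x),
      ((kahlerForm x u v : ℝ) : ℂ) • l = (I / (2 * (Real.pi : ℂ))) • curvature nablaL x u v l)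
    {nablaDet : CovariantDerivative 𝕀 ℂ (detCore E X).Fiber}
    (hD : IsChernConnection detMetric nablaDet) (ha : IsUnitary a) (hn : finrank ℂ E = n)
    (hw : ∀ j k, evalDual (hol (a k)).conjugate (wbar j) = if j = k then 1 else 0)
    {N : ℕ} {e : Fin N → 𝔛} (he : ∀ i, SmoothNear E E (e i) x)
    (ho : ∀ᶠ y in 𝓝 x, Orthonormal ℝ (fun i => e i y))
    (hc : Fintype.card (Fin N) = finrank ℝ E) (hs : (H.clifford p).sec s x) :
    (2 : ℂ) • (H.clifford p).dirac ((H.clifford p).dirac s) x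
      = bochnerLaplacian nablaT nablaL nablaV e s x
        - ∑ j, actEnd (complexify₂ (curvature nablaV x) (hol (a j)) (hol (a j)).conjugate) (s x)
        - (2 * Real.pi * p * n : ℂ) • s x + (4 * Real.pi * p : ℂ) • number (s x)
        + (2 : ℂ) • ∑ l, ∑ m,
            actEnd (complexify₂ (curvature nablaV x) (hol (a l)) (hol (a m)).conjugate
              + ((1 / 2 : ℂ) * complexify₂ (fun b c => trace ℂ _
                (curvature nablaDet x b c)) (hol (a l)) (hol (a m)).conjugate) • LinearMap.id)
              (wedge (wbar m) (interiorMul (hol (a l)).conjugate (s x)))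
        + ∑ l, ∑ m, actEnd (complexify₂ (curvature nablaV x) (hol (a l)) (hol (a m)))
          (interiorMul (hol (a l)).conjugate (interiorMul (hol (a m)).conjugate (s x)))
        + ∑ l, ∑ m, actEnd (complexify₂ (curvature nablaV x) (hol (a l)).conjugate
            (hol (a m)).conjugate) (wedge (wbar l) (wedge (wbar m) (s x))) := by
  have hca : ∀ j k (ξ : 𝔽 x), (H.clifford p).creation (a j)
      ((H.clifford p).annihilation (a k) ξ)
      = wedge (wbar j) (interiorMul (hol (a k)).conjugate ξ) := fun j k ξ =>
    (H.creation_eq ha hn hw j _).trans (congrArg _ (H.annihilation_eq (a k) ξ))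
  have h1 := (H.clifford p).two_smul_dirac_dirac H.kahler H.leviCivita he ho hc hs
  have h2 := (H.clifford p).sum_cliff_twist actEndHom (fun A v ξ => actEnd_wedge A _ ξ)
    (fun A v ξ => actEnd_interiorMul A _ ξ) ha H.kahler H.leviCivita hD hn
    (orthonormalBasisOf ho.self_of_nhds hc) (stdOrthonormalBasis ℝ (𝕋 x))
    (curvature_isRealBilinear H.connV.toIsComplexConnection x)
    (curvature_swap H.connV.toIsComplexConnection) (p * -(2 * Real.pi * I)) (s x)
  rw [coe_orthonormalBasisOf] at h2
  have hc1 : (p * -(2 * Real.pi * I)) * I = (2 * Real.pi * p : ℂ) := by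
    linear_combination -(2 * Real.pi * p : ℂ) * I_sq
  have hc2 : 2 * (2 * Real.pi * p) = (4 * Real.pi * p : ℂ) := by ring
  rw [hc1, hc2] at h2
  refine combine_terms h1 (Eq.trans (sum_congr rfl fun i _ => sum_congr rfl fun j _ =>
    congrArg (fun ξ => (H.clifford p).cliff x (e i x) ((H.clifford p).cliff x (e j x) ξ))
      (H.curv_prequantum hL (he i) (he j) hs)) h2) rfl (congrArg _ ?_) ?_ ?_ ?_
  · exact (sum_congr rfl fun j _ => hca j j (s x)).trans
      (ha.number_eq_sum H.kahler hn hw (s x)).symm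
  · refine sum_congr rfl fun l _ => sum_congr rfl fun m _ => ?_
    rw [hca, actEnd_add_smul_id]
    rfl
  · refine sum_congr rfl fun l _ => sum_congr rfl fun m _ => ?_
    exact congrArg (actEnd _) ((H.annihilation_eq (a l) _).trans
      (congrArg _ (H.annihilation_eq (a m) (s x))))
  · refine sum_congr rfl fun l _ => sum_congr rfl fun m _ => ?_
    exact congrArg (actEnd _) ((H.creation_eq ha hn hw l _).trans
      (congrArg _ (H.creation_eq ha hn hw m (s x))))

end Main

end Kahler

end SpinDirac

end

theorem theorem2p4
    -- a compact complex manifold `X` of dimension `n`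
    {n : ℕ} {E : Type*} [NormedAddCommGroup E] [NormedSpace ℂ E] [FiniteDimensional ℂ E]
    [MeasurableSpace E] [BorelSpace E] (hn : Module.finrank ℂ E = n)
    {X : Type*} [TopologicalSpace X] [T2Space X] [CompactSpace X] [ChartedSpace E X]
    [IsManifold 𝓘(ℂ, E) ω X] [MeasurableSpace X] [BorelSpace X]
    -- a smooth Kähler metric, its Levi-Civita connection and its volume measure
    [RiemannianBundle (fun x : X => TangentSpace 𝓘(ℝ, E) x)]
    [IsContMDiffRiemannianBundle 𝓘(ℝ, E) ∞ E (fun x : X => TangentSpace 𝓘(ℝ, E) x)]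
    (hX : IsKahlerMetric E X)
    (nablaT : CovariantDerivative 𝓘(ℝ, E) E (fun x : X => TangentSpace 𝓘(ℝ, E) x))
    (hnablaT : IsLeviCivita nablaT)
    (vol : Measure X) (hvol : IsRiemannianVolume E vol)
    -- a Hermitian holomorphic line bundle `L` with its Chern connection
    {L : X → Type*} [∀ x, NormedAddCommGroup (L x)] [∀ x, InnerProductSpace ℂ (L x)]
    [TopologicalSpace (TotalSpace ℂ L)] [FiberBundle ℂ L] [VectorBundle ℂ ℂ L]
    [ContMDiffVectorBundle ω ℂ L 𝓘(ℂ, E)]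
    (hmetL : IsSmoothHermitianMetric E ℂ (fun x (a b : L x) => inner ℂ a b))
    (nablaL : CovariantDerivative 𝓘(ℝ, E) ℂ L)
    (hnablaL : IsChernConnection (fun x (a b : L x) => inner ℂ a b) nablaL)
    -- the prequantization condition `ω = (i / 2π) R^L`
    (hL : ∀ (x : X) (u v : TangentSpace 𝓘(ℝ, E) x) (l : L x),
      ((kahlerForm x u v : ℝ) : ℂ) • l =
        (Complex.I / (2 * (Real.pi : ℂ))) • curvature nablaL x u v l)
    -- a Hermitian complex vector bundle `V` with a Hermitian connection
    {F : Type*} [NormedAddCommGroup F] [NormedSpace ℂ F] [FiniteDimensional ℂ F]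
    {V : X → Type*} [∀ x, NormedAddCommGroup (V x)] [∀ x, InnerProductSpace ℂ (V x)]
    [TopologicalSpace (TotalSpace F V)] [FiberBundle F V] [VectorBundle ℂ F V]
    [ContMDiffVectorBundle ∞ F V 𝓘(ℝ, E)]
    (hmetV : IsSmoothHermitianMetric E F (fun x (a b : V x) => inner ℂ a b))
    (nablaV : CovariantDerivative 𝓘(ℝ, E) F V)
    (hnablaV : IsHermitianConnection (fun x (a b : V x) => inner ℂ a b) nablaV)
    -- the Chern connection of `det T^{(1,0)} X`
    (nablaDet : CovariantDerivative 𝓘(ℝ, E) ℂ (detCore E X).Fiber)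
    (hnablaDet : IsChernConnection detMetric nablaDet)
    (p : ℕ) :
    -- `∂̄` and `∂̄^*` act on smooth forms, and `∂̄^*` is the formal adjoint of `∂̄`
    (∀ s : Π x : X, FormFiber E p L V x, IsSmoothForm F s →
      IsSmoothForm F (dolbeault nablaL nablaV s) ∧
      IsDolbeaultAdjoint vol nablaL nablaV s (dolbeaultAdjoint vol nablaL nablaV s)) ∧
    -- for a local orthonormal frame `e` of `TX` on an open set `U`, a point `x` of `U` and an
    -- orthonormal basis `w` of `T^{(1,0)}_x X` with dual basis `wbar` of the `w̄_j`
    (∀ (U : Set X) (e : Fin (2 * n) → Π x : X, TangentSpace 𝓘(ℝ, E) x), IsOpen U →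
      (∀ j, SmoothFieldOn (e j) U) →
      (∀ y ∈ U, ∀ j k, (inner ℝ (e j y) (e k y) : ℝ) = if j = k then 1 else 0) →
      ∀ x ∈ U, ∀ w : Fin n → ComplexTangent E x,
      (∀ j, (w j).IsType10) →
      (∀ j k, metricC (w j) (w k).conjugate = if j = k then 1 else 0) →
      ∀ wbar : Fin n → T01Dual E x,
      (∀ j k, evalDual (w k).conjugate (wbar j) = if j = k then 1 else 0) →
      let RV := fun u v : ComplexTangent E x => complexify₂ (curvature nablaV x) u v
      let Rdet := fun u v : ComplexTangent E x =>
        complexify₂ (fun a b => LinearMap.trace ℂ _ (curvature nablaDet x a b)) u v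
      ∀ s : Π x : X, FormFiber E p L V x, IsSmoothForm F s →
        dirac vol nablaL nablaV (dirac vol nablaL nablaV s) x =
          bochnerLaplacian nablaT nablaL nablaV e s x
          - ∑ j, actEnd (RV (w j) (w j).conjugate) (s x)
          - (2 * (Real.pi : ℂ) * p * n) • s x
          + (4 * (Real.pi : ℂ) * p) • number (s x)
          + (2 : ℂ) • ∑ l, ∑ m,
              actEnd (RV (w l) (w m).conjugate
                  + ((1 / 2 : ℂ) * Rdet (w l) (w m).conjugate) • LinearMap.id)
                (wedge (wbar m) (interiorMul (w l).conjugate (s x)))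
          + ∑ l, ∑ m, actEnd (RV (w l) (w m))
              (interiorMul (w l).conjugate (interiorMul (w m).conjugate (s x)))
          + ∑ l, ∑ m, actEnd (RV (w l).conjugate (w m).conjugate)
              (wedge (wbar l) (wedge (wbar m) (s x)))) := by
  have H : HermitianData nablaT nablaL nablaV :=
    ⟨hX, hnablaT, hmetL, hnablaL.toIsHermitianConnection, hmetV, hnablaV⟩
  refine ⟨fun s hs => ⟨H.isSmoothForm_dolbeault hs,
    (H.isDolbeaultAdjoint_iff hvol hs).2 (H.dolbeaultAdjoint_eq hvol hs)⟩, ?_⟩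
  intro U e hU he ho x hxU w hw10 hw wbar hwbar RV Rdet s hs
  obtain ⟨a, rfl⟩ : ∃ a : Fin n → TangentSpace 𝓘(ℝ, E) x, w = fun j => hol (a j) :=
    ⟨fun j => (w j).re, funext fun j => eq_hol_of_isType10 (hw10 j)⟩
  have ha : IsUnitary a := isUnitary_of_metricC hX hw
  have hs' : (H.clifford p).sec s x := isSmoothForm_iff.1 hs x
  have hc : Fintype.card (Fin (2 * n)) = Module.finrank ℝ E := by
    rw [Fintype.card_fin, ← hn, finrank_real_of_complex]
  have ho' : ∀ᶠ y in 𝓝 x, Orthonormal ℝ (fun i => e i y) := by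
    filter_upwards [hU.mem_nhds hxU] with y hy
    exact orthonormal_iff_ite.2 (ho y hy)
  exact (H.dirac_dirac_eq hvol hs).trans (H.dirac_sq hL hnablaDet ha hn hwbar
    (fun j => smoothNear_of_smoothFieldOn (he j) hU hxU) ho' hc hs')
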